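/- **Setting.** Let $n,m\ge 1$, $a\in\mathbb Z_{\ge0}^n$, $b\in\mathbb Z_{\ge0}^m$ with $\sum_i a_i=\sum_j b_j$, let $\lambda^{(n)}=(\lambda^{(n)}_1,\dots,\lambda^{(n)}_n)\in\mathbb C^n$, let $\xi_1,\dots,\xi_m\in\mathbb C$ be nonzero and pairwise distinct, and let $\lambda^{(m)}=(\lambda_{n+1},\dots,\lambda_{n+m})$ be independent variables. Put $z_j=\lambda^{(n)}_j+a_j-j$ ($1\le j\le n$) and $w_j=\lambda_{n+j}+b_j-j$ ($1\le j\le m$). Let $S^{(n)}(b)=S^{b_1}\mathbb C^n\otimes\dots\otimes S^{b_m}\mathbb C^n$ and $S^{(m)}(a)=S^{a_1}\mathbb C^m\otimes\dots\otimes S^{a_n}\mathbb C^m$; $S^{(n)}(b)[a]$ and $S^{(m)}(a)[b]$ are their weight subspaces of $\mathfrak{gl}_n$-weight $a$ and $\mathfrak{gl}_m$-weight $b$. For a Verma module $M_\mu$ of $\mathfrak{gl}_N$ with highest weight vector $v_\mu$ and a finite-dimensional module $V$, let $\theta=\theta^V_{\mu,\beta}:(V\otimes M_\mu)^{\rm sing}[\mu+\beta]\to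 V[\beta]$ be given by $v=\theta(v)\otimes v_\mu+\sum_i w_i\otimes v_i$ with weight vectors $v_i\in M_\mu$ of weights $\ne\mu$. Write $u^{\underline j}=u(u-1)\cdots(u-j+1)$, $u^{\overline j}=u(u+1)\cdots(u+j-1)$, $(\tau f)(u)=f(u+1)$, $d=\tau-1$. Let $D_N=\sum_{\sigma\in S_N}(-1)^\sigma D_{\sigma(1),1}\cdots D_{\sigma(N),N}$ with $D_{ij}=\delta_{ij}\tau-t_{ij}(u-j+1)$, where $t_{ij}(u)$ are the generating series of the Yangian $Y(\mathfrak{gl}_N)$. On an evaluation module $V(c)$, $t_{ij}(u)$ acts as $\delta_{ij}+e_{ij}/(u-c)$, and on tensor products through $t_{ij}(u)\mapsto\sum_k t_{ik}(u)\otimes t_{kj}(u)$. Over the field $\mathbb C(\lambda^{(m)})$, let $D_n(b,w;a,\lambda^{(n)})=\theta D_n\theta^{-1}$ with $D_n$ acting on the singular vectors of weight $\lambda^{(n)}+a$ in $S^{b_1}\mathbb C^n(w_1)\otimes\dots\otimes S^{b_m}\mathbb C^n(w_m)\otimes M_{\lambda^{(n)}}(0)$, and let $D_m(a,z;b,\lambda^{(m)})=\theta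 D_m\theta^{-1}$ with $D_m$ acting on the singular vectors of weight $\lambda^{(m)}+b$ in $S^{a_1}\mathbb C^m(z_1)\otimes\dots\otimes S^{a_n}\mathbb C^m(z_n)\otimes M_{\lambda^{(m)}}(0)$. For the former, and for the assertions about $C_{ij}$ and $\overline H^{(n)}_i$ below, assume that $\lambda^{(n)}$ is such that $\theta^{S^{(n)}(b)}_{\lambda^{(n)},a}$ is bijective. **Leading coefficients.** There are unique operators $C_{ij}\in\operatorname{End}(S^{(n)}(b)[a])\otimes\mathbb C(\lambda^{(m)})$ and $D_{ij}\in\operatorname{End}(S^{(m)}(a)[b])\otimes\mathbb C(\lambda^{(m)})$, $0\le i\le m$, $0\le j\le n$, such that $$u^{\underline n}\prod_{k=1}^m(u-w_k)\,D_n(b,w;a,\lambda^{(n)})=\sum_{i=0}^m\sum_{j=0}^n C_{ij}\,(u+m)^i\,(u-n+1)^{\overline j}\,d^j,$$ $$u^{\underline m}\prod_{k=1}^n(u-z_k)\,D_m(a,z;b,\lambda^{(m)})=\sum_{i=0}^m\sum_{j=0}^n D_{ij}\,(u+n)^{\underline j}\,\bigl((u-m+1)d\bigr)^i .$$ After the substitution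 $\lambda_{n+k}=r\xi_k$, $C_{ij}$ and $D_{ij}$ have degree at most $m-i$ in $r$. Let $gr_{m-i}C_{ij}\in\operatorname{End}(S^{(n)}(b)[a])$ and $gr_{m-i}D_{ij}\in\operatorname{End}(S^{(m)}(a)[b])$ be the coefficients of $r^{m-i}$ in their expansions at $r=\infty$; as rational functions of $\xi$ these are regular at the given point $\xi$. Define rational operator-valued functions $C_k(u)$, $D_k(u)$, $0\le k\le n$, by the identities of polynomials in $x$ $$\sum_{i=0}^m\sum_{j=0}^n (gr_{m-i}C_{ij})\,u^i\,x^{\underline j}=\prod_{l=1}^m(u-\xi_l)\sum_{k=0}^n C_k(u)\,x^{n-k},\qquad \sum_{i=0}^m\sum_{j=0}^n (gr_{m-i}D_{ij})\,u^i\,x^{\underline j}=\prod_{l=1}^m(u-\xi_l)\sum_{k=0}^n D_k(u)\,x^{n-k},$$ and $C_2=D_2=0$ if $n=1$. (So $C_k(u)$ is the coefficient of $(u\partial_u)^{n-k}$ in the differential operator $\prod_l(u-\xi_l)^{-1}\sum_{i,j}(gr_{m-i}C_{ij})u^{i+j}\partial_u^j$.) **Hamiltonians.** Let $(e)_{(i)}$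 denote $e$ acting in the $i$-th tensor factor, and $e=\sum_i (e)_{(i)}$. Let $\overline H^{(n)}_i\in\operatorname{End}(S^{(n)}(b)[a])$ and $\overline G^{(m)}_i\in\operatorname{End}(S^{(m)}(a)[b])$, $i=1,\dots,m$, be the actions of $$H^{(n)}_i=\sum_{j=1}^n\Bigl(z_j+n-\frac{e_{jj}}2\Bigr)(e_{jj})_{(i)}+\sum_{k\ne i}\frac{\xi_i\Omega^+_{ik}+\xi_k\Omega^-_{ik}}{\xi_i-\xi_k},$$ $$\Omega^{+}_{ik}=\frac12\sum_{j=1}^n(e_{jj})_{(i)}(e_{jj})_{(k)}+\sum_{1\le j<l\le n}(e_{jl})_{(i)}(e_{lj})_{(k)},\qquad \Omega^{-}_{ik}=\frac12\sum_{j=1}^n(e_{jj})_{(i)}(e_{jj})_{(k)}+\sum_{1\le j<l\le n}(e_{lj})_{(i)}(e_{jl})_{(k)},$$ $$G^{(m)}_i=-\frac{e_{ii}^2}2+\sum_{j=1}^n(z_j+n)(e_{ii})_{(j)}+\sum_{j=1}^m\sum_{1\le k<l\le n}(e_{ij})_{(k)}(e_{ji})_{(l)}+\sum_{j\ne i}\frac{\xi_j}{\xi_i-\xi_j}(e_{ij}e_{ji}-e_{ii}).$$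 **Theorem.** For each $i=1,\dots,m$, $$\overline H^{(n)}_i=\frac1{\xi_i}\operatorname{Res}_{u=\xi_i}\Bigl(\tfrac12C_1(u)^2-C_2(u)\Bigr)-\tfrac12b_i^2,\qquad \overline G^{(m)}_i=\frac1{\xi_i}\operatorname{Res}_{u=\xi_i}\Bigl(\tfrac12D_1(u)^2-D_2(u)\Bigr)-\tfrac12b_i^2 .$$ -/

import Mathlib

open scoped TensorProduct

noncomputable section

namespace GaudinXXX

/-! ### Tensor products of symmetric powers

`(S F^N)^{⊗ M}` is realised as the polynomial ring in the variables `x_{s,i}`, where `s` numbers the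
tensor factors (sites) and `i` the basis of `F^N`. The vector
`∏ x_{1,i}^{k 1 i} ⊗ ⋯ ⊗ ∏ x_{M,i}^{k M i}` is the monomial with exponents `k`. -/

/-- The space `(S F^N)^{⊗ M}`. -/
abbrev Fock (F : Type) [Field F] (M N : ℕ) : Type := MvPolynomial (Fin M × Fin N) F

/-- The generator `e_{ij}` of `gl_N` acting in the `s`-th tensor factor: `x_{s,i} ∂/∂x_{s,j}`. -/
def siteOp (F : Type) [Field F] {M N : ℕ} (s : Fin M) (i j : Fin N) :
    Module.End F (Fock F M N) :=
  LinearMap.mulLeft F (MvPolynomial.X (s, i)) ∘ₗ (MvPolynomial.pderiv (s, j)).toLinearMap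

/-- The generator `e_{ij}` of `gl_N` acting diagonally on the tensor product. -/
def diagOp (F : Type) [Field F] {M N : ℕ} (i j : Fin N) : Module.End F (Fock F M N) :=
  ∑ s, siteOp F s i j

/-- Exponent tables with row sums `b` (one row per site) and column sums `a`. They index the
monomial basis of the weight-`a` subspace of `S^{b_1} ⊗ ⋯ ⊗ S^{b_M}`. -/
abbrev Table {M N : ℕ} (b : Fin M → ℕ) (a : Fin N → ℕ) : Type :=
  {k : Fin M → Fin N → ℕ // (∀ s, ∑ i, k s i = b s) ∧ ∀ i, ∑ s, k s i = a i}

instance tableFinite {M N : ℕ} (b : Fin M → ℕ) (a : Fin N → ℕ) : Finite (Table b a) := by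
  have hlt : ∀ (k : Table b a) (s : Fin M) (i : Fin N), k.1 s i < b s + 1 := fun k s i => by
    have h := Finset.single_le_sum (f := fun i => k.1 s i) (fun _ _ => Nat.zero_le _)
      (Finset.mem_univ i)
    have h2 := k.2.1 s
    have h3 : k.1 s i ≤ ∑ i, k.1 s i := h
    omega
  refine Finite.of_injective
    (fun (k : Table b a) (s : Fin M) (i : Fin N) => (⟨k.1 s i, hlt k s i⟩ : Fin (b s + 1))) ?_
  intro k l h
  apply Subtype.ext
  funext s i
  simpa using congrArg Fin.val (congrFun (congrFun h s) i)

instance tableFintype {M N : ℕ} (b : Fin M → ℕ) (a : Fin N → ℕ) : Fintype (Table b a) :=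
  Fintype.ofFinite _

/-- The exponent vector of a table. -/
def expo {M N : ℕ} (k : Fin M → Fin N → ℕ) : Fin M × Fin N →₀ ℕ :=
  Finsupp.equivFunOnFinite.symm fun p => k p.1 p.2

/-- The vector of the weight-`a` subspace of `S^{b_1} ⊗ ⋯ ⊗ S^{b_M}` with coordinates `x` in the
monomial basis. -/
def toFock {F : Type} [Field F] {M N : ℕ} {b : Fin M → ℕ} {a : Fin N → ℕ} (x : Table b a → F) :
    Fock F M N :=
  ∑ k, MvPolynomial.monomial (expo k.1) (x k)

/-- The matrix, in the monomial basis, of an operator that preserves the weight-`a` subspace of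
`S^{b_1} ⊗ ⋯ ⊗ S^{b_M}`. -/
def opMatrix {F : Type} [Field F] {M N : ℕ} (b : Fin M → ℕ) (a : Fin N → ℕ)
    (A : Module.End F (Fock F M N)) : Matrix (Table b a) (Table b a) F :=
  Matrix.of fun l k => MvPolynomial.coeff (expo l.1) (A (MvPolynomial.monomial (expo k.1) 1))

/-- The subspace `S^{b_1} ⊗ ⋯ ⊗ S^{b_M}`. -/
def symPowers (F : Type) [Field F] {M : ℕ} (N : ℕ) (b : Fin M → ℕ) : Submodule F (Fock F M N) :=
  Submodule.span F {p | ∃ k : Fin M → Fin N → ℕ,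
    (∀ s, ∑ i, k s i = b s) ∧ p = MvPolynomial.monomial (expo k) 1}

/-! ### Verma modules -/

attribute [local instance 100] LieRing.ofAssociativeRing

/-- The universal enveloping algebra of `gl_N`. -/
abbrev UGL (F : Type) [Field F] (N : ℕ) : Type :=
  UniversalEnvelopingAlgebra F (Matrix (Fin N) (Fin N) F)

/-- The generator `e_{ij}` in `U(gl_N)`. -/
def genU (F : Type) [Field F] {N : ℕ} (i j : Fin N) : UGL F N :=
  UniversalEnvelopingAlgebra.ι F (Matrix.single i j (1 : F))

/-- The left ideal generated by `e_{ij}`, `i < j`, and by `e_{ii} - lam_i`. -/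
def vermaIdeal {F : Type} [Field F] {N : ℕ} (lam : Fin N → F) : Submodule (UGL F N) (UGL F N) :=
  Submodule.span (UGL F N)
    ({x | ∃ i j : Fin N, i < j ∧ x = genU F i j} ∪
      {x | ∃ i : Fin N, x = genU F i i - algebraMap F (UGL F N) (lam i)})

/-- The Verma module of highest weight `lam`. -/
abbrev Verma {F : Type} [Field F] {N : ℕ} (lam : Fin N → F) : Type :=
  UGL F N ⧸ vermaIdeal lam

/-- The highest weight vector. -/
def vermaVec {F : Type} [Field F] {N : ℕ} (lam : Fin N → F) : Verma lam :=
  Submodule.Quotient.mk 1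

/-- The generator `e_{ij}` acting in the Verma module. -/
def vermaOp {F : Type} [Field F] {N : ℕ} (lam : Fin N → F) (i j : Fin N) :
    Module.End F (Verma lam) :=
  Algebra.lsmul F F (Verma lam) (genU F i j)

/-- The weight subspace of weight `eta` of the Verma module. -/
def vermaWeight {F : Type} [Field F] {N : ℕ} (lam eta : Fin N → F) : Submodule F (Verma lam) :=
  ⨅ i, LinearMap.ker (vermaOp lam i i - algebraMap F (Module.End F (Verma lam)) (eta i))

/-- The span of the weight vectors whose weight is not the highest one. -/
def vermaLower {F : Type} [Field F] {N : ℕ} (lam : Fin N → F) : Submodule F (Verma lam) :=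
  ⨆ (eta : Fin N → F) (_ : eta ≠ lam), vermaWeight lam eta

/-! ### Singular vectors and the map `θ` -/

/-- `(S F^N)^{⊗ M} ⊗ M_lam`. -/
abbrev State {F : Type} [Field F] (M : ℕ) {N : ℕ} (lam : Fin N → F) : Type :=
  Fock F M N ⊗[F] Verma lam

/-- The generator `e_{ij}` of `gl_N` acting on `(S F^N)^{⊗ M} ⊗ M_lam`. -/
def totalOp {F : Type} [Field F] (M : ℕ) {N : ℕ} (lam : Fin N → F) (i j : Fin N) :
    Module.End F (State M lam) :=
  (diagOp F i j).rTensor (Verma lam) + (vermaOp lam i j).lTensor (Fock F M N)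

/-- The space of singular vectors of weight `lam + a` in `S^{b_1} ⊗ ⋯ ⊗ S^{b_M} ⊗ M_lam`. -/
def singular {F : Type} [Field F] {M N : ℕ} (b : Fin M → ℕ) (a : Fin N → ℕ) (lam : Fin N → F) :
    Submodule F (State M lam) :=
  LinearMap.range ((symPowers F N b).subtype.rTensor (Verma lam)) ⊓
    (⨅ (i : Fin N) (j : Fin N) (_ : i < j), LinearMap.ker (totalOp M lam i j)) ⊓
    ⨅ i : Fin N, LinearMap.ker
      (totalOp M lam i i - algebraMap F (Module.End F (State M lam)) (lam i + (a i : F)))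

/-- The graph of `θ`: `v = x ⊗ v_lam + ∑ w_i ⊗ v_i`, where the `v_i` are weight vectors of the Verma
module of weights distinct from `lam`. -/
def IsTheta {F : Type} [Field F] {M N : ℕ} {b : Fin M → ℕ} {a : Fin N → ℕ} (lam : Fin N → F)
    (v : State M lam) (x : Table b a → F) : Prop :=
  v - toFock x ⊗ₜ[F] vermaVec lam ∈
    LinearMap.range ((vermaLower lam).subtype.lTensor (Fock F M N))

/-- `θ` is a bijection from the singular vectors of weight `lam + a` in
`S^{b_1} ⊗ ⋯ ⊗ S^{b_M} ⊗ M_lam` onto the weight-`a` subspace of `S^{b_1} ⊗ ⋯ ⊗ S^{b_M}`. -/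
def ThetaBijective {F : Type} [Field F] {M N : ℕ} (b : Fin M → ℕ) (a : Fin N → ℕ)
    (lam : Fin N → F) : Prop :=
  ∀ x : Table b a → F, ∃! v : State M lam, v ∈ singular b a lam ∧ IsTheta lam v x

/-! ### The action of the Yangian and the difference operator -/

/-- The operators `δ_{ij} + e_{ij} / (u - w)` in the `s`-th tensor factor. -/
def siteL {F : Type} [Field F] {M N : ℕ} (lam : Fin N → F) (s : Fin M) (w u : F) :
    Matrix (Fin N) (Fin N) (Module.End F (State M lam)) :=
  1 + Matrix.of fun i j => (u - w)⁻¹ • (siteOp F s i j).rTensor (Verma lam)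

/-- The operators `δ_{ij} + e_{ij} / u` in the Verma module. -/
def vermaL {F : Type} [Field F] (M : ℕ) {N : ℕ} (lam : Fin N → F) (u : F) :
    Matrix (Fin N) (Fin N) (Module.End F (State M lam)) :=
  1 + Matrix.of fun i j => u⁻¹ • (vermaOp lam i j).lTensor (Fock F M N)

/-- The images of the series `t_{ij}(u)` under the action of the Yangian of `gl_N` on the tensor
product of evaluation modules `S(w_1) ⊗ ⋯ ⊗ S(w_M) ⊗ M_lam(0)`, with the comultiplication
`t_{ij}(u) ↦ ∑_k t_{ik}(u) ⊗ t_{kj}(u)`. They are rational functions of `u`; the values at the poles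
are irrelevant. -/
def transfer {F : Type} [Field F] {M N : ℕ} (lam : Fin N → F) (w : Fin M → F) (u : F) :
    Matrix (Fin N) (Fin N) (Module.End F (State M lam)) :=
  (List.ofFn fun s => siteL lam s (w s) u).prod * vermaL M lam u

/-- The shift operator `(τ f)(u) = f (u + 1)`. -/
def shiftOp (F : Type) [Field F] (V : Type) [AddCommGroup V] [Module F V] :
    Module.End F (F → V) :=
  LinearMap.funLeft F V fun u => u + 1

/-- The operator of multiplication by an operator-valued function of `u`. -/
def mulOp {F : Type} [Field F] {V : Type} [AddCommGroup V] [Module F V]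
    (A : F → Module.End F V) : Module.End F (F → V) :=
  LinearMap.pi fun u => A u ∘ₗ LinearMap.proj u

/-- The difference operator `d = τ - 1`. -/
def deltaOp (F : Type) [Field F] (V : Type) [AddCommGroup V] [Module F V] :
    Module.End F (F → V) :=
  shiftOp F V - 1

/-- The entries `δ_{ij} τ - t_{ij}(u - j + 1)`, `j = 1, …, N`; here `j : Fin N` starts from `0`. -/
def diffEntry {F : Type} [Field F] {M N : ℕ} (lam : Fin N → F) (w : Fin M → F) (i j : Fin N) :
    Module.End F (F → State M lam) :=
  (if i = j then shiftOp F (State M lam) else 0) -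
    mulOp fun u => transfer lam w (u - ((j : ℕ) : F)) i j

/-- The image of the generating difference operator of the Yangian Bethe algebra: the column
determinant of the matrix with entries `diffEntry`. -/
def diffOp {F : Type} [Field F] {M N : ℕ} (lam : Fin N → F) (w : Fin M → F) :
    Module.End F (F → State M lam) :=
  ∑ σ : Equiv.Perm (Fin N),
    (Equiv.Perm.sign σ : ℤ) • (List.ofFn fun j => diffEntry lam w (σ j) j).prod

/-- The scalar `u (u - 1) ⋯ (u - N + 1) (u - w_1) ⋯ (u - w_M)`. -/
def prefactor {F : Type} [Field F] {M : ℕ} (N : ℕ) (w : Fin M → F) (u : F) : F :=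
  (descPochhammer F N).eval u * ∏ s, (u - w s)

/-- The matrices `C i j` (operators on the weight-`a` subspace of `S^{b_1} ⊗ ⋯ ⊗ S^{b_M}`) are the
coefficients in the expansion of difference operators with rational coefficients
`prefactor(u) θ D θ⁻¹ = ∑_{i,j} C_{ij} (u+M)^i (u-N+1)(u-N+2)⋯(u-N+j) d^j`. -/
def IsCCoeff {F : Type} [Field F] {M N : ℕ} {b : Fin M → ℕ} {a : Fin N → ℕ} (lam : Fin N → F)
    (w : Fin M → F) (C : Fin (M + 1) → Fin (N + 1) → Matrix (Table b a) (Table b a) F) : Prop :=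
  ∀ᶠ u : F in Filter.cofinite, ∀ (φ : F → State M lam) (ψ : F → Table b a → F),
    (∀ v, φ v ∈ singular b a lam) → (∀ v, IsTheta lam (φ v) (ψ v)) →
      IsTheta lam (prefactor N w u • diffOp lam w φ u)
        (∑ i : Fin (M + 1), ∑ j : Fin (N + 1),
          ((u + M) ^ (i : ℕ) * (ascPochhammer F j).eval (u - N + 1)) •
            (C i j).mulVec ((deltaOp F (Table b a → F) ^ (j : ℕ)) ψ u))

/-- The matrices `D i j` are the coefficients in the expansion of difference operators with rational
coefficients
`prefactor(u) θ D θ⁻¹ = ∑_{i,j} D_{ij} (u+M)(u+M-1)⋯(u+M-j+1) ((u-N+1)d)^i`. -/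
def IsDCoeff {F : Type} [Field F] {M N : ℕ} {b : Fin M → ℕ} {a : Fin N → ℕ} (lam : Fin N → F)
    (w : Fin M → F) (D : Fin (N + 1) → Fin (M + 1) → Matrix (Table b a) (Table b a) F) : Prop :=
  ∀ᶠ u : F in Filter.cofinite, ∀ (φ : F → State M lam) (ψ : F → Table b a → F),
    (∀ v, φ v ∈ singular b a lam) → (∀ v, IsTheta lam (φ v) (ψ v)) →
      IsTheta lam (prefactor N w u • diffOp lam w φ u)
        (∑ i : Fin (N + 1), ∑ j : Fin (M + 1),
          (descPochhammer F j).eval (u + M) •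
            (D i j).mulVec
              (((mulOp (fun v : F => algebraMap F (Module.End F (Table b a → F)) (v - N + 1)) *
                deltaOp F (Table b a → F)) ^ (i : ℕ)) ψ u))

/-! ### Leading coefficients -/

/-- The field `ℂ(λ_1, …, λ_m)` of rational functions in `m` variables. -/
abbrev ParamField (m : ℕ) : Type := FractionRing (MvPolynomial (Fin m) ℂ)

/-- The variable `λ_j`. -/
def lamVar (m : ℕ) (j : Fin m) : ParamField m :=
  algebraMap (MvPolynomial (Fin m) ℂ) (ParamField m) (MvPolynomial.X j)

/-- After the substitution `λ_j = r ξ_j`, the rational function `f` has degree at most `k` in `r`,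
and the coefficient of `r^k` in its expansion at `r = ∞`, a rational function of `ξ`, is regular at
the given point `ξ`, where its value is `c`. -/
def IsLeading {m : ℕ} (ξ : Fin m → ℂ) (k : ℕ) (f : ParamField m) (c : ℂ) : Prop :=
  ∃ p q : MvPolynomial (Fin m) ℂ,
    f * algebraMap (MvPolynomial (Fin m) ℂ) (ParamField m) q =
      algebraMap (MvPolynomial (Fin m) ℂ) (ParamField m) p ∧
    p.totalDegree ≤ k + q.totalDegree ∧
    MvPolynomial.eval ξ (MvPolynomial.homogeneousComponent q.totalDegree q) ≠ 0 ∧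
    c = MvPolynomial.eval ξ (MvPolynomial.homogeneousComponent (k + q.totalDegree) p) /
      MvPolynomial.eval ξ (MvPolynomial.homogeneousComponent q.totalDegree q)

/-- The operator-valued rational functions `C_k(u)` determined by
`∑_{i,j} c_{ij} u^i x(x-1)⋯(x-j+1) = (u-ξ_1)⋯(u-ξ_m) ∑_k C_k(u) x^(n-k)`
(and `C_k(u) = 0` for `k > n`). -/
def leadSeries {m : ℕ} (n : ℕ) {T : Type} (ξ : Fin m → ℂ)
    (c : Fin (m + 1) → Fin (n + 1) → Matrix T T ℂ) (k : ℕ) : Matrix T T (RatFunc ℂ) :=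
  if k ≤ n then
    Matrix.of fun x y =>
      (∑ i : Fin (m + 1), ∑ j : Fin (n + 1),
        RatFunc.C ((descPochhammer ℂ j).coeff (n - k) * c i j x y) * RatFunc.X ^ (i : ℕ)) /
        ∏ l, (RatFunc.X - RatFunc.C (ξ l))
  else 0

/-- The residue of a rational function at the point `x`: the coefficient of `t⁻¹` in the Laurent
expansion after the substitution `u = x + t`. -/
def residueAt (x : ℂ) (f : RatFunc ℂ) : ℂ :=
  (RatFunc.eval (HahnSeries.C : ℂ →+* LaurentSeries ℂ)
    (HahnSeries.C x + HahnSeries.single (1 : ℤ) (1 : ℂ)) f).coeff (-1)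

/-- `ξ_i⁻¹ Res_{u = ξ_i} (C_1(u)^2 / 2 - C_2(u)) - b_i^2 / 2`. -/
def residueExpr {m : ℕ} (n : ℕ) {T : Type} [Fintype T] [DecidableEq T] (ξ : Fin m → ℂ)
    (b : Fin m → ℕ) (c : Fin (m + 1) → Fin (n + 1) → Matrix T T ℂ) (i : Fin m) : Matrix T T ℂ :=
  (ξ i)⁻¹ • (RatFunc.C (1 / 2 : ℂ) • leadSeries n ξ c 1 ^ 2 - leadSeries n ξ c 2).map
      (residueAt (ξ i)) -
    ((b i : ℂ) ^ 2 / 2) • (1 : Matrix T T ℂ)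

/-! ### The Hamiltonians -/

/-- `z_j = μ_j + a_j - j`, `j = 1, …, n`; here `j : Fin n` starts from `0`. -/
def zParam {n : ℕ} (μ : Fin n → ℂ) (a : Fin n → ℕ) (j : Fin n) : ℂ :=
  μ j + (a j : ℂ) - (((j : ℕ) : ℂ) + 1)

/-- `w_j = λ_j + b_j - j`, `j = 1, …, m`, where the `λ_j` are variables; here `j : Fin m` starts
from `0`. -/
def wParam {m : ℕ} (b : Fin m → ℕ) (j : Fin m) : ParamField m :=
  lamVar m j + ((b j : ℕ) : ParamField m) - (((j : ℕ) : ParamField m) + 1)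

/-- `Ω⁺_{ik}`. -/
def omegaPlus (n : ℕ) {m : ℕ} (i k : Fin m) : Module.End ℂ (Fock ℂ m n) :=
  (1 / 2 : ℂ) • ∑ j : Fin n, siteOp ℂ i j j * siteOp ℂ k j j +
    ∑ j : Fin n, ∑ l ∈ Finset.univ.filter (fun l => j < l), siteOp ℂ i j l * siteOp ℂ k l j

/-- `Ω⁻_{ik}`. -/
def omegaMinus (n : ℕ) {m : ℕ} (i k : Fin m) : Module.End ℂ (Fock ℂ m n) :=
  (1 / 2 : ℂ) • ∑ j : Fin n, siteOp ℂ i j j * siteOp ℂ k j j +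
    ∑ j : Fin n, ∑ l ∈ Finset.univ.filter (fun l => j < l), siteOp ℂ i l j * siteOp ℂ k j l

/-- The trigonometric Gaudin Hamiltonians, acting on `(S ℂ^n)^{⊗ m}`. -/
def gaudinH {n m : ℕ} (z : Fin n → ℂ) (ξ : Fin m → ℂ) (i : Fin m) :
    Module.End ℂ (Fock ℂ m n) :=
  ∑ j : Fin n, ((z j + n) • (1 : Module.End ℂ (Fock ℂ m n)) - (1 / 2 : ℂ) • diagOp ℂ j j) *
      siteOp ℂ i j j +
    ∑ k ∈ Finset.univ.erase i,
      (ξ i - ξ k)⁻¹ • (ξ i • omegaPlus n i k + ξ k • omegaMinus n i k)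

/-- The XXX dynamical Hamiltonians, acting on `(S ℂ^m)^{⊗ n}`. -/
def dynamicalG {n m : ℕ} (z : Fin n → ℂ) (ξ : Fin m → ℂ) (i : Fin m) :
    Module.End ℂ (Fock ℂ n m) :=
  -((1 / 2 : ℂ) • (diagOp ℂ i i) ^ 2) +
    ∑ j : Fin n, (z j + n) • siteOp ℂ j i i +
    ∑ j : Fin m, ∑ k : Fin n, ∑ l ∈ Finset.univ.filter (fun l => k < l),
      siteOp ℂ k i j * siteOp ℂ l j i +
    ∑ j ∈ Finset.univ.erase i,
      (ξ j / (ξ i - ξ j)) • (diagOp ℂ i j * diagOp ℂ j i - diagOp ℂ i i)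

end GaudinXXX

end

/-! The difference operator is a column determinant, so it is expanded with fermions. In `Λ ⊗ H` the
product of the columns `∑ ψ_i A_{ij}` has the column determinant as its top coefficient. After `τ =
1 + d` each factor splits into `d ψ_j - Φ_j`, where `d` behaves like a central variable. This gives
`∑_r (-1)^r ∑_{|K| = r} (minor of K)(u) d^{N-r}`, with minors given by the products `colProd`
(`cdet_expansion`).

In a symmetric power `e_{ij} = x_i ∂_j`, so every site changes the monodromy by a rank-one term. As
`∑ ψ_i x_i` squares to zero, a minor has only a simple pole at `w_s` (`colProd_site`), while the
Verma factor has the denominator `u (u-1) ⋯ (u-r+1)` (`colProd_base`). Clearing denominators yields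
the polynomial recursion `coefRec`, and the prefactor times the operator becomes `∑_r (u-N+1) ⋯
(u-r) bethe_r(u) d^{N-r}` (`prefactor_smul_diffOp`).

Conjugation by `θ` uses the functional `vermaFun` on the Verma module, which is built from an
oscillator representation. It extends `θ` to a linear map `thetaMap` on all states (`isTheta_iff`).
This map kills images of lowering operators and turns Cartan generators into numbers. On vectors
killed by the total raising operators, a raising operator of the Verma module can be traded for
minus the one of the Fock space. Hence every word in Verma generators becomes a Fock space operator
(`WordSpan.exists_theta`), and the coefficients exist explicitly. They are unique because a
difference operator is determined by its values on delta functions (`coeff_unique`), provided that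
`θ` is surjective over the field of parameters. For the first kind surjectivity is inherited by
extension of scalars (`exists_singular_bc`). For the second kind it follows from projections by
polynomials in the Casimir element (`exists_singular_generic`).

Leading terms are tracked by `IsLead`, `Rel` and `Lead`, which record a degree bound together with
the top coefficient. For the first kind `u` and the `w_s` have degree one and the Verma module is
constant (`lead_coefRec_C`). For the second kind only the highest weight is large, and a Verma minor
on `K` degenerates to `∏_{k ∈ K} ξ_k` (`lead_coefRec_D`, `capLead`).

In both cases the first coefficient is the scalar `-(A + ∑ b_s ξ_s / (u - ξ_s))` with `A = ∑ (z_j +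
n)`, and the second has simple poles. So the residue consists of an explicit scalar and the
numerator of the second coefficient at `ξ_i` (`residueExpr_eq`). That numerator comes from principal
minors of order two (`leadOpC_two`, `topD_two`). Rewriting the Hamiltonians in terms of number
operators and these minors (`gaudinH_eq`, `dynamicalG_eq`) finishes the comparison. -/

open scoped TensorProduct

noncomputable section

namespace GaudinXXX

/-! ### Fermionic calculus: products of columns and difference column determinants -/

section

/-! ### Alternating sums over lists -/

/-- The alternating sum `∑_k (-1)^k f (l_k) (l without its k-th entry)`. -/
def altSum {ι A : Type*} [AddCommGroup A] : List ι → (ι → List ι → A) → A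
  | [], _ => 0
  | j :: l, f => f j l - altSum l fun k l' => f k (j :: l')

section altSum

variable {ι A B : Type*} [AddCommGroup A] [AddCommGroup B]

@[simp] lemma altSum_nil (f : ι → List ι → A) : altSum [] f = 0 := rfl

lemma altSum_cons (j : ι) (l : List ι) (f : ι → List ι → A) :
    altSum (j :: l) f = f j l - altSum l fun k l' => f k (j :: l') := rfl

lemma map_altSum {G : Type*} [FunLike G A B] [AddMonoidHomClass G A B] (g : G) (l : List ι)
    (f : ι → List ι → A) : g (altSum l f) = altSum l fun k l' => g (f k l') := by
  induction l generalizing f with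
  | nil => simp
  | cons j l ih => simp [altSum_cons, ih]

lemma altSum_add (l : List ι) (f g : ι → List ι → A) :
    altSum l (fun k l' => f k l' + g k l') = altSum l f + altSum l g := by
  induction l generalizing f g with
  | nil => simp
  | cons j l ih => simp only [altSum_cons, ih]; abel

/-- Only the terms that occur matter. Keeping the permutation in the hypothesis gives later
arguments access to the length, the weight and the absence of repetitions of the shortened list. -/
lemma altSum_congr (l : List ι) (f g : ι → List ι → A)
    (h : ∀ k l', (k :: l').Perm l → f k l' = g k l') : altSum l f = altSum l g := by
  induction l generalizing f g with
  | nil => simp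
  | cons j l ih =>
    rw [altSum_cons, altSum_cons, h j l (List.Perm.refl _),
      ih _ (fun k l' => g k (j :: l'))]
    intro k l' hp
    exact h _ _ ((List.Perm.swap j k l').trans (hp.cons j))

lemma mul_altSum {R : Type*} [Ring R] (a : R) (l : List ι) (f : ι → List ι → R) :
    a * altSum l f = altSum l fun k l' => a * f k l' :=
  map_altSum (AddMonoidHom.mulLeft a) l f

lemma smul_altSum {R : Type*} [DistribSMul R A] (a : R) (l : List ι)
    (f : ι → List ι → A) : a • altSum l f = altSum l fun k l' => a • f k l' :=
  map_altSum (DistribSMul.toAddMonoidHom A a) l f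

end altSum

/-! ### Fermionic operators -/

section Fermions

variable {F : Type} [Field F] {N : ℕ} {H : Type} [AddCommGroup H] [Module F H]

variable (F N) in
/-- The exterior algebra on `N` generators. -/
abbrev Ext : Type := ExteriorAlgebra F (Fin N → F)

variable (F N H) in
/-- The space `Λ ⊗ H`, where `Λ` is the exterior algebra on `N` generators. -/
def Fermi : Type := Ext F N ⊗[F] H

instance : AddCommGroup (Fermi F N H) := inferInstanceAs (AddCommGroup (Ext F N ⊗[F] H))

instance : Module F (Fermi F N H) := inferInstanceAs (Module F (Ext F N ⊗[F] H))

/-- The element `x ⊗ y` of `Λ ⊗ H`. -/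
def Fermi.mk (x : Ext F N) (y : H) : Fermi F N H := x ⊗ₜ[F] y

lemma Fermi.mk_add (x x' : Ext F N) (y : H) :
    Fermi.mk (x + x') y = Fermi.mk x y + Fermi.mk x' y := TensorProduct.add_tmul x x' y

lemma Fermi.mk_sub (x x' : Ext F N) (y : H) :
    Fermi.mk (x - x') y = Fermi.mk x y - Fermi.mk x' y := TensorProduct.sub_tmul x x' y

@[simp] lemma Fermi.zero_mk (y : H) : Fermi.mk (0 : Ext F N) y = 0 := TensorProduct.zero_tmul _ y

lemma Fermi.hom_ext {P : Type*} [AddCommGroup P] [Module F P] {f g : Fermi F N H →ₗ[F] P}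
    (h : ∀ (x : Ext F N) (y : H), f (Fermi.mk x y) = g (Fermi.mk x y)) : f = g :=
  TensorProduct.ext' (M := Ext F N) (N := H) h

/-- The creation operator in `Λ ⊗ H`. -/
def psi (F : Type) [Field F] {N : ℕ} (H : Type) [AddCommGroup H] [Module F H] (i : Fin N) :
    Module.End F (Fermi F N H) :=
  (LinearMap.mulLeft F (ExteriorAlgebra.ι F (Pi.single i 1 : Fin N → F))).rTensor H

/-- The annihilation operator in `Λ ⊗ H`. -/
def iota (F : Type) [Field F] {N : ℕ} (H : Type) [AddCommGroup H] [Module F H] (i : Fin N) :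
    Module.End F (Fermi F N H) :=
  LinearMap.rTensor H (CliffordAlgebra.contractLeft (Q := (0 : QuadraticForm F (Fin N → F)))
    (LinearMap.proj i))

/-- An operator in `H`, acting in `Λ ⊗ H`. -/
def ampl (N : ℕ) (A : Module.End F H) : Module.End F (Fermi F N H) :=
  A.lTensor (Ext F N)

variable (F N H) in
/-- The embedding of `H` in `Λ ⊗ H`. -/
def vac : H →ₗ[F] Fermi F N H := TensorProduct.mk F (Ext F N) H 1

variable (F N H) in
/-- The projection of `Λ ⊗ H` onto `H`. -/
def vacProj : Fermi F N H →ₗ[F] H :=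
  TensorProduct.lid F H ∘ₗ (ExteriorAlgebra.algebraMapInv (R := F)
    (M := Fin N → F)).toLinearMap.rTensor H

lemma psi_mk (i : Fin N) (x : Ext F N) (y : H) : psi F H i (Fermi.mk x y) =
    Fermi.mk (ExteriorAlgebra.ι F (Pi.single i 1 : Fin N → F) * x) y := rfl

lemma iota_mk (i : Fin N) (x : Ext F N) (y : H) : iota F H i (Fermi.mk x y) =
    Fermi.mk (CliffordAlgebra.contractLeft (Q := (0 : QuadraticForm F (Fin N → F)))
      (LinearMap.proj i) x) y := rfl

lemma ampl_mk (A : Module.End F H) (x : Ext F N) (y : H) :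
    ampl N A (Fermi.mk x y) = Fermi.mk x (A y) := rfl

lemma vac_apply (y : H) : vac F N H y = Fermi.mk 1 y := rfl

lemma vacProj_mk (x : Ext F N) (y : H) :
    vacProj F N H (Fermi.mk x y) = ExteriorAlgebra.algebraMapInv x • y := rfl

lemma psi_mul_psi (i j : Fin N) : psi F H i * psi F H j = -(psi F H j * psi F H i) := by
  rw [eq_neg_iff_add_eq_zero]
  apply Fermi.hom_ext
  intro x y
  simp only [LinearMap.add_apply, Module.End.mul_apply, psi_mk, ← Fermi.mk_add, ← mul_assoc,
    ← add_mul, ExteriorAlgebra.ι_add_mul_swap]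
  simp

lemma psi_sq (i : Fin N) : psi F H i * psi F H i = 0 := by
  apply Fermi.hom_ext
  intro x y
  simp [psi_mk, ← mul_assoc]

/-- Contraction is an antiderivation of the exterior algebra. Together with `psi_mul_psi` this
provides the anticommutation relations used throughout. -/
lemma iota_mul_psi (i j : Fin N) :
    iota F H i * psi F H j = (if i = j then 1 else 0) - psi F H j * iota F H i := by
  apply Fermi.hom_ext
  intro x y
  have h : (if i = j then (1 : Module.End F (Fermi F N H)) else 0) (Fermi.mk x y) =
      Fermi.mk ((LinearMap.proj i : (Fin N → F) →ₗ[F] F) (Pi.single j 1) • x) y := by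
    by_cases h : i = j
    · subst h; simp
    · simp [h]
  rw [LinearMap.sub_apply, h, Module.End.mul_apply, Module.End.mul_apply, psi_mk, iota_mk, iota_mk,
    psi_mk, ← Fermi.mk_sub]
  exact congrArg (Fermi.mk · y) (CliffordAlgebra.contractLeft_ι_mul
    (Q := (0 : QuadraticForm F (Fin N → F))) (LinearMap.proj i) (Pi.single j 1) x)

lemma iota_vac (i : Fin N) (h : H) : iota F H i (vac F N H h) = 0 := by
  rw [vac_apply, iota_mk, CliffordAlgebra.contractLeft_one, Fermi.zero_mk]

lemma vacProj_vac (h : H) : vacProj F N H (vac F N H h) = h := by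
  rw [vac_apply, vacProj_mk, map_one, one_smul]

lemma vacProj_psi (i : Fin N) (y : Fermi F N H) : vacProj F N H (psi F H i y) = 0 := by
  have : vacProj F N H ∘ₗ psi F H i = 0 := by
    apply Fermi.hom_ext
    intro x y
    simp [psi_mk, vacProj_mk, ExteriorAlgebra.algebraMapInv]
  exact LinearMap.congr_fun this y

lemma ampl_mul (A B : Module.End F H) : ampl N (A * B) = ampl N A * ampl N B :=
  LinearMap.lTensor_comp (Ext F N) A B

@[simp] lemma ampl_one : ampl N (1 : Module.End F H) = 1 := LinearMap.lTensor_id (Ext F N) H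

@[simp] lemma ampl_zero : ampl N (0 : Module.End F H) = 0 := LinearMap.lTensor_zero (Ext F N)

lemma ampl_add (A B : Module.End F H) : ampl N (A + B) = ampl N A + ampl N B :=
  LinearMap.lTensor_add (Ext F N) A B

lemma ampl_sub (A B : Module.End F H) : ampl N (A - B) = ampl N A - ampl N B :=
  LinearMap.lTensor_sub (M := Ext F N) A B

lemma ampl_smul (c : F) (A : Module.End F H) : ampl N (c • A) = c • ampl N A :=
  LinearMap.lTensor_smul (Ext F N) c A

lemma ampl_sum {ι : Type*} (s : Finset ι) (f : ι → Module.End F H) :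
    ampl N (∑ i ∈ s, f i) = ∑ i ∈ s, ampl N (f i) :=
  map_sum (LinearMap.lTensorHom (Ext F N)) f s

lemma ampl_vac (A : Module.End F H) (h : H) : ampl N A (vac F N H h) = vac F N H (A h) := by
  rw [vac_apply, ampl_mk, vac_apply]

lemma vacProj_ampl (A : Module.End F H) (y : Fermi F N H) :
    vacProj F N H (ampl N A y) = A (vacProj F N H y) := by
  have : vacProj F N H ∘ₗ ampl N A = A ∘ₗ vacProj F N H := by
    apply Fermi.hom_ext
    intro x y
    simp [vacProj_mk, ampl_mk]
  exact LinearMap.congr_fun this y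

lemma ampl_psi (A : Module.End F H) (i : Fin N) : ampl N A * psi F H i = psi F H i * ampl N A := by
  apply Fermi.hom_ext
  intro x y
  simp [psi_mk, ampl_mk]

lemma ampl_iota (A : Module.End F H) (i : Fin N) :
    ampl N A * iota F H i = iota F H i * ampl N A := by
  apply Fermi.hom_ext
  intro x y
  simp [iota_mk, ampl_mk]

/-- The coefficient functional dual to `ψ_{k_1} ⋯ ψ_{k_r}`. -/
def contr (F : Type) [Field F] {N : ℕ} (H : Type) [AddCommGroup H] [Module F H] :
    List (Fin N) → (Fermi F N H →ₗ[F] H)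
  | [] => vacProj F N H
  | k :: l => contr F H l ∘ₗ iota F H k

lemma contr_nil (y : Fermi F N H) : contr F H [] y = vacProj F N H y := rfl

lemma contr_cons (k : Fin N) (l : List (Fin N)) (y : Fermi F N H) :
    contr F H (k :: l) y = contr F H l (iota F H k y) := rfl

lemma contr_ampl (l : List (Fin N)) (A : Module.End F H) (y : Fermi F N H) :
    contr F H l (ampl N A y) = A (contr F H l y) := by
  induction l generalizing y with
  | nil => exact vacProj_ampl A y
  | cons k l ih =>
    rw [contr_cons, contr_cons, ← ih, ← Module.End.mul_apply, ← ampl_iota, Module.End.mul_apply]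

lemma iota_psi_apply (i j : Fin N) (y : Fermi F N H) :
    iota F H i (psi F H j y) = (if i = j then y else 0) - psi F H j (iota F H i y) := by
  rw [← Module.End.mul_apply, iota_mul_psi]
  split_ifs <;> simp

lemma contr_psi_of_notMem (l : List (Fin N)) (j : Fin N) (hj : j ∉ l) (y : Fermi F N H) :
    contr F H l (psi F H j y) = 0 := by
  induction l generalizing y with
  | nil => exact vacProj_psi j y
  | cons k l ih =>
    simp only [List.mem_cons, not_or] at hj
    rw [contr_cons, iota_psi_apply, if_neg (Ne.symm hj.1), zero_sub, map_neg, ih hj.2, neg_zero]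

/-- The creation operator passes the annihilators of `l₀` with one sign each, and then only the
pairing with its own annihilator survives. -/
lemma contr_append_psi (l₀ l : List (Fin N)) (j : Fin N) (h₀ : j ∉ l₀) (h : j ∉ l)
    (y : Fermi F N H) :
    contr F H (l₀ ++ j :: l) (psi F H j y) = (-1 : F) ^ l₀.length • contr F H (l₀ ++ l) y := by
  induction l₀ generalizing y with
  | nil =>
    simp [contr_cons, iota_psi_apply, contr_psi_of_notMem l j h]
  | cons k l₀ ih =>
    simp only [List.mem_cons, not_or] at h₀
    rw [List.cons_append, contr_cons, iota_psi_apply, if_neg (Ne.symm h₀.1), zero_sub, map_neg,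
      ih h₀.2, List.cons_append, contr_cons, List.length_cons, pow_succ]
    simp

/-- The element `∑_i ψ_i A_{ij}`. -/
def col (A : Matrix (Fin N) (Fin N) (Module.End F H)) (j : Fin N) :
    Module.End F (Fermi F N H) :=
  ∑ i, psi F H i * ampl N (A i j)

/-- The element `∑_i ψ_i x_i`. -/
def odd (x : Fin N → Module.End F H) : Module.End F (Fermi F N H) :=
  ∑ i, psi F H i * ampl N (x i)

/-- Laplace expansion along the first odd factor: each annihilator either meets it and produces a
coefficient, or passes it with a sign. The alternating sums of the file originate here. -/
lemma contr_odd (l : List (Fin N)) (x : Fin N → Module.End F H) (y : Fermi F N H) :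
    contr F H l (odd x y) = altSum l fun i l' => x i (contr F H l' y) := by
  induction l generalizing y with
  | nil =>
    simp [odd, contr_nil, LinearMap.sum_apply, vacProj_psi]
  | cons k l ih =>
    have h : iota F H k (odd x y) = ampl N (x k) y - odd x (iota F H k y) := by
      simp only [odd, LinearMap.sum_apply, map_sum, Module.End.mul_apply, iota_psi_apply,
        Finset.sum_sub_distrib, Finset.sum_ite_eq, Finset.mem_univ, if_true]
      congr 1
      refine Finset.sum_congr rfl fun i _ => ?_
      rw [← Module.End.mul_apply (iota F H k), ← ampl_iota, Module.End.mul_apply]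
    rw [contr_cons, h, map_sub, contr_ampl, ih, altSum_cons]
    rfl

lemma psi_odd (j : Fin N) (x : Fin N → Module.End F H) :
    psi F H j * odd x = -(odd x * psi F H j) := by
  simp only [odd, Finset.mul_sum, Finset.sum_mul, ← Finset.sum_neg_distrib]
  refine Finset.sum_congr rfl fun i _ => ?_
  rw [← mul_assoc, psi_mul_psi, mul_assoc (psi F H i), ampl_psi, neg_mul, mul_assoc]

lemma odd_mul_odd (x y : Fin N → Module.End F H) (h : ∀ i j, Commute (x i) (y j)) :
    odd x * odd y = -(odd y * odd x) := by
  simp only [odd, Finset.mul_sum, Finset.sum_mul, ← Finset.sum_neg_distrib]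
  rw [Finset.sum_comm]
  refine Finset.sum_congr rfl fun i _ => Finset.sum_congr rfl fun j _ => ?_
  calc psi F H i * ampl N (x i) * (psi F H j * ampl N (y j))
      = psi F H i * psi F H j * (ampl N (x i) * ampl N (y j)) := by
        rw [mul_assoc, ← mul_assoc (ampl N (x i)), ampl_psi]; simp only [mul_assoc]
    _ = -(psi F H j * psi F H i * (ampl N (y j) * ampl N (x i))) := by
        rw [psi_mul_psi, ← ampl_mul, (h i j).eq, ampl_mul, neg_mul]
    _ = _ := by
        rw [mul_assoc (psi F H j), ← mul_assoc (psi F H i) (ampl N (y j)), ← ampl_psi]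
        simp only [mul_assoc]

/-- The terms for `(i, j)` and `(j, i)` cancel. Applied to the multiplications `x_i` of one site,
this nilpotency prevents higher products of poles from that site. -/
lemma odd_sq (x : Fin N → Module.End F H) (h : ∀ i j, Commute (x i) (x j)) :
    odd x * odd x = 0 := by
  have hx : ∀ i j, psi F H j * ampl N (x j) * (psi F H i * ampl N (x i)) =
      psi F H j * psi F H i * ampl N (x i * x j) := fun i j => by
    rw [mul_assoc, ← mul_assoc (ampl N (x j)), ampl_psi, (h i j).eq, ampl_mul]
    simp only [mul_assoc]
  simp only [odd, Finset.mul_sum, Finset.sum_mul, hx]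
  rw [← Finset.sum_product']
  refine Finset.sum_involution (fun p _ => (p.2, p.1)) ?_ ?_ ?_ ?_
  · rintro ⟨i, j⟩ -
    simp only
    rw [psi_mul_psi j i, (h i j).eq, neg_mul, neg_add_cancel]
  · rintro ⟨i, j⟩ - hne heq
    simp only [Prod.mk.injEq] at heq
    apply hne
    simp only [heq.1, psi_sq, zero_mul]
  · simp
  · simp

lemma col_eq_odd (A : Matrix (Fin N) (Fin N) (Module.End F H)) (j : Fin N) :
    col A j = odd fun i => A i j := rfl

lemma iota_odd (c : Fin N) (x : Fin N → Module.End F H) :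
    iota F H c * odd x = ampl N (x c) - odd x * iota F H c := by
  simp only [odd, Finset.mul_sum, Finset.sum_mul, ← mul_assoc, iota_mul_psi, sub_mul,
    Finset.sum_sub_distrib, ite_mul, one_mul, zero_mul, Finset.sum_ite_eq, Finset.mem_univ,
    if_true]
  congr 1
  refine Finset.sum_congr rfl fun i _ => ?_
  rw [mul_assoc, ← ampl_iota, ← mul_assoc]

/-- The operators `Φ_{j_1} ⋯ Φ_{j_r}` applied to functions of `u` that do not depend on `u`, where
`(Φ_j f)(u) = ∑_i ψ_i t_{ij}(u) f (u - 1) - ψ_j f(u)`. -/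
def colProd (t : F → Matrix (Fin N) (Fin N) (Module.End F H)) :
    List (Fin N) → F → Module.End F (Fermi F N H)
  | [], _ => 1
  | j :: l, u => col (t u) j * colProd t l (u - 1) - psi F H j * colProd t l u

/-- The algebra of one induction step of `colProd_site`: `C` is a column of the old monodromy, `X`
the odd element of the new site, `E` the row of derivatives times that column, and `P` is `ψ_j`.
Moving `X` through `C` gives `-g' X C R₁`, and `X E X = X C` gives `g g' X C R₁`. By `g' = g + g
g'`, which holds for `g = 1 / (u - w)` and `g' = 1 / (u - 1 - w)`, the sum is `-g X C R₁`, so one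
simple pole remains. -/
lemma site_step {A B : Type*} [Ring A] [Algebra F A] [AddCommGroup B] [Module A B] [Module F B]
    [IsScalarTower F A B] (C X E P : A) (W₀ W₁ R₀ R₁ : B) (g g' : F)
    (hX : X * X = 0) (hC : C * X = -(X * C)) (hE : E * X = X * E + C) (hP : P * X = -(X * P))
    (hg : g' = g + g * g') :
    (C + g • (X * E)) • (W₁ + g' • X • R₁) - P • (W₀ + g • X • R₀) =
      (C • W₁ - P • W₀) + g • X • (E • W₁ - (C • R₁ - P • R₀)) := by
  have hsc (a : A) (c : F) (b : B) : a • c • b = c • a • b := by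
    rw [← algebraMap_smul A c b, ← algebraMap_smul A c (a • b), smul_smul, smul_smul,
      Algebra.commutes]
  have h1 : C • X • R₁ = -(X • C • R₁) := by rw [smul_smul, hC, neg_smul, mul_smul]
  have h2 : X • E • X • R₁ = X • C • R₁ := by
    rw [smul_smul E, hE, add_smul, smul_add, mul_smul X E, smul_smul X X, hX, zero_smul, zero_add]
  have h3 : P • X • R₀ = -(X • P • R₀) := by rw [smul_smul, hP, neg_smul, mul_smul]
  have h4 : g' • X • C • R₁ = g • X • C • R₁ + (g * g') • X • C • R₁ := by
    rw [← add_smul, ← hg]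
  simp only [add_smul, smul_add, smul_sub, smul_assoc, mul_smul X E, hsc, h1, h2, h3, smul_neg]
  rw [h4, smul_smul g' g, mul_comm g' g]
  abel

/-- Multiplying the monodromy on the left by `1 + (u - w)⁻¹ x_i ∂_j`. -/
theorem colProd_site (t' t : F → Matrix (Fin N) (Fin N) (Module.End F H))
    (x y : Fin N → Module.End F H) (w : F)
    (hxx : ∀ i j, Commute (x i) (x j))
    (hyx : ∀ i j, y i * x j = x j * y i + if i = j then 1 else 0)
    (hx : ∀ u i j k, Commute (x k) (t' u i j)) (hy : ∀ u i j k, Commute (y k) (t' u i j))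
    (ht : ∀ u i j, t u i j = t' u i j + (u - w)⁻¹ • (x i * ∑ c, y c * t' u c j))
    (h : H) (l : List (Fin N)) (u : F) (hu : ∀ k ≤ l.length, u - k ≠ w) :
    colProd t l u (vac F N H h) = colProd t' l u (vac F N H h) + (u - w)⁻¹ • odd x
      (∑ c, ampl N (y c) (iota F H c (colProd t' l u (vac F N H h))) +
        altSum l fun j l' => ampl N (y j) (colProd t' l' u (vac F N H h))) := by
  induction l generalizing u with
  | nil => simp [colProd, iota_vac]
  | cons j l ih =>
    have hw : u - w ≠ 0 := fun h0 => hu 0 (by simp) (by rw [Nat.cast_zero, sub_zero]; exact sub_eq_zero.1 h0)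
    -- `R` is the cofactor of the odd element in the asserted formula, and `D` is the part of it in
    -- which a derivative is paired with an annihilator.
    set D : Module.End F (Fermi F N H) := ∑ c, ampl N (y c) * iota F H c with hD
    set R : List (Fin N) → F → Fermi F N H := fun l u =>
      (∑ c, ampl N (y c) (iota F H c (colProd t' l u (vac F N H h))) +
        altSum l fun j l' => ampl N (y j) (colProd t' l' u (vac F N H h))) with hR
    set E : Module.End F (Fermi F N H) := ampl N (∑ c, y c * t' u c j) with hE
    have hcol : col (t u) j = col (t' u) j + (u - w)⁻¹ • (odd x * E) := by
      simp only [col, odd, hE, ht, ampl_add, ampl_smul, ampl_mul, mul_add, Finset.sum_add_distrib,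
        Finset.sum_mul, Finset.smul_sum, mul_smul_comm, mul_assoc]
    have ih0 : colProd t l u (vac F N H h) = colProd t' l u (vac F N H h) +
        (u - w)⁻¹ • odd x • R l u := ih u fun k hk => hu k (by simp; omega)
    have ih1 : colProd t l (u - 1) (vac F N H h) = colProd t' l (u - 1) (vac F N H h) +
        (u - 1 - w)⁻¹ • odd x • R l (u - 1) := ih (u - 1) fun k hk => by
      have := hu (k + 1) (by simpa using hk)
      rwa [Nat.cast_add, Nat.cast_one, add_comm, ← sub_sub] at this
    have hw1 : u - 1 - w ≠ 0 := fun h0 => hu 1 (by simp) (by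
      rw [Nat.cast_one]; exact sub_eq_zero.1 h0)
    have hiota (c : Fin N) (z : Fermi F N H) : iota F H c (col (t' u) j z) =
        ampl N (t' u c j) z - col (t' u) j (iota F H c z) := by
      rw [← Module.End.mul_apply, col_eq_odd, iota_odd]; rfl
    have hDpsi (z : Fermi F N H) : D (psi F H j z) = ampl N (y j) z - psi F H j (D z) := by
      have (c : Fin N) : ampl N (y c) (iota F H c (psi F H j z)) =
          (if c = j then ampl N (y c) z else 0) - psi F H j (ampl N (y c) (iota F H c z)) := by
        rw [iota_psi_apply, map_sub, ← Module.End.mul_apply (ampl N (y c)) (psi F H j), ampl_psi]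
        split_ifs <;> simp
      simp [hD, LinearMap.sum_apply, this]
    have hycol (c : Fin N) : ampl N (y c) * col (t' u) j = col (t' u) j * ampl N (y c) := by
      simp only [col, Finset.mul_sum, Finset.sum_mul]
      refine Finset.sum_congr rfl fun i _ => ?_
      rw [← mul_assoc, ampl_psi, mul_assoc, ← ampl_mul, (hy u i j c).eq, ampl_mul, mul_assoc]
    have hDcol (z : Fermi F N H) : D (col (t' u) j z) = E z - col (t' u) j (D z) := by
      have (c : Fin N) : ampl N (y c) (iota F H c (col (t' u) j z)) =
          ampl N (y c * t' u c j) z - col (t' u) j (ampl N (y c) (iota F H c z)) := by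
        rw [hiota, map_sub, ← Module.End.mul_apply (ampl N (y c)) (col (t' u) j), hycol,
          ← Module.End.mul_apply, ← ampl_mul]
        rfl
      simp [hD, hE, LinearMap.sum_apply, this, ampl_sum]
    have hRdef (l : List (Fin N)) (u : F) : R l u = D (colProd t' l u (vac F N H h)) +
        altSum l fun j l' => ampl N (y j) (colProd t' l' u (vac F N H h)) := by
      simp [hR, hD, LinearMap.sum_apply]
    -- The cofactor satisfies the recursion of the column products with the extra source `E`. This
    -- is exactly the bracket that `site_step` leaves behind.
    have hR1 : R (j :: l) u = E • colProd t' l (u - 1) (vac F N H h) -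
        (col (t' u) j • R l (u - 1) - psi F H j • R l u) := by
      rw [hRdef, hRdef, hRdef, altSum_cons]
      have h1 : (altSum l fun k l' => ampl N (y k) (colProd t' (j :: l') u (vac F N H h))) =
          col (t' u) j (altSum l fun k l' => ampl N (y k) (colProd t' l' (u - 1) (vac F N H h))) -
          psi F H j (altSum l fun k l' => ampl N (y k) (colProd t' l' u (vac F N H h))) := by
        rw [map_altSum, map_altSum, eq_sub_iff_add_eq, ← altSum_add]
        refine altSum_congr _ _ _ fun k l' _ => ?_
        rw [← Module.End.mul_apply (col (t' u) j), ← hycol,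
          ← Module.End.mul_apply (psi F H j), ← ampl_psi]
        simp [colProd]
      rw [h1]
      simp only [colProd, LinearMap.sub_apply, Module.End.mul_apply, map_sub, hDcol, hDpsi,
        Module.End.smul_def, map_add]
      abel
    have key := site_step (F := F) (col (t' u) j) (odd x) E (psi F H j)
      (colProd t' l u (vac F N H h)) (colProd t' l (u - 1) (vac F N H h)) (R l u) (R l (u - 1))
      (u - w)⁻¹ (u - 1 - w)⁻¹ (odd_sq x hxx)
      (by rw [col_eq_odd]; exact odd_mul_odd _ _ fun i k => (hx u i j k).symm) ?_
      (psi_odd j x) (by field_simp; ring)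
    · calc colProd t (j :: l) u (vac F N H h)
          = col (t u) j • colProd t l (u - 1) (vac F N H h) -
            psi F H j • colProd t l u (vac F N H h) := rfl
        _ = _ := by rw [ih0, ih1, hcol, key]
        _ = _ := by rw [← hR1]; rfl
    -- The commutator of `y` with `x` returns the old entry of the column, which is the relation `E
    -- X = X E + C` entry by entry.
    · have hEx (k : Fin N) : (∑ c, y c * t' u c j) * x k = x k * (∑ c, y c * t' u c j) + t' u k j := by
        have (c : Fin N) : y c * t' u c j * x k =
            x k * (y c * t' u c j) + if c = k then t' u c j else 0 := by
          rw [mul_assoc, ← (hx u c j k).eq, ← mul_assoc, hyx]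
          split_ifs <;> simp [add_mul, mul_assoc]
        simp [Finset.sum_mul, this, Finset.sum_add_distrib, Finset.mul_sum]
      simp only [odd, col, Finset.mul_sum, Finset.sum_mul, ← Finset.sum_add_distrib]
      refine Finset.sum_congr rfl fun k _ => ?_
      rw [hE, ← mul_assoc, ampl_psi, mul_assoc, ← ampl_mul, hEx, ampl_add, ampl_mul, mul_add,
        mul_assoc]

/-- The column products for the matrix `1 + u⁻¹ E`. -/
def capProd (E : Matrix (Fin N) (Fin N) (Module.End F H)) :
    List (Fin N) → Module.End F (Fermi F N H)
  | [] => 1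
  | j :: l => (col E j + (l.length : F) • psi F H j) * capProd E l

lemma col_one (j : Fin N) : col (1 : Matrix (Fin N) (Fin N) (Module.End F H)) j = psi F H j := by
  have : ∀ i, psi F H i * ampl N ((1 : Matrix (Fin N) (Fin N) (Module.End F H)) i j) =
      if i = j then psi F H i else 0 := by
    intro i
    by_cases h : i = j
    · subst h; simp
    · simp [h]
  simp [col, this]

lemma col_add (A B : Matrix (Fin N) (Fin N) (Module.End F H)) (j : Fin N) :
    col (A + B) j = col A j + col B j := by
  simp [col, ampl_add, mul_add, Finset.sum_add_distrib]

/-- The falling factorial is factored in two ways: its first factor `u` clears the shifted term, its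
last factor `u - r` accompanies the unshifted one. In the difference `u` cancels and the integer
`r`, the length of the tail, remains as the diagonal correction in `capProd`. -/
theorem colProd_base (E : Matrix (Fin N) (Fin N) (Module.End F H)) (l : List (Fin N)) (u : F)
    (hu : ∀ k ≤ l.length, u ≠ k) :
    (descPochhammer F l.length).eval u •
      colProd (fun u => 1 + Matrix.of fun i j => u⁻¹ • E i j) l u = capProd E l := by
  induction l generalizing u with
  | nil => simp [colProd, capProd]
  | cons j l ih =>
    have hu0 : u ≠ 0 := by simpa using hu 0 (by simp)
    have h0 := ih u fun k hk => hu k (by simp; omega)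
    have h1 := ih (u - 1) fun k hk h => by
      have := hu (k + 1) (by simpa using hk)
      apply this
      rw [Nat.cast_add, Nat.cast_one, ← h]; ring
    have hcol : col (1 + Matrix.of fun i j => u⁻¹ • E i j) j = psi F H j + u⁻¹ • col E j := by
      rw [col_add, col_one]
      simp [col, ampl_smul, Finset.smul_sum]
    have hp0 : (descPochhammer F (l.length + 1)).eval u =
        (descPochhammer F l.length).eval u * (u - l.length) := descPochhammer_succ_eval _ _
    have hp1 : (descPochhammer F (l.length + 1)).eval u =
        u * (descPochhammer F l.length).eval (u - 1) := by
      rw [descPochhammer_succ_left]; simp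
    have e1 : (descPochhammer F (l.length + 1)).eval u • ((psi F H j + u⁻¹ • col E j) *
        colProd (fun u => 1 + Matrix.of fun i j => u⁻¹ • E i j) l (u - 1)) =
        (u • psi F H j + col E j) * capProd E l := by
      rw [← h1, hp1, mul_comm u, mul_smul, ← smul_mul_assoc u, smul_add, smul_inv_smul₀ hu0,
        mul_smul_comm]
    have e0 : (descPochhammer F (l.length + 1)).eval u • (psi F H j *
        colProd (fun u => 1 + Matrix.of fun i j => u⁻¹ • E i j) l u) =
        ((u - l.length) • psi F H j) * capProd E l := by
      rw [← h0, hp0, mul_comm, mul_smul, smul_mul_assoc (u - _), mul_smul_comm]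
    rw [colProd, capProd, List.length_cons, hcol, smul_sub, e1, e0, ← sub_mul]
    congr 1
    rw [sub_smul]
    abel

end Fermions

end

section

section CDet

variable {F : Type} [Field F] {N : ℕ} {H : Type} [AddCommGroup H] [Module F H]

/-! ### Column determinants -/

lemma contr_mk (l : List (Fin N)) (x : Ext F N) (h : H) :
    contr F H l (Fermi.mk x h) = contr F F l (Fermi.mk x 1) • h := by
  induction l generalizing x with
  | nil => simp [contr_nil, vacProj_mk]
  | cons k l ih => rw [contr_cons, contr_cons, iota_mk, iota_mk, ih]

lemma contr_prod_psi_self (l : List (Fin N)) (hl : l.Nodup) (h : H) :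
    contr F H l ((l.map (psi F H)).prod (vac F N H h)) = h := by
  induction l with
  | nil => simp [contr_nil, vacProj_vac]
  | cons j l ih =>
    rw [List.nodup_cons] at hl
    rw [List.map_cons, List.prod_cons, Module.End.mul_apply]
    have := contr_append_psi (F := F) (H := H) [] l j (by simp) hl.1
      ((l.map (psi F H)).prod (vac F N H h))
    simpa [ih hl.2] using this

lemma prod_psi_vac (l : List (Fin N)) (h : H) :
    (l.map (psi F H)).prod (vac F N H h) =
      Fermi.mk (l.map fun i => ExteriorAlgebra.ι F (Pi.single i 1 : Fin N → F)).prod h := by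
  induction l with
  | nil => rfl
  | cons j l ih =>
    rw [List.map_cons, List.prod_cons, Module.End.mul_apply, ih, psi_mk, List.map_cons,
      List.prod_cons]

variable (F N) in
/-- The coefficient of the top exterior power, as an alternating map. -/
def topCoeff : (Fin N → F) [⋀^Fin N]→ₗ[F] F :=
  LinearMap.compAlternatingMap
    (contr F F (List.finRange N) ∘ₗ ((TensorProduct.mk F (Ext F N) F).flip 1 : Ext F N →ₗ[F] Fermi F N F))
    (ExteriorAlgebra.ιMulti F N)

lemma contr_prod_psi (f : Fin N → Fin N) (h : H) :
    contr F H (List.finRange N) (((List.finRange N).map fun j => psi F H (f j)).prod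
      (vac F N H h)) = topCoeff F N (fun j => Pi.single (f j) 1) • h := by
  have := prod_psi_vac (F := F) ((List.finRange N).map f) h
  rw [List.map_map, List.map_map] at this
  rw [show (fun j => psi F H (f j)) = psi F H ∘ f from rfl, this, contr_mk]
  congr 1
  simp only [topCoeff, LinearMap.compAlternatingMap_apply, ExteriorAlgebra.ιMulti_apply]
  rw [List.ofFn_eq_map]
  rfl

lemma topCoeff_perm (σ : Equiv.Perm (Fin N)) :
    topCoeff F N (fun j => Pi.single (σ j) 1) = ((Equiv.Perm.sign σ : ℤ) : F) := by
  have h1 : topCoeff F N (fun j => Pi.single j 1) = 1 := by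
    have h := contr_prod_psi (F := F) (H := F) (N := N) id 1
    have h2 := contr_prod_psi_self (F := F) (H := F) (List.finRange N) (List.nodup_finRange N) 1
    have h3 : (fun j => psi F F (id j)) = psi F F (N := N) := rfl
    rw [h3, h2] at h
    simpa using h.symm
  have := (topCoeff F N).map_perm (fun j => Pi.single j 1) σ
  rw [h1] at this
  rw [show (fun j => (Pi.single (σ j) 1 : Fin N → F)) = (fun j => Pi.single j 1) ∘ σ from rfl, this]
  simp [Units.smul_def]

lemma prod_psi_ampl (f : Fin N → Fin N) (B : Fin N → Module.End F H) (l : List (Fin N)) :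
    (l.map fun j => psi F H (f j) * ampl N (B j)).prod =
      (l.map fun j => psi F H (f j)).prod * ampl N (l.map B).prod := by
  induction l with
  | nil => simp
  | cons j l ih =>
    have hc : ampl N (B j) * (l.map fun j => psi F H (f j)).prod =
        (l.map fun j => psi F H (f j)).prod * ampl N (B j) := by
      refine Commute.list_prod_right _ _ ?_
      intro x hx
      obtain ⟨k, -, rfl⟩ := List.mem_map.1 hx
      exact ampl_psi _ _
    simp only [List.map_cons, List.prod_cons, ih, ampl_mul]
    rw [mul_assoc, ← mul_assoc (ampl N (B j)), hc]
    simp only [mul_assoc]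

/-- The product of columns is expanded over all maps `f` of indices. The fermions commute with the
entries and can be collected on the left. Their top coefficient alternates in `f`, so only
permutations survive, with their signs, and the order of the entries is that of the columns. -/
theorem contr_prod_col (A : Matrix (Fin N) (Fin N) (Module.End F H)) (h : H) :
    contr F H (List.finRange N) (((List.finRange N).map (col A)).prod (vac F N H h)) =
      ∑ σ : Equiv.Perm (Fin N), (Equiv.Perm.sign σ : ℤ) •
        ((List.finRange N).map fun j => A (σ j) j).prod h := by
  have hexp : ((List.finRange N).map (col A)).prod = ∑ f : Fin N → Fin N,
      ((List.finRange N).map fun j => psi F H (f j) * ampl N (A (f j) j)).prod := by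
    have := (MultilinearMap.mkPiAlgebraFin F N (Module.End F (Fermi F N H))).map_sum
      (fun j i => psi F H i * ampl N (A i j))
    simp only [MultilinearMap.mkPiAlgebraFin_apply, List.ofFn_eq_map] at this
    exact this
  have hterm (f : Fin N → Fin N) : contr F H (List.finRange N)
      (((List.finRange N).map fun j => psi F H (f j) * ampl N (A (f j) j)).prod (vac F N H h)) =
      topCoeff F N (fun j => Pi.single (f j) 1) •
        ((List.finRange N).map fun j => A (f j) j).prod h := by
    rw [prod_psi_ampl f (fun j => A (f j) j), Module.End.mul_apply, ampl_vac, contr_prod_psi]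
  rw [hexp, LinearMap.sum_apply, map_sum]
  simp only [hterm]
  symm
  refine Fintype.sum_of_injective (fun σ : Equiv.Perm (Fin N) => (σ : Fin N → Fin N))
    DFunLike.coe_injective _ _ ?_ ?_
  · intro f hf
    have : ¬ Function.Injective fun j => (Pi.single (f j) 1 : Fin N → F) := by
      intro hinj
      apply hf
      have hf' : Function.Injective f := fun i j hij => hinj (by simp only [hij])
      exact ⟨Equiv.ofBijective f (Finite.injective_iff_bijective.1 hf'), rfl⟩
    rw [(topCoeff F N).map_eq_zero_of_not_injective _ this, zero_smul]
  · intro σ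
    rw [topCoeff_perm, Int.cast_smul_eq_zsmul]

/-! ### Expansion of products of `d ψ_j - Φ_j` -/

/-- The coefficient of `d^k` in `∏ (d ψ_j - Φ_j)`, where `d` is a central variable. -/
def mixProd (Φ : Fin N → Module.End F (Fermi F N H)) :
    List (Fin N) → ℕ → Module.End F (Fermi F N H)
  | [], 0 => 1
  | [], _ + 1 => 0
  | j :: l, 0 => -(Φ j * mixProd Φ l 0)
  | j :: l, k + 1 => psi F H j * mixProd Φ l k - Φ j * mixProd Φ l (k + 1)

lemma mixProd_eq_zero (Φ : Fin N → Module.End F (Fermi F N H)) (l : List (Fin N)) (k : ℕ)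
    (hk : l.length < k) : mixProd Φ l k = 0 := by
  induction l generalizing k with
  | nil =>
    obtain ⟨k, rfl⟩ := Nat.exists_eq_succ_of_ne_zero (by omega : k ≠ 0)
    rfl
  | cons j l ih =>
    obtain ⟨k, rfl⟩ := Nat.exists_eq_succ_of_ne_zero (by omega : k ≠ 0)
    simp only [List.length_cons] at hk
    rw [Nat.succ_eq_add_one, mixProd, ih k (by omega), ih (k + 1) (by omega)]
    simp

/-- Each factor chooses `d ψ_j` or `-Φ_j`. A chosen `ψ_j` pairs with its own annihilator and deletes
`j`, so the indices that chose `Φ` run over sublists. For the induction, `Q` stands for the factors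
`Φ` already chosen, with indices `l₀`. Only the sign with which `ψ_j` passes `Q` is needed, and it
cancels the sign of `contr_append_psi`. -/
theorem contr_mixProd (Φ : Fin N → Module.End F (Fermi F N H))
    (hΦ : ∀ i j, Φ i * psi F H j = -(psi F H j * Φ i)) (l : List (Fin N)) :
    ∀ (l₀ : List (Fin N)) (Q : Module.End F (Fermi F N H)) (k r : ℕ) (y : Fermi F N H),
    (l₀ ++ l).Nodup → (∀ j, Q * psi F H j = (-1 : F) ^ l₀.length • (psi F H j * Q)) →
    k + r = l.length →
    contr F H (l₀ ++ l) (Q (mixProd Φ l k y)) = (-1 : F) ^ r •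
      ((List.sublistsLen r l).map fun K => contr F H (l₀ ++ K) (Q ((K.map Φ).prod y))).sum := by
  induction l with
  | nil =>
    intro l₀ Q k r y _ _ hkr
    simp only [List.length_nil, Nat.add_eq_zero_iff] at hkr
    obtain ⟨rfl, rfl⟩ := hkr
    simp [mixProd]
  | cons j l ih =>
    intro l₀ Q k r y hnd hQ hkr
    have hΦpart : ∀ k r, k + r = l.length →
        contr F H (l₀ ++ j :: l) (Q (Φ j (mixProd Φ l k y))) = (-1 : F) ^ r •
          ((List.sublistsLen r l).map fun K =>
            contr F H (l₀ ++ j :: K) (Q (((j :: K).map Φ).prod y))).sum := by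
      intro k r hkr
      have h := ih (l₀ ++ [j]) (Q * Φ j) k r y (by simpa using hnd) (fun i => by
        rw [mul_assoc, hΦ, mul_neg, ← mul_assoc, hQ]
        simp [pow_succ, mul_assoc]) hkr
      simpa using h
    have hj₀ : j ∉ l₀ := fun h => by
      have := List.disjoint_of_nodup_append hnd h
      simp at this
    have hj : j ∉ l := (List.nodup_cons.1 hnd.of_append_right).1
    have hψpart : ∀ k r, k + r = l.length →
        contr F H (l₀ ++ j :: l) (Q (psi F H j (mixProd Φ l k y))) = (-1 : F) ^ r •
          ((List.sublistsLen r l).map fun K => contr F H (l₀ ++ K) (Q ((K.map Φ).prod y))).sum := by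
      intro k r hkr
      rw [← Module.End.mul_apply, hQ, LinearMap.smul_apply, map_smul, Module.End.mul_apply,
        contr_append_psi _ _ _ hj₀ hj, smul_smul, ← pow_add, Even.neg_one_pow ⟨_, rfl⟩, one_smul]
      exact ih l₀ Q k r y (hnd.sublist (by simp)) hQ hkr
    rw [List.length_cons] at hkr
    cases k with
    | zero =>
      obtain rfl : r = l.length + 1 := by omega
      rw [List.sublistsLen_succ_cons, List.sublistsLen_of_length_lt (Nat.lt_succ_self _),
        List.nil_append, List.map_map, mixProd, LinearMap.neg_apply, map_neg, map_neg,
        Module.End.mul_apply, hΦpart 0 l.length (by omega), pow_succ]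
      simp [Function.comp_def]
    | succ k =>
      rw [mixProd, LinearMap.sub_apply, map_sub, map_sub, Module.End.mul_apply,
        Module.End.mul_apply, hψpart k r (by omega)]
      cases r with
      | zero => simp [mixProd_eq_zero Φ l (k + 1) (by omega)]
      | succ r =>
        rw [hΦpart (k + 1) r (by omega), List.sublistsLen_succ_cons, List.map_append,
          List.sum_append, List.map_map, smul_add, pow_succ]
        simp [Function.comp_def, sub_eq_add_neg]

/-! ### Functions of `u` -/

/-- The map `id ⊗ f`. -/
def fmap {H' : Type} [AddCommGroup H'] [Module F H'] (f : H →ₗ[F] H') :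
    Fermi F N H →ₗ[F] Fermi F N H' := f.lTensor (Ext F N)

variable {H' : Type} [AddCommGroup H'] [Module F H']

lemma fmap_mk (f : H →ₗ[F] H') (x : Ext F N) (h : H) :
    fmap f (Fermi.mk x h) = Fermi.mk x (f h) := rfl

lemma fmap_psi (f : H →ₗ[F] H') (i : Fin N) (y : Fermi F N H) :
    fmap f (psi F H i y) = psi F H' i (fmap f y) := by
  have : fmap f ∘ₗ psi F H i = psi F H' i ∘ₗ fmap f := by
    apply Fermi.hom_ext
    intro x y
    simp [psi_mk, fmap_mk]
  exact LinearMap.congr_fun this y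

lemma fmap_ampl (f g : H →ₗ[F] H') (A : Module.End F H) (B : Module.End F H')
    (h : ∀ x, f (A x) = B (g x)) (y : Fermi F N H) : fmap f (ampl N A y) = ampl N B (fmap g y) := by
  have : fmap f ∘ₗ ampl N A = ampl N B ∘ₗ fmap g := by
    apply Fermi.hom_ext
    intro x y
    simp [ampl_mk, fmap_mk, h]
  exact LinearMap.congr_fun this y

lemma fmap_vac (f : H →ₗ[F] H') (h : H) : fmap f (vac F N H h) = vac F N H' (f h) := rfl

lemma contr_fmap (f : H →ₗ[F] H') (l : List (Fin N)) (y : Fermi F N H) :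
    contr F H' l (fmap f y) = f (contr F H l y) := by
  have : contr F H' l ∘ₗ fmap f = f ∘ₗ contr F H l := by
    apply Fermi.hom_ext
    intro x y
    simp only [LinearMap.comp_apply, fmap_mk]
    rw [contr_mk l x (f y), contr_mk l x y, map_smul]
  exact LinearMap.congr_fun this y

/-- Evaluation at `u`. -/
abbrev evAt (F : Type) [Field F] (H : Type) [AddCommGroup H] [Module F H] (u : F) :
    (F → H) →ₗ[F] H := LinearMap.proj u

/-- The operators `Φ_j`. -/
def phiOp (t : F → Matrix (Fin N) (Fin N) (Module.End F H)) (j : Fin N) :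
    Module.End F (Fermi F N (F → H)) :=
  col (Matrix.of fun i j => mulOp (fun u => t u i j) * LinearMap.funLeft F H fun u => u - 1) j -
    psi F (F → H) j

lemma phiOp_psi (t : F → Matrix (Fin N) (Fin N) (Module.End F H)) (i j : Fin N) :
    phiOp t i * psi F (F → H) j = -(psi F (F → H) j * phiOp t i) := by
  rw [phiOp, sub_mul, mul_sub, col_eq_odd, psi_odd, psi_mul_psi i j]
  abel

lemma fmap_evAt_phiOp (t : F → Matrix (Fin N) (Fin N) (Module.End F H)) (j : Fin N) (u : F)
    (y : Fermi F N (F → H)) :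
    fmap (evAt F H u) (phiOp t j y) =
      col (t u) j (fmap (evAt F H (u - 1)) y) - psi F H j (fmap (evAt F H u) y) := by
  rw [phiOp, LinearMap.sub_apply, map_sub, fmap_psi]
  congr 1
  simp only [col, LinearMap.sum_apply, map_sum, Module.End.mul_apply, fmap_psi]
  refine Finset.sum_congr rfl fun i _ => ?_
  rw [fmap_ampl (evAt F H u) (evAt F H (u - 1)) _ (t u i j)]
  intro x
  rfl

lemma fmap_evAt_prod_phiOp (t : F → Matrix (Fin N) (Fin N) (Module.End F H)) (l : List (Fin N))
    (u : F) (h : H) :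
    fmap (evAt F H u) ((l.map (phiOp t)).prod (vac F N (F → H) fun _ => h)) =
      colProd t l u (vac F N H h) := by
  induction l generalizing u with
  | nil => simp [colProd, fmap_vac]
  | cons j l ih =>
    rw [List.map_cons, List.prod_cons, Module.End.mul_apply, fmap_evAt_phiOp, ih, ih]
    rfl

/-- The matrix with entries `δ_{ij} τ - t_{ij}(u - j)`. -/
def tauMatrix (t : F → Matrix (Fin N) (Fin N) (Module.End F H)) :
    Matrix (Fin N) (Fin N) (Module.End F (F → H)) :=
  Matrix.of fun i j => (if i = j then shiftOp F H else 0) - mulOp fun u => t (u - ((j : ℕ) : F)) i j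

lemma fmap_evAt_tauMatrix (t : F → Matrix (Fin N) (Fin N) (Module.End F H)) (j : Fin N) (u : F)
    (y : Fermi F N (F → H)) :
    fmap (evAt F H u) (col (tauMatrix t) j y) = psi F H j (fmap (evAt F H (u + 1)) y) -
      col (t (u - ((j : ℕ) : F))) j (fmap (evAt F H u) y) := by
  have h1 (i : Fin N) : fmap (evAt F H u) (ampl N (if i = j then shiftOp F H else 0) y) =
      if i = j then fmap (evAt F H (u + 1)) y else 0 := by
    split_ifs
    · rw [fmap_ampl (evAt F H u) (evAt F H (u + 1)) _ 1]
      · simp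
      · intro x; rfl
    · simp
  have h2 (i : Fin N) : fmap (evAt F H u) (ampl N (mulOp fun u => t (u - ((j : ℕ) : F)) i j) y) =
      ampl N (t (u - ((j : ℕ) : F)) i j) (fmap (evAt F H u) y) := by
    apply fmap_ampl
    intro x; rfl
  simp only [col, tauMatrix, LinearMap.sum_apply, map_sum, Module.End.mul_apply, fmap_psi,
    Matrix.of_apply, ampl_sub, LinearMap.sub_apply, map_sub, h1, h2, Finset.sum_sub_distrib]
  congr 1
  have : ∀ i, psi F H i (if i = j then fmap (evAt F H (u + 1)) y else 0) =
      if i = j then psi F H i (fmap (evAt F H (u + 1)) y) else 0 := fun i => by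
    split_ifs <;> simp
  simp [this]

/-- Writing a value at `u + 1` as the value at `u` plus its difference turns `τ ψ_j - T` into `d ψ_j
- Φ_j`. The shift `τ` brings the tail from position `u - o - 1` to `u - o`, while the term without
`τ` stays one step behind, which is the backward shift inside `Φ`. The differences of `φ` at `u`
enter as constant functions, so `d` commutes with everything. -/
lemma fmap_evAt_prod_tauMatrix (t : F → Matrix (Fin N) (Fin N) (Module.End F H))
    (φ : F → H) (l : List (Fin N)) :
    ∀ (o : ℕ), (∀ (k : ℕ) (hk : k < l.length), (l[k] : ℕ) = o + k) → ∀ u : F,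
    fmap (evAt F H u) ((l.map (col (tauMatrix t))).prod (vac F N (F → H) φ)) =
      ∑ k ∈ Finset.range (l.length + 1), fmap (evAt F H (u - o))
        (mixProd (phiOp t) l k (vac F N (F → H) fun _ => ((deltaOp F H) ^ k) φ u)) := by
  induction l with
  | nil =>
    intro o _ u
    simp [mixProd, fmap_vac]
  | cons j l ih =>
    intro o ho u
    have hj : (j : ℕ) = o := ho 0 (by simp)
    have ih' := ih (o + 1) (fun k hk => by
      have := ho (k + 1) (by simpa using hk)
      rw [List.getElem_cons_succ] at this
      omega)
    have hd (k : ℕ) : ((deltaOp F H) ^ k) φ (u + 1) = ((deltaOp F H) ^ k) φ u +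
        ((deltaOp F H) ^ (k + 1)) φ u := by
      rw [pow_succ', Module.End.mul_apply]
      simp [deltaOp, shiftOp]
    have hu1 : u + 1 - ((o + 1 : ℕ) : F) = u - o := by push_cast; ring
    have hu2 : u - ((o + 1 : ℕ) : F) = u - o - 1 := by push_cast; ring
    have hvac (k : ℕ) : (vac F N (F → H) fun _ => ((deltaOp F H) ^ k) φ (u + 1)) =
        (vac F N (F → H) fun _ => ((deltaOp F H) ^ k) φ u) +
        (vac F N (F → H) fun _ => ((deltaOp F H) ^ (k + 1)) φ u) := by
      rw [← map_add]
      congr 1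
      funext _
      exact hd k
    rw [List.map_cons, List.prod_cons, Module.End.mul_apply, fmap_evAt_tauMatrix, ih', ih', hu1, hu2,
      hj]
    simp only [hvac, map_add, map_sum, Finset.sum_add_distrib]
    set g : ℕ → Fermi F N (F → H) := fun k => vac F N (F → H) fun _ => ((deltaOp F H) ^ k) φ u
    -- The tail has no coefficient in this degree, so the sums over `k` and over `k + 1` can be
    -- given the same range.
    have hlast : mixProd (phiOp t) l (l.length + 1) = 0 := mixProd_eq_zero _ _ _ (Nat.lt_succ_self _)
    rw [List.length_cons, Finset.sum_range_succ' _ (l.length + 1)]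
    have hstep (k : ℕ) : fmap (evAt F H (u - o)) (mixProd (phiOp t) (j :: l) (k + 1) (g (k + 1))) =
        psi F H j (fmap (evAt F H (u - o)) (mixProd (phiOp t) l k (g (k + 1)))) -
        (col (t (u - o)) j (fmap (evAt F H (u - o - 1)) (mixProd (phiOp t) l (k + 1) (g (k + 1)))) -
        psi F H j (fmap (evAt F H (u - o)) (mixProd (phiOp t) l (k + 1) (g (k + 1))))) := by
      rw [mixProd, LinearMap.sub_apply, map_sub, Module.End.mul_apply, Module.End.mul_apply,
        fmap_psi, fmap_evAt_phiOp]
    have hzero : fmap (evAt F H (u - o)) (mixProd (phiOp t) (j :: l) 0 (g 0)) =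
        - (col (t (u - o)) j (fmap (evAt F H (u - o - 1)) (mixProd (phiOp t) l 0 (g 0))) -
        psi F H j (fmap (evAt F H (u - o)) (mixProd (phiOp t) l 0 (g 0)))) := by
      rw [mixProd, LinearMap.neg_apply, map_neg, Module.End.mul_apply, fmap_evAt_phiOp]
    simp only [show ∀ k, (vac F N (F → H) fun _ => ((deltaOp F H) ^ k) φ u) = g k from
      fun _ => rfl, hstep, hzero, Finset.sum_sub_distrib]
    have e1 := Finset.sum_range_succ' (fun k => col (t (u - o)) j
      (fmap (evAt F H (u - o - 1)) (mixProd (phiOp t) l k (g k)))) (l.length + 1)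
    have e2 := Finset.sum_range_succ' (fun k => psi F H j
      (fmap (evAt F H (u - o)) (mixProd (phiOp t) l k (g k)))) (l.length + 1)
    rw [Finset.sum_range_succ, hlast] at e1 e2
    simp only [LinearMap.zero_apply, map_zero, add_zero] at e1 e2
    rw [e1, e2]
    abel

/-- The column determinant of `δ_{ij} τ - t_{ij}(u - j)` in terms of powers of `d`. -/
theorem cdet_expansion (t : F → Matrix (Fin N) (Fin N) (Module.End F H)) (φ : F → H) (u : F) :
    (∑ σ : Equiv.Perm (Fin N), (Equiv.Perm.sign σ : ℤ) •
        (List.ofFn fun j => tauMatrix t (σ j) j).prod) φ u =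
      ∑ r ∈ Finset.range (N + 1), (-1 : F) ^ r • ((List.sublistsLen r (List.finRange N)).map
        fun K => contr F H K (colProd t K u
          (vac F N H (((deltaOp F H) ^ (N - r)) φ u)))).sum := by
  have h1 := contr_prod_col (tauMatrix t) φ
  have h2 := fmap_evAt_prod_tauMatrix t φ (List.finRange N) 0 (by simp) u
  have h3 := congrArg (contr F H (List.finRange N)) h2
  rw [contr_fmap, h1, map_sum] at h3
  simp only [List.ofFn_eq_map, LinearMap.sum_apply, LinearMap.smul_apply, Finset.sum_apply,
    Pi.smul_apply]
  refine (Eq.trans rfl h3).trans ?_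
  rw [map_sum, List.length_finRange, ← Finset.sum_range_reflect]
  refine Finset.sum_congr rfl fun r hr => ?_
  have hr' : r ≤ N := by simpa [Nat.lt_succ_iff] using hr
  rw [contr_fmap, show N + 1 - 1 - r = N - r by omega]
  have h4 := contr_mixProd (phiOp t) (phiOp_psi t) (List.finRange N) [] 1 (N - r) r
    (vac F N (F → H) fun _ => ((deltaOp F H) ^ (N - r)) φ u) (by simpa using List.nodup_finRange N)
    (by simp) (by simp; omega)
  simp only [List.nil_append, Module.End.one_apply] at h4
  rw [h4, map_smul, map_list_sum, List.map_map]
  congr 3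
  funext K
  simp only [Function.comp_apply]
  rw [← contr_fmap, Nat.cast_zero, sub_zero, fmap_evAt_prod_phiOp]

end CDet

end

/-! ### A polynomial recursion for the coefficients of the difference operator -/

section

/-! ### The Fock space -/

section Fock

variable {F : Type} [Field F] {M N : ℕ}

/-- Multiplication by `x_{s,i}`. -/
def xOp (F : Type) [Field F] {M N : ℕ} (s : Fin M) (i : Fin N) : Module.End F (Fock F M N) :=
  LinearMap.mulLeft F (MvPolynomial.X (s, i))

/-- The derivative with respect to `x_{s,i}`. -/
def dOp (F : Type) [Field F] {M N : ℕ} (s : Fin M) (i : Fin N) : Module.End F (Fock F M N) :=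
  (MvPolynomial.pderiv (s, i)).toLinearMap

lemma siteOp_eq (s : Fin M) (i j : Fin N) : siteOp F s i j = xOp F s i * dOp F s j := rfl

lemma dOp_mul_xOp (s t : Fin M) (i j : Fin N) :
    dOp F s j * xOp F t i = xOp F t i * dOp F s j + if s = t ∧ j = i then 1 else 0 := by
  ext1 k
  ext1
  simp only [LinearMap.comp_apply, Module.End.mul_apply, LinearMap.add_apply, xOp, dOp,
    LinearMap.mulLeft_apply, Derivation.coeFn_coe,
    Derivation.leibniz, MvPolynomial.pderiv_X, smul_eq_mul]
  congr 1
  by_cases h : s = t ∧ j = i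
  · obtain ⟨rfl, rfl⟩ := h
    simp
  · rw [if_neg h, Pi.single_eq_of_ne]
    · simp
    · rintro ⟨⟩
      exact h ⟨rfl, rfl⟩

lemma xOp_comm (s t : Fin M) (i j : Fin N) : Commute (xOp F s i) (xOp F t j) := by
  apply LinearMap.ext
  intro p
  simp only [xOp, Module.End.mul_apply, LinearMap.mulLeft_apply]
  ring

lemma dOp_comm (s t : Fin M) (i j : Fin N) : Commute (dOp F s i) (dOp F t j) := by
  have h : ⁅MvPolynomial.pderiv (R := F) (s, i), MvPolynomial.pderiv (R := F) (t, j)⁆ = 0 := by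
    apply MvPolynomial.derivation_ext
    intro k
    simp only [Derivation.commutator_apply, MvPolynomial.pderiv_X]
    simp only [Pi.single_apply, Derivation.zero_apply]
    split_ifs <;> simp
  apply LinearMap.ext
  intro p
  have := DFunLike.congr_fun h p
  rw [Derivation.commutator_apply, Derivation.zero_apply, sub_eq_zero] at this
  exact this

lemma dOp_mul_xOp_of_ne {s t : Fin M} (h : s ≠ t) (i j : Fin N) :
    Commute (dOp F s j) (xOp F t i) := by
  have := dOp_mul_xOp (F := F) s t i j
  rw [if_neg (by tauto), add_zero] at this
  exact this

lemma xOp_siteOp_of_ne {s t : Fin M} (h : s ≠ t) (k i j : Fin N) :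
    Commute (xOp F s k) (siteOp F t i j) := by
  rw [siteOp_eq]
  exact (xOp_comm _ _ _ _).mul_right (dOp_mul_xOp_of_ne h.symm _ _).symm

lemma dOp_siteOp_of_ne {s t : Fin M} (h : s ≠ t) (k i j : Fin N) :
    Commute (dOp F s k) (siteOp F t i j) := by
  rw [siteOp_eq]
  exact (dOp_mul_xOp_of_ne h _ _).mul_right (dOp_comm _ _ _ _)

lemma siteOp_comm_of_ne {s t : Fin M} (h : s ≠ t) (i j k l : Fin N) :
    Commute (siteOp F s i j) (siteOp F t k l) := by
  rw [siteOp_eq s]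
  exact (xOp_siteOp_of_ne h _ _ _).mul_left (dOp_siteOp_of_ne h _ _ _)

/-- The normally ordered product of two generators at the same site. -/
lemma siteOp_mul_siteOp_same (s : Fin M) (i j k l : Fin N) :
    siteOp F s i j * siteOp F s k l =
      xOp F s i * xOp F s k * (dOp F s j * dOp F s l) + if j = k then siteOp F s i l else 0 := by
  rw [siteOp_eq, siteOp_eq, mul_assoc, ← mul_assoc (dOp F s j), dOp_mul_xOp, add_mul, mul_add]
  simp only [true_and, mul_assoc]
  congr 1
  split_ifs
  · rw [one_mul]; rfl
  · simp

lemma siteOp_lie (s t : Fin M) (i j k l : Fin N) :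
    siteOp F s i j * siteOp F t k l - siteOp F t k l * siteOp F s i j =
      if s = t then (if j = k then siteOp F s i l else 0) - (if l = i then siteOp F s k j else 0)
      else 0 := by
  split_ifs with h
  all_goals try subst h
  all_goals try rw [siteOp_mul_siteOp_same, siteOp_mul_siteOp_same, (xOp_comm s s k i).eq,
    (dOp_comm s s l j).eq]
  all_goals try (simp only [*, if_true, if_false]; abel)
  rw [(siteOp_comm_of_ne h i j k l).eq, sub_self]

lemma diagOp_siteOp_lie (t : Fin M) (i j k l : Fin N) :
    diagOp F i j * siteOp F t k l - siteOp F t k l * diagOp F i j =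
      (if j = k then siteOp F t i l else 0) - (if l = i then siteOp F t k j else 0) := by
  simp only [diagOp, Finset.sum_mul, Finset.mul_sum, ← Finset.sum_sub_distrib, siteOp_lie]
  simp

lemma diagOp_lie (i j k l : Fin N) :
    diagOp F (M := M) i j * diagOp F k l - diagOp F k l * diagOp F i j =
      (if j = k then diagOp F i l else 0) - (if l = i then diagOp F k j else 0) := by
  have : ∀ t : Fin M, _ := fun t => diagOp_siteOp_lie (F := F) t i j k l
  conv_lhs => rw [diagOp, diagOp.eq_def F k l]
  rw [← diagOp, Finset.mul_sum, Finset.sum_mul, ← Finset.sum_sub_distrib]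
  simp only [this, Finset.sum_sub_distrib]
  congr 1 <;> split_ifs <;> simp [diagOp]

end Fock

/-! ### Matrix elements of column products -/

section CoefRec

variable {F : Type} [Field F] {M N : ℕ}

/-- The recursion for the matrix elements of column products of monodromy matrices. -/
def coefRec {A : Type*} [Ring A] [Algebra F A] (E : Fin M → Fin N → Fin N → A) (w : Fin M → F)
    (base : List (Fin N) → List (Fin N) → A) :
    List (Fin M) → F → List (Fin N) → List (Fin N) → A
  | [], _, I, J => base I J
  | s :: S, u, I, J => (u - w s) • coefRec E w base S u I J +
      altSum I fun i I' => ∑ c, E s i c * coefRec E w base S u (c :: I') J +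
        (u - J.length + 1) • altSum J fun j J' => E s i j * coefRec E w base S u I' J'

/-- The matrix elements of column products of the matrix `1 + u⁻¹ E`. -/
def capBase {A : Type*} [Ring A] (E : Fin N → Fin N → A) (I J : List (Fin N)) : A :=
  match J with
  | [] => if I = [] then 1 else 0
  | j :: l => altSum I fun i I' => (E i j + if i = j then (l.length : A) else 0) * capBase E I' l

lemma capBase_nil {A : Type*} [Ring A] (E : Fin N → Fin N → A) (I : List (Fin N)) :
    capBase E I [] = if I = [] then 1 else 0 := rfl

lemma capBase_cons {A : Type*} [Ring A] (E : Fin N → Fin N → A) (I : List (Fin N)) (j : Fin N)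
    (l : List (Fin N)) : capBase E I (j :: l) = altSum I fun i I' =>
      (E i j + if i = j then (l.length : A) else 0) * capBase E I' l := rfl

lemma contr_capProd {H : Type} [AddCommGroup H] [Module F H]
    (E : Fin N → Fin N → Module.End F H) (I J : List (Fin N)) (v : H) :
    contr F H I (capProd (Matrix.of E) J (vac F N H v)) = capBase E I J v := by
  induction J generalizing I with
  | nil =>
    rw [capProd, capBase_nil, Module.End.one_apply]
    cases I with
    | nil => simp [contr_nil, vacProj_vac]
    | cons i I => simp [contr_cons, iota_vac]
  | cons j l ih =>
    have hcol : col (Matrix.of E) j + (l.length : F) • psi F H j =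
        odd fun i => E i j + if i = j then (l.length : Module.End F H) else 0 := by
      rw [← col_one, col_eq_odd, col_eq_odd, odd, odd, odd, Finset.smul_sum,
        ← Finset.sum_add_distrib]
      refine Finset.sum_congr rfl fun i _ => ?_
      rw [Matrix.of_apply, ampl_add, mul_add, ← mul_smul_comm, ← ampl_smul]
      congr 3
      by_cases h : i = j
      · subst h
        simp [Algebra.smul_def]
      · simp [h]
    rw [capProd, hcol, Module.End.mul_apply, contr_odd, capBase_cons]
    rw [show ∀ f : Fin N → List (Fin N) → Module.End F H, (altSum I f) v =
      altSum I fun i I' => f i I' v from fun f => map_altSum (LinearMap.applyₗ (R := F) v) I f]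
    simp only [ih, Module.End.mul_apply]

/-- The monodromy matrix of a list of sites. -/
def monodromy {F : Type} [Field F] {M N : ℕ} (lam : Fin N → F) (w : Fin M → F)
    (S : List (Fin M)) (u : F) : Matrix (Fin N) (Fin N) (Module.End F (State M lam)) :=
  (S.map fun s => siteL lam s (w s) u).prod * vermaL M lam u

lemma monodromy_cons (lam : Fin N → F) (w : Fin M → F) (s : Fin M) (S : List (Fin M)) (u : F) :
    monodromy lam w (s :: S) u = siteL lam s (w s) u * monodromy lam w S u := by
  rw [monodromy, List.map_cons, List.prod_cons, mul_assoc, monodromy]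

lemma transfer_eq_monodromy (lam : Fin N → F) (w : Fin M → F) (u : F) :
    transfer lam w u = monodromy lam w (List.finRange M) u := by
  rw [transfer, monodromy, List.ofFn_eq_map]

lemma rTensor_monodromy (lam : Fin N → F) (w : Fin M → F) (A : Module.End F (Fock F M N))
    (S : List (Fin M)) (hA : ∀ s ∈ S, ∀ i j, Commute A (siteOp F s i j)) (u : F) (i j : Fin N) :
    Commute (A.rTensor (Verma lam)) (monodromy lam w S u i j) := by
  have hone (i j : Fin N) : Commute (A.rTensor (Verma lam) : Module.End F (State M lam))
      ((1 : Matrix (Fin N) (Fin N) (Module.End F (State M lam))) i j) := by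
    by_cases h : i = j
    · subst h; rw [Matrix.one_apply_eq]; exact Commute.one_right _
    · rw [Matrix.one_apply_ne h]; exact Commute.zero_right _
  induction S generalizing i j with
  | nil =>
    rw [monodromy, List.map_nil, List.prod_nil, one_mul, vermaL, Matrix.add_apply, Matrix.of_apply]
    refine (hone i j).add_right (Commute.smul_right ?_ _)
    change _ ∘ₗ _ = _ ∘ₗ _
    rw [LinearMap.rTensor_comp_lTensor, LinearMap.lTensor_comp_rTensor]
  | cons s S ih =>
    rw [monodromy_cons, Matrix.mul_apply]
    refine Commute.sum_right _ _ _ fun k _ => ?_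
    refine Commute.mul_right ?_ (ih (fun s hs => hA s (List.mem_cons_of_mem _ hs)) k j)
    rw [siteL, Matrix.add_apply, Matrix.of_apply]
    refine (hone i k).add_right (Commute.smul_right ?_ _)
    change _ ∘ₗ _ = _ ∘ₗ _
    rw [← LinearMap.rTensor_comp, ← LinearMap.rTensor_comp]
    exact congrArg _ (hA s List.mem_cons_self i k).eq

/-- The operators `e_{ij}` of a tensor factor, acting in the space of states. -/
abbrev siteState {F : Type} [Field F] {M N : ℕ} (lam : Fin N → F) (s : Fin M) (i j : Fin N) :
    Module.End F (State M lam) := (siteOp F s i j).rTensor (Verma lam)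

/-- The operators `e_{ij}` of the Verma module, acting in the space of states. -/
abbrev vermaState {F : Type} [Field F] (M : ℕ) {N : ℕ} (lam : Fin N → F) (i j : Fin N) :
    Module.End F (State M lam) := (vermaOp lam i j).lTensor (Fock F M N)

/-- These are the matrix elements of `colProd_site` after clearing denominators. A new site either
inserts an index into the row list or deletes one index from each list. Deleting a column shortens
the falling factorial by its last factor, which therefore appears as `u - J.length + 1`. -/
theorem contr_colProd_monodromy (lam : Fin N → F) (w : Fin M → F) (S : List (Fin M))
    (hS : S.Nodup) (I J : List (Fin N)) (u : F) (hu0 : ∀ k ≤ J.length, u ≠ k)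
    (huw : ∀ k ≤ J.length, ∀ s, u - k ≠ w s) (v : State M lam) :
    ((descPochhammer F J.length).eval u * (S.map fun s => u - w s).prod) •
      contr F _ I (colProd (monodromy lam w S) J u (vac F N _ v)) =
    coefRec (siteState lam) w (capBase (vermaState M lam)) S u I J v := by
  induction S generalizing I J with
  | nil =>
    have := colProd_base (F := F) (H := State M lam) (Matrix.of (vermaState M lam)) J u hu0
    rw [coefRec, ← contr_capProd (vermaState M lam), ← this, List.map_nil, List.prod_nil, mul_one,
      LinearMap.smul_apply, map_smul]
    have hm : monodromy lam w [] = fun u => 1 + Matrix.of fun i j => u⁻¹ • vermaState M lam i j := by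
      funext u
      rw [monodromy, List.map_nil, List.prod_nil, one_mul]
      rfl
    rw [hm]
    rfl
  | cons s S ih =>
    rw [List.nodup_cons] at hS
    have hne : ∀ s' ∈ S, s ≠ s' := fun s' hs' h => hS.1 (h ▸ hs')
    have huws : u - w s ≠ 0 := by
      have := huw 0 (by simp) s
      rw [Nat.cast_zero, sub_zero] at this
      exact sub_ne_zero.2 this
    have hsite := colProd_site (monodromy lam w S) (monodromy lam w (s :: S))
      (fun i => (xOp F s i).rTensor (Verma lam)) (fun i => (dOp F s i).rTensor (Verma lam)) (w s)
      (fun i j => by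
        change _ ∘ₗ _ = _ ∘ₗ _
        rw [← LinearMap.rTensor_comp, ← LinearMap.rTensor_comp]
        exact congrArg _ (xOp_comm s s i j).eq)
      (fun i j => by
        have := congrArg (LinearMap.rTensor (Verma lam)) (dOp_mul_xOp (F := F) s s j i)
        rw [LinearMap.rTensor_add] at this
        change LinearMap.rTensor _ _ ∘ₗ LinearMap.rTensor _ _ =
          LinearMap.rTensor _ _ ∘ₗ LinearMap.rTensor _ _ + _
        rw [← LinearMap.rTensor_comp, ← LinearMap.rTensor_comp]
        refine this.trans ?_
        congr 1
        by_cases h : i = j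
        · rw [if_pos ⟨rfl, h⟩, if_pos h]; exact LinearMap.rTensor_id _ _
        · rw [if_neg (by tauto), if_neg h]; exact LinearMap.rTensor_zero _)
      (fun u i j k => rTensor_monodromy lam w _ S (fun s' hs' i j =>
        xOp_siteOp_of_ne (hne s' hs') k i j) u i j)
      (fun u i j k => rTensor_monodromy lam w _ S (fun s' hs' i j =>
        dOp_siteOp_of_ne (hne s' hs') k i j) u i j)
      (fun u i j => by
        rw [monodromy_cons, siteL, add_mul, one_mul, Matrix.add_apply, Matrix.mul_apply]
        congr 1
        rw [Finset.mul_sum, Finset.smul_sum]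
        refine Finset.sum_congr rfl fun c _ => ?_
        rw [Matrix.of_apply, smul_mul_assoc, ← mul_assoc, siteOp_eq]
        congr 2
        exact LinearMap.rTensor_comp _ _ _)
      v J u (fun k hk => huw k hk s)
    have hap (f : Fin N → List (Fin N) → Module.End F (State M lam)) (l : List (Fin N)) :
        (altSum l f) v = altSum l fun i I' => f i I' v :=
      map_altSum (LinearMap.applyₗ (R := F) v) l f
    set p := (S.map fun s => u - w s).prod with hp
    have hprod : ((s :: S).map fun s => u - w s).prod = (u - w s) * p := by
      rw [List.map_cons, List.prod_cons]
    have hsx (i c : Fin N) (z : State M lam) : (xOp F s i).rTensor (Verma lam)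
        ((dOp F s c).rTensor (Verma lam) z) = siteState lam s i c z := by
      rw [← LinearMap.comp_apply, ← LinearMap.rTensor_comp]; rfl
    have ihS := ih hS.2
    rw [coefRec, hsite, map_add, smul_add, LinearMap.add_apply, LinearMap.smul_apply,
      ← ihS I J hu0 huw, hap, hprod]
    congr 1
    · rw [smul_smul]; congr 1; ring
    · rw [map_smul, contr_odd, smul_smul, smul_altSum]
      refine altSum_congr _ _ _ fun i I' _ => ?_
      simp only [map_add, map_sum, contr_ampl, LinearMap.add_apply, LinearMap.sum_apply,
        Module.End.mul_apply, LinearMap.smul_apply, smul_add, hap, map_altSum]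
      have hscal : (descPochhammer F J.length).eval u * ((u - w s) * p) * (u - w s)⁻¹ =
          (descPochhammer F J.length).eval u * p := by field_simp
      rw [hscal]
      congr 1
      · rw [Finset.smul_sum]
        refine Finset.sum_congr rfl fun c _ => ?_
        rw [← ihS (c :: I') J hu0 huw, map_smul, hsx, contr_cons]
      · rw [smul_altSum, smul_altSum]
        refine altSum_congr _ _ _ fun j J' hJ' => ?_
        have hlen : J.length = J'.length + 1 := by rw [← hJ'.length_eq, List.length_cons]
        rw [← ihS I' J' (fun k hk => hu0 k (by omega)) (fun k hk => huw k (by omega)), map_smul, hsx,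
          smul_smul]
        congr 1
        rw [hlen, descPochhammer_succ_eval]
        push_cast
        ring

/-- The operators that multiply `(u - N + 1) ⋯ (u - r) d^{N - r}` in the difference operator. -/
def bethe {A : Type*} [Ring A] [Algebra F A] (E : Fin M → Fin N → Fin N → A) (w : Fin M → F)
    (base : List (Fin N) → List (Fin N) → A) (r : ℕ) (u : F) : A :=
  (-1 : F) ^ r • ((List.sublistsLen r (List.finRange N)).map fun K =>
    coefRec E w base (List.finRange M) u K K).sum

lemma descPochhammer_eval_split {r N : ℕ} (h : r ≤ N) (u : F) :
    (descPochhammer F N).eval u =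
      (ascPochhammer F (N - r)).eval (u - N + 1) * (descPochhammer F r).eval u := by
  have := congrArg (Polynomial.eval u) (descPochhammer_mul (R := F) r (N - r))
  rw [Nat.add_sub_cancel' h, Polynomial.eval_mul, Polynomial.eval_comp] at this
  rw [← this, mul_comm, descPochhammer_eval_eq_ascPochhammer]
  congr 2
  simp [Nat.cast_sub h]

/-- A minor of order `r` uses only the first `r` factors of the falling factorial. The remaining `N
- r` factors form the rising factorial that accompanies `d^{N-r}`. -/
theorem prefactor_smul_diffOp (lam : Fin N → F) (w : Fin M → F) (u : F)
    (hu0 : ∀ k ≤ N, u ≠ k) (huw : ∀ k ≤ N, ∀ s, u - k ≠ w s) (φ : F → State M lam) :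
    prefactor N w u • diffOp lam w φ u =
      ∑ r ∈ Finset.range (N + 1), (ascPochhammer F (N - r)).eval (u - N + 1) •
        bethe (siteState lam) w (capBase (vermaState M lam)) r u
          (((deltaOp F (State M lam)) ^ (N - r)) φ u) := by
  have hD : diffOp lam w φ u = (∑ σ : Equiv.Perm (Fin N), (Equiv.Perm.sign σ : ℤ) •
        (List.ofFn fun j => tauMatrix (monodromy lam w (List.finRange M)) (σ j) j).prod) φ u := by
    rw [← funext (transfer_eq_monodromy lam w)]
    rfl
  rw [hD, cdet_expansion, Finset.smul_sum]
  refine Finset.sum_congr rfl fun r hr => ?_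
  have hr : r ≤ N := by simpa [Nat.lt_succ_iff] using hr
  have hlist (L : List (List (Fin N))) (g : List (Fin N) → Module.End F (State M lam))
      (v : State M lam) : (L.map g).sum v = (L.map fun K => g K v).sum := by
    induction L with
    | nil => simp
    | cons K L ih => simp [ih]
  rw [bethe, LinearMap.smul_apply, hlist, smul_comm, smul_comm _ ((-1 : F) ^ r)]
  congr 1
  rw [List.smul_sum, List.smul_sum, List.map_map, List.map_map]
  congr 1
  refine List.map_congr_left fun K hK => ?_
  have hlen : K.length = r := List.length_of_sublistsLen hK
  simp only [Function.comp_apply]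
  rw [← contr_colProd_monodromy lam w _ (List.nodup_finRange M) K K u
    (fun k hk => hu0 k (by omega)) (fun k hk => huw k (by omega)), smul_smul, hlen, prefactor,
    descPochhammer_eval_split hr, ← mul_assoc]
  congr 2

end CoefRec

end

/-! ### Verma modules and a linear form of the map θ -/

section

attribute [local instance 100] LieRing.ofAssociativeRing

/-! ### Representations of `gl_N` -/

/-- The commutation relations of `gl_N`. -/
def IsGL {A : Type*} [Ring A] {N : ℕ} (E : Fin N → Fin N → A) : Prop :=
  ∀ i j k l, E i j * E k l - E k l * E i j =
    (if j = k then E i l else 0) - (if l = i then E k j else 0)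

lemma isGL_of_ccr {A : Type*} [Ring A] {M N : ℕ} (x d : Fin M → Fin N → A)
    (hx : ∀ s t i j, Commute (x s i) (x t j)) (hd : ∀ s t i j, Commute (d s i) (d t j))
    (h : ∀ s t i j, d s j * x t i = x t i * d s j + if s = t ∧ j = i then 1 else 0) :
    IsGL fun i j => ∑ s, x s i * d s j := by
  intro i j k l
  have hst (s t : Fin M) (i j k l : Fin N) : x s i * d s j * (x t k * d t l) =
      x s i * x t k * (d s j * d t l) + if s = t ∧ j = k then x s i * d t l else 0 := by
    rw [mul_assoc, ← mul_assoc (d s j), h, add_mul, mul_add]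
    simp only [mul_assoc]
    congr 1
    split_ifs <;> simp
  have hc (s t : Fin M) : x s i * d s j * (x t k * d t l) - x t k * d t l * (x s i * d s j) =
      (if s = t then if j = k then x s i * d t l else 0 else 0) -
        if s = t then if l = i then x t k * d s j else 0 else 0 := by
    rw [hst, hst, (hx t s k i).eq, (hd t s l j).eq, add_sub_add_left_eq_sub]
    by_cases hs : s = t <;> simp [hs, eq_comm]
  have e2 : (∑ s, x s k * d s l) * ∑ s, x s i * d s j =
      ∑ s, ∑ t, x t k * d t l * (x s i * d s j) := by
    rw [Finset.sum_mul_sum, Finset.sum_comm]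
  rw [e2, Finset.sum_mul_sum, ← Finset.sum_sub_distrib]
  simp only [← Finset.sum_sub_distrib, hc]
  simp only [Finset.sum_sub_distrib, Finset.sum_ite_eq, Finset.mem_univ, if_true]
  congr 1 <;> split_ifs <;> simp

/-- The Lie algebra homomorphism given by operators that satisfy the relations of `gl_N`. -/
def glHom {F : Type} [Field F] {A : Type} [Ring A] [Algebra F A] {N : ℕ} (E : Fin N → Fin N → A)
    (hE : IsGL E) : Matrix (Fin N) (Fin N) F →ₗ⁅F⁆ A where
  toFun X := ∑ i, ∑ j, X i j • E i j
  map_add' X Y := by simp [add_smul, Finset.sum_add_distrib]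
  map_smul' c X := by simp [mul_smul, Finset.smul_sum]
  map_lie' := by
    intro X Y
    have h1 : (∑ i, ∑ j, X i j • E i j) * (∑ i, ∑ j, Y i j • E i j) -
        (∑ i, ∑ j, Y i j • E i j) * (∑ i, ∑ j, X i j • E i j) =
        ∑ i, ∑ j, ∑ k, ∑ l, (X i j * Y k l) • (E i j * E k l - E k l * E i j) := by
      have e1 : (∑ i, ∑ j, X i j • E i j) * (∑ i, ∑ j, Y i j • E i j) =
          ∑ i, ∑ j, ∑ k, ∑ l, (X i j * Y k l) • (E i j * E k l) := by
        simp only [Finset.sum_mul]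
        simp only [Finset.mul_sum, smul_mul_smul_comm]
      have e2 : (∑ i, ∑ j, Y i j • E i j) * (∑ i, ∑ j, X i j • E i j) =
          ∑ i, ∑ j, ∑ k, ∑ l, (X i j * Y k l) • (E k l * E i j) := by
        simp only [Finset.mul_sum]
        refine Finset.sum_congr rfl fun i _ => Finset.sum_congr rfl fun j _ => ?_
        simp only [Finset.sum_mul, smul_mul_smul_comm, mul_comm (X i j)]
      rw [e1, e2]
      simp only [← Finset.sum_sub_distrib, smul_sub]
    rw [LieRing.of_associative_ring_bracket, LieRing.of_associative_ring_bracket, h1]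
    simp only [hE _ _ _ _, smul_sub, smul_ite, smul_zero, Finset.sum_sub_distrib, Matrix.sub_apply,
      sub_smul, Matrix.mul_apply, Finset.sum_smul]
    congr 1
    · refine Finset.sum_congr rfl fun i _ => ?_
      rw [Finset.sum_comm]
      refine Finset.sum_congr rfl fun j _ => ?_
      rw [Finset.sum_comm]
      simp
    · simp only [Finset.sum_ite_eq', Finset.mem_univ, if_true]
      symm
      calc _ = ∑ x, ∑ z, ∑ y, (X x y * Y z x) • E z y :=
            Finset.sum_congr rfl fun _ _ => Finset.sum_comm
        _ = ∑ z, ∑ x, ∑ y, (X x y * Y z x) • E z y := Finset.sum_comm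
        _ = _ := Finset.sum_congr rfl fun _ _ => by
            rw [Finset.sum_comm]
            simp only [mul_comm]

/-- The extension to the universal enveloping algebra. -/
def uglHom {F : Type} [Field F] {A : Type} [Ring A] [Algebra F A] {N : ℕ} (E : Fin N → Fin N → A)
    (hE : IsGL E) : UGL F N →ₐ[F] A := UniversalEnvelopingAlgebra.lift F (glHom E hE)

lemma uglHom_genU {F : Type} [Field F] {A : Type} [Ring A] [Algebra F A] {N : ℕ}
    (E : Fin N → Fin N → A) (hE : IsGL E) (i j : Fin N) : uglHom E hE (genU F i j) = E i j := by
  rw [uglHom, genU, UniversalEnvelopingAlgebra.lift_ι_apply]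
  change ∑ k, ∑ l, Matrix.single i j (1 : F) k l • E k l = E i j
  simp [Matrix.single_apply, ite_and]

variable {F : Type} [Field F] {N : ℕ}

lemma genU_lie : IsGL (genU F (N := N)) := by
  intro i j k l
  have h : ⁅genU F i j, genU F k l⁆ = _ :=
    (LieHom.map_lie (UniversalEnvelopingAlgebra.ι F) (Matrix.single i j (1 : F))
      (Matrix.single k l (1 : F))).symm
  rw [LieRing.of_associative_ring_bracket, LieRing.of_associative_ring_bracket] at h
  rw [h, map_sub]
  congr 1
  · split_ifs with hjk
    · subst hjk; simp [genU]
    · simp [hjk]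
  · split_ifs with hli
    · subst hli; simp [genU]
    · simp [hli]

lemma vermaOp_lie (lam : Fin N → F) : IsGL (vermaOp lam) := by
  intro i j k l
  have h := congrArg (Algebra.lsmul F F (Verma lam)) (genU_lie (F := F) i j k l)
  rw [map_sub, map_sub, map_mul, map_mul] at h
  refine h.trans ?_
  congr 1 <;> split_ifs <;> simp [vermaOp]

lemma vermaOp_vec (lam : Fin N → F) {i j : Fin N} (hij : i < j) :
    vermaOp lam i j (vermaVec lam) = 0 := by
  change Submodule.Quotient.mk (genU F i j * 1) = 0
  rw [mul_one, Submodule.Quotient.mk_eq_zero]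
  exact Submodule.subset_span (Or.inl ⟨i, j, hij, rfl⟩)

lemma vermaOp_vec_self (lam : Fin N → F) (i : Fin N) :
    vermaOp lam i i (vermaVec lam) = lam i • vermaVec lam := by
  have h : Submodule.Quotient.mk (p := vermaIdeal lam)
      (genU F i i - algebraMap F (UGL F N) (lam i)) = 0 :=
    (Submodule.Quotient.mk_eq_zero _).2 (Submodule.subset_span (Or.inr ⟨i, rfl⟩))
  rw [Submodule.Quotient.mk_sub, sub_eq_zero] at h
  change Submodule.Quotient.mk (genU F i i * 1) = lam i • Submodule.Quotient.mk 1
  rw [mul_one, h, Algebra.algebraMap_eq_smul_one]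
  rfl

lemma ugl_induction {p : UGL F N → Prop} (hc : ∀ c, p (algebraMap F _ c))
    (hg : ∀ i j, p (genU F i j)) (ha : ∀ x y, p x → p y → p (x + y))
    (hm : ∀ x y, p x → p y → p (x * y)) (x : UGL F N) : p x := by
  obtain ⟨t, rfl⟩ : ∃ t, UniversalEnvelopingAlgebra.mkAlgHom F (Matrix (Fin N) (Fin N) F) t = x :=
    RingCon.mkₐ_surjective (UniversalEnvelopingAlgebra.ringCon F (Matrix (Fin N) (Fin N) F)) x
  induction t using TensorAlgebra.induction with
  | algebraMap c => rw [AlgHom.commutes]; exact hc c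
  | ι X =>
    have : UniversalEnvelopingAlgebra.mkAlgHom F (Matrix (Fin N) (Fin N) F)
        (TensorAlgebra.ι F X) = ∑ i, ∑ j, algebraMap F _ (X i j) * genU F i j := by
      change UniversalEnvelopingAlgebra.ι F X = _
      conv_lhs => rw [Matrix.matrix_eq_sum_single X]
      simp only [map_sum]
      refine Finset.sum_congr rfl fun i _ => Finset.sum_congr rfl fun j _ => ?_
      rw [genU, ← Algebra.smul_def, ← map_smul, Matrix.smul_single, smul_eq_mul, mul_one]
    rw [this]
    have h0 : p 0 := by simpa using hc 0
    exact Finset.sum_induction _ p ha h0 fun i _ => Finset.sum_induction _ p ha h0 fun j _ =>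
      hm _ _ (hc _) (hg i j)
  | mul a b ha' hb' => rw [map_mul]; exact hm _ _ ha' hb'
  | add a b ha' hb' => rw [map_add]; exact ha _ _ ha' hb'

lemma verma_eq_top (lam : Fin N → F) (S : Submodule F (Verma lam)) (hv : vermaVec lam ∈ S)
    (hS : ∀ i j, ∀ y ∈ S, vermaOp lam i j y ∈ S) : S = ⊤ := by
  have key : ∀ x : UGL F N, ∀ y ∈ S, Algebra.lsmul F F (Verma lam) x y ∈ S := by
    intro x
    induction x using ugl_induction with
    | hc c =>
      intro y hy
      rw [AlgHom.commutes]
      exact S.smul_mem c hy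
    | hg i j => exact hS i j
    | ha x y hx hy =>
      intro z hz
      rw [map_add]
      exact S.add_mem (hx z hz) (hy z hz)
    | hm x y hx hy =>
      intro z hz
      rw [map_mul]
      exact hx _ (hy z hz)
  rw [Submodule.eq_top_iff']
  intro y
  obtain ⟨x, rfl⟩ := Submodule.Quotient.mk_surjective _ y
  have := key x _ hv
  change Submodule.Quotient.mk (x * 1) ∈ S at this
  rwa [mul_one] at this

/-- The linear map from a Verma module defined by a singular vector. -/
def vermaLift {W : Type} [AddCommGroup W] [Module F W] (lam : Fin N → F)
    (E : Fin N → Fin N → Module.End F W) (hE : IsGL E) (w : W) (h1 : ∀ i j, i < j → E i j w = 0)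
    (h2 : ∀ i, E i i w = lam i • w) : Verma lam →ₗ[F] W :=
  Submodule.liftQ ((vermaIdeal lam).restrictScalars F)
    ((LinearMap.applyₗ w) ∘ₗ (uglHom E hE).toLinearMap) (by
      intro x hx
      rw [Submodule.restrictScalars_mem] at hx
      change uglHom E hE x w = 0
      induction hx using Submodule.span_induction with
      | mem x hx =>
        rcases hx with ⟨i, j, hij, rfl⟩ | ⟨i, rfl⟩
        · rw [uglHom_genU, h1 i j hij]
        · rw [map_sub, uglHom_genU, AlgHom.commutes, LinearMap.sub_apply, h2, sub_eq_zero]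
          rfl
      | zero => simp
      | add x y _ _ hx hy => rw [map_add, LinearMap.add_apply, hx, hy, add_zero]
      | smul a x _ hx => rw [smul_eq_mul, map_mul, Module.End.mul_apply, hx, map_zero]) ∘ₗ
    (Submodule.Quotient.restrictScalarsEquiv F (vermaIdeal lam)).symm.toLinearMap

lemma vermaLift_mk {W : Type} [AddCommGroup W] [Module F W] (lam : Fin N → F)
    (E : Fin N → Fin N → Module.End F W) (hE : IsGL E) (w : W) (h1 : ∀ i j, i < j → E i j w = 0)
    (h2 : ∀ i, E i i w = lam i • w) (x : UGL F N) :
    vermaLift lam E hE w h1 h2 (Submodule.Quotient.mk x) = uglHom E hE x w := rfl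

lemma vermaLift_vec {W : Type} [AddCommGroup W] [Module F W] (lam : Fin N → F)
    (E : Fin N → Fin N → Module.End F W) (hE : IsGL E) (w : W) (h1 : ∀ i j, i < j → E i j w = 0)
    (h2 : ∀ i, E i i w = lam i • w) : vermaLift lam E hE w h1 h2 (vermaVec lam) = w := by
  rw [vermaVec, vermaLift_mk, map_one, Module.End.one_apply]

lemma vermaLift_op {W : Type} [AddCommGroup W] [Module F W] (lam : Fin N → F)
    (E : Fin N → Fin N → Module.End F W) (hE : IsGL E) (w : W) (h1 : ∀ i j, i < j → E i j w = 0)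
    (h2 : ∀ i, E i i w = lam i • w) (i j : Fin N) (y : Verma lam) :
    vermaLift lam E hE w h1 h2 (vermaOp lam i j y) = E i j (vermaLift lam E hE w h1 h2 y) := by
  obtain ⟨x, rfl⟩ := Submodule.Quotient.mk_surjective _ y
  change vermaLift lam E hE w h1 h2 (Submodule.Quotient.mk (genU F i j * x)) = _
  rw [vermaLift_mk, vermaLift_mk, map_mul, uglHom_genU, Module.End.mul_apply]

end

section

/-! ### The projection of a Verma module to the highest weight vector -/

section Oscillator

variable {F : Type} [Field F] {ι : Type} [DecidableEq ι]

/-- A weighted shift of functions on a lattice. -/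
def latShift (p : ι) (α : ℤ → F) (k : ℤ) : Module.End F ((ι → ℤ) → F) where
  toFun f κ := α (κ p) * f (κ + Pi.single p k)
  map_add' f g := by ext κ; simp [mul_add]
  map_smul' c f := by ext κ; simp [mul_left_comm]

lemma latShift_apply (p : ι) (α : ℤ → F) (k : ℤ) (f : (ι → ℤ) → F) (κ : ι → ℤ) :
    latShift p α k f κ = α (κ p) * f (κ + Pi.single p k) := rfl

lemma latShift_comm {p q : ι} (h : p ≠ q) (α β : ℤ → F) (k l : ℤ) :
    latShift p α k * latShift q β l = latShift q β l * latShift p α k := by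
  refine LinearMap.ext fun f => funext fun κ => ?_
  simp only [Module.End.mul_apply, latShift_apply, Pi.add_apply, Pi.single_eq_of_ne h,
    Pi.single_eq_of_ne h.symm, add_zero]
  rw [add_right_comm]
  ring

variable {N : ℕ}

/-- The weights of the raising shifts. -/
def oscA (k i : Fin N) (n : ℤ) : F :=
  if i < k then (if n = 1 then 0 else 1) else if i = k then 1 else if n = 0 then 0 else 1

/-- The weights of the lowering shifts. -/
def oscB (c : Fin N → F) (k i : Fin N) (n : ℤ) : F :=
  if i < k then (n : F) else if i = k then c k + n + 1 else n + 1

/-- Only this product enters the canonical commutation relation. For `i ≠ k` its zero is placed in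
both factors: then for `i < k` the operator `Q` kills the delta function at `0` and evaluation at
`0` kills `P`, and for `i > k` the roles are exchanged. For `i = k` the free parameter adjusts the
weight. -/
lemma oscB_mul_oscA (c : Fin N → F) (k i : Fin N) (n : ℤ) : oscB c k i n * oscA k i (n + 1) =
    (if i < k then 0 else if i = k then c k + 1 else 1) + n := by
  unfold oscA oscB
  split_ifs with h1 h2 h3 h4
  · have : n = 0 := by omega
    simp [this]
  · simp
  · ring
  · have : n = -1 := by omega
    simp [this]
  · ring

/-- The creation operators. -/
def oscQ (F : Type) [Field F] (k i : Fin N) : Module.End F ((Fin N × Fin N → ℤ) → F) :=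
  latShift (k, i) (oscA k i) (-1)

/-- The annihilation operators. -/
def oscP (c : Fin N → F) (k i : Fin N) : Module.End F ((Fin N × Fin N → ℤ) → F) :=
  latShift (k, i) (oscB c k i) 1

lemma oscP_mul_oscQ_self (c : Fin N → F) (k i : Fin N) (f : (Fin N × Fin N → ℤ) → F)
    (κ : Fin N × Fin N → ℤ) : (oscP c k i * oscQ F k i) f κ =
      oscB c k i (κ (k, i)) * oscA k i (κ (k, i) + 1) * f κ := by
  rw [Module.End.mul_apply, oscP, latShift_apply, oscQ, latShift_apply, add_assoc,
    ← Pi.single_add]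
  simp [mul_assoc]

lemma oscQ_mul_oscP_self (c : Fin N → F) (k i : Fin N) (f : (Fin N × Fin N → ℤ) → F)
    (κ : Fin N × Fin N → ℤ) : (oscQ F k i * oscP c k i) f κ =
      oscB c k i (κ (k, i) - 1) * oscA k i (κ (k, i) - 1 + 1) * f κ := by
  rw [Module.End.mul_apply, oscQ, latShift_apply, oscP, latShift_apply, add_assoc,
    ← Pi.single_add]
  simp only [Pi.add_apply, Pi.single_eq_same, Int.reduceNeg, neg_add_cancel, Pi.single_zero,
    add_zero, sub_eq_add_neg, neg_add_cancel_right]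
  ring

lemma oscQ_mul_oscP_apply (c : Fin N → F) (k : Fin N) {i j : Fin N} (hij : i ≠ j)
    (f : (Fin N × Fin N → ℤ) → F) (κ : Fin N × Fin N → ℤ) : (oscQ F k i * oscP c k j) f κ =
      oscA k i (κ (k, i)) * oscB c k j (κ (k, j)) *
        f (κ + (Pi.single (k, i) (-1) + Pi.single (k, j) 1)) := by
  have h : ((k, j) : Fin N × Fin N) ≠ (k, i) := fun h => hij (Prod.ext_iff.1 h).2.symm
  rw [Module.End.mul_apply, oscQ, latShift_apply, oscP, latShift_apply, add_assoc, Pi.add_apply,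
    Pi.single_eq_of_ne h, add_zero, mul_assoc]

/-- The oscillator representation. -/
def oscE (c : Fin N → F) (i j : Fin N) : Module.End F ((Fin N × Fin N → ℤ) → F) :=
  ∑ k, oscQ F k i * oscP c k j

lemma oscE_isGL (c : Fin N → F) : IsGL (oscE c) := by
  refine isGL_of_ccr (oscQ F) (oscP c) ?_ ?_ ?_
  · intro s t i j
    by_cases h : (s, i) = (t, j)
    · obtain ⟨rfl, rfl⟩ := Prod.ext_iff.1 h
      exact Commute.refl _
    · exact latShift_comm h _ _ _ _
  · intro s t i j
    by_cases h : (s, i) = (t, j)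
    · obtain ⟨rfl, rfl⟩ := Prod.ext_iff.1 h
      exact Commute.refl _
    · exact latShift_comm h _ _ _ _
  · intro s t i j
    by_cases h : s = t ∧ j = i
    · obtain ⟨rfl, rfl⟩ := h
      rw [if_pos ⟨rfl, rfl⟩]
      refine LinearMap.ext fun f => funext fun κ => ?_
      rw [LinearMap.add_apply, Pi.add_apply, oscP_mul_oscQ_self, oscQ_mul_oscP_self, oscB_mul_oscA,
        oscB_mul_oscA, Module.End.one_apply]
      push_cast
      ring
    · rw [if_neg h, add_zero]
      exact latShift_comm (fun e => h ⟨(Prod.ext_iff.1 e).1, (Prod.ext_iff.1 e).2⟩) _ _ _ _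

/-- Each summand contains a factor that evaluation at `0` kills: the creation operator if `k < i`,
and otherwise the annihilation operator, since then `j < k`. -/
lemma oscE_zero (c : Fin N → F) (i j : Fin N) (hij : j < i) (f : (Fin N × Fin N → ℤ) → F) :
    oscE c i j f 0 = 0 := by
  rw [oscE, LinearMap.sum_apply, Finset.sum_apply]
  refine Finset.sum_eq_zero fun k _ => ?_
  rw [oscQ_mul_oscP_apply c k hij.ne']
  by_cases hk : k < i
  · simp [oscA, hk.not_gt, hk.ne']
  · simp [oscB, lt_of_lt_of_le hij (not_lt.1 hk)]

/-- In each summand a single lattice point could contribute, with coordinates `1` and `-1` at the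
two shifted places, and one of the two weights vanishes there. -/
lemma oscE_single (c : Fin N → F) (i j : Fin N) (hij : i < j) :
    oscE c i j (Pi.single 0 1) = 0 := by
  funext κ
  rw [oscE, LinearMap.sum_apply, Finset.sum_apply]
  refine Finset.sum_eq_zero fun k _ => ?_
  rw [oscQ_mul_oscP_apply c k hij.ne]
  by_cases hκ : κ + (Pi.single (k, i) (-1) + Pi.single (k, j) 1) = 0
  · have h : ((k, j) : Fin N × Fin N) ≠ (k, i) := fun h => hij.ne' (Prod.ext_iff.1 h).2
    have h1 := congrFun hκ (k, i)
    have h2 := congrFun hκ (k, j)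
    simp only [Pi.add_apply, Pi.single_eq_same, Pi.single_eq_of_ne h, Pi.single_eq_of_ne h.symm,
      Pi.zero_apply] at h1 h2
    have h1' : κ (k, i) = 1 := by omega
    have h2' : κ (k, j) = -1 := by omega
    rw [h1', h2']
    by_cases hk : i < k
    · simp [oscA, hk]
    · have := lt_of_le_of_lt (not_lt.1 hk) hij
      simp [oscB, this.not_gt, this.ne']
  · rw [Pi.single_eq_of_ne hκ, mul_zero]

lemma oscE_self (c : Fin N → F) (i : Fin N) (f : (Fin N × Fin N → ℤ) → F)
    (κ : Fin N × Fin N → ℤ) : oscE c i i f κ = (∑ k : Fin N,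
      ((if i < k then 0 else if i = k then c k + 1 else 1) + ((κ (k, i) : ℤ) : F) - 1)) * f κ := by
  rw [oscE, LinearMap.sum_apply, Finset.sum_apply, Finset.sum_mul]
  refine Finset.sum_congr rfl fun k _ => ?_
  rw [oscQ_mul_oscP_self, oscB_mul_oscA]
  push_cast
  ring

/-- The parameters of the oscillator representation with a given highest weight. -/
def oscC (lam : Fin N → F) (i : Fin N) : F :=
  lam i - ∑ k ∈ Finset.univ.erase i, ((if i < k then 0 else 1) - 1)

lemma oscC_spec (lam : Fin N → F) (i : Fin N) : (∑ k : Fin N,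
    ((if i < k then 0 else if i = k then oscC lam k + 1 else 1) +
      (((0 : Fin N × Fin N → ℤ) (k, i) : ℤ) : F) - 1)) = lam i := by
  rw [← Finset.add_sum_erase _ _ (Finset.mem_univ i)]
  simp only [lt_irrefl, if_true, if_false, Pi.zero_apply, Int.cast_zero, add_zero,
    add_sub_cancel_right]
  rw [oscC, sub_add_eq_add_sub, sub_eq_iff_eq_add]
  congr 1
  refine Finset.sum_congr rfl fun k hk => ?_
  rw [if_neg (Finset.ne_of_mem_erase hk).symm]

end Oscillator

variable {F : Type} [Field F] {N : ℕ}

/-- The coefficient of the highest weight vector. -/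
def vermaFun (lam : Fin N → F) : Verma lam →ₗ[F] F :=
  LinearMap.proj 0 ∘ₗ vermaLift lam (oscE (oscC lam)) (oscE_isGL _) (Pi.single 0 1)
    (oscE_single _) (by
      intro i
      funext κ
      rw [oscE_self, Pi.smul_apply, smul_eq_mul]
      by_cases hκ : κ = 0
      · rw [hκ, oscC_spec]
      · rw [Pi.single_eq_of_ne hκ, mul_zero, mul_zero])

/-- This carries the nontriviality of the Verma module: its highest weight vector maps to a delta
function. -/
lemma vermaFun_vec (lam : Fin N → F) : vermaFun lam (vermaVec lam) = 1 := by
  rw [vermaFun, LinearMap.comp_apply, vermaLift_vec]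
  simp

lemma vermaFun_op (lam : Fin N → F) {i j : Fin N} (hij : j < i) (y : Verma lam) :
    vermaFun lam (vermaOp lam i j y) = 0 := by
  rw [vermaFun, LinearMap.comp_apply, vermaLift_op]
  exact oscE_zero _ i j hij _

lemma vermaFun_op_self (lam : Fin N → F) (i : Fin N) (y : Verma lam) :
    vermaFun lam (vermaOp lam i i y) = lam i * vermaFun lam y := by
  rw [vermaFun, LinearMap.comp_apply, LinearMap.comp_apply, vermaLift_op, LinearMap.proj_apply,
    oscE_self, oscC_spec]
  rfl

lemma mem_vermaWeight {lam eta : Fin N → F} {y : Verma lam} :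
    y ∈ vermaWeight lam eta ↔ ∀ i, vermaOp lam i i y = eta i • y := by
  simp [vermaWeight, Submodule.mem_iInf, sub_eq_zero, Module.algebraMap_end_apply]

/-- The functional is an eigenvector of the Cartan generators with eigenvalues `lam`, so it vanishes
on every other weight space. -/
lemma vermaLower_le_ker (lam : Fin N → F) : vermaLower lam ≤ LinearMap.ker (vermaFun lam) := by
  refine iSup₂_le fun eta heta y hy => ?_
  obtain ⟨i, hi⟩ := Function.ne_iff.1 heta
  have h := vermaFun_op_self lam i y
  rw [mem_vermaWeight.1 hy, map_smul, smul_eq_mul, ← sub_eq_zero, ← sub_mul] at h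
  exact (mul_eq_zero.1 h).resolve_left (sub_ne_zero.2 hi)

/-- The filtration of a Verma module by the length of words in the lowering operators. -/
def vermaFilt (lam : Fin N → F) : ℕ → Submodule F (Verma lam)
  | 0 => Submodule.span F {vermaVec lam}
  | k + 1 => vermaFilt lam k ⊔
      ⨆ (i : Fin N) (j : Fin N) (_ : j < i), (vermaFilt lam k).map (vermaOp lam i j)

lemma vermaFilt_op {lam : Fin N → F} {k : ℕ} {i j : Fin N} (hij : j < i) {y : Verma lam}
    (hy : y ∈ vermaFilt lam k) : vermaOp lam i j y ∈ vermaFilt lam (k + 1) :=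
  le_sup_right (α := Submodule F (Verma lam))
    (Submodule.mem_iSup_of_mem i (Submodule.mem_iSup_of_mem j (Submodule.mem_iSup_of_mem hij
      (Submodule.mem_map_of_mem hy))))

/-- Commuting a raising or Cartan generator past the first lowering letter leaves single generators
on shorter words, which can increase the length by one at most. So words in lowering operators alone
exhaust the module. -/
lemma vermaFilt_raise (lam : Fin N → F) (k : ℕ) : ∀ i j, i ≤ j → ∀ y ∈ vermaFilt lam k,
    vermaOp lam i j y ∈ vermaFilt lam k := by
  induction k with
  | zero =>
    intro i j hij y hy
    obtain ⟨c, rfl⟩ := Submodule.mem_span_singleton.1 hy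
    rw [map_smul]
    refine Submodule.smul_mem _ _ ?_
    rcases hij.lt_or_eq with h | rfl
    · rw [vermaOp_vec lam h]; exact Submodule.zero_mem _
    · rw [vermaOp_vec_self]
      exact Submodule.smul_mem _ _ (Submodule.mem_span_singleton_self _)
  | succ k ih =>
    have ih' : ∀ i j, ∀ y ∈ vermaFilt lam k, vermaOp lam i j y ∈ vermaFilt lam (k + 1) := by
      intro i j y hy
      rcases lt_or_ge j i with h | h
      · exact vermaFilt_op h hy
      · exact le_sup_left (α := Submodule F (Verma lam)) (ih i j h y hy)
    intro i j hij
    suffices h : vermaFilt lam (k + 1) ≤ (vermaFilt lam (k + 1)).comap (vermaOp lam i j) from h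
    refine sup_le (fun y hy => ih' i j y hy) ?_
    refine iSup_le fun p => iSup_le fun q => iSup_le fun hpq => ?_
    rintro _ ⟨y, hy, rfl⟩
    have h := LinearMap.congr_fun (vermaOp_lie lam i j p q) y
    rw [LinearMap.sub_apply, sub_eq_iff_eq_add] at h
    rw [Submodule.mem_comap, ← Module.End.mul_apply, h, LinearMap.sub_apply]
    refine Submodule.add_mem _ (Submodule.sub_mem _ ?_ ?_) ?_
    · split_ifs
      · exact ih' _ _ _ hy
      · exact Submodule.zero_mem _
    · split_ifs
      · exact ih' _ _ _ hy
      · exact Submodule.zero_mem _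
    · exact vermaFilt_op hpq (ih i j hij y hy)

lemma iSup_vermaFilt (lam : Fin N → F) : ⨆ k, vermaFilt lam k = ⊤ := by
  have hm : Monotone (vermaFilt lam) := monotone_nat_of_le_succ fun k => le_sup_left
  refine verma_eq_top lam _ (Submodule.mem_iSup_of_mem 0 (Submodule.mem_span_singleton_self _)) ?_
  intro i j y hy
  obtain ⟨k, hk⟩ := (Submodule.mem_iSup_of_directed _ hm.directed_le).1 hy
  rcases lt_or_ge j i with h | h
  · exact Submodule.mem_iSup_of_mem (k + 1) (vermaFilt_op h hk)
  · exact Submodule.mem_iSup_of_mem k (vermaFilt_raise lam k i j h y hk)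

lemma vermaOp_mem_weight {lam eta : Fin N → F} {y : Verma lam} (hy : y ∈ vermaWeight lam eta)
    (i j : Fin N) : vermaOp lam i j y ∈ vermaWeight lam (eta + Pi.single i 1 - Pi.single j 1) := by
  rw [mem_vermaWeight] at hy ⊢
  intro k
  have h := LinearMap.congr_fun (vermaOp_lie lam k k i j) y
  rw [LinearMap.sub_apply, sub_eq_iff_eq_add] at h
  rw [← Module.End.mul_apply, h, Module.End.mul_apply, hy k, map_smul]
  simp only [LinearMap.sub_apply, Pi.add_apply, Pi.sub_apply, add_smul, sub_smul, Pi.single_apply]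
  have h1 : (if k = i then vermaOp lam k j else 0) y =
      (if k = i then (1 : F) else 0) • vermaOp lam i j y := by
    split_ifs with h
    · subst h; simp
    · simp
  have h2 : (if j = k then vermaOp lam i k else 0) y =
      (if k = j then (1 : F) else 0) • vermaOp lam i j y := by
    by_cases h : k = j
    · subst h; simp
    · simp [h, Ne.symm h]
  rw [h1, h2]
  abel

/-- A nonempty word in lowering operators raises the height `∑ i η_i` by a positive integer, which
is nonzero in characteristic zero. Its weight therefore differs from the highest one. -/
lemma verma_span_sup_lower [CharZero F] (lam : Fin N → F) :
    Submodule.span F {vermaVec lam} ⊔ vermaLower lam = ⊤ := by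
  let ht : (Fin N → F) → F := fun eta => ∑ i : Fin N, ((i : ℕ) : F) * eta i
  let T : Submodule F (Verma lam) := ⨆ (eta : Fin N → F) (n : ℕ) (_ : ht eta = ht lam + (n + 1 : ℕ)),
    vermaWeight lam eta
  have hht (eta : Fin N → F) {i j : Fin N} (hij : j < i) :
      ht (eta + Pi.single i 1 - Pi.single j 1) = ht eta + ((i - j - 1 : ℕ) + 1 : ℕ) := by
    have hij' : (j : ℕ) < i := hij
    have e : ((i - j - 1 : ℕ) + 1 : ℕ) = (i : ℕ) - (j : ℕ) := by omega
    rw [e, Nat.cast_sub hij'.le]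
    simp only [ht, Pi.sub_apply, Pi.add_apply, mul_add, mul_sub, Finset.sum_add_distrib,
      Finset.sum_sub_distrib, Pi.single_apply, mul_ite, mul_one, mul_zero, Finset.sum_ite_eq',
      Finset.mem_univ, if_true]
    ring
  have hv : vermaVec lam ∈ vermaWeight lam lam := mem_vermaWeight.2 (vermaOp_vec_self lam)
  have hTv {i j : Fin N} (hij : j < i) : vermaOp lam i j (vermaVec lam) ∈ T :=
    Submodule.mem_iSup_of_mem _ (Submodule.mem_iSup_of_mem _ (Submodule.mem_iSup_of_mem
      (hht lam hij) (vermaOp_mem_weight hv i j)))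
  have hT {i j : Fin N} (hij : j < i) : T ≤ T.comap (vermaOp lam i j) := by
    refine iSup_le fun eta => iSup_le fun n => iSup_le fun h y hy => ?_
    refine Submodule.mem_iSup_of_mem _ (Submodule.mem_iSup_of_mem (n + (i - j - 1 : ℕ) + 1)
      (Submodule.mem_iSup_of_mem ?_ (vermaOp_mem_weight hy i j)))
    rw [hht eta hij, h]
    push_cast
    ring
  have hle (k : ℕ) : vermaFilt lam k ≤ Submodule.span F {vermaVec lam} ⊔ T := by
    induction k with
    | zero => exact le_sup_left
    | succ k ih =>
      refine sup_le ih (iSup_le fun i => iSup_le fun j => iSup_le fun hij => ?_)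
      rw [Submodule.map_le_iff_le_comap]
      refine ih.trans (sup_le ?_ ?_)
      · rw [Submodule.span_singleton_le_iff_mem]
        exact le_sup_right (α := Submodule F (Verma lam)) (hTv hij)
      · exact (hT hij).trans (Submodule.comap_mono le_sup_right)
  have hTl : T ≤ vermaLower lam := by
    refine iSup_le fun eta => iSup_le fun n => iSup_le fun h => ?_
    refine le_iSup₂_of_le eta ?_ le_rfl
    rintro rfl
    rw [left_eq_add] at h
    exact absurd (Nat.cast_eq_zero.1 h) (Nat.succ_ne_zero n)
  rw [eq_top_iff, ← iSup_vermaFilt]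
  exact (iSup_le hle).trans (sup_le_sup_left hTl _)

lemma sub_vermaFun_mem_lower [CharZero F] (lam : Fin N → F) (y : Verma lam) :
    y - vermaFun lam y • vermaVec lam ∈ vermaLower lam := by
  have hy : y ∈ Submodule.span F {vermaVec lam} ⊔ vermaLower lam := by
    rw [verma_span_sup_lower]; trivial
  obtain ⟨z, hz, l, hl, rfl⟩ := Submodule.mem_sup.1 hy
  obtain ⟨c, rfl⟩ := Submodule.mem_span_singleton.1 hz
  have : vermaFun lam l = 0 := vermaLower_le_ker lam hl
  rw [map_add, map_smul, vermaFun_vec, this, smul_eq_mul, mul_one, add_zero, add_sub_cancel_left]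
  exact hl

/-! ### The map `θ` -/

/-- The coefficient of the highest weight vector as a map defined on all states. -/
def thetaMap (M : ℕ) (lam : Fin N → F) : State M lam →ₗ[F] Fock F M N :=
  (TensorProduct.rid F _).toLinearMap ∘ₗ (vermaFun lam).lTensor _

variable {M : ℕ} (lam : Fin N → F)

lemma thetaMap_tmul (p : Fock F M N) (y : Verma lam) :
    thetaMap M lam (p ⊗ₜ[F] y) = vermaFun lam y • p := rfl

lemma thetaMap_rTensor (A : Module.End F (Fock F M N)) (v : State M lam) :
    thetaMap M lam (A.rTensor (Verma lam) v) = A (thetaMap M lam v) := by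
  have h : thetaMap M lam ∘ₗ A.rTensor (Verma lam) = A ∘ₗ thetaMap M lam :=
    TensorProduct.ext' fun p y => by
      simp [thetaMap_tmul]
  exact LinearMap.congr_fun h v

lemma thetaMap_vermaOp {i j : Fin N} (hij : j < i) (v : State M lam) :
    thetaMap M lam ((vermaOp lam i j).lTensor _ v) = 0 := by
  have h : thetaMap M lam ∘ₗ (vermaOp lam i j).lTensor _ = 0 :=
    TensorProduct.ext' fun p y => by
      simp [thetaMap_tmul, vermaFun_op lam hij]
  exact LinearMap.congr_fun h v

lemma thetaMap_vermaOp_self (i : Fin N) (v : State M lam) :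
    thetaMap M lam ((vermaOp lam i i).lTensor _ v) = lam i • thetaMap M lam v := by
  have h : thetaMap M lam ∘ₗ (vermaOp lam i i).lTensor _ = lam i • thetaMap M lam :=
    TensorProduct.ext' fun p y => by
      simp [thetaMap_tmul, vermaFun_op_self, mul_smul]
  exact LinearMap.congr_fun h v

/-- The functional is `1` on the highest weight vector and `0` on the lower weight spaces, and these
span the module. So the relation defining `θ` is the graph of a linear map, and operators can be
carried through it without inverting `θ`. -/
lemma isTheta_iff [CharZero F] {b : Fin M → ℕ} {a : Fin N → ℕ} (v : State M lam)
    (x : Table b a → F) : IsTheta lam v x ↔ thetaMap M lam v = toFock x := by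
  constructor
  · rintro ⟨w, hw⟩
    have h : thetaMap M lam ∘ₗ (vermaLower lam).subtype.lTensor (Fock F M N) = 0 :=
      TensorProduct.ext' fun p y => by
        have : vermaFun lam y = 0 := vermaLower_le_ker lam y.2
        simp [thetaMap_tmul, this]
    have h2 := LinearMap.congr_fun h w
    rw [LinearMap.comp_apply, hw, map_sub, thetaMap_tmul, vermaFun_vec, one_smul] at h2
    exact sub_eq_zero.1 h2
  · intro h
    rw [IsTheta, ← h]
    clear h
    induction v using TensorProduct.induction_on with
    | zero => rw [map_zero, TensorProduct.zero_tmul, sub_zero]; exact Submodule.zero_mem _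
    | tmul p y =>
      rw [thetaMap_tmul, TensorProduct.smul_tmul, ← TensorProduct.tmul_sub]
      exact ⟨p ⊗ₜ ⟨_, sub_vermaFun_mem_lower lam y⟩, rfl⟩
    | add v w hv hw =>
      rw [map_add, TensorProduct.add_tmul, add_sub_add_comm]
      exact Submodule.add_mem _ hv hw

end

/-! ### Degrees in the parameters, weights and leading terms of operators -/

section

/-! ### Leading terms of polynomials in the parameters -/

section IsLead

open Polynomial

variable {m : ℕ} (ξ : Fin m → ℂ)

/-- The substitution `λ_j = r ξ_j`. -/
def rayHom : MvPolynomial (Fin m) ℂ →ₐ[ℂ] ℂ[X] :=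
  MvPolynomial.aeval fun j => Polynomial.C (ξ j) * Polynomial.X

lemma natDegree_rayHom_le {p : MvPolynomial (Fin m) ℂ} {d : ℕ} (h : p.totalDegree ≤ d) :
    (rayHom ξ p).natDegree ≤ d := by
  have := MvPolynomial.aeval_natDegree_le p h (fun j => Polynomial.C (ξ j) * Polynomial.X)
    (n := 1) (fun j => (natDegree_C_mul_le _ _).trans natDegree_X_le)
  rwa [mul_one] at this

/-- On the ray `r ξ` a monomial of degree `d` becomes a multiple of `r^d`. Leading coefficients can
thus be handled as coefficients of polynomials in one variable. -/
lemma coeff_rayHom (p : MvPolynomial (Fin m) ℂ) (d : ℕ) :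
    (rayHom ξ p).coeff d = MvPolynomial.eval ξ (MvPolynomial.homogeneousComponent d p) := by
  classical
  induction p using MvPolynomial.induction_on' with
  | monomial s c =>
    rw [rayHom, MvPolynomial.aeval_monomial, Finsupp.prod_fintype _ _ (by simp)]
    simp only [mul_pow, Finset.prod_mul_distrib, ← map_pow, ← map_prod, Finset.prod_pow_eq_pow_sum]
    rw [Polynomial.algebraMap_apply, Algebra.algebraMap_self_apply, ← mul_assoc, ← map_mul,
      coeff_C_mul_X_pow]
    have hs : ∑ i, s i = s.degree := by
      rw [Finsupp.degree_eq_sum]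
    rw [hs]
    split_ifs with h
    · rw [MvPolynomial.homogeneousComponent_of_mem (m := d) (n := d), if_pos rfl,
        MvPolynomial.eval_monomial, Finsupp.prod_fintype _ _ (by simp)]
      rw [MvPolynomial.mem_homogeneousSubmodule]
      exact MvPolynomial.isHomogeneous_monomial _ h.symm
    · rw [MvPolynomial.homogeneousComponent_of_mem (m := d) (n := s.degree), if_neg h, map_zero]
      rw [MvPolynomial.mem_homogeneousSubmodule]
      exact MvPolynomial.isHomogeneous_monomial _ rfl
  | add p q hp hq => simp [hp, hq]

/-- `x` is a polynomial of degree at most `d` in the parameters, and its component of degree `d`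
takes the value `c` at `ξ`. -/
def IsLead (d : ℕ) (x : ParamField m) (c : ℂ) : Prop :=
  ∃ p : MvPolynomial (Fin m) ℂ, x = algebraMap _ (ParamField m) p ∧ p.totalDegree ≤ d ∧
    c = (rayHom ξ p).coeff d

variable {ξ}

/-- All coefficients constructed below are polynomials in the parameters, so the denominator `1` is
enough. -/
lemma IsLead.isLeading {d : ℕ} {x : ParamField m} {c : ℂ} (h : IsLead ξ d x c) :
    IsLeading ξ d x c := by
  obtain ⟨p, rfl, hd, rfl⟩ := h
  refine ⟨p, 1, by simp, by simpa using hd, ?_, ?_⟩ <;>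
    simp [MvPolynomial.homogeneousComponent_zero, coeff_rayHom]

lemma IsLead.const (z : ℂ) : IsLead ξ 0 (algebraMap ℂ (ParamField m) z) z :=
  ⟨MvPolynomial.C z, by
    rw [IsScalarTower.algebraMap_apply ℂ (MvPolynomial (Fin m) ℂ) (ParamField m)]; rfl,
    by simp, by simp [rayHom]⟩

lemma IsLead.zero (d : ℕ) : IsLead ξ d 0 0 := ⟨0, by simp, by simp, by simp⟩

lemma IsLead.one : IsLead ξ 0 1 1 := by simpa using IsLead.const (ξ := ξ) 1

lemma IsLead.natCast (k : ℕ) : IsLead ξ 0 (k : ParamField m) k := by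
  simpa using IsLead.const (ξ := ξ) (k : ℂ)

lemma IsLead.lamVar (j : Fin m) : IsLead ξ 1 (lamVar m j) (ξ j) :=
  ⟨MvPolynomial.X j, rfl, by simp, by simp [rayHom]⟩

lemma IsLead.add {d : ℕ} {x y : ParamField m} {c c' : ℂ} (h : IsLead ξ d x c)
    (h' : IsLead ξ d y c') : IsLead ξ d (x + y) (c + c') := by
  obtain ⟨p, rfl, hd, rfl⟩ := h
  obtain ⟨q, rfl, hd', rfl⟩ := h'
  exact ⟨p + q, by simp, (MvPolynomial.totalDegree_add _ _).trans (max_le hd hd'), by simp⟩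

lemma IsLead.mul {d d' : ℕ} {x y : ParamField m} {c c' : ℂ} (h : IsLead ξ d x c)
    (h' : IsLead ξ d' y c') : IsLead ξ (d + d') (x * y) (c * c') := by
  obtain ⟨p, rfl, hd, rfl⟩ := h
  obtain ⟨q, rfl, hd', rfl⟩ := h'
  refine ⟨p * q, by simp, (MvPolynomial.totalDegree_mul _ _).trans (add_le_add hd hd'), ?_⟩
  rw [map_mul, coeff_mul_add_eq_of_natDegree_le (natDegree_rayHom_le ξ hd)
    (natDegree_rayHom_le ξ hd')]

lemma IsLead.weaken {d d' : ℕ} {x : ParamField m} {c : ℂ} (h : IsLead ξ d x c) (hd : d < d') :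
    IsLead ξ d' x 0 := by
  obtain ⟨p, rfl, hp, rfl⟩ := h
  exact ⟨p, rfl, hp.trans hd.le,
    (coeff_eq_zero_of_natDegree_lt ((natDegree_rayHom_le ξ hp).trans_lt hd)).symm⟩

lemma IsLead.neg {d : ℕ} {x : ParamField m} {c : ℂ} (h : IsLead ξ d x c) :
    IsLead ξ d (-x) (-c) := by
  obtain ⟨p, rfl, hd, rfl⟩ := h
  exact ⟨-p, by simp, by simpa using hd, by simp⟩

lemma IsLead.sub {d : ℕ} {x y : ParamField m} {c c' : ℂ} (h : IsLead ξ d x c)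
    (h' : IsLead ξ d y c') : IsLead ξ d (x - y) (c - c') := by
  rw [sub_eq_add_neg, sub_eq_add_neg]
  exact h.add h'.neg

lemma IsLead.sum {ι : Type*} {s : Finset ι} {d : ℕ} {x : ι → ParamField m} {c : ι → ℂ}
    (h : ∀ i ∈ s, IsLead ξ d (x i) (c i)) : IsLead ξ d (∑ i ∈ s, x i) (∑ i ∈ s, c i) := by
  classical
  induction s using Finset.induction_on with
  | empty => simpa using IsLead.zero d
  | insert a s ha ih =>
    rw [Finset.sum_insert ha, Finset.sum_insert ha]
    exact (h a (Finset.mem_insert_self _ _)).add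
      (ih fun i hi => h i (Finset.mem_insert_of_mem hi))

lemma IsLead.congr {d : ℕ} {x : ParamField m} {c c' : ℂ} (h : IsLead ξ d x c) (hc : c = c') :
    IsLead ξ d x c' := hc ▸ h

lemma IsLead.wParam (b : Fin m → ℕ) (j : Fin m) : IsLead ξ 1 (wParam b j) (ξ j) := by
  have h := ((IsLead.lamVar (ξ := ξ) j).add ((IsLead.natCast (b j)).weaken one_pos)).sub
    (((IsLead.natCast (ξ := ξ) j).add IsLead.one).weaken one_pos)
  simpa [GaudinXXX.wParam] using h

/-- A polynomial in `u` of degree at most `d` whose coefficient of `u^i` has degree at most `k - e i`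
in the parameters, together with the polynomial of leading coefficients. -/
structure Rel (ξ : Fin m → ℂ) (e d k : ℕ) (f : (ParamField m)[X]) (c : ℂ[X]) : Prop where
  natDegree_left : f.natDegree ≤ d
  natDegree_right : c.natDegree ≤ d
  le : e * d ≤ k
  isLead : ∀ i ≤ d, IsLead ξ (k - e * i) (f.coeff i) (c.coeff i)

variable {e d k d' k' : ℕ} {f g : (ParamField m)[X]} {c c' : ℂ[X]}

lemma Rel.zero (h : e * d ≤ k) : Rel ξ e d k 0 0 :=
  ⟨by simp, by simp, h, fun i _ => by simpa using IsLead.zero _⟩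

lemma Rel.add (h : Rel ξ e d k f c) (h' : Rel ξ e d k g c') : Rel ξ e d k (f + g) (c + c') :=
  ⟨natDegree_add_le_of_degree_le h.1 h'.1, natDegree_add_le_of_degree_le h.2 h'.2, h.3,
    fun i hi => by rw [coeff_add, coeff_add]; exact (h.4 i hi).add (h'.4 i hi)⟩

lemma Rel.mul (h : Rel ξ e d k f c) (h' : Rel ξ e d' k' g c') :
    Rel ξ e (d + d') (k + k') (f * g) (c * c') := by
  refine ⟨natDegree_mul_le_of_le h.1 h'.1, natDegree_mul_le_of_le h.2 h'.2, ?_, ?_⟩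
  · rw [mul_add]; exact add_le_add h.3 h'.3
  · intro i _
    rw [coeff_mul, coeff_mul]
    refine IsLead.sum fun p hp => ?_
    obtain ⟨j, l⟩ := p
    replace hp := Finset.HasAntidiagonal.mem_antidiagonal.1 hp
    change j + l = i at hp
    by_cases hj : j ≤ d
    · by_cases hl : l ≤ d'
      -- The field `le` keeps the natural number subtractions from truncating, so the degree bounds
      -- of the two factors add exactly.
      · have h1 := (Nat.mul_le_mul_left e hj).trans h.3
        have h2 := (Nat.mul_le_mul_left e hl).trans h'.3
        have : k + k' - e * i = (k - e * j) + (k' - e * l) := by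
          rw [← hp, mul_add]; omega
        rw [this]
        exact (h.4 j hj).mul (h'.4 l hl)
      · have h1 : g.coeff l = 0 := coeff_eq_zero_of_natDegree_lt (h'.1.trans_lt (not_le.1 hl))
        have h2 : c'.coeff l = 0 := coeff_eq_zero_of_natDegree_lt (h'.2.trans_lt (not_le.1 hl))
        simpa [h1, h2] using IsLead.zero _
    · have h1 : f.coeff j = 0 := coeff_eq_zero_of_natDegree_lt (h.1.trans_lt (not_le.1 hj))
      have h2 : c.coeff j = 0 := coeff_eq_zero_of_natDegree_lt (h.2.trans_lt (not_le.1 hj))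
      simpa [h1, h2] using IsLead.zero _

lemma Rel.C {x : ParamField m} {z : ℂ} (h : IsLead ξ k x z) :
    Rel ξ e 0 k (Polynomial.C x) (Polynomial.C z) :=
  ⟨by simp, by simp, by simp, fun i hi => by
    obtain rfl := Nat.le_zero.1 hi
    simpa using h⟩

lemma Rel.X : Rel ξ e 1 e (Polynomial.X) (Polynomial.X) :=
  ⟨by simp, by simp, by simp, fun i hi => by
    rcases Nat.le_one_iff_eq_zero_or_eq_one.1 hi with rfl | rfl
    · simpa using IsLead.zero _
    · simpa using IsLead.one⟩

lemma Rel.mono_left (h : Rel ξ e d k f c) (hd : d ≤ d') (hk : e * d' ≤ k) : Rel ξ e d' k f c :=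
  ⟨h.1.trans hd, h.2.trans hd, hk, fun i _ => by
    by_cases hi : i ≤ d
    · exact h.4 i hi
    · have h1 : f.coeff i = 0 := coeff_eq_zero_of_natDegree_lt (h.1.trans_lt (not_le.1 hi))
      have h2 : c.coeff i = 0 := coeff_eq_zero_of_natDegree_lt (h.2.trans_lt (not_le.1 hi))
      simpa [h1, h2] using IsLead.zero _⟩

/-- The way in which lower order terms are discarded: with a strictly larger degree bound the
leading part is zero. -/
lemma Rel.weaken (h : Rel ξ e d k f c) (hd : d ≤ d') (hk : k < k') (hd' : e * d' ≤ k') :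
    Rel ξ e d' k' f 0 :=
  ⟨h.1.trans hd, by simp, hd', fun i _ => by
    by_cases hi : i ≤ d
    · have h1 := (Nat.mul_le_mul_left e hi).trans h.3
      simpa using (h.4 i hi).weaken (show k - e * i < k' - e * i by omega)
    · have h1 : f.coeff i = 0 := coeff_eq_zero_of_natDegree_lt (h.1.trans_lt (not_le.1 hi))
      simpa [h1] using IsLead.zero _⟩

end IsLead

/-! ### Extension of scalars -/

section BaseChange

variable {F : Type} [Field F] [Algebra ℂ F] {M N : ℕ}

/-- The extension of a linear operator to the larger field. -/
def bcLin (A : Module.End ℂ (Fock ℂ M N)) : Module.End F (Fock F M N) :=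
  (MvPolynomial.basisMonomials (Fin M × Fin N) F).constr F
    fun k => MvPolynomial.map (algebraMap ℂ F) (A (MvPolynomial.monomial k 1))

lemma bcLin_monomial (A : Module.End ℂ (Fock ℂ M N)) (k : Fin M × Fin N →₀ ℕ) :
    bcLin A (MvPolynomial.monomial k (1 : F)) =
      MvPolynomial.map (algebraMap ℂ F) (A (MvPolynomial.monomial k 1)) := by
  have := (MvPolynomial.basisMonomials (Fin M × Fin N) F).constr_basis F
    (fun k => MvPolynomial.map (algebraMap ℂ F) (A (MvPolynomial.monomial k 1))) k
  rwa [MvPolynomial.coe_basisMonomials] at this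

lemma map_complex_smul (c : ℂ) (p : Fock ℂ M N) :
    MvPolynomial.map (algebraMap ℂ F) (c • p) = c • MvPolynomial.map (algebraMap ℂ F) p := by
  rw [MvPolynomial.smul_eq_C_mul, map_mul, MvPolynomial.map_C, ← MvPolynomial.smul_eq_C_mul,
    algebraMap_smul]

lemma bcLin_map (A : Module.End ℂ (Fock ℂ M N)) (p : Fock ℂ M N) :
    bcLin (F := F) A (MvPolynomial.map (algebraMap ℂ F) p) =
      MvPolynomial.map (algebraMap ℂ F) (A p) := by
  induction p using MvPolynomial.induction_on' with
  | monomial k c =>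
    have h : MvPolynomial.monomial k c = c • MvPolynomial.monomial k (1 : ℂ) := by
      rw [MvPolynomial.smul_monomial, smul_eq_mul, mul_one]
    rw [h, map_complex_smul, ← algebraMap_smul F c, map_smul, algebraMap_smul, map_smul,
      map_complex_smul, MvPolynomial.map_monomial, map_one, bcLin_monomial]
  | add p q hp hq => simp [hp, hq]

lemma end_ext {A B : Module.End F (Fock F M N)}
    (h : ∀ p : Fock ℂ M N, A (MvPolynomial.map (algebraMap ℂ F) p) =
      B (MvPolynomial.map (algebraMap ℂ F) p)) : A = B := by
  refine (MvPolynomial.basisMonomials (Fin M × Fin N) F).ext fun k => ?_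
  simpa using h (MvPolynomial.monomial k 1)

variable (F M N) in
/-- Extension of scalars for operators on the Fock space. -/
def bc : Module.End ℂ (Fock ℂ M N) →+* Module.End F (Fock F M N) where
  toFun := bcLin
  map_one' := end_ext fun p => by rw [bcLin_map]; rfl
  map_mul' A B := end_ext fun p => by
    rw [bcLin_map, Module.End.mul_apply, Module.End.mul_apply, bcLin_map, bcLin_map]
  map_zero' := end_ext fun p => by rw [bcLin_map]; simp
  map_add' A B := end_ext fun p => by
    rw [bcLin_map, LinearMap.add_apply, LinearMap.add_apply, bcLin_map, bcLin_map, map_add]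

lemma bc_map (A : Module.End ℂ (Fock ℂ M N)) (p : Fock ℂ M N) :
    bc F M N A (MvPolynomial.map (algebraMap ℂ F) p) =
      MvPolynomial.map (algebraMap ℂ F) (A p) := bcLin_map A p

lemma bc_smul (c : ℂ) (A : Module.End ℂ (Fock ℂ M N)) :
    bc F M N (c • A) = algebraMap ℂ F c • bc F M N A := end_ext fun p => by
  rw [bc_map, LinearMap.smul_apply, LinearMap.smul_apply, bc_map, map_complex_smul,
    algebraMap_smul]

lemma bc_siteOp (s : Fin M) (i j : Fin N) : bc F M N (siteOp ℂ s i j) = siteOp F s i j :=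
  end_ext fun p => by
    rw [bc_map]
    simp [siteOp, MvPolynomial.pderiv_map]

lemma bc_diagOp (i j : Fin N) : bc F M N (diagOp ℂ i j) = diagOp F i j := by
  simp [diagOp, bc_siteOp]

end BaseChange

/-! ### Weights -/

section Weights

variable {F : Type} [Field F] {M N : ℕ}

lemma siteOp_monomial (s : Fin M) (i : Fin N) (k : Fin M × Fin N →₀ ℕ) (c : F) :
    siteOp F s i i (MvPolynomial.monomial k c) =
      (k (s, i) : F) • MvPolynomial.monomial k c := by
  rw [siteOp, LinearMap.comp_apply, Derivation.coeFn_coe, MvPolynomial.pderiv_monomial,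
    LinearMap.mulLeft_apply, mul_comm, MvPolynomial.smul_monomial]
  by_cases h : k (s, i) = 0
  · simp [h]
  · rw [MvPolynomial.X, MvPolynomial.monomial_mul, tsub_add_cancel_of_le]
    · simp [mul_comm]
    · rw [Finsupp.single_le_iff]; omega

lemma coeff_siteOp (s : Fin M) (i : Fin N) (k : Fin M × Fin N →₀ ℕ) (p : Fock F M N) :
    MvPolynomial.coeff k (siteOp F s i i p) = (k (s, i) : F) * MvPolynomial.coeff k p := by
  classical
  induction p using MvPolynomial.induction_on' with
  | monomial l c =>
    rw [siteOp_monomial, MvPolynomial.coeff_smul, MvPolynomial.coeff_monomial, smul_eq_mul]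
    split_ifs with h
    · rw [h]
    · simp
  | add p q hp hq => rw [map_add, MvPolynomial.coeff_add, hp, hq, MvPolynomial.coeff_add, mul_add]

/-- The number operator of a tensor factor. -/
def rowOp (F : Type) [Field F] {M : ℕ} (N : ℕ) (s : Fin M) : Module.End F (Fock F M N) :=
  ∑ i, siteOp F s i i

/-- The vectors of `S^{b_1} ⊗ ⋯ ⊗ S^{b_M}` of weight `a`. -/
def IsTab (b : Fin M → ℕ) (a : Fin N → ℤ) (p : Fock F M N) : Prop :=
  (∀ s, rowOp F N s p = (b s : F) • p) ∧ ∀ i, diagOp F i i p = (a i : F) • p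

lemma coeff_rowOp (s : Fin M) (k : Fin M × Fin N →₀ ℕ) (p : Fock F M N) :
    MvPolynomial.coeff k (rowOp F N s p) =
      ((∑ i, k (s, i) : ℕ) : F) * MvPolynomial.coeff k p := by
  rw [rowOp, LinearMap.sum_apply, MvPolynomial.coeff_sum, Nat.cast_sum, Finset.sum_mul]
  exact Finset.sum_congr rfl fun i _ => coeff_siteOp s i k p

lemma coeff_diagOp (i : Fin N) (k : Fin M × Fin N →₀ ℕ) (p : Fock F M N) :
    MvPolynomial.coeff k (diagOp F i i p) =
      ((∑ s, k (s, i) : ℕ) : F) * MvPolynomial.coeff k p := by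
  rw [diagOp, LinearMap.sum_apply, MvPolynomial.coeff_sum, Nat.cast_sum, Finset.sum_mul]
  exact Finset.sum_congr rfl fun s _ => coeff_siteOp s i k p

lemma expo_apply (k : Fin M → Fin N → ℕ) (s : Fin M) (i : Fin N) : expo k (s, i) = k s i := rfl

lemma expo_injective : Function.Injective (expo : (Fin M → Fin N → ℕ) → _) := fun k l h => by
  funext s i
  rw [← expo_apply k, h, expo_apply]

variable {b : Fin M → ℕ} {a : Fin N → ℕ}

lemma coeff_toFock (x : Table b a → F) (k : Table b a) :
    MvPolynomial.coeff (expo k.1) (toFock x) = x k := by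
  classical
  rw [toFock, MvPolynomial.coeff_sum, Finset.sum_eq_single k]
  · simp
  · intro l _ hl
    rw [MvPolynomial.coeff_monomial, if_neg fun h => hl (Subtype.ext (expo_injective h))]
  · simp

lemma toFock_injective : Function.Injective (toFock : (Table b a → F) → _) := fun x y h => by
  funext k
  rw [← coeff_toFock x, h, coeff_toFock]

lemma toFock_add (x y : Table b a → F) : toFock (x + y) = toFock x + toFock y := by
  simp [toFock, Finset.sum_add_distrib]

lemma toFock_smul (c : F) (x : Table b a → F) : toFock (c • x) = c • toFock x := by
  simp [toFock, Finset.smul_sum, MvPolynomial.smul_monomial]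

variable (F b a) in
/-- The inclusion of the weight subspace. -/
def toFockLin : (Table b a → F) →ₗ[F] Fock F M N where
  toFun := toFock
  map_add' := toFock_add
  map_smul' := toFock_smul

lemma toFockLin_apply (x : Table b a → F) : toFockLin F b a x = toFock x := rfl

lemma isTab_toFock (x : Table b a → F) : IsTab b (fun i => (a i : ℤ)) (toFock x) := by
  constructor
  · intro s
    rw [toFock, map_sum, Finset.smul_sum]
    refine Finset.sum_congr rfl fun k _ => ?_
    rw [rowOp, LinearMap.sum_apply, ← k.2.1 s]
    simp only [siteOp_monomial, expo_apply, ← Finset.sum_smul]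
    push_cast
    rfl
  · intro i
    rw [toFock, map_sum, Finset.smul_sum]
    refine Finset.sum_congr rfl fun k _ => ?_
    rw [diagOp, LinearMap.sum_apply, Int.cast_natCast, ← k.2.2 i]
    simp only [siteOp_monomial, expo_apply, ← Finset.sum_smul]
    push_cast
    rfl

lemma IsTab.eq_of_coeff_ne_zero [CharZero F] {a : Fin N → ℤ} {p : Fock F M N} (h : IsTab b a p)
    {k : Fin M × Fin N →₀ ℕ} (hk : MvPolynomial.coeff k p ≠ 0) :
    (∀ s, ∑ i, k (s, i) = b s) ∧ ∀ i, ((∑ s, k (s, i) : ℕ) : ℤ) = a i := by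
  constructor
  · intro s
    have h1 := congrArg (MvPolynomial.coeff k) (h.1 s)
    rw [coeff_rowOp, MvPolynomial.coeff_smul, smul_eq_mul] at h1
    exact_mod_cast mul_right_cancel₀ hk h1
  · intro i
    have h1 := congrArg (MvPolynomial.coeff k) (h.2 i)
    rw [coeff_diagOp, MvPolynomial.coeff_smul, smul_eq_mul] at h1
    have h2 := mul_right_cancel₀ hk h1
    rw [← Int.cast_natCast (R := F)] at h2
    exact Int.cast_injective h2

lemma IsTab.eq_toFock [CharZero F] {p : Fock F M N} (h : IsTab b (fun i => (a i : ℤ)) p) :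
    p = toFock fun k : Table b a => MvPolynomial.coeff (expo k.1) p := by
  ext k
  by_cases hk : (∀ s, ∑ i, k (s, i) = b s) ∧ ∀ i, ∑ s, k (s, i) = a i
  · have : k = expo (⟨fun s i => k (s, i), hk⟩ : Table b a).1 := by ext; rfl
    rw [this, coeff_toFock]
  · rw [toFock, MvPolynomial.coeff_sum, Finset.sum_eq_zero]
    · by_contra hne
      obtain ⟨h1, h2⟩ := h.eq_of_coeff_ne_zero hne
      exact hk ⟨h1, fun i => by exact_mod_cast h2 i⟩
    · intro l _
      classical
      rw [MvPolynomial.coeff_monomial, if_neg]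
      rintro rfl
      exact hk l.2

/-- An operator that preserves the degrees of the tensor factors and shifts the weights by `κ`. -/
def HasWt (κ : Fin N → ℤ) (A : Module.End F (Fock F M N)) : Prop :=
  (∀ s, Commute (rowOp F N s) A) ∧ ∀ i, diagOp F i i * A - A * diagOp F i i = (κ i : F) • A

lemma HasWt.isTab {κ : Fin N → ℤ} {A : Module.End F (Fock F M N)} (h : HasWt κ A)
    {a : Fin N → ℤ} {p : Fock F M N} (hp : IsTab b a p) : IsTab b (a + κ) (A p) := by
  constructor
  · intro s
    have := LinearMap.congr_fun (h.1 s).eq p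
    rw [Module.End.mul_apply, Module.End.mul_apply, hp.1, map_smul] at this
    exact this
  · intro i
    have := LinearMap.congr_fun (h.2 i) p
    rw [LinearMap.sub_apply, Module.End.mul_apply, Module.End.mul_apply, hp.2, map_smul,
      sub_eq_iff_eq_add, LinearMap.smul_apply, ← add_smul] at this
    rw [this, Pi.add_apply, add_comm, Int.cast_add]

lemma HasWt.add {κ : Fin N → ℤ} {A B : Module.End F (Fock F M N)} (hA : HasWt κ A)
    (hB : HasWt κ B) : HasWt κ (A + B) :=
  ⟨fun s => (hA.1 s).add_right (hB.1 s), fun i => by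
    rw [smul_add, ← hA.2, ← hB.2, mul_add, add_mul]; abel⟩

lemma HasWt.zero (κ : Fin N → ℤ) : HasWt κ (0 : Module.End F (Fock F M N)) :=
  ⟨fun s => Commute.zero_right _, fun i => by simp⟩

lemma HasWt.smul {κ : Fin N → ℤ} {A : Module.End F (Fock F M N)} (hA : HasWt κ A) (c : F) :
    HasWt κ (c • A) :=
  ⟨fun s => (hA.1 s).smul_right c, fun i => by
    rw [smul_comm, ← hA.2, smul_sub, mul_smul_comm, smul_mul_assoc]⟩

lemma HasWt.neg {κ : Fin N → ℤ} {A : Module.End F (Fock F M N)} (hA : HasWt κ A) :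
    HasWt κ (-A) := by rw [← neg_one_smul F A]; exact hA.smul (-1)

lemma HasWt.one : HasWt 0 (1 : Module.End F (Fock F M N)) :=
  ⟨fun s => Commute.one_right _, fun i => by simp⟩

lemma HasWt.mul {κ κ' : Fin N → ℤ} {A B : Module.End F (Fock F M N)} (hA : HasWt κ A)
    (hB : HasWt κ' B) : HasWt (κ + κ') (A * B) :=
  ⟨fun s => (hA.1 s).mul_right (hB.1 s), fun i => by
    have h : diagOp F i i * (A * B) - A * B * diagOp F i i =
        (diagOp F i i * A - A * diagOp F i i) * B + A * (diagOp F i i * B - B * diagOp F i i) := by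
      simp only [sub_mul, mul_sub, mul_assoc]
      abel
    rw [h, hA.2, hB.2, Pi.add_apply, Int.cast_add, add_smul, smul_mul_assoc, mul_smul_comm]⟩

lemma HasWt.sum {ι : Type*} {s : Finset ι} {κ : Fin N → ℤ} {A : ι → Module.End F (Fock F M N)}
    (h : ∀ i ∈ s, HasWt κ (A i)) : HasWt κ (∑ i ∈ s, A i) :=
  Finset.sum_induction _ _ (fun _ _ => HasWt.add) (HasWt.zero κ) h

/-- The weight of `e_{ij}`. -/
def rootWt (i j : Fin N) : Fin N → ℤ := Pi.single i 1 - Pi.single j 1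

lemma HasWt.siteOp (s : Fin M) (i j : Fin N) : HasWt (rootWt i j) (siteOp F s i j) := by
  constructor
  · intro t
    rw [commute_iff_lie_eq, LieRing.of_associative_ring_bracket, rowOp, Finset.sum_mul,
      Finset.mul_sum, ← Finset.sum_sub_distrib]
    simp only [siteOp_lie]
    by_cases h : t = s
    · subst h; simp [Finset.sum_sub_distrib]
    · simp [h]
  · intro k
    rw [diagOp_siteOp_lie]
    by_cases h1 : k = i
    · subst h1
      by_cases h2 : k = j
      · subst h2; simp [rootWt]
      · simp [rootWt, h2, Ne.symm h2]
    · by_cases h2 : k = j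
      · subst h2
        simp only [rootWt, if_neg h1, if_true, Pi.sub_apply, Pi.single_eq_of_ne h1,
          Pi.single_eq_same, zero_sub, Int.cast_neg, Int.cast_one]
        exact (neg_one_smul F _).symm
      · simp [rootWt, h1, h2, Ne.symm h2]

lemma HasWt.diagOp (i j : Fin N) : HasWt (rootWt i j) (diagOp F i j : Module.End F (Fock F M N)) :=
  HasWt.sum fun s _ => HasWt.siteOp s i j

lemma HasWt.congr {κ κ' : Fin N → ℤ} {A : Module.End F (Fock F M N)} (h : HasWt κ A)
    (hκ : κ = κ') : HasWt κ' A := hκ ▸ h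

end Weights

end

section

/-! ### Leading terms of operators -/

open Polynomial (C X)

variable {m : ℕ} {ξ : Fin m → ℂ} {e M N : ℕ}

/-- The operators `A u` depend polynomially on `u` and the parameters, with the bounds on the degrees
of `Rel`, and have leading term `A₀ u` and weight `κ`. -/
inductive Lead (ξ : Fin m → ℂ) (e : ℕ) : ℕ → ℕ → (Fin N → ℤ) →
    (ParamField m → Module.End (ParamField m) (Fock (ParamField m) M N)) →
    (ℂ → Module.End ℂ (Fock ℂ M N)) → Prop
  | of {d k : ℕ} {κ : Fin N → ℤ} {f : Polynomial (ParamField m)} {c : Polynomial ℂ}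
      {B : Module.End ℂ (Fock ℂ M N)} (h : Rel ξ e d k f c) (hB : HasWt κ B) :
      Lead ξ e d k κ (fun u => f.eval u • bc _ M N B) fun u => c.eval u • B
  | add {d k : ℕ} {κ : Fin N → ℤ}
      {A A' : ParamField m → Module.End (ParamField m) (Fock (ParamField m) M N)}
      {A₀ A₀' : ℂ → Module.End ℂ (Fock ℂ M N)} (h : Lead ξ e d k κ A A₀)
      (h' : Lead ξ e d k κ A' A₀') : Lead ξ e d k κ (A + A') (A₀ + A₀')

variable {d k d' k' : ℕ} {κ κ' : Fin N → ℤ}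
  {A A' : ParamField m → Module.End (ParamField m) (Fock (ParamField m) M N)}
  {A₀ A₀' : ℂ → Module.End ℂ (Fock ℂ M N)} {f : Polynomial (ParamField m)} {c : Polynomial ℂ}

lemma Lead.congr (h : Lead ξ e d k κ A A₀) (hA : A' = A) (hA₀ : A₀' = A₀) :
    Lead ξ e d k κ A' A₀' := hA ▸ hA₀ ▸ h

lemma Lead.congr_wt (h : Lead ξ e d k κ A A₀) (hκ : κ' = κ) : Lead ξ e d k κ' A A₀ := hκ ▸ h

lemma Lead.zero (hd : e * d ≤ k) (κ : Fin N → ℤ) : Lead (M := M) ξ e d k κ 0 0 :=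
  (Lead.of (Rel.zero hd) (HasWt.zero κ)).congr (by ext1; simp) (by ext1; simp)

lemma Lead.mul (h : Lead ξ e d k κ A A₀) (h' : Lead ξ e d' k' κ' A' A₀') :
    Lead ξ e (d + d') (k + k') (κ + κ') (A * A') (A₀ * A₀') := by
  induction h with
  | of h hB =>
    induction h' with
    | of h' hB' =>
      refine (Lead.of (h.mul h') (hB.mul hB')).congr ?_ ?_
      · ext1 u; simp only [Pi.mul_apply, Polynomial.eval_mul, map_mul, smul_mul_smul_comm]
      · ext1 u; simp only [Pi.mul_apply, Polynomial.eval_mul, smul_mul_smul_comm]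
    | add _ _ ih ih' => exact (ih.add ih').congr (mul_add _ _ _) (mul_add _ _ _)
  | add _ _ ih ih' => exact (ih.add ih').congr (add_mul _ _ _) (add_mul _ _ _)

lemma Lead.smul (h : Rel ξ e d k f c) (h' : Lead ξ e d' k' κ A A₀) :
    Lead ξ e (d + d') (k + k') κ (fun u => f.eval u • A u) fun u => c.eval u • A₀ u :=
  (((Lead.of h HasWt.one).mul h').congr (by ext1 u; simp) (by ext1 u; simp)).congr_wt
    (zero_add κ).symm

lemma Lead.neg (h : Lead ξ e d k κ A A₀) : Lead ξ e d k κ (-A) (-A₀) := by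
  have := h.smul (Rel.C (e := e) (IsLead.const (ξ := ξ) (-1)))
  rw [zero_add, zero_add] at this
  refine this.congr ?_ ?_
  · ext1 u
    rw [Polynomial.eval_C, map_neg, map_one]
    exact (neg_one_smul _ _).symm
  · ext1 u
    rw [Polynomial.eval_C]
    exact (neg_one_smul _ _).symm

lemma Lead.sub (h : Lead ξ e d k κ A A₀) (h' : Lead ξ e d k κ A' A₀') :
    Lead ξ e d k κ (A - A') (A₀ - A₀') := by
  rw [sub_eq_add_neg, sub_eq_add_neg]
  exact h.add h'.neg

lemma Lead.sum {ι : Type*} (s : Finset ι)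
    {A : ι → ParamField m → Module.End (ParamField m) (Fock (ParamField m) M N)}
    {A₀ : ι → ℂ → Module.End ℂ (Fock ℂ M N)} (hd : e * d ≤ k)
    (h : ∀ i ∈ s, Lead ξ e d k κ (A i) (A₀ i)) :
    Lead ξ e d k κ (fun u => ∑ i ∈ s, A i u) (fun u => ∑ i ∈ s, A₀ i u) := by
  classical
  induction s using Finset.induction_on with
  | empty => exact (Lead.zero hd κ).congr (by ext1; simp) (by ext1; simp)
  | insert a s ha ih =>
    refine ((h a (Finset.mem_insert_self _ _)).add
      (ih fun i hi => h i (Finset.mem_insert_of_mem hi))).congr ?_ ?_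
    · ext1 u; simp [Finset.sum_insert ha]
    · ext1 u; simp [Finset.sum_insert ha]

lemma Lead.listSum {ι : Type*} (l : List ι)
    {A : ι → ParamField m → Module.End (ParamField m) (Fock (ParamField m) M N)}
    {A₀ : ι → ℂ → Module.End ℂ (Fock ℂ M N)} (hd : e * d ≤ k)
    (h : ∀ i ∈ l, Lead ξ e d k κ (A i) (A₀ i)) :
    Lead ξ e d k κ (fun u => (l.map fun i => A i u).sum) (fun u => (l.map fun i => A₀ i u).sum) := by
  induction l with
  | nil => exact (Lead.zero hd κ).congr (by ext1; simp) (by ext1; simp)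
  | cons a l ih =>
    refine ((h a List.mem_cons_self).add (ih fun i hi => h i (List.mem_cons_of_mem _ hi))).congr ?_ ?_
    · ext1 u; simp
    · ext1 u; simp

lemma altSum_zero {ι G : Type*} [AddCommGroup G] (l : List ι) :
    (altSum l fun _ _ => (0 : G)) = 0 := by
  have := altSum_add l (fun _ _ => (0 : G)) (fun _ _ => 0)
  simpa using this

lemma Lead.altSum {ι : Type*} (l : List ι)
    {A : ι → List ι → ParamField m → Module.End (ParamField m) (Fock (ParamField m) M N)}
    {A₀ : ι → List ι → ℂ → Module.End ℂ (Fock ℂ M N)} (hd : e * d ≤ k)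
    (h : ∀ i l', (i :: l').Perm l → Lead ξ e d k κ (A i l') (A₀ i l')) :
    Lead ξ e d k κ (fun u => altSum l fun i l' => A i l' u)
      (fun u => altSum l fun i l' => A₀ i l' u) := by
  induction l generalizing A A₀ with
  | nil => exact (Lead.zero hd κ).congr (by ext1; simp) (by ext1; simp)
  | cons j l ih =>
    exact (h j l (List.Perm.refl _)).sub (ih fun i l' hp => h i (j :: l')
      ((List.Perm.swap j i l').trans (hp.cons j)))

lemma Lead.mono_left (h : Lead ξ e d k κ A A₀) (hd : d ≤ d') (hk : e * d' ≤ k) :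
    Lead ξ e d' k κ A A₀ := by
  induction h with
  | of h hB => exact Lead.of (h.mono_left hd hk) hB
  | add _ _ ih ih' => exact ih.add ih'

lemma Lead.weaken (h : Lead ξ e d k κ A A₀) (hd : d ≤ d') (hk : k < k') (hd' : e * d' ≤ k') :
    Lead ξ e d' k' κ A 0 := by
  induction h with
  | of h hB => exact (Lead.of (h.weaken hd hk hd') hB).congr rfl (by ext1; simp)
  | add _ _ ih ih' => exact (ih.add ih').congr rfl (add_zero _).symm

lemma Lead.const {B : Module.End ℂ (Fock ℂ M N)} (hB : HasWt κ B) :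
    Lead ξ e 0 0 κ (fun _ => bc _ M N B) fun _ => B :=
  (Lead.of (Rel.C IsLead.one) hB).congr (by ext1; simp) (by ext1; simp)

lemma Lead.siteOp (s : Fin M) (i j : Fin N) : Lead ξ e 0 0 (rootWt i j)
    (fun _ => siteOp (ParamField m) s i j) fun _ => siteOp ℂ s i j :=
  (Lead.const (HasWt.siteOp s i j)).congr (by ext1; rw [bc_siteOp]) rfl

lemma Lead.diagOp (i j : Fin N) : Lead (M := M) ξ e 0 0 (rootWt i j)
    (fun _ => diagOp (ParamField m) i j) fun _ => diagOp ℂ i j :=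
  (Lead.const (HasWt.diagOp i j)).congr (by ext1; rw [bc_diagOp]) rfl

lemma opMatrix_add {F : Type} [Field F] (b : Fin M → ℕ) (a : Fin N → ℕ)
    (A B : Module.End F (Fock F M N)) :
    opMatrix b a (A + B) = opMatrix b a A + opMatrix b a B := by
  ext; simp [opMatrix]

lemma opMatrix_smul {F : Type} [Field F] (b : Fin M → ℕ) (a : Fin N → ℕ) (c : F)
    (A : Module.End F (Fock F M N)) : opMatrix b a (c • A) = c • opMatrix b a A := by
  ext; simp [opMatrix]

lemma toFock_single {F : Type} [Field F] {b : Fin M → ℕ} {a : Fin N → ℕ} [DecidableEq (Table b a)]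
    (k : Table b a) (c : F) : toFock (Pi.single k c) = MvPolynomial.monomial (expo k.1) c := by
  rw [toFock, Finset.sum_eq_single k]
  · simp
  · intro l _ hl; simp [hl]
  · simp

lemma toFock_eq_sum {F : Type} [Field F] {b : Fin M → ℕ} {a : Fin N → ℕ} (x : Table b a → F) :
    toFock x = ∑ k, x k • MvPolynomial.monomial (expo k.1) (1 : F) := by
  simp [toFock, MvPolynomial.smul_monomial]

lemma HasWt.apply_toFock {F : Type} [Field F] [CharZero F] {b : Fin M → ℕ} {a : Fin N → ℕ}
    {B : Module.End F (Fock F M N)} (hB : HasWt 0 B) (x : Table b a → F) :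
    B (toFock x) = toFock ((opMatrix b a B).mulVec x) := by
  classical
  have h := (hB.isTab (isTab_toFock x))
  rw [add_zero] at h
  rw [h.eq_toFock]
  congr 1
  funext l
  rw [toFock_eq_sum, map_sum, MvPolynomial.coeff_sum]
  refine Finset.sum_congr rfl fun k _ => ?_
  rw [map_smul, MvPolynomial.coeff_smul, smul_eq_mul, mul_comm]
  rfl

lemma bc_toFock {F : Type} [Field F] [Algebra ℂ F] {b : Fin M → ℕ} {a : Fin N → ℕ}
    {B : Module.End ℂ (Fock ℂ M N)} (hB : HasWt 0 B) (x : Table b a → F) :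
    bc F M N B (toFock x) = toFock (((opMatrix b a B).map (algebraMap ℂ F)).mulVec x) := by
  classical
  rw [toFock_eq_sum x, map_sum, ← toFockLin_apply (F := F)]
  have hx : x = ∑ k, x k • (Pi.single k 1 : Table b a → F) := by
    ext l; simp [Pi.single_apply]
  conv_rhs => rw [hx, Matrix.mulVec_sum, map_sum]
  refine Finset.sum_congr rfl fun k _ => ?_
  rw [map_smul, Matrix.mulVec_smul, map_smul]
  congr 1
  have h1 : MvPolynomial.monomial (expo k.1) (1 : F) =
      MvPolynomial.map (algebraMap ℂ F) (MvPolynomial.monomial (expo k.1) 1) := by simp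
  rw [h1, bc_map, ← toFock_single, hB.apply_toFock, toFockLin_apply, toFock, map_sum, toFock]
  refine Finset.sum_congr rfl fun l _ => ?_
  rw [MvPolynomial.map_monomial]
  simp

/-- Operators of weight zero preserve the weight subspace, so a finite sum of terms `f(u) B` becomes
a matrix of polynomials to which `Rel` applies entry by entry. -/
lemma Lead.exists_matrix (h : Lead ξ e d k κ A A₀) (hκ : κ = 0) (b : Fin M → ℕ) (a : Fin N → ℕ) :
    ∃ (f : Table b a → Table b a → Polynomial (ParamField m))
      (c : Table b a → Table b a → Polynomial ℂ), (∀ x y, Rel ξ e d k (f x y) (c x y)) ∧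
      (∀ u x, A u (toFock x) = toFock ((Matrix.of fun l k => (f l k).eval u).mulVec x)) ∧
      ∀ u, opMatrix b a (A₀ u) = Matrix.of fun l k => (c l k).eval u := by
  induction h with
  | @of f c B h hB =>
    subst hκ
    refine ⟨fun x y => f * C (algebraMap ℂ _ (opMatrix b a B x y)),
      fun x y => c * C (opMatrix b a B x y), fun x y => ?_, fun u x => ?_, fun u => ?_⟩
    · simpa using h.mul (Rel.C (e := e) (IsLead.const (ξ := ξ) (opMatrix b a B x y)))
    · rw [LinearMap.smul_apply, bc_toFock hB, ← toFock_smul, ← Matrix.smul_mulVec]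
      congr 2
      ext l k
      simp
    · rw [opMatrix_smul]
      ext l k
      simp
  | add _ _ ih ih' =>
    obtain ⟨f, c, h1, h2, h3⟩ := ih
    obtain ⟨f', c', h1', h2', h3'⟩ := ih'
    refine ⟨f + f', c + c', fun x y => (h1 x y).add (h1' x y), fun u x => ?_, fun u => ?_⟩
    · rw [Pi.add_apply, LinearMap.add_apply, h2, h2', ← toFock_add, ← Matrix.add_mulVec]
      congr 2
      ext l k
      simp
    · rw [Pi.add_apply, opMatrix_add, h3, h3']
      ext l k
      simp

/-! ### Leading terms of the coefficients of the difference operator -/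

/-- The weight of the indices of a minor. -/
def minorWt (I J : List (Fin N)) : Fin N → ℤ := fun i => (I.count i : ℤ) - J.count i

lemma minorWt_self (I : List (Fin N)) : minorWt I I = 0 := by
  ext i; simp [minorWt]

lemma minorWt_perm {I I' J J' : List (Fin N)} (hI : I.Perm I') (hJ : J.Perm J') :
    minorWt I J = minorWt I' J' := by
  ext i; simp [minorWt, hI.count_eq, hJ.count_eq]

lemma minorWt_cons_left (i : Fin N) (I J : List (Fin N)) (c : Fin N) :
    minorWt (i :: I) J = rootWt i c + minorWt (c :: I) J := by
  ext k
  simp only [minorWt, rootWt, List.count_cons, Pi.add_apply, Pi.sub_apply, Pi.single_apply,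
    beq_iff_eq, @eq_comm _ k]
  push_cast
  ring

lemma minorWt_cons_cons (i j : Fin N) (I J : List (Fin N)) :
    minorWt (i :: I) (j :: J) = rootWt i j + minorWt I J := by
  ext k
  simp only [minorWt, rootWt, List.count_cons, Pi.add_apply, Pi.sub_apply, Pi.single_apply,
    beq_iff_eq, @eq_comm _ k]
  push_cast
  ring

/-- The leading terms of `coefRec` when the positions of the sites are parameters. -/
def coefLeadC (ξ : Fin M → ℂ) (base : List (Fin N) → List (Fin N) → Module.End ℂ (Fock ℂ M N)) :
    List (Fin M) → ℂ → List (Fin N) → List (Fin N) → Module.End ℂ (Fock ℂ M N)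
  | [], _, I, J => base I J
  | s :: S, u, I, J => (u - ξ s) • coefLeadC ξ base S u I J +
      altSum I fun i I' => u • altSum J fun j J' =>
        siteOp ℂ s i j * coefLeadC ξ base S u I' J'

/-- The leading terms of `coefRec` when the highest weight is a parameter. -/
def coefLeadD (z : Fin M → ℂ) (base : List (Fin N) → List (Fin N) → Module.End ℂ (Fock ℂ M N)) :
    List (Fin M) → ℂ → List (Fin N) → List (Fin N) → Module.End ℂ (Fock ℂ M N)
  | [], _, I, J => base I J
  | s :: S, u, I, J => (u - z s) • coefLeadD z base S u I J +
      altSum I fun i I' => ∑ c, siteOp ℂ s i c * coefLeadD z base S u (c :: I') J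

/-- With `u` and the `w_s` of degree one and the Verma operators constant, the sum over inserted
rows has no factor of degree one and drops out, while `u - J.length + 1` reduces to `u`. -/
lemma lead_coefRec_C {ξ : Fin M → ℂ} {w : Fin M → ParamField M}
    (hw : ∀ s, IsLead ξ 1 (w s) (ξ s))
    {P : List (Fin N) → List (Fin N) → Module.End (ParamField M) (Fock (ParamField M) M N)}
    {B : List (Fin N) → List (Fin N) → Module.End ℂ (Fock ℂ M N)}
    (hP : ∀ I J, P I J = bc _ M N (B I J)) (hB : ∀ I J, HasWt (minorWt I J) (B I J))
    (S : List (Fin M)) : ∀ I J, Lead ξ 1 S.length S.length (minorWt I J)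
      (fun u => coefRec (siteOp (ParamField M)) w P S u I J)
      (fun u => coefLeadC ξ B S u I J) := by
  induction S with
  | nil => exact fun I J => (Lead.const (hB I J)).congr (by ext1; exact hP I J) rfl
  | cons s S ih =>
    intro I J
    have h1 : Rel ξ 1 1 1 (X - C (w s)) (X - C (ξ s)) := by
      rw [sub_eq_add_neg, sub_eq_add_neg, ← map_neg, ← map_neg]
      exact Rel.X.add ((Rel.C (hw s).neg).mono_left zero_le_one le_rfl)
    have h2 (n : ℕ) : Rel ξ 1 1 1 (X + C ((1 - n : ParamField M))) X := by
      have := (Rel.X (ξ := ξ) (e := 1)).add ((Rel.C (e := 1)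
        ((IsLead.one (ξ := ξ)).sub (IsLead.natCast n))).weaken zero_le_one zero_lt_one le_rfl)
      rwa [add_zero] at this
    have hl : (s :: S).length = 1 + S.length := by rw [List.length_cons, add_comm]
    have h3 := (ih I J).smul h1
    have h4 : Lead ξ 1 (1 + S.length) (1 + S.length) (minorWt I J)
        (fun u => altSum I fun i I' => ∑ c, siteOp (ParamField M) s i c *
          coefRec (siteOp (ParamField M)) w P S u (c :: I') J) fun _ => altSum I fun _ _ => 0 := by
      refine Lead.altSum I (by simp) fun i I' hI => ?_
      refine (Lead.sum Finset.univ (A₀ := fun _ => 0) (by simp) fun c _ => ?_).congr rfl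
        (by ext1; simp)
      refine (((Lead.siteOp s i c).mul (ih (c :: I') J)).weaken (d' := 1 + S.length)
        (k' := 1 + S.length) (by simp) (by simp) (by simp)).congr_wt ?_
      rw [← minorWt_perm hI (List.Perm.refl J), minorWt_cons_left i I' J c]
    have h5 : Lead ξ 1 (1 + S.length) (1 + S.length) (minorWt I J)
        (fun u => altSum I fun i I' => (u - J.length + 1) • altSum J fun j J' =>
          siteOp (ParamField M) s i j * coefRec (siteOp (ParamField M)) w P S u I' J')
        (fun u => altSum I fun i I' => u • altSum J fun j J' =>
          siteOp ℂ s i j * coefLeadC ξ B S u I' J') := by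
      refine Lead.altSum I (by simp) fun i I' hI => ?_
      have h6 : Lead ξ 1 S.length S.length (minorWt I J)
          (fun u => altSum J fun j J' =>
            siteOp (ParamField M) s i j * coefRec (siteOp (ParamField M)) w P S u I' J')
          (fun u => altSum J fun j J' => siteOp ℂ s i j * coefLeadC ξ B S u I' J') := by
        refine Lead.altSum J (by simp) fun j J' hJ => ?_
        have := (Lead.siteOp s i j).mul (ih I' J')
        rw [zero_add] at this
        refine this.congr_wt ?_
        rw [← minorWt_perm hI hJ, minorWt_cons_cons]
      refine (h6.smul (h2 J.length)).congr ?_ ?_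
      · ext1 u
        congr 1
        simp only [Polynomial.eval_add, Polynomial.eval_X, Polynomial.eval_C]
        ring
      · ext1 u; simp
    rw [hl]
    refine (h3.add (h4.add h5)).congr ?_ ?_
    · ext1 u
      simp only [coefRec, Pi.add_apply, altSum_add, Polynomial.eval_sub, Polynomial.eval_X,
        Polynomial.eval_C]
    · ext1 u
      simp only [coefLeadC, Pi.add_apply, Polynomial.eval_sub, Polynomial.eval_X,
        Polynomial.eval_C, altSum_zero, zero_add]

/-- Only the highest weight is large here, and a minor with columns `J` has degree `J.length`. The
term that deletes a column is then of lower order and drops out. The dependence on `u` has degree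
zero and is kept exactly. -/
lemma lead_coefRec_D {w : Fin M → ParamField m} {z : Fin M → ℂ}
    (hw : ∀ s, w s = algebraMap ℂ _ (z s))
    {P : List (Fin N) → List (Fin N) → Module.End (ParamField m) (Fock (ParamField m) M N)}
    {B : List (Fin N) → List (Fin N) → Module.End ℂ (Fock ℂ M N)}
    (hP : ∀ I J, Lead ξ 0 0 J.length (minorWt I J) (fun _ => P I J) fun _ => B I J)
    (S : List (Fin M)) : ∀ I J, Lead ξ 0 S.length J.length (minorWt I J)
      (fun u => coefRec (siteOp (ParamField m)) w P S u I J)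
      (fun u => coefLeadD z B S u I J) := by
  induction S with
  | nil => exact fun I J => hP I J
  | cons s S ih =>
    intro I J
    have h1 : Rel ξ 0 1 0 (X - C (w s)) (X - C (z s)) := by
      rw [sub_eq_add_neg, sub_eq_add_neg, ← map_neg, ← map_neg, hw]
      exact Rel.X.add ((Rel.C (IsLead.const (z s)).neg).mono_left zero_le_one (by simp))
    have h2 (n : ℕ) : Rel ξ 0 1 0 (X + C ((1 - n : ParamField m))) (X + C (1 - n : ℂ)) :=
      (Rel.X (ξ := ξ) (e := 0)).add ((Rel.C (e := 0)
        ((IsLead.one (ξ := ξ)).sub (IsLead.natCast n))).mono_left zero_le_one (by simp))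
    have hl : (s :: S).length = 1 + S.length := by rw [List.length_cons, add_comm]
    have h3 := (ih I J).smul h1
    have h4 : Lead ξ 0 (1 + S.length) J.length (minorWt I J)
        (fun u => altSum I fun i I' => ∑ c, siteOp (ParamField m) s i c *
          coefRec (siteOp (ParamField m)) w P S u (c :: I') J)
        (fun u => altSum I fun i I' => ∑ c, siteOp ℂ s i c * coefLeadD z B S u (c :: I') J) := by
      refine Lead.altSum I (by simp) fun i I' hI => ?_
      refine Lead.sum Finset.univ (by simp) fun c _ => ?_
      have := ((Lead.siteOp s i c).mul (ih (c :: I') J))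
      rw [zero_add, zero_add] at this
      refine (this.mono_left (d' := 1 + S.length) (by simp) (by simp)).congr_wt ?_
      rw [← minorWt_perm hI (List.Perm.refl J), minorWt_cons_left i I' J c]
    have h5 : Lead ξ 0 (1 + S.length) J.length (minorWt I J)
        (fun u => altSum I fun i I' => (u - J.length + 1) • altSum J fun j J' =>
          siteOp (ParamField m) s i j * coefRec (siteOp (ParamField m)) w P S u I' J')
        (fun u => altSum I fun i I' => 0) := by
      refine Lead.altSum I (by simp) fun i I' hI => ?_
      have h6 : Lead ξ 0 S.length J.length (minorWt I J)
          (fun u => altSum J fun j J' =>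
            siteOp (ParamField m) s i j * coefRec (siteOp (ParamField m)) w P S u I' J')
          (fun u => altSum J fun j J' => 0) := by
        refine Lead.altSum J (by simp) fun j J' hJ => ?_
        have h7 := ((Lead.siteOp s i j).mul (ih I' J'))
        have h8 := hJ.length_eq
        rw [List.length_cons] at h8
        refine (h7.weaken (d' := S.length) (k' := J.length) (by simp) (by omega)
          (by simp)).congr_wt ?_
        rw [← minorWt_perm hI hJ, minorWt_cons_cons]
      have h9 := h6.smul (h2 J.length)
      rw [zero_add] at h9
      refine h9.congr ?_ ?_
      · ext1 u
        congr 1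
        simp only [Polynomial.eval_add, Polynomial.eval_X, Polynomial.eval_C]
        ring
      · ext1 u; simp [altSum_zero]
    rw [zero_add] at h3
    rw [hl]
    refine (h3.add (h4.add h5)).congr ?_ ?_
    · ext1 u
      simp only [coefRec, Pi.add_apply, altSum_add, Polynomial.eval_sub, Polynomial.eval_X,
        Polynomial.eval_C]
    · ext1 u
      simp only [coefLeadD, Pi.add_apply, Polynomial.eval_sub, Polynomial.eval_X,
        Polynomial.eval_C, altSum_zero, add_zero]

/-- The leading term of `bethe`, given the leading terms of the minors. -/
def betheLead (V : List (Fin N) → Module.End ℂ (Fock ℂ M N)) (r : ℕ) : Module.End ℂ (Fock ℂ M N) :=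
  (-1 : ℂ) ^ r • ((List.sublistsLen r (List.finRange N)).map V).sum

lemma lead_bethe {w : Fin M → ParamField m}
    {P : List (Fin N) → List (Fin N) → Module.End (ParamField m) (Fock (ParamField m) M N)}
    {V : ℂ → List (Fin N) → Module.End ℂ (Fock ℂ M N)} {r : ℕ} (hd : e * d ≤ k)
    (h : ∀ K ∈ List.sublistsLen r (List.finRange N), Lead ξ e d k 0
      (fun u => coefRec (siteOp (ParamField m)) w P (List.finRange M) u K K) fun u => V u K) :
    Lead ξ e d k 0 (fun u => bethe (siteOp (ParamField m)) w P r u)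
      (fun u => betheLead (V u) r) := by
  have := (Lead.listSum _ hd h).smul (Rel.C (e := e) (IsLead.const (ξ := ξ) ((-1) ^ r)))
  rw [zero_add, zero_add] at this
  refine this.congr ?_ ?_
  · ext1 u
    rw [Polynomial.eval_C, map_pow, map_neg, map_one]
    rfl
  · ext1 u
    rw [Polynomial.eval_C]
    rfl

end

/-! ### Conjugation by θ: Verma generators become Fock space operators -/

section

variable {F : Type} [Field F] {M N : ℕ} {lam : Fin N → F}

/-! ### The map `θ` and products of generators of the Verma module -/

/-- The vectors annihilated by the raising operators. -/
def IsRaised (v : State M lam) : Prop := ∀ i j : Fin N, i < j → totalOp M lam i j v = 0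

/-- Combinations of products of `n` generators of `gl_N`, acting in the Verma module, of weight `κ`;
`c` is the value of the leading coefficient at the highest weight `η`. -/
inductive WordSpan (M : ℕ) (lam : Fin N → F) (η : Fin N → ℂ) :
    ℕ → (Fin N → ℤ) → Module.End F (State M lam) → ℂ → Prop
  | one : WordSpan M lam η 0 0 1 1
  | cons (i j : Fin N) {n : ℕ} {κ : Fin N → ℤ} {T : Module.End F (State M lam)} {c : ℂ}
      (h : WordSpan M lam η n κ T c) :
      WordSpan M lam η (n + 1) (rootWt i j + κ) (vermaState M lam i j * T)
        (if i = j then η i * c else 0)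
  | add {n : ℕ} {κ : Fin N → ℤ} {T T' : Module.End F (State M lam)} {c c' : ℂ}
      (h : WordSpan M lam η n κ T c) (h' : WordSpan M lam η n κ T' c') :
      WordSpan M lam η n κ (T + T') (c + c')
  | neg {n : ℕ} {κ : Fin N → ℤ} {T : Module.End F (State M lam)} {c : ℂ}
      (h : WordSpan M lam η n κ T c) : WordSpan M lam η n κ (-T) (-c)
  | zero (n : ℕ) (κ : Fin N → ℤ) : WordSpan M lam η n κ 0 0
  | weaken {n : ℕ} {κ : Fin N → ℤ} {T : Module.End F (State M lam)} {c : ℂ}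
      (h : WordSpan M lam η n κ T c) : WordSpan M lam η (n + 1) κ T 0

variable {η : Fin N → ℂ} {n : ℕ} {κ : Fin N → ℤ} {T T' : Module.End F (State M lam)} {c c' : ℂ}

lemma WordSpan.sub (h : WordSpan M lam η n κ T c) (h' : WordSpan M lam η n κ T' c') :
    WordSpan M lam η n κ (T - T') (c - c') := by
  have h1 : T - T' = T + -T' := sub_eq_add_neg T T'
  rw [h1, sub_eq_add_neg c]
  exact h.add h'.neg

lemma WordSpan.congr_wt {κ' : Fin N → ℤ} (h : WordSpan M lam η n κ T c) (hκ : κ' = κ) :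
    WordSpan M lam η n κ' T c := hκ ▸ h

lemma vermaState_lie (M : ℕ) (lam : Fin N → F) : IsGL (vermaState M lam) := by
  intro i j k l
  have h := congrArg (LinearMap.lTensorHom (R := F) (Fock F M N)) (vermaOp_lie lam i j k l)
  rw [map_sub, map_sub] at h
  change (_ ∘ₗ _ : _ →ₗ[F] _) - (_ ∘ₗ _ : _ →ₗ[F] _) = _
  rw [← LinearMap.lTensor_comp, ← LinearMap.lTensor_comp]
  refine h.trans ?_
  congr 1 <;> split_ifs <;> simp

lemma totalOp_vermaState (i j k l : Fin N) (v : State M lam) :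
    totalOp M lam i j (vermaState M lam k l v) = vermaState M lam k l (totalOp M lam i j v) +
      ((if j = k then vermaState M lam i l v else 0) -
        if l = i then vermaState M lam k j v else 0) := by
  have h := LinearMap.congr_fun (vermaState_lie M lam i j k l) v
  have h2 : ((if j = k then vermaState M lam i l else 0) -
      if l = i then vermaState M lam k j else 0) v =
      (if j = k then vermaState M lam i l v else 0) -
        if l = i then vermaState M lam k j v else 0 := by
    split_ifs <;> simp
  rw [LinearMap.sub_apply, Module.End.mul_apply, Module.End.mul_apply, h2, sub_eq_iff_eq_add] at h
  rw [totalOp, LinearMap.add_apply, LinearMap.add_apply, h, map_add]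
  have h3 : (diagOp F i j).rTensor (Verma lam) (vermaState M lam k l v) =
      vermaState M lam k l ((diagOp F i j).rTensor (Verma lam) v) := by
    rw [← LinearMap.comp_apply, ← LinearMap.comp_apply, LinearMap.lTensor_comp_rTensor,
      LinearMap.rTensor_comp_lTensor]
  rw [h3]
  abel

/-- A generator that kills `v` acts on `T v` through its commutator with the word, which replaces
one letter at a time. The length is kept and the weight is shifted. -/
lemma WordSpan.totalOp (h : WordSpan M lam η n κ T c) (i j : Fin N) : ∃ T' c',
    WordSpan M lam η n (rootWt i j + κ) T' c' ∧ ∀ v : State M lam, totalOp M lam i j v = 0 →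
      totalOp M lam i j (T v) = T' v := by
  induction h with
  | one => exact ⟨0, 0, .zero _ _, fun v hv => by simpa using hv⟩
  | @cons k l n κ T c h ih =>
    obtain ⟨T', c', h', hT⟩ := ih
    have h1 : ∃ c₁, WordSpan M lam η (n + 1) (rootWt i j + (rootWt k l + κ))
        ((if j = k then vermaState M lam i l else 0) * T) c₁ := by
      split_ifs with hjk
      · subst hjk
        exact ⟨_, (WordSpan.cons i l h).congr_wt (by simp [rootWt]; abel)⟩
      · exact ⟨0, by rw [zero_mul]; exact .zero _ _⟩
    have h2 : ∃ c₂, WordSpan M lam η (n + 1) (rootWt i j + (rootWt k l + κ))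
        ((if l = i then vermaState M lam k j else 0) * T) c₂ := by
      split_ifs with hli
      · subst hli
        exact ⟨_, (WordSpan.cons k j h).congr_wt (by simp [rootWt]; abel)⟩
      · exact ⟨0, by rw [zero_mul]; exact .zero _ _⟩
    obtain ⟨c₁, h1⟩ := h1
    obtain ⟨c₂, h2⟩ := h2
    refine ⟨_, _, ((WordSpan.cons k l h').congr_wt (by abel)).add (h1.sub h2), fun v hv => ?_⟩
    rw [Module.End.mul_apply, totalOp_vermaState, hT v hv]
    simp only [LinearMap.add_apply, LinearMap.sub_apply, Module.End.mul_apply]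
    congr 2 <;> split_ifs <;> simp
  | add _ _ ih ih' =>
    obtain ⟨T₁, c₁, h₁, hT₁⟩ := ih
    obtain ⟨T₂, c₂, h₂, hT₂⟩ := ih'
    exact ⟨_, _, h₁.add h₂, fun v hv => by
      rw [LinearMap.add_apply, map_add, hT₁ v hv, hT₂ v hv]; rfl⟩
  | neg _ ih =>
    obtain ⟨T₁, c₁, h₁, hT₁⟩ := ih
    exact ⟨_, _, h₁.neg, fun v hv => by rw [LinearMap.neg_apply, map_neg, hT₁ v hv]; rfl⟩
  | zero n κ => exact ⟨0, 0, .zero _ _, fun v hv => by simp⟩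
  | weaken _ ih =>
    obtain ⟨T₁, c₁, h₁, hT₁⟩ := ih
    exact ⟨_, _, h₁.weaken, hT₁⟩

/-- The closure properties of classes of operators on the Fock space which guarantee that they
represent the products of generators of the Verma module. -/
structure WordClass (lam : Fin N → F) (η : Fin N → ℂ)
    (Q : ℕ → (Fin N → ℤ) → Module.End F (Fock F M N) → ℂ → Prop) : Prop where
  one : Q 0 0 1 1
  lam : ∀ {n κ P c} i, Q n κ P c → Q (n + 1) κ (lam i • P) (η i * c)
  raise : ∀ {n κ P c P' c'} (i j : Fin N), Q n κ P c → Q n (rootWt i j + κ) P' c' →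
    Q (n + 1) (rootWt i j + κ) (P' - diagOp F i j * P) 0
  add : ∀ {n κ P c P' c'}, Q n κ P c → Q n κ P' c' → Q n κ (P + P') (c + c')
  neg : ∀ {n κ P c}, Q n κ P c → Q n κ (-P) (-c)
  zero : ∀ n κ, Q n κ 0 0
  weaken : ∀ {n κ P c}, Q n κ P c → Q (n + 1) κ P 0

/-- The leftmost letter is removed. A lowering letter is killed by `θ`, and a Cartan letter becomes
a number. A raising letter is the total generator minus its Fock part, and the total generator turns
the remaining word into another one of the same length. Since that word is not a part of the given
one, the induction runs over the bound `k` on the length. -/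
lemma WordSpan.exists_theta {Q : ℕ → (Fin N → ℤ) → Module.End F (Fock F M N) → ℂ → Prop}
    (hQ : WordClass lam η Q) (k : ℕ) : ∀ {n κ T c}, WordSpan M lam η n κ T c → n ≤ k →
      ∃ P, Q n κ P c ∧ ∀ v, IsRaised v → thetaMap M lam (T v) = P (thetaMap M lam v) := by
  induction k with
  | zero =>
    intro n κ T c h hn
    induction h with
    | one => exact ⟨1, hQ.one, fun v _ => rfl⟩
    | cons => omega
    | add _ _ ih ih' =>
      obtain ⟨P, hP, h⟩ := ih hn
      obtain ⟨P', hP', h'⟩ := ih' hn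
      exact ⟨_, hQ.add hP hP', fun v hv => by
        rw [LinearMap.add_apply, map_add, h v hv, h' v hv]; rfl⟩
    | neg _ ih =>
      obtain ⟨P, hP, h⟩ := ih hn
      exact ⟨_, hQ.neg hP, fun v hv => by rw [LinearMap.neg_apply, map_neg, h v hv]; rfl⟩
    | zero n κ => exact ⟨0, hQ.zero _ _, fun v _ => by simp⟩
    | weaken => omega
  | succ k IH =>
    intro n κ T c h hn
    induction h with
    | one => exact ⟨1, hQ.one, fun v _ => rfl⟩
    | @cons i j n κ T c h ih =>
      obtain ⟨P, hP, hT⟩ := IH h (by omega)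
      rcases lt_trichotomy i j with hij | rfl | hij
      · obtain ⟨T', c', h', hT'⟩ := h.totalOp i j
        obtain ⟨P', hP', hTP⟩ := IH h' (by omega)
        refine ⟨P' - diagOp F i j * P, ?_, fun v hv => ?_⟩
        · rw [if_neg hij.ne]
          exact hQ.raise i j hP hP'
        · have h1 := hT' v (hv i j hij)
          rw [GaudinXXX.totalOp, LinearMap.add_apply, ← eq_sub_iff_add_eq'] at h1
          rw [Module.End.mul_apply, h1, map_sub, hTP v hv, thetaMap_rTensor, hT v hv]
          rfl
      · refine ⟨lam i • P, ?_, fun v hv => ?_⟩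
        · rw [if_pos rfl]
          have h0 : rootWt i i + κ = κ := by simp [rootWt]
          rw [h0]
          exact hQ.lam i hP
        · rw [Module.End.mul_apply, thetaMap_vermaOp_self, hT v hv]
          rfl
      · refine ⟨0, ?_, fun v hv => ?_⟩
        · rw [if_neg hij.ne']
          exact hQ.zero _ _
        · rw [Module.End.mul_apply, thetaMap_vermaOp lam hij]
          rfl
    | add _ _ ih ih' =>
      obtain ⟨P, hP, h⟩ := ih hn
      obtain ⟨P', hP', h'⟩ := ih' hn
      exact ⟨_, hQ.add hP hP', fun v hv => by
        rw [LinearMap.add_apply, map_add, h v hv, h' v hv]; rfl⟩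
    | neg _ ih =>
      obtain ⟨P, hP, h⟩ := ih hn
      exact ⟨_, hQ.neg hP, fun v hv => by rw [LinearMap.neg_apply, map_neg, h v hv]; rfl⟩
    | zero n κ => exact ⟨0, hQ.zero _ _, fun v _ => by simp⟩
    | weaken _ ih =>
      obtain ⟨P, hP, h⟩ := ih (by omega)
      exact ⟨P, hQ.weaken hP, h⟩

lemma WordSpan.altSum {ι : Type*} (l : List ι) {T : ι → List ι → Module.End F (State M lam)}
    {c : ι → List ι → ℂ} (h : ∀ i l', (i :: l').Perm l → WordSpan M lam η n κ (T i l') (c i l')) :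
    WordSpan M lam η n κ (altSum l T) (altSum l c) := by
  induction l generalizing T c with
  | nil => exact .zero _ _
  | cons j l ih =>
    exact (h j l (List.Perm.refl _)).sub (ih fun i l' hp => h i (j :: l')
      ((List.Perm.swap j i l').trans (hp.cons j)))

lemma WordSpan.natCast_mul (k : ℕ) (h : WordSpan M lam η n κ T c) :
    WordSpan M lam η n κ (k * T) (k * c) := by
  induction k with
  | zero => simpa using WordSpan.zero n κ
  | succ k ih =>
    push_cast
    rw [add_mul, add_mul, one_mul, one_mul]
    exact ih.add h

/-- The leading coefficient of `capBase`. -/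
def capLead (η : Fin N → ℂ) (I J : List (Fin N)) : ℂ :=
  match J with
  | [] => if I = [] then 1 else 0
  | j :: l => altSum I fun i I' => if i = j then η i * capLead η I' l else 0

lemma wordSpan_capBase (M : ℕ) (lam : Fin N → F) (η : Fin N → ℂ) (J : List (Fin N)) :
    ∀ I, WordSpan M lam η J.length (minorWt I J) (capBase (vermaState M lam) I J)
      (capLead η I J) := by
  induction J with
  | nil =>
    intro I
    rw [capBase_nil, capLead]
    split_ifs with h
    · subst h
      exact WordSpan.one.congr_wt (minorWt_self _)
    · exact .zero _ _
  | cons j l ih =>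
    intro I
    rw [capBase_cons, capLead]
    refine WordSpan.altSum I fun i I' hI => ?_
    have hw : minorWt I (j :: l) = rootWt i j + minorWt I' l := by
      rw [← minorWt_perm hI (List.Perm.refl (j :: l)), minorWt_cons_cons]
    have h1 := (WordSpan.cons i j (ih I')).congr_wt hw
    -- The integer shift on the diagonal uses one generator fewer than allowed, so it has no leading
    -- part.
    have h2 : WordSpan M lam η (l.length + 1) (minorWt I (j :: l))
        ((if i = j then (l.length : Module.End F (State M lam)) else 0) *
          capBase (vermaState M lam) I' l) 0 := by
      split_ifs with hij
      · subst hij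
        exact ((ih I').natCast_mul l.length).weaken.congr_wt (by simpa [rootWt] using hw)
      · rw [zero_mul]; exact .zero _ _
    rw [add_mul]
    simpa using h1.add h2

/-! ### The map `θ` and the difference operator -/

lemma thetaMap_coefRec (w : Fin M → F)
    (P : List (Fin N) → List (Fin N) → Module.End F (Fock F M N)) (v : State M lam)
    (hP : ∀ I J, thetaMap M lam (capBase (vermaState M lam) I J v) = P I J (thetaMap M lam v))
    (S : List (Fin M)) (u : F) : ∀ I J,
    thetaMap M lam (coefRec (siteState lam) w (capBase (vermaState M lam)) S u I J v) =
      coefRec (siteOp F) w P S u I J (thetaMap M lam v) := by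
  induction S with
  | nil => exact hP
  | cons s S ih =>
    intro I J
    have ev {H : Type} [AddCommGroup H] [Module F H] (l : List (Fin N))
        (f : Fin N → List (Fin N) → Module.End F H) (x : H) :
        (altSum l f) x = altSum l fun i l' => f i l' x :=
      map_altSum (LinearMap.applyₗ (R := F) x : Module.End F H →ₗ[F] H) l f
    simp only [coefRec, LinearMap.add_apply, LinearMap.smul_apply, map_add, map_smul, ih, ev,
      map_altSum, LinearMap.sum_apply, map_sum, Module.End.mul_apply, thetaMap_rTensor]

lemma map_deltaOp_pow {V W : Type} [AddCommGroup V] [Module F V] [AddCommGroup W] [Module F W]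
    (g : V →ₗ[F] W) (k : ℕ) (φ : F → V) (u : F) :
    g ((deltaOp F V ^ k) φ u) = (deltaOp F W ^ k) (fun v => g (φ v)) u := by
  induction k generalizing φ with
  | zero => rfl
  | succ k ih =>
    rw [pow_succ, pow_succ, Module.End.mul_apply, Module.End.mul_apply, ih]
    refine congrArg (fun f => (deltaOp F W ^ k) f u) (funext fun v => ?_)
    exact map_sub g _ _

lemma deltaOp_pow_mem {V : Type} [AddCommGroup V] [Module F V] (p : Submodule F V) (k : ℕ)
    (φ : F → V) (hφ : ∀ v, φ v ∈ p) (u : F) : (deltaOp F V ^ k) φ u ∈ p := by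
  induction k generalizing φ with
  | zero => exact hφ u
  | succ k ih =>
    rw [pow_succ, Module.End.mul_apply]
    exact ih _ fun v => p.sub_mem (hφ _) (hφ _)

lemma isRaised_of_mem_singular {b : Fin M → ℕ} {a : Fin N → ℕ} {v : State M lam}
    (hv : v ∈ singular b a lam) : IsRaised v := by
  intro i j hij
  have h := (Submodule.mem_inf.1 (Submodule.mem_inf.1 hv).1).2
  simp only [Submodule.mem_iInf] at h
  exact h i j hij

/-- Site generators act on the Fock factor and pass through `θ` unchanged. Only the base of the
recursion has to be replaced, which is allowed because differences of singular vectors are singular.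
-/
theorem thetaMap_diffOp [CharZero F] {b : Fin M → ℕ} {a : Fin N → ℕ} (w : Fin M → F)
    (P : List (Fin N) → List (Fin N) → Module.End F (Fock F M N))
    (hP : ∀ I J (v : State M lam), IsRaised v →
      thetaMap M lam (capBase (vermaState M lam) I J v) = P I J (thetaMap M lam v))
    (u : F) (hu0 : ∀ k ≤ N, u ≠ k) (huw : ∀ k ≤ N, ∀ s, u - k ≠ w s) (φ : F → State M lam)
    (ψ : F → Table b a → F) (hφ : ∀ v, φ v ∈ singular b a lam)
    (hψ : ∀ v, IsTheta lam (φ v) (ψ v)) :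
    thetaMap M lam (prefactor N w u • diffOp lam w φ u) =
      ∑ r ∈ Finset.range (N + 1), (ascPochhammer F (N - r)).eval (u - N + 1) •
        bethe (siteOp F) w P r u (toFock ((deltaOp F (Table b a → F) ^ (N - r)) ψ u)) := by
  rw [prefactor_smul_diffOp lam w u hu0 huw, map_sum]
  refine Finset.sum_congr rfl fun r _ => ?_
  rw [map_smul]
  congr 1
  have hs := isRaised_of_mem_singular (deltaOp_pow_mem _ (N - r) φ hφ u)
  have ht : thetaMap M lam ((deltaOp F (State M lam) ^ (N - r)) φ u) =
      toFock ((deltaOp F (Table b a → F) ^ (N - r)) ψ u) := by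
    rw [map_deltaOp_pow, ← toFockLin_apply, map_deltaOp_pow]
    refine congrArg (fun f => (deltaOp F (Fock F M N) ^ (N - r)) f u) (funext fun v => ?_)
    exact (isTheta_iff lam _ _).1 (hψ v)
  rw [← ht, bethe, bethe, LinearMap.smul_apply, LinearMap.smul_apply, map_smul]
  congr 1
  generalize List.sublistsLen r (List.finRange N) = l
  induction l with
  | nil => simp
  | cons K l ih =>
    simp only [List.map_cons, List.sum_cons, LinearMap.add_apply, map_add, ih]
    congr 1
    exact thetaMap_coefRec w P _ (fun I J => hP I J _ hs) _ u K K

end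

section

variable {m M N : ℕ} {ξ : Fin m → ℂ}

/-! ### The operators on the Fock space that represent the minors in the Verma module -/

/-- For a complex highest weight all representing operators are defined over `ℂ`, so they do not
involve the parameters. Degrees and leading coefficients of words play no role. -/
lemma wordClass_const (μ : Fin N → ℂ) (η : Fin N → ℂ) :
    WordClass (F := ParamField m) (M := M) (fun i => algebraMap ℂ _ (μ i)) η
      fun _ κ P _ => ∃ B, HasWt κ B ∧ P = bc _ M N B where
  one := ⟨1, HasWt.one, by simp⟩
  lam := by
    rintro n κ P c i ⟨B, hB, rfl⟩
    exact ⟨μ i • B, hB.smul _, (bc_smul _ _).symm⟩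
  raise := by
    rintro n κ P c P' c' i j ⟨B, hB, rfl⟩ ⟨B', hB', rfl⟩
    exact ⟨B' + -(diagOp ℂ i j * B), hB'.add ((HasWt.diagOp i j).mul hB).neg, by
      rw [map_add, map_neg, map_mul, bc_diagOp]; exact sub_eq_add_neg _ _⟩
  add := by
    rintro n κ P c P' c' ⟨B, hB, rfl⟩ ⟨B', hB', rfl⟩
    exact ⟨B + B', hB.add hB', by simp⟩
  neg := by
    rintro n κ P c ⟨B, hB, rfl⟩
    exact ⟨-B, hB.neg, by simp⟩
  zero := fun n κ => ⟨0, HasWt.zero κ, by simp⟩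
  weaken := fun h => h

/-- Only Cartan letters bring a factor `λ_i`. A raising letter lengthens the word but adds no power
of the parameters, so it contributes no leading part. -/
lemma wordClass_lead (ξ : Fin m → ℂ) :
    WordClass (M := M) (lamVar m) ξ
      fun n κ P c => Lead ξ 0 0 n κ (fun _ => P) fun _ => c • 1 where
  one := ((Lead.const HasWt.one).congr (by simp) (by simp))
  lam := by
    intro n κ P c i h
    have := h.smul (Rel.C (e := 0) (IsLead.lamVar (ξ := ξ) i))
    rw [zero_add, add_comm 1 n] at this
    exact this.congr (by simp) (by simp [mul_smul])
  raise := by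
    intro n κ P c P' c' i j h h'
    have h1 := (Lead.diagOp i j).mul h
    rw [zero_add, zero_add] at h1
    refine ((h'.sub h1).weaken (d' := 0) (k' := n + 1) le_rfl (by simp) (by simp)).congr rfl ?_
    ext1 u
    exact zero_smul ℂ _
  add := by
    intro n κ P c P' c' h h'
    exact (h.add h').congr rfl (by ext1; exact add_smul _ _ _)
  neg := by
    intro n κ P c h
    exact h.neg.congr rfl (funext fun _ => neg_smul c (1 : Module.End ℂ (Fock ℂ M m)))
  zero := fun n κ => (Lead.zero (by simp) κ).congr rfl (by ext1; exact zero_smul ℂ _)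
  weaken := by
    intro n κ P c h
    exact (h.weaken (d' := 0) (k' := n + 1) le_rfl (by simp) (by simp)).congr rfl
      (by ext1; exact zero_smul ℂ _)

lemma exists_base_lead (M : ℕ) (ξ : Fin m → ℂ) : ∃ P : List (Fin m) → List (Fin m) →
    Module.End (ParamField m) (Fock (ParamField m) M m),
    (∀ I J, Lead ξ 0 0 J.length (minorWt I J) (fun _ => P I J)
      fun _ => capLead ξ I J • (1 : Module.End ℂ (Fock ℂ M m))) ∧
    ∀ I J (v : State M (lamVar m)), IsRaised v →
      thetaMap M _ (capBase (vermaState M _) I J v) = P I J (thetaMap M _ v) := by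
  choose P h1 h2 using fun I J => (wordSpan_capBase M (lamVar m) ξ J I).exists_theta
    (wordClass_lead ξ) J.length le_rfl
  exact ⟨P, h1, h2⟩

/-- The operator which represents `e_{ij}` acting in the Verma module. -/
def minorOp (M : ℕ) (μ : Fin N → ℂ) (i j : Fin N) : Module.End ℂ (Fock ℂ M N) :=
  if i < j then -diagOp ℂ i j else if i = j then μ i • 1 else 0

lemma minorOp_hasWt (μ : Fin N → ℂ) (i j : Fin N) : HasWt (minorWt [i] [j]) (minorOp M μ i j) := by
  have h : minorWt [i] [j] = rootWt i j := by
    rw [minorWt_cons_cons, minorWt_self, add_zero]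
  rw [h, minorOp]
  split_ifs with h1 h2
  · exact (HasWt.diagOp i j).neg
  · subst h2
    exact (HasWt.one.smul _).congr (by simp [rootWt])
  · exact HasWt.zero _

lemma thetaMap_capBase_single (μ : Fin N → ℂ) (i j : Fin N)
    (v : State M fun i => algebraMap ℂ (ParamField m) (μ i)) (hv : IsRaised v) :
    thetaMap M _ (capBase (vermaState M _) [i] [j] v) =
      bc _ M N (minorOp M μ i j) (thetaMap M _ v) := by
  have h : capBase (vermaState M fun i => algebraMap ℂ (ParamField m) (μ i)) [i] [j] =
      vermaState M _ i j := by
    simp [capBase_cons, altSum_cons, capBase_nil]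
  rw [h, minorOp]
  split_ifs with h1 h2
  · have h3 := hv i j h1
    rw [totalOp, LinearMap.add_apply, add_eq_zero_iff_eq_neg'] at h3
    rw [h3, map_neg, thetaMap_rTensor, map_neg, bc_diagOp]
    rfl
  · subst h2
    rw [thetaMap_vermaOp_self, bc_smul, map_one]
    rfl
  · rw [thetaMap_vermaOp _ (lt_of_le_of_ne (not_lt.1 h1) (Ne.symm h2)), map_zero]
    rfl

/-- The off-diagonal product begins on the left with the lowering operator `e_{kj}` and is killed by
`θ`. The shift by `1` is the length of the column list behind `j`. -/
lemma thetaMap_capBase_pair (μ : Fin N → ℂ) {j k : Fin N} (hjk : j < k)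
    (v : State M fun i => algebraMap ℂ (ParamField m) (μ i)) :
    thetaMap M _ (capBase (vermaState M _) [j, k] [j, k] v) =
      bc _ M N (((μ j + 1) * μ k) • 1) (thetaMap M _ v) := by
  have h : capBase (vermaState M fun i => algebraMap ℂ (ParamField m) (μ i)) [j, k] [j, k] =
      (vermaState M _ j j + 1) * vermaState M _ k k - vermaState M _ k j * vermaState M _ j k := by
    simp [capBase_cons, altSum_cons, capBase_nil, hjk.ne']
  rw [h, LinearMap.sub_apply, map_sub, Module.End.mul_apply, Module.End.mul_apply,
    thetaMap_vermaOp _ hjk, LinearMap.add_apply, map_add, thetaMap_vermaOp_self,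
    Module.End.one_apply, thetaMap_vermaOp_self, bc_smul, map_one, map_mul, map_add, map_one,
    LinearMap.smul_apply, Module.End.one_apply]
  rw [mul_smul, add_smul, one_smul, sub_zero]

/-- The first and second coefficients of the theorem involve minors of order at most two, so the
listed ones are pinned down explicitly. The others are taken from `WordSpan.exists_theta` without a
formula. -/
lemma exists_base_const (m M : ℕ) (μ : Fin N → ℂ) : ∃ B : List (Fin N) → List (Fin N) →
    Module.End ℂ (Fock ℂ M N), (∀ I J, HasWt (minorWt I J) (B I J)) ∧
    (∀ I J (v : State M fun i => algebraMap ℂ (ParamField m) (μ i)), IsRaised v →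
      thetaMap M _ (capBase (vermaState M _) I J v) = bc _ M N (B I J) (thetaMap M _ v)) ∧
    B [] [] = 1 ∧ (∀ i j, B [i] [j] = minorOp M μ i j) ∧
    ∀ j k, j < k → B [j, k] [j, k] = ((μ j + 1) * μ k) • 1 := by
  have key : ∀ I J, ∃ B : Module.End ℂ (Fock ℂ M N), HasWt (minorWt I J) B ∧
      (∀ v : State M fun i => algebraMap ℂ (ParamField m) (μ i), IsRaised v →
        thetaMap M _ (capBase (vermaState M _) I J v) = bc _ M N B (thetaMap M _ v)) ∧
      (I = [] → J = [] → B = 1) ∧ (∀ i j, I = [i] → J = [j] → B = minorOp M μ i j) ∧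
      ∀ j k, j < k → I = [j, k] → J = [j, k] → B = ((μ j + 1) * μ k) • 1 := by
    intro I J
    by_cases h0 : I = [] ∧ J = []
    · obtain ⟨rfl, rfl⟩ := h0
      exact ⟨1, by rw [minorWt_self]; exact HasWt.one, fun v _ => by simp [capBase_nil],
        by simp, by simp, by simp⟩
    by_cases h1 : ∃ i j, I = [i] ∧ J = [j]
    · obtain ⟨i, j, rfl, rfl⟩ := h1
      exact ⟨minorOp M μ i j, minorOp_hasWt μ i j, thetaMap_capBase_single μ i j,
        by simp, by simp, by simp⟩
    by_cases h2 : ∃ j k, j < k ∧ I = [j, k] ∧ J = [j, k]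
    · obtain ⟨j, k, hjk, rfl, rfl⟩ := h2
      refine ⟨((μ j + 1) * μ k) • 1, by rw [minorWt_self]; exact HasWt.one.smul _,
        fun v _ => thetaMap_capBase_pair μ hjk v, by simp, by simp, ?_⟩
      intro j' k' _ h _
      simp only [List.cons.injEq, and_true] at h
      rw [h.1, h.2]
    · obtain ⟨P, ⟨B, hB, rfl⟩, h⟩ := (wordSpan_capBase M
        (fun i => algebraMap ℂ (ParamField m) (μ i)) 0 J I).exists_theta
        (wordClass_const μ 0) J.length le_rfl
      exact ⟨B, hB, h, fun h h' => absurd ⟨h, h'⟩ h0, fun i j h h' => absurd ⟨i, j, h, h'⟩ h1,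
        fun j k hjk h h' => absurd ⟨j, k, hjk, h, h'⟩ h2⟩
  choose B hB1 hB2 hB3 hB4 hB5 using key
  exact ⟨B, hB1, hB2, hB3 _ _ rfl rfl, fun i j => hB4 _ _ i j rfl rfl,
    fun j k hjk => hB5 _ _ j k hjk rfl rfl⟩

/-! ### The Casimir operator -/

section Casimir

variable {F : Type} [Field F]

/-- The Casimir element. -/
def casimir {A : Type*} [Ring A] {N : ℕ} (E : Fin N → Fin N → A) : A := ∑ i, ∑ j, E i j * E j i

lemma casimir_commute {A : Type*} [Ring A] {N : ℕ} {E : Fin N → Fin N → A} (hE : IsGL E)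
    (k l : Fin N) : Commute (casimir E) (E k l) := by
  have h (i j : Fin N) : E i j * E j i * E k l - E k l * (E i j * E j i) =
      ((if i = k then E i j * E j l else 0) - (if l = j then E i j * E k i else 0)) +
      ((if j = k then E i l * E j i else 0) - (if l = i then E k j * E j i else 0)) := by
    have e : E i j * E j i * E k l - E k l * (E i j * E j i) =
        E i j * (E j i * E k l - E k l * E j i) + (E i j * E k l - E k l * E i j) * E j i := by
      noncomm_ring
    rw [e, hE, hE]
    split_ifs <;> noncomm_ring
  rw [commute_iff_lie_eq, LieRing.of_associative_ring_bracket, casimir, Finset.sum_mul,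
    Finset.mul_sum, ← Finset.sum_sub_distrib]
  simp only [Finset.sum_mul, Finset.mul_sum, ← Finset.sum_sub_distrib, h]
  simp only [Finset.sum_add_distrib, Finset.sum_sub_distrib]
  have e1 : ∑ i, ∑ j, (if i = k then E i j * E j l else 0) = ∑ j, E k j * E j l := by
    rw [Finset.sum_comm]; simp
  have e2 : ∑ i, ∑ j, (if l = j then E i j * E k i else 0) = ∑ i, E i l * E k i := by
    simp
  have e3 : ∑ i, ∑ j, (if j = k then E i l * E j i else 0) = ∑ i, E i l * E k i := by
    simp
  have e4 : ∑ i, ∑ j, (if l = i then E k j * E j i else 0) = ∑ j, E k j * E j l := by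
    rw [Finset.sum_comm]; simp
  rw [e1, e2, e3, e4]
  abel

/-- The eigenvalue of the Casimir element on singular vectors of weight `η`. -/
def casEig (η : Fin N → F) : F :=
  ∑ i, ∑ j, if i < j then η i - η j else if i = j then η i ^ 2 else 0

/-- Normal ordering: for `i < j` the product `e_{ij} e_{ji}` equals `e_{ji} e_{ij} + e_{ii} -
e_{jj}`. On a weight vector the Casimir element is thus a scalar up to terms that first raise. -/
lemma casimir_apply {H : Type*} [AddCommGroup H] [Module F H] {E : Fin N → Fin N → Module.End F H}
    (hE : IsGL E) (η : Fin N → F) (z : H) (hz : ∀ i, E i i z = η i • z) :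
    casimir E z = casEig η • z + ∑ i, ∑ j, (if i < j then E j i (E i j z) else
      if j < i then E i j (E j i z) else 0) := by
  rw [casimir, casEig, Finset.sum_smul, ← Finset.sum_add_distrib, LinearMap.sum_apply]
  refine Finset.sum_congr rfl fun i _ => ?_
  rw [Finset.sum_smul, ← Finset.sum_add_distrib, LinearMap.sum_apply]
  refine Finset.sum_congr rfl fun j _ => ?_
  rw [Module.End.mul_apply]
  rcases lt_trichotomy i j with h | rfl | h
  · have h1 := LinearMap.congr_fun (hE i j j i) z
    simp only [LinearMap.sub_apply, Module.End.mul_apply, if_true, hz] at h1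
    rw [if_pos h, if_pos h, sub_smul, ← h1]
    abel
  · simp only [lt_irrefl, if_true, if_false, hz, map_smul, smul_smul, add_zero, sq]
  · simp [h, h.not_gt, h.ne']

lemma totalOp_lie (M : ℕ) (lam : Fin N → F) : IsGL (totalOp M lam) := by
  intro i j k l
  have h1 := LinearMap.congr_fun (congrArg (LinearMap.rTensorHom (R := F) (Verma lam))
    (diagOp_lie (F := F) (M := M) i j k l))
  have e1 : ∀ v, (diagOp F i j).rTensor (Verma lam) ((diagOp F k l).rTensor (Verma lam) v) -
      (diagOp F k l).rTensor (Verma lam) ((diagOp F i j).rTensor (Verma lam) v) =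
      ((if j = k then (diagOp F i l).rTensor (Verma lam) else 0) -
        if l = i then (diagOp F k j).rTensor (Verma lam) else 0 : Module.End F (State M lam)) v := by
    intro v
    have := h1 v
    rw [map_sub, map_sub] at this
    rw [← LinearMap.comp_apply, ← LinearMap.comp_apply, ← LinearMap.rTensor_comp,
      ← LinearMap.rTensor_comp]
    refine this.trans ?_
    congr 2 <;> split_ifs <;> simp
  have hc : ∀ (i j k l : Fin N) (v : State M lam), (diagOp F i j).rTensor (Verma lam)
      (vermaState M lam k l v) = vermaState M lam k l ((diagOp F i j).rTensor (Verma lam) v) := by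
    intro i j k l v
    rw [← LinearMap.comp_apply, ← LinearMap.comp_apply, LinearMap.lTensor_comp_rTensor,
      LinearMap.rTensor_comp_lTensor]
  refine LinearMap.ext fun v => ?_
  have e2 := LinearMap.congr_fun (vermaState_lie M lam i j k l) v
  have e3 : ((if j = k then totalOp M lam i l else 0) - if l = i then totalOp M lam k j else 0) =
      ((if j = k then (diagOp F i l).rTensor (Verma lam) else 0) -
        if l = i then (diagOp F (M := M) k j).rTensor (Verma lam) else 0) +
      ((if j = k then vermaState M lam i l else 0) - if l = i then vermaState M lam k j else 0) := by
    split_ifs <;> (try simp only [totalOp]) <;> abel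
  rw [e3, LinearMap.add_apply, ← e1, ← e2]
  simp only [totalOp, LinearMap.sub_apply, Module.End.mul_apply, LinearMap.add_apply, map_add, hc]
  abel

end Casimir

end

/-! ### Existence of sufficiently many singular vectors -/

section

open Polynomial (C X aeval)

/-! ### Singular vectors for generic highest weights -/

section

variable {F : Type} [Field F] [CharZero F] {M N : ℕ} {b : Fin M → ℕ} (lam : Fin N → F)

lemma mem_symPowers {p : Fock F M N} :
    p ∈ symPowers F N b ↔ ∀ s, rowOp F N s p = (b s : F) • p := by
  constructor
  · intro h s
    induction h using Submodule.span_induction with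
    | mem p hp =>
      obtain ⟨k, hk, rfl⟩ := hp
      rw [rowOp, LinearMap.sum_apply, ← hk s]
      simp only [siteOp_monomial, expo_apply, ← Finset.sum_smul]
      push_cast
      rfl
    | zero => simp
    | add p q _ _ hp hq => rw [map_add, hp, hq, smul_add]
    | smul c p _ hp => rw [map_smul, hp, smul_comm]
  · intro h
    rw [MvPolynomial.as_sum p]
    refine Submodule.sum_mem _ fun k hk => ?_
    have h1 : MvPolynomial.monomial k (MvPolynomial.coeff k p) =
        MvPolynomial.coeff k p • MvPolynomial.monomial k (1 : F) := by
      rw [MvPolynomial.smul_monomial, smul_eq_mul, mul_one]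
    rw [h1]
    refine Submodule.smul_mem _ _ (Submodule.subset_span ⟨fun s i => k (s, i), fun s => ?_, ?_⟩)
    · have h2 := congrArg (MvPolynomial.coeff k) (h s)
      rw [coeff_rowOp, MvPolynomial.coeff_smul, smul_eq_mul] at h2
      exact_mod_cast mul_right_cancel₀ (MvPolynomial.mem_support_iff.1 hk) h2
    · exact congrArg (fun k => MvPolynomial.monomial k (1 : F)) (Finsupp.ext fun _ => rfl)

lemma HasWt.mem_symPowers {κ : Fin N → ℤ} {A : Module.End F (Fock F M N)} (hA : HasWt κ A)
    {p : Fock F M N} (hp : p ∈ symPowers F N b) : A p ∈ symPowers F N b := by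
  rw [GaudinXXX.mem_symPowers] at hp ⊢
  intro s
  have := LinearMap.congr_fun (hA.1 s).eq p
  rw [Module.End.mul_apply, Module.End.mul_apply, hp, map_smul] at this
  exact this

variable (b) in
/-- The space `S^{b_1} ⊗ ⋯ ⊗ S^{b_M} ⊗ M_lam`. -/
def powersState : Submodule F (State M lam) :=
  LinearMap.range ((symPowers F N b).subtype.rTensor (Verma lam))

lemma totalOp_mem_powersState (i j : Fin N) {v : State M lam} (hv : v ∈ powersState b lam) :
    totalOp M lam i j v ∈ powersState b lam := by
  obtain ⟨w, rfl⟩ := hv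
  induction w using TensorProduct.induction_on with
  | zero => rw [map_zero, map_zero]; exact Submodule.zero_mem _
  | tmul p y =>
    exact Submodule.add_mem _ ⟨⟨_, (HasWt.diagOp i j).mem_symPowers p.2⟩ ⊗ₜ y, rfl⟩
      ⟨p ⊗ₜ vermaOp lam i j y, rfl⟩
  | add w w' h h' => rw [map_add, map_add]; exact Submodule.add_mem _ h h'

omit [CharZero F] in
lemma totalOp_tmul_vec {i j : Fin N} (hij : i < j) (x : Fock F M N) :
    totalOp M lam i j (x ⊗ₜ vermaVec lam) = diagOp F i j x ⊗ₜ vermaVec lam := by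
  change diagOp F i j x ⊗ₜ vermaVec lam + x ⊗ₜ vermaOp lam i j (vermaVec lam) = _
  rw [vermaOp_vec lam hij, TensorProduct.tmul_zero, add_zero]

omit [CharZero F] in
lemma totalOp_tmul_vec_self {ν : Fin N → ℤ} {x : Fock F M N} (hx : IsTab b ν x) (i : Fin N) :
    totalOp M lam i i (x ⊗ₜ vermaVec lam) = (lam i + ν i) • (x ⊗ₜ[F] vermaVec lam) := by
  change diagOp F i i x ⊗ₜ vermaVec lam + x ⊗ₜ vermaOp lam i i (vermaVec lam) = _
  rw [vermaOp_vec_self, hx.2, TensorProduct.tmul_smul, ← TensorProduct.smul_tmul', add_smul,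
    add_comm]

omit [CharZero F] in
lemma aeval_commute {A : Type*} [Ring A] [Algebra F A] {c x : A} (h : Commute c x)
    (p : Polynomial F) : Commute (aeval c p) x := by
  induction p using Polynomial.induction_on' with
  | add p q hp hq => rw [map_add]; exact hp.add_left hq
  | monomial n a =>
    rw [Polynomial.aeval_monomial]
    exact Commute.mul_left (Algebra.commutes a x) (h.pow_left n)

/-- The polynomial whose roots are the eigenvalues of the Casimir element which correspond to a set
of weights. -/
def casPoly (s : Finset (Fin N → ℤ)) : Polynomial F :=
  ∏ ν ∈ s, (X - C (casEig fun i => lam i + ν i))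

/-- The projection of `x ⊗ v_lam` along the eigenspaces of the Casimir element. -/
def casVec (s : Finset (Fin N → ℤ)) (x : Fock F M N) : State M lam :=
  aeval (casimir (totalOp M lam)) (casPoly lam s) (x ⊗ₜ vermaVec lam)

omit [CharZero F] in
lemma totalOp_aeval (i j : Fin N) (p : Polynomial F) (v : State M lam) :
    totalOp M lam i j (aeval (casimir (totalOp M lam)) p v) =
      aeval (casimir (totalOp M lam)) p (totalOp M lam i j v) :=
  (LinearMap.congr_fun (aeval_commute (casimir_commute (totalOp_lie M lam) i j) p).eq v).symm

lemma casVec_raise (s : Finset (Fin N → ℤ)) {i j : Fin N} (hij : i < j) (x : Fock F M N) :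
    totalOp M lam i j (casVec lam s x) = casVec lam s (diagOp F i j x) := by
  rw [casVec, totalOp_aeval, totalOp_tmul_vec lam hij, casVec]

lemma casVec_self (s : Finset (Fin N → ℤ)) {ν : Fin N → ℤ} {x : Fock F M N} (hx : IsTab b ν x)
    (i : Fin N) : totalOp M lam i i (casVec lam s x) = (lam i + ν i) • casVec lam s x := by
  rw [casVec, totalOp_aeval, totalOp_tmul_vec_self lam hx, map_smul]

lemma casimir_mem (p : Polynomial F) {v : State M lam} (hv : v ∈ powersState b lam) :
    aeval (casimir (totalOp M lam)) p v ∈ powersState b lam := by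
  have h (n : ℕ) : ((casimir (totalOp M lam)) ^ n) v ∈ powersState b lam := by
    induction n with
    | zero => exact hv
    | succ n ih =>
      rw [pow_succ', Module.End.mul_apply, casimir, LinearMap.sum_apply]
      refine Submodule.sum_mem _ fun i _ => ?_
      rw [LinearMap.sum_apply]
      exact Submodule.sum_mem _ fun j _ =>
        totalOp_mem_powersState lam _ _ (totalOp_mem_powersState lam _ _ ih)
  rw [Polynomial.aeval_eq_sum_range, LinearMap.sum_apply]
  exact Submodule.sum_mem _ fun n _ => Submodule.smul_mem _ _ (h n)

/-- A height function on weights, lowered by the raising operators. -/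
def wtHeight (ν : Fin N → ℤ) : ℤ := ∑ i : Fin N, (i : ℤ) * ν i

lemma wtHeight_add (ν : Fin N → ℤ) (i j : Fin N) :
    wtHeight (ν + rootWt i j) = wtHeight ν + (i - j) := by
  simp only [wtHeight, rootWt, Pi.add_apply, Pi.sub_apply, mul_add, mul_sub,
    Finset.sum_add_distrib, Finset.sum_sub_distrib, Pi.single_apply, mul_ite, mul_one, mul_zero,
    Finset.sum_ite_eq', Finset.mem_univ, if_true]

lemma IsTab.nonneg {ν : Fin N → ℤ} {x : Fock F M N} (hx : IsTab b ν x) (h0 : x ≠ 0) (i : Fin N) :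
    0 ≤ ν i ∧ ν i ≤ ∑ s, (b s : ℤ) := by
  obtain ⟨k, hk⟩ := MvPolynomial.ne_zero_iff.1 h0
  obtain ⟨h1, h2⟩ := hx.eq_of_coeff_ne_zero hk
  rw [← h2 i]
  refine ⟨by positivity, ?_⟩
  push_cast
  refine Finset.sum_le_sum fun s _ => ?_
  rw [← h1 s]
  exact_mod_cast Finset.single_le_sum (f := fun i => k (s, i)) (fun _ _ => Nat.zero_le _)
    (Finset.mem_univ i)

/-- The factor of the polynomial for the weight `ν` removes the scalar part of the Casimir element.
What remains begins by raising `x ⊗ v_lam` to `(e_{ij} x) ⊗ v_lam`, a vector of smaller height that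
the other factors kill by induction. The number `n` bounds the height. -/
lemma casVec_eq_zero (n : ℕ) : ∀ (s : Finset (Fin N → ℤ)) (ν : Fin N → ℤ) (x : Fock F M N),
    IsTab b ν x → wtHeight ν < n → (∀ ν', (∃ y : Fock F M N, y ≠ 0 ∧ IsTab b ν' y) →
      wtHeight ν' ≤ wtHeight ν → ν' ∈ s) → casVec lam s x = 0 := by
  induction n with
  | zero =>
    intro s ν x hx hν _
    have h0 : x = 0 := by
      by_contra h0
      have : 0 ≤ wtHeight ν := Finset.sum_nonneg fun i _ =>
        mul_nonneg (by positivity) (hx.nonneg h0 i).1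
      exact absurd hν (not_lt.2 (by simpa using this))
    rw [h0, casVec, TensorProduct.zero_tmul, map_zero]
  | succ n ih =>
    intro s ν x hx hν hs
    by_cases h0 : x = 0
    · rw [h0, casVec, TensorProduct.zero_tmul, map_zero]
    classical
    have hνs : ν ∈ s := hs ν ⟨x, h0, hx⟩ le_rfl
    have hr {i j : Fin N} (hij : i < j) : casVec lam (s.erase ν) (diagOp F i j x) = 0 := by
      have hlt : (i : ℤ) < j := by exact_mod_cast hij
      refine ih _ (ν + rootWt i j) _ ((HasWt.diagOp i j).isTab hx) ?_ fun ν' h1 h2 => ?_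
      · rw [wtHeight_add]
        push_cast at hν
        omega
      · rw [wtHeight_add] at h2
        refine Finset.mem_erase.2 ⟨?_, hs ν' h1 (by omega)⟩
        rintro rfl
        omega
    rw [casVec, casPoly, ← Finset.prod_erase_mul _ _ hνs, map_mul, Module.End.mul_apply, map_sub,
      Polynomial.aeval_X, Polynomial.aeval_C, LinearMap.sub_apply, Module.algebraMap_end_apply,
      casimir_apply (totalOp_lie M lam) (fun i => lam i + ν i) _
        (fun i => totalOp_tmul_vec_self lam hx i), add_sub_cancel_left, map_sum]
    refine Finset.sum_eq_zero fun i _ => ?_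
    rw [map_sum]
    refine Finset.sum_eq_zero fun j _ => ?_
    split_ifs with h1 h2
    · rw [totalOp_tmul_vec lam h1, ← totalOp_aeval]
      exact (congrArg _ (hr h1)).trans (map_zero _)
    · rw [totalOp_tmul_vec lam h2, ← totalOp_aeval]
      exact (congrArg _ (hr h2)).trans (map_zero _)
    · exact map_zero _

/-- The weights other than `β`. -/
def otherWts (b : Fin M → ℕ) (β : Fin N → ℤ) : Finset (Fin N → ℤ) :=
  (Fintype.piFinset fun _ => Finset.Icc 0 (∑ s, (b s : ℤ))).erase β

/-- Raising commutes with the Casimir element and strictly lowers the height. So the weights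
required to annihilate a raised vector do not include `a`, the only weight omitted from the
polynomial. -/
lemma casVec_mem_singular {a : Fin N → ℕ} (x : Table b a → F) :
    casVec lam (otherWts b fun i => (a i : ℤ)) (toFock x) ∈ singular b a lam := by
  have hx := isTab_toFock x
  refine Submodule.mem_inf.2 ⟨Submodule.mem_inf.2 ⟨?_, ?_⟩, ?_⟩
  · exact casimir_mem lam _ ⟨⟨_, mem_symPowers.2 hx.1⟩ ⊗ₜ vermaVec lam, rfl⟩
  · simp only [Submodule.mem_iInf, LinearMap.mem_ker]
    intro i j hij
    rw [casVec_raise lam _ hij]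
    have hlt : (i : ℤ) < j := by exact_mod_cast hij
    refine casVec_eq_zero lam (wtHeight ((fun i => (a i : ℤ)) + rootWt i j) + 1).toNat _ _ _
      ((HasWt.diagOp i j).isTab hx) (by omega) fun ν' h1 h2 => ?_
    rw [wtHeight_add] at h2
    obtain ⟨y, hy0, hy⟩ := h1
    refine Finset.mem_erase.2 ⟨?_, Fintype.mem_piFinset.2 fun i => ?_⟩
    · rintro rfl
      omega
    · exact Finset.mem_Icc.2 (hy.nonneg hy0 i)
  · simp only [Submodule.mem_iInf, LinearMap.mem_ker]
    intro i
    rw [LinearMap.sub_apply, casVec_self lam _ hx, Module.algebraMap_end_apply, sub_eq_zero,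
      Int.cast_natCast]

end

/-! ### Surjectivity of `θ` for the generic highest weight -/

variable {m M : ℕ} {b : Fin M → ℕ}

/-- A factor of the polynomial multiplies the image under `θ` by the difference of the Casimir
eigenvalues at `λ + β` and `λ + ν`, linear in `λ` with leading part `2 ∑ ξ_i (β_i - ν_i)`. The terms
that raise and then lower add no power of `λ` and are of lower order. They involve the operator for
the raised weight, hence the family over all `β`. -/
lemma exists_theta_casVec (ξ : Fin m → ℂ) (s : Finset (Fin m → ℤ)) :
    ∃ G : (Fin m → ℤ) → Module.End (ParamField m) (Fock (ParamField m) M m),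
      (∀ β, Lead ξ 0 0 s.card 0 (fun _ => G β)
        fun _ => (∏ ν ∈ s, ∑ i, 2 * ξ i * (β i - ν i)) • 1) ∧
      ∀ β (x : Fock (ParamField m) M m), IsTab b β x →
        thetaMap M (lamVar m) (casVec (lamVar m) s x) = G β x := by
  classical
  induction s using Finset.induction_on with
  | empty =>
    refine ⟨fun _ => 1, fun β => (Lead.const HasWt.one).congr (by simp) (by simp), fun β x _ => ?_⟩
    rw [casVec, casPoly, Finset.prod_empty, map_one, Module.End.one_apply, thetaMap_tmul,
      vermaFun_vec, one_smul]
    rfl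
  | insert ν s hν ih =>
    obtain ⟨G, hG, hGx⟩ := ih
    let t (β : Fin m → ℤ) : ParamField m :=
      casEig (fun i => lamVar m i + β i) - casEig (fun i => lamVar m i + ν i)
    have ht (β : Fin m → ℤ) : IsLead ξ 1 (t β) (∑ i, 2 * ξ i * (β i - ν i)) := by
      -- The quadratic terms in `λ` cancel in the difference of eigenvalues, and a linear polynomial
      -- remains.
      have e : t β = ∑ i, ∑ j, (if i < j then
          algebraMap ℂ _ ((β i - β j) - (ν i - ν j)) else if i = j then
          algebraMap ℂ _ (β i - ν i) * (2 * lamVar m i + algebraMap ℂ _ (β i + ν i)) else 0) := by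
        simp only [t, casEig, ← Finset.sum_sub_distrib]
        refine Finset.sum_congr rfl fun i _ => Finset.sum_congr rfl fun j _ => ?_
        split_ifs
        · simp; ring
        · simp; ring
        · simp
      rw [e]
      have h2 (i j : Fin m) : IsLead ξ 1 (if i < j then
          algebraMap ℂ (ParamField m) ((β i - β j) - (ν i - ν j)) else if i = j then
          algebraMap ℂ _ (β i - ν i) * (2 * lamVar m i + algebraMap ℂ _ (β i + ν i)) else 0)
          (if i = j then 2 * ξ i * (β i - ν i) else 0) := by
        split_ifs with h3 h4 h4
        · exact absurd h4 h3.ne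
        · exact (IsLead.const _).weaken one_pos
        · have h5 := (IsLead.const (ξ := ξ) (β i - ν i : ℂ)).mul
            (((IsLead.natCast 2).mul (IsLead.lamVar i)).add
              ((IsLead.const (β i + ν i : ℂ)).weaken one_pos))
          simp only [zero_add, Nat.cast_ofNat, add_zero] at h5
          exact h5.congr (by ring)
        · exact IsLead.zero _
      refine (IsLead.sum fun i _ => IsLead.sum fun j _ => h2 i j).congr ?_
      simp
    let R (β : Fin m → ℤ) (i j : Fin m) : Module.End (ParamField m) (Fock (ParamField m) M m) :=
      diagOp _ j i * G (β + rootWt i j) * diagOp _ i j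
    have hR (β : Fin m → ℤ) (i j : Fin m) : Lead ξ 0 0 (s.card + 1) 0 (fun _ => R β i j)
        fun _ => 0 := by
      have h1 := ((Lead.diagOp (M := M) (ξ := ξ) (e := 0) j i).mul (hG (β + rootWt i j))).mul
        (Lead.diagOp i j)
      refine ((h1.weaken (d' := 0) (k' := s.card + 1) (by simp) (by simp)
        (by simp)).congr rfl rfl).congr_wt ?_
      simp [rootWt]
    refine ⟨fun β => t β • G β + ∑ i, ∑ j, (if i < j then R β i j else
      if j < i then R β j i else 0), fun β => ?_, fun β x hx => ?_⟩
    · rw [Finset.card_insert_of_notMem hν]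
      have h1 := (hG β).smul (Rel.C (e := 0) (ht β))
      rw [zero_add, add_comm 1] at h1
      have h2 : Lead ξ 0 0 (s.card + 1) 0 (fun _ => ∑ i, ∑ j, (if i < j then R β i j else
          if j < i then R β j i else 0)) fun _ => ∑ i : Fin m, ∑ j : Fin m, 0 := by
        refine Lead.sum Finset.univ (by simp) fun i _ => Lead.sum Finset.univ (by simp) fun j _ => ?_
        split_ifs
        · exact hR β i j
        · exact hR β j i
        · exact Lead.zero (by simp) 0
      refine (h1.add h2).congr ?_ ?_
      · ext1 u; simp
      · ext1 u
        simp only [Finset.prod_insert hν, Polynomial.eval_C, Pi.add_apply, Finset.sum_const_zero,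
          add_zero, mul_smul]
    · have hz : casVec (lamVar m) (insert ν s) x = casimir (totalOp M (lamVar m))
          (casVec (lamVar m) s x) -
          casEig (fun i => lamVar m i + (ν i : ParamField m)) • casVec (lamVar m) s x := by
        rw [casVec, casPoly, Finset.prod_insert hν, map_mul, Module.End.mul_apply, map_sub,
          Polynomial.aeval_X, Polynomial.aeval_C, LinearMap.sub_apply,
          Module.algebraMap_end_apply]
        rfl
      have hR' {i j : Fin m} (hij : i < j) : thetaMap M (lamVar m) (totalOp M _ j i
          (totalOp M _ i j (casVec (lamVar m) s x))) = R β i j x := by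
        rw [totalOp, LinearMap.add_apply, map_add, thetaMap_vermaOp _ hij, add_zero,
          thetaMap_rTensor, casVec_raise _ _ hij, hGx _ _ ((HasWt.diagOp i j).isTab hx)]
        rfl
      rw [hz, casimir_apply (totalOp_lie M _) (fun i => lamVar m i + β i) _
        (casVec_self _ s hx), add_sub_right_comm, ← sub_smul, map_add, map_smul, hGx β x hx,
        LinearMap.add_apply, LinearMap.smul_apply, map_sum, LinearMap.sum_apply]
      congr 1
      refine Finset.sum_congr rfl fun i _ => ?_
      rw [map_sum, LinearMap.sum_apply]
      refine Finset.sum_congr rfl fun j _ => ?_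
      split_ifs with h1 h2
      · exact hR' h1
      · exact hR' h2
      · simp

/-- A product of nonzero linear forms is a nonzero polynomial, so it does not vanish identically
over an infinite field. -/
lemma exists_prod_ne_zero (s : Finset (Fin m → ℤ)) (β : Fin m → ℤ) (hβ : β ∉ s) :
    ∃ ξ : Fin m → ℂ, ∏ ν ∈ s, ∑ i, 2 * ξ i * (β i - ν i : ℂ) ≠ 0 := by
  let p : MvPolynomial (Fin m) ℂ :=
    ∏ ν ∈ s, ∑ i, 2 * MvPolynomial.X i * MvPolynomial.C (β i - ν i : ℂ)
  have hp : p ≠ 0 := by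
    refine Finset.prod_ne_zero_iff.2 fun ν hν h0 => hβ ?_
    have : β = ν := by
      funext i
      have h1 := congrArg (MvPolynomial.eval (Pi.single i (1 : ℂ))) h0
      simp only [map_sum, map_mul, MvPolynomial.eval_X, MvPolynomial.eval_C, map_zero,
        Pi.single_apply, mul_ite, ite_mul, mul_zero, zero_mul, Finset.sum_ite_eq', Finset.mem_univ,
        if_true, map_ofNat, mul_one, mul_eq_zero, OfNat.ofNat_ne_zero, false_or, sub_eq_zero] at h1
      exact_mod_cast h1
    rwa [this]
  by_contra! h
  refine hp (MvPolynomial.funext fun ξ => ?_)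
  rw [map_zero, ← h ξ]
  simp [p]

/-- The matrix of `x ↦ θ (casVec x)` has a nonzero multiple of the identity as its leading part. Its
determinant is then a nonzero polynomial in the parameters, and the system for the preimage can be
solved. -/
theorem exists_singular_generic {a : Fin m → ℕ} (x : Table b a → ParamField m) :
    ∃ v ∈ singular b a (lamVar m), IsTheta (lamVar m) v x := by
  classical
  let β : Fin m → ℤ := fun i => (a i : ℤ)
  -- This point is auxiliary: it serves only as a direction in which the determinant is seen to be
  -- nonzero.
  obtain ⟨ξ, hξ⟩ := exists_prod_ne_zero (otherWts b β) β (Finset.notMem_erase _ _)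
  obtain ⟨G, hG, hGx⟩ := exists_theta_casVec (M := M) (b := b) ξ (otherWts b β)
  obtain ⟨f, c, hfc, hf, hc⟩ := (hG β).exists_matrix rfl b a
  set q := ∏ ν ∈ otherWts b β, ∑ i, 2 * ξ i * (β i - ν i : ℂ) with hq
  let A : Matrix (Table b a) (Table b a) (ParamField m) := Matrix.of fun l k => (f l k).eval 0
  have hA (l k : Table b a) : IsLead ξ (otherWts b β).card (A l k) (if l = k then q else 0) := by
    have h1 := (hfc l k).4 0 le_rfl
    rw [mul_zero, Nat.sub_zero, Polynomial.coeff_zero_eq_eval_zero,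
      Polynomial.coeff_zero_eq_eval_zero] at h1
    refine h1.congr ?_
    have h2 := congrFun (congrFun (hc 0) l) k
    rw [Matrix.of_apply] at h2
    rw [← h2, opMatrix_smul, Matrix.smul_apply, opMatrix, Matrix.of_apply, Module.End.one_apply,
      MvPolynomial.coeff_monomial, smul_eq_mul]
    by_cases h : l = k
    · simp [h]
    · rw [if_neg h, if_neg fun e => h (Subtype.ext (expo_injective e)).symm, mul_zero]
  have hprod (σ : Equiv.Perm (Table b a)) (t : Finset (Table b a)) :
      IsLead ξ (t.card * (otherWts b β).card) (∏ k ∈ t, A (σ k) k)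
        (∏ k ∈ t, if σ k = k then q else 0) := by
    induction t using Finset.induction_on with
    | empty => simpa using IsLead.one
    | insert k t hk ih =>
      rw [Finset.prod_insert hk, Finset.prod_insert hk, Finset.card_insert_of_notMem hk, add_mul,
        one_mul, add_comm]
      exact (hA _ _).mul ih
  have hdet : A.det ≠ 0 := by
    intro h0
    have h1 : IsLead ξ ((Finset.univ : Finset (Table b a)).card * (otherWts b β).card) A.det
        (Matrix.det (q • (1 : Matrix (Table b a) (Table b a) ℂ))) := by
      rw [Matrix.det_apply', Matrix.det_apply']
      refine IsLead.sum fun σ _ => ?_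
      have h2 := (IsLead.const (ξ := ξ) ((Equiv.Perm.sign σ : ℤ) : ℂ)).mul (hprod σ Finset.univ)
      rw [zero_add, map_intCast] at h2
      refine h2.congr ?_
      congr 1
      refine Finset.prod_congr rfl fun k _ => ?_
      simp [Matrix.one_apply]
    obtain ⟨p, hp, _, hp2⟩ := h1
    rw [h0] at hp
    have hp0 : p = 0 := by
      refine (IsFractionRing.injective (MvPolynomial (Fin m) ℂ) (ParamField m)) ?_
      rw [← hp, map_zero]
    rw [hp0, map_zero, Polynomial.coeff_zero, Matrix.det_smul, Matrix.det_one, mul_one] at hp2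
    exact pow_ne_zero _ hξ hp2
  refine ⟨casVec (lamVar m) (otherWts b β) (toFock (A⁻¹.mulVec x)),
    casVec_mem_singular _ _, (isTheta_iff _ _ _).2 ?_⟩
  rw [hGx β _ (isTab_toFock _), hf 0]
  congr 1
  change A.mulVec _ = x
  rw [Matrix.mulVec_mulVec, Matrix.mul_nonsing_inv _ (isUnit_iff_ne_zero.2 hdet), Matrix.one_mulVec]

end

section

/-! ### Extension of scalars and the map `θ` -/

variable {F : Type} [Field F] [Algebra ℂ F] {M N : ℕ}

/-- The highest weight of a Verma module after extension of scalars. -/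
abbrev bcWt (F : Type) [Field F] [Algebra ℂ F] (μ : Fin N → ℂ) : Fin N → F :=
  fun i => algebraMap ℂ F (μ i)

/-- The Verma module over the large field, viewed as a complex vector space, contains a singular
vector of weight `μ`, so the universal property applies. -/
lemma exists_vermaMap (F : Type) [Field F] [Algebra ℂ F] (μ : Fin N → ℂ) :
    ∃ g : Verma μ →+ Verma (bcWt F μ),
      (∀ (c : ℂ) y, g (c • y) = algebraMap ℂ F c • g y) ∧
      (∀ i j y, g (vermaOp μ i j y) = vermaOp (bcWt F μ) i j (g y)) ∧
      g (vermaVec μ) = vermaVec (bcWt F μ) := by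
  let _ : Module ℂ (Verma (bcWt F μ)) := Module.compHom _ (algebraMap ℂ F)
  let E (i j : Fin N) : Module.End ℂ (Verma (bcWt F μ)) :=
    { toFun := vermaOp (bcWt F μ) i j
      map_add' := map_add _
      map_smul' := fun c y => map_smul (vermaOp (bcWt F μ) i j) (algebraMap ℂ F c) y }
  have hE : IsGL E := by
    intro i j k l
    refine LinearMap.ext fun y => ?_
    have h := LinearMap.congr_fun (vermaOp_lie (bcWt F μ) i j k l) y
    refine h.trans ?_
    rw [LinearMap.sub_apply, LinearMap.sub_apply]
    congr 1 <;> split_ifs <;> rfl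
  have h1 : ∀ i j, i < j → E i j (vermaVec (bcWt F μ)) = 0 := fun i j hij => vermaOp_vec _ hij
  have h2 : ∀ i, E i i (vermaVec (bcWt F μ)) = μ i • vermaVec (bcWt F μ) :=
    fun i => vermaOp_vec_self _ i
  let g := vermaLift μ E hE (vermaVec (bcWt F μ)) h1 h2
  exact ⟨g.toAddMonoidHom, fun c y => g.map_smul c y,
    fun i j y => vermaLift_op μ E hE _ h1 h2 i j y, vermaLift_vec μ E hE _ h1 h2⟩

/-- Singular vectors over `ℂ` with prescribed basis vectors as images are carried to the large field
by a semilinear map compatible with `θ`. Linear combinations of them reach every `x`. -/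
theorem exists_singular_bc [CharZero F] {b : Fin M → ℕ} {a : Fin N → ℕ} {μ : Fin N → ℂ}
    (hμ : ThetaBijective b a μ) (x : Table b a → F) :
    ∃ v ∈ singular b a (bcWt F μ), IsTheta (bcWt F μ) v x := by
  classical
  obtain ⟨g, hgs, hgo, hgv⟩ := exists_vermaMap F μ
  let mp : Fock ℂ M N →+ Fock F M N := (MvPolynomial.map (algebraMap ℂ F)).toAddMonoidHom
  have hmp (c : ℂ) (p : Fock ℂ M N) : mp (c • p) = algebraMap ℂ F c • mp p := by
    change MvPolynomial.map _ _ = _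
    rw [map_complex_smul, algebraMap_smul]
    rfl
  let st : State M μ →+ State M (bcWt F μ) := TensorProduct.liftAddHom
    { toFun := fun p =>
        { toFun := fun y => mp p ⊗ₜ g y
          map_zero' := by rw [map_zero, TensorProduct.tmul_zero]
          map_add' := fun y y' => by rw [map_add, TensorProduct.tmul_add] }
      map_zero' := by
        ext y
        change mp 0 ⊗ₜ g y = 0
        rw [map_zero, TensorProduct.zero_tmul]
      map_add' := fun p p' => by
        ext y
        change mp (p + p') ⊗ₜ g y = mp p ⊗ₜ g y + mp p' ⊗ₜ g y
        rw [map_add, TensorProduct.add_tmul] } (by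
      intro c p y
      change mp (c • p) ⊗ₜ g y = mp p ⊗ₜ g (c • y)
      rw [hmp, hgs, TensorProduct.smul_tmul])
  have st_tmul (p : Fock ℂ M N) (y : Verma μ) : st (p ⊗ₜ y) = mp p ⊗ₜ[F] g y := rfl
  have st_smul (c : ℂ) (v : State M μ) : st (c • v) = algebraMap ℂ F c • st v := by
    induction v using TensorProduct.induction_on with
    | zero => simp
    | tmul p y =>
      rw [TensorProduct.smul_tmul', st_tmul, st_tmul, hmp, TensorProduct.smul_tmul']
    | add v w hv hw => rw [smul_add, map_add, map_add, hv, hw, smul_add]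
  have st_op (i j : Fin N) (v : State M μ) :
      st (totalOp M μ i j v) = totalOp M (bcWt F μ) i j (st v) := by
    induction v using TensorProduct.induction_on with
    | zero => simp
    | tmul p y =>
      change st (diagOp ℂ i j p ⊗ₜ y + p ⊗ₜ vermaOp μ i j y) =
        diagOp F i j (mp p) ⊗ₜ g y + mp p ⊗ₜ vermaOp _ i j (g y)
      rw [map_add, st_tmul, st_tmul, hgo, ← bc_diagOp (F := F)]
      congr 2
      exact (bc_map (F := F) (diagOp ℂ i j) p).symm
    | add v w hv hw => rw [map_add, map_add, map_add, hv, hw, map_add]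
  have st_mem (v : State M μ) (hv : v ∈ powersState b μ) : st v ∈ powersState b (bcWt F μ) := by
    obtain ⟨w, rfl⟩ := hv
    induction w using TensorProduct.induction_on with
    | zero => rw [map_zero, map_zero]; exact Submodule.zero_mem _
    | tmul p y =>
      refine ⟨⟨mp p, mem_symPowers.2 fun s => ?_⟩ ⊗ₜ g y, rfl⟩
      have h := mem_symPowers.1 p.2 s
      have h2 : rowOp F N s = bc F M N (rowOp ℂ N s) := by simp [rowOp, bc_siteOp]
      rw [h2]
      change bc F M N (rowOp ℂ N s) (MvPolynomial.map (algebraMap ℂ F) p) = _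
      rw [bc_map, h]
      change mp _ = _
      rw [hmp, map_natCast]
    | add v w hv hw => rw [map_add, map_add]; exact Submodule.add_mem _ hv hw
  have g_low (y : Verma μ) (hy : y ∈ vermaLower μ) : vermaFun (bcWt F μ) (g y) = 0 := by
    let K : Submodule ℂ (Verma μ) :=
      { carrier := {y | vermaFun (bcWt F μ) (g y) = 0}
        zero_mem' := by simp
        add_mem' := fun {y z} hy hz => by
          change vermaFun _ (g (y + z)) = 0
          rw [map_add, map_add, hy, hz, add_zero]
        smul_mem' := fun c y hy => by
          change vermaFun _ (g (c • y)) = 0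
          rw [hgs, map_smul, hy, smul_zero] }
    suffices h : vermaLower μ ≤ K from h hy
    refine iSup₂_le fun eta heta z hz => ?_
    refine vermaLower_le_ker (bcWt F μ) ?_
    refine Submodule.mem_iSup_of_mem (bcWt F eta) (Submodule.mem_iSup_of_mem ?_ ?_)
    · intro h
      exact heta (funext fun i => (algebraMap ℂ F).injective (congrFun h i))
    · rw [mem_vermaWeight] at hz ⊢
      intro i
      rw [← hgo, hz, hgs]
  have g_fun (y : Verma μ) : vermaFun (bcWt F μ) (g y) = algebraMap ℂ F (vermaFun μ y) := by
    have h := g_low _ (sub_vermaFun_mem_lower μ y)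
    rw [map_sub, hgs, hgv, map_sub, map_smul, vermaFun_vec, sub_eq_zero, smul_eq_mul, mul_one] at h
    exact h
  have st_theta (v : State M μ) : thetaMap M (bcWt F μ) (st v) = mp (thetaMap M μ v) := by
    induction v using TensorProduct.induction_on with
    | zero => simp
    | tmul p y => rw [st_tmul, thetaMap_tmul, thetaMap_tmul, hmp, g_fun]
    | add v w hv hw => rw [map_add, map_add, map_add, hv, hw, map_add]
  have st_sing (v : State M μ) (hv : v ∈ singular b a μ) : st v ∈ singular b a (bcWt F μ) := by
    obtain ⟨h12, h3⟩ := Submodule.mem_inf.1 hv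
    obtain ⟨h1, h2⟩ := Submodule.mem_inf.1 h12
    simp only [Submodule.mem_iInf, LinearMap.mem_ker, LinearMap.sub_apply,
      Module.algebraMap_end_apply, sub_eq_zero] at h2 h3
    refine Submodule.mem_inf.2 ⟨Submodule.mem_inf.2 ⟨st_mem v h1, ?_⟩, ?_⟩
    · simp only [Submodule.mem_iInf, LinearMap.mem_ker]
      intro i j hij
      rw [← st_op, h2 i j hij, map_zero]
    · simp only [Submodule.mem_iInf, LinearMap.mem_ker, LinearMap.sub_apply,
        Module.algebraMap_end_apply, sub_eq_zero]
      intro i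
      rw [← st_op, h3 i, st_smul, map_add, map_natCast]
  choose v hv _ using fun k : Table b a => hμ (Pi.single k 1)
  refine ⟨∑ k, x k • st (v k), Submodule.sum_mem _ fun k _ =>
    Submodule.smul_mem _ _ (st_sing _ (hv k).1), (isTheta_iff _ _ _).2 ?_⟩
  rw [map_sum, toFock_eq_sum]
  refine Finset.sum_congr rfl fun k _ => ?_
  rw [map_smul, st_theta, (isTheta_iff _ _ _).1 (hv k).2, toFock_single]
  congr 1
  change MvPolynomial.map (algebraMap ℂ F) _ = _
  simp

end

/-! ### Uniqueness and existence of the coefficients -/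

section

open Polynomial (C X aeval)

/-! ### Difference operators on functions -/

section Difference

variable {F : Type} [Field F] {V : Type} [AddCommGroup V] [Module F V]

/-- The operator `g(u) d`. -/
def weightedDelta (V : Type) [AddCommGroup V] [Module F V] (g : F → F) : Module.End F (F → V) :=
  mulOp (fun v : F => algebraMap F (Module.End F V) (g v)) * deltaOp F V

lemma weightedDelta_apply (g : F → F) (ψ : F → V) (u : F) :
    weightedDelta V g ψ u = g u • (ψ (u + 1) - ψ u) := rfl

lemma weightedDelta_one : weightedDelta V (fun _ : F => 1) = deltaOp F V := by
  refine LinearMap.ext fun ψ => funext fun u => ?_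
  rw [weightedDelta_apply, one_smul]
  rfl

/-- The `i`-th power sees values at most `i` steps ahead, and the value at the last of these points
comes with the product of the weights on the way. -/
lemma weightedDelta_pow_single [CharZero F] [DecidableEq F] (g : F → F) (u : F) (j : ℕ) (x : V)
    (i : ℕ) : ∀ k : ℕ, (i + k < j → (weightedDelta V g ^ i) (Pi.single (u + j) x) (u + k) = 0) ∧
      (i + k = j → (weightedDelta V g ^ i) (Pi.single (u + j) x) (u + k) =
        (∏ l ∈ Finset.range i, g (u + k + l)) • x) := by
  induction i with
  | zero =>
    intro k
    constructor
    · intro h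
      have : u + (k : F) ≠ u + j := fun e => by
        have := Nat.cast_injective (add_left_cancel e)
        omega
      simp [this]
    · intro h
      obtain rfl : k = j := by omega
      simp
  | succ i ih =>
    intro k
    have e : u + (k : F) + 1 = u + ((k + 1 : ℕ) : F) := by push_cast; ring
    constructor
    · intro h
      rw [pow_succ', Module.End.mul_apply, weightedDelta_apply, e, (ih (k + 1)).1 (by omega),
        (ih k).1 (by omega), sub_zero, smul_zero]
    · intro h
      rw [pow_succ', Module.End.mul_apply, weightedDelta_apply, e, (ih (k + 1)).2 (by omega),
        (ih k).1 (by omega), sub_zero, smul_smul, Finset.prod_range_succ', mul_comm]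
      congr 2
      · refine Finset.prod_congr rfl fun l _ => ?_
        congr 1
        push_cast
        ring
      · simp

/-- Triangularity: if `j` is the largest index of a nonzero coefficient, a delta function at `u + j`
is invisible to all smaller powers and detects the coefficient at `j`. -/
lemma eq_zero_of_weightedDelta [CharZero F] (g : F → F) (u : F) {N : ℕ}
    (Q : Fin (N + 1) → V →ₗ[F] V) (hg : ∀ l < N, g (u + l) ≠ 0)
    (h : ∀ ψ : F → V, ∑ i, Q i ((weightedDelta V g ^ (i : ℕ)) ψ u) = 0) (i : Fin (N + 1)) :
    Q i = 0 := by
  classical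
  by_contra hi
  let S : Finset (Fin (N + 1)) := Finset.univ.filter fun i => Q i ≠ 0
  have hS : S.Nonempty := ⟨i, by simpa [S] using hi⟩
  set j := S.max' hS with hj
  have hQj : Q j ≠ 0 := by
    have := S.max'_mem hS
    simpa [S] using this
  refine hQj (LinearMap.ext fun x => ?_)
  have h1 := h (Pi.single (u + (j : ℕ)) x)
  rw [Finset.sum_eq_single j] at h1
  · have h2 := (weightedDelta_pow_single g u j x j 0).2 (by omega)
    rw [Nat.cast_zero, add_zero] at h2
    rw [h2, map_smul] at h1
    refine (smul_eq_zero.1 h1).resolve_left (Finset.prod_ne_zero_iff.2 fun l hl => hg l ?_)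
    have := Finset.mem_range.1 hl
    omega
  · intro k _ hk
    rcases lt_or_gt_of_ne hk with hk | hk
    · have h2 := (weightedDelta_pow_single g u j x k 0).1 (by simpa using hk)
      rw [Nat.cast_zero, add_zero] at h2
      rw [h2, map_zero]
    · have : Q k = 0 := by
        by_contra h2
        exact absurd (S.le_max' k (by simpa [S] using h2)) (not_le.2 hk)
      rw [this, LinearMap.zero_apply]
  · simp

/-- The difference analogue of `ϑ (ϑ - 1) ⋯ (ϑ - l + 1) = x^l ∂^l` for `ϑ = x ∂`. It converts
between the two forms of difference operators in the statement. -/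
lemma aeval_descPochhammer_weightedDelta (c : F) (l : ℕ) (ψ : F → V) (u : F) :
    (aeval (weightedDelta V fun v : F => v + c) (descPochhammer F l)) ψ u =
      (ascPochhammer F l).eval (u + c) • (deltaOp F V ^ l) ψ u := by
  induction l generalizing u with
  | zero => simp
  | succ l ih =>
    rw [descPochhammer_succ_right, mul_comm, map_mul, Module.End.mul_apply, map_sub,
      Polynomial.aeval_X, map_natCast, LinearMap.sub_apply, Pi.sub_apply, weightedDelta_apply, ih,
      ih]
    have h1 : ((l : Module.End F (F → V)) ((aeval (weightedDelta V fun v : F => v + c)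
        (descPochhammer F l)) ψ)) u = (l : F) • ((ascPochhammer F l).eval (u + c) •
          (deltaOp F V ^ l) ψ u) := by
      rw [← ih, Module.End.natCast_apply, ← Nat.cast_smul_eq_nsmul F]
      rfl
    have h2 : (deltaOp F V ^ (l + 1)) ψ u =
        (deltaOp F V ^ l) ψ (u + 1) - (deltaOp F V ^ l) ψ u := by
      rw [pow_succ']
      rfl
    have h3 : (u + c) * (ascPochhammer F l).eval (u + 1 + c) =
        (ascPochhammer F (l + 1)).eval (u + c) := by
      rw [ascPochhammer_succ_left, Polynomial.eval_mul, Polynomial.eval_X, Polynomial.eval_comp]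
      congr 2
      simp only [Polynomial.eval_add, Polynomial.eval_X, Polynomial.eval_one]
      ring
    have h4 : (ascPochhammer F (l + 1)).eval (u + c) =
        (ascPochhammer F l).eval (u + c) * (u + c + l) := by
      rw [ascPochhammer_succ_right]
      simp
    rw [h1, h2, smul_sub, smul_sub, smul_smul, h3, h4]
    module

end Difference

/-! ### Polynomials over infinite fields -/

section Polynomials

variable {F : Type} [Field F]

lemma eventually_eval_ne_zero {p : Polynomial F} (hp : p ≠ 0) :
    ∀ᶠ u in Filter.cofinite, p.eval u ≠ 0 := by
  rw [Filter.eventually_cofinite]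
  classical
  exact p.roots.toFinset.finite_toSet.subset fun u hu => by simpa [hp] using hu

lemma eq_zero_of_eventually [Infinite F] {p : Polynomial F}
    (h : ∀ᶠ u in Filter.cofinite, p.eval u = 0) : p = 0 := by
  by_contra hp
  obtain ⟨u, h1, h2⟩ := (h.and (eventually_eval_ne_zero hp)).exists
  exact h2 h1

/-- A family of monic polynomials, one in each degree. -/
def IsMonicFamily (B : ℕ → Polynomial F) : Prop := ∀ j, (B j).Monic ∧ (B j).natDegree = j

lemma IsMonicFamily.exists_expansion {B : ℕ → Polynomial F} (hB : IsMonicFamily B) (M : ℕ)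
    (p : Polynomial F) (hp : p.natDegree ≤ M) :
    ∃ c : ℕ → F, p = ∑ j ∈ Finset.range (M + 1), C (c j) * B j := by
  induction M generalizing p with
  | zero =>
    refine ⟨fun _ => p.coeff 0, ?_⟩
    have h0 : B 0 = 1 := (hB 0).1.natDegree_eq_zero.1 (hB 0).2
    simpa [h0] using Polynomial.eq_C_of_natDegree_le_zero hp
  | succ M ih =>
    have hd : (p - C (p.coeff (M + 1)) * B (M + 1)).natDegree ≤ M := by
      rw [Polynomial.natDegree_le_iff_coeff_eq_zero]
      intro k hk
      rw [Polynomial.coeff_sub, Polynomial.coeff_C_mul]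
      rcases (Nat.succ_le_of_lt hk).lt_or_eq with h | h
      · have h1 : p.coeff k = 0 := Polynomial.coeff_eq_zero_of_natDegree_lt (hp.trans_lt h)
        have h2 : (B (M + 1)).coeff k = 0 := Polynomial.coeff_eq_zero_of_natDegree_lt
          ((hB _).2.le.trans_lt h)
        rw [h1, h2, mul_zero, sub_zero]
      · have h2 : (B (M + 1)).coeff (M + 1) = 1 := by
          have := (hB (M + 1)).1.coeff_natDegree
          rwa [(hB (M + 1)).2] at this
        rw [← h, Nat.succ_eq_add_one, h2, mul_one, sub_self]
    obtain ⟨c, hc⟩ := ih _ hd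
    refine ⟨Function.update c (M + 1) (p.coeff (M + 1)), ?_⟩
    rw [Finset.sum_range_succ, Function.update_self, ← sub_eq_iff_eq_add, hc]
    refine Finset.sum_congr rfl fun j hj => ?_
    rw [Function.update_of_ne (Finset.mem_range.1 hj).ne]

lemma IsMonicFamily.eq_zero {B : ℕ → Polynomial F} (hB : IsMonicFamily B) (M : ℕ) (c : ℕ → F)
    (h : ∑ j ∈ Finset.range (M + 1), C (c j) * B j = 0) : ∀ j ≤ M, c j = 0 := by
  have key (M : ℕ) : ((∑ j ∈ Finset.range M, C (c j) * B j).coeff M) = 0 := by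
    rw [Polynomial.finsetSum_coeff]
    refine Finset.sum_eq_zero fun j hj => ?_
    rw [Polynomial.coeff_C_mul, Polynomial.coeff_eq_zero_of_natDegree_lt, mul_zero]
    rw [(hB j).2]
    exact Finset.mem_range.1 hj
  induction M with
  | zero =>
    intro j hj
    obtain rfl := Nat.le_zero.1 hj
    have h0 : B 0 = 1 := (hB 0).1.natDegree_eq_zero.1 (hB 0).2
    simpa [h0] using h
  | succ M ih =>
    have h1 : c (M + 1) = 0 := by
      have h2 := congrArg (fun p => Polynomial.coeff p (M + 1)) h
      have h3 : (B (M + 1)).coeff (M + 1) = 1 := by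
        have := (hB (M + 1)).1.coeff_natDegree
        rwa [(hB (M + 1)).2] at this
      rwa [Finset.sum_range_succ, Polynomial.coeff_add, key, zero_add, Polynomial.coeff_C_mul, h3,
        mul_one, Polynomial.coeff_zero] at h2
    rw [Finset.sum_range_succ, h1, map_zero, zero_mul, add_zero] at h
    intro j hj
    rcases hj.lt_or_eq with hj | rfl
    · exact ih h j (by omega)
    · exact h1

lemma isMonicFamily_pow (c : F) : IsMonicFamily fun j => (X + C c) ^ j :=
  fun j => ⟨(Polynomial.monic_X_add_C c).pow j, by
    rw [(Polynomial.monic_X_add_C c).natDegree_pow, Polynomial.natDegree_X_add_C, mul_one]⟩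

lemma isMonicFamily_descPochhammer (c : F) :
    IsMonicFamily fun j => (descPochhammer F j).comp (X + C c) := by
  intro j
  constructor
  · exact (monic_descPochhammer F j).comp (Polynomial.monic_X_add_C c) (by simp)
  · rw [Polynomial.natDegree_comp, Polynomial.natDegree_X_add_C, mul_one,
      descPochhammer_natDegree]

/-- The coefficients of a difference operator with respect to a family of monic polynomials in `u`
are determined by its values at almost all points. -/
lemma coeff_unique [CharZero F] {T : Type} [Fintype T] [DecidableEq T] {N M : ℕ}
    {B : ℕ → Polynomial F} (hB : IsMonicFamily B) (g : F → F) (p : ℕ → Polynomial F)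
    (hp : ∀ i, p i ≠ 0) (hg : ∀ l < N, ∀ᶠ u : F in Filter.cofinite, g (u + l) ≠ 0)
    (D : Fin (N + 1) → Fin (M + 1) → Matrix T T F)
    (h : ∀ᶠ u : F in Filter.cofinite, ∀ ψ : F → T → F, ∑ i : Fin (N + 1), ∑ j : Fin (M + 1),
      ((B j).eval u * (p i).eval u) •
        (D i j).mulVec ((weightedDelta (T → F) g ^ (i : ℕ)) ψ u) = 0) : D = 0 := by
  have hg' : ∀ᶠ u : F in Filter.cofinite, ∀ l < N, g (u + l) ≠ 0 := by
    have := (Filter.eventually_all_finset (Finset.range N)).2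
      fun l hl => hg l (Finset.mem_range.1 hl)
    simpa using this
  have key (i : Fin (N + 1)) (x y : T) : ∀ j ≤ M, (if hj : j < M + 1 then D i ⟨j, hj⟩ x y else 0) = 0 := by
    refine hB.eq_zero M _ (eq_zero_of_eventually ?_)
    filter_upwards [h, hg', eventually_eval_ne_zero (hp i)] with u hu hgu hpu
    have h1 := eq_zero_of_weightedDelta g u
      (fun i => ∑ j : Fin (M + 1), ((B j).eval u * (p i).eval u) • (D i j).mulVecLin) hgu
      (fun ψ => by simpa using hu ψ) i
    have h2 := congrFun (LinearMap.congr_fun h1 (Pi.single y 1)) x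
    rw [LinearMap.sum_apply, Finset.sum_apply] at h2
    have h3 : (p i).eval u * ∑ j : Fin (M + 1), (D i j x y) * (B j).eval u = 0 := by
      rw [LinearMap.zero_apply, Pi.zero_apply] at h2
      refine Eq.trans ?_ h2
      rw [Finset.mul_sum]
      refine Finset.sum_congr rfl fun j _ => ?_
      simp
      ring
    have h4 := (mul_eq_zero.1 h3).resolve_left hpu
    rw [Polynomial.eval_finsetSum, Finset.sum_range]
    refine Eq.trans (Finset.sum_congr rfl fun j _ => ?_) h4
    rw [dif_pos j.2, Polynomial.eval_mul, Polynomial.eval_C]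
  funext i j
  ext x y
  have := key i x y j (by omega)
  rwa [dif_pos j.2] at this

end Polynomials

end

section

open Polynomial (C X aeval)

/-! ### The coefficients of the difference operators -/

section

variable {F : Type} [Field F] [CharZero F] {M N : ℕ} {b : Fin M → ℕ} {a : Fin N → ℕ}
  {lam : Fin N → F} {w : Fin M → F}

omit [CharZero F] in
lemma eventually_regular (N : ℕ) (w : Fin M → F) : ∀ᶠ u : F in Filter.cofinite,
    (∀ k ≤ N, u ≠ (k : ℕ)) ∧ ∀ k ≤ N, ∀ s, u - (k : ℕ) ≠ w s := by
  have hp : (∏ k ∈ Finset.range (N + 1), ((X - C (k : F)) * ∏ s, (X - C (k + w s)))) ≠ 0 :=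
    Finset.prod_ne_zero_iff.2 fun k _ => mul_ne_zero (Polynomial.X_sub_C_ne_zero _)
      (Finset.prod_ne_zero_iff.2 fun s _ => Polynomial.X_sub_C_ne_zero _)
  filter_upwards [eventually_eval_ne_zero hp] with u hu
  rw [Polynomial.eval_prod, Finset.prod_ne_zero_iff] at hu
  have h (k : ℕ) (hk : k ≤ N) := hu k (Finset.mem_range.2 (Nat.lt_succ_of_le hk))
  simp only [Polynomial.eval_mul, Polynomial.eval_prod, Polynomial.eval_sub, Polynomial.eval_X,
    Polynomial.eval_C, mul_ne_zero_iff, Finset.prod_ne_zero_iff, sub_ne_zero] at h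
  exact ⟨fun k hk => (h k hk).1, fun k hk s e => (h k hk).2 s (Finset.mem_univ s) (by rw [← e]; ring)⟩

lemma isTheta_diffOp {P : List (Fin N) → List (Fin N) → Module.End F (Fock F M N)}
    (hP : ∀ I J (v : State M lam), IsRaised v →
      thetaMap M lam (capBase (vermaState M lam) I J v) = P I J (thetaMap M lam v))
    (f : ℕ → Table b a → Table b a → Polynomial F)
    (hf : ∀ r u (x : Table b a → F), bethe (siteOp F) w P r u (toFock x) =
      toFock ((Matrix.of fun l k => (f r l k).eval u).mulVec x)) :
    ∀ᶠ u : F in Filter.cofinite, ∀ (φ : F → State M lam) (ψ : F → Table b a → F),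
      (∀ v, φ v ∈ singular b a lam) → (∀ v, IsTheta lam (φ v) (ψ v)) →
      IsTheta lam (prefactor N w u • diffOp lam w φ u)
        (∑ j : Fin (N + 1), (ascPochhammer F j).eval (u - N + 1) •
          (Matrix.of fun l k => (f (N - j) l k).eval u).mulVec
            ((deltaOp F (Table b a → F) ^ (j : ℕ)) ψ u)) := by
  filter_upwards [eventually_regular N w] with u hu φ ψ hφ hψ
  rw [isTheta_iff, thetaMap_diffOp w P hP u hu.1 hu.2 φ ψ hφ hψ, ← toFockLin_apply, map_sum,
    ← Finset.sum_range_reflect, Finset.sum_range]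
  refine Finset.sum_congr rfl fun j _ => ?_
  have h1 : N + 1 - 1 - (j : ℕ) = N - j := by omega
  have h2 : N - (N - (j : ℕ)) = j := by omega
  rw [map_smul, h1, h2, hf]
  rfl

lemma coeff_unique_of_isTheta {B : ℕ → Polynomial F} (hB : IsMonicFamily B) (g : F → F)
    (p : ℕ → Polynomial F) (hp : ∀ i, p i ≠ 0)
    (hg : ∀ l < N, ∀ᶠ u : F in Filter.cofinite, g (u + l) ≠ 0)
    (hs : ∀ x : Table b a → F, ∃ v ∈ singular b a lam, IsTheta lam v x)
    {D D' : Fin (N + 1) → Fin (M + 1) → Matrix (Table b a) (Table b a) F}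
    (h : ∀ᶠ u : F in Filter.cofinite, ∀ (φ : F → State M lam) (ψ : F → Table b a → F),
      (∀ v, φ v ∈ singular b a lam) → (∀ v, IsTheta lam (φ v) (ψ v)) →
      IsTheta lam (prefactor N w u • diffOp lam w φ u)
        (∑ i : Fin (N + 1), ∑ j : Fin (M + 1), ((B j).eval u * (p i).eval u) •
        (D i j).mulVec ((weightedDelta (Table b a → F) g ^ (i : ℕ)) ψ u)))
    (h' : ∀ᶠ u : F in Filter.cofinite, ∀ (φ : F → State M lam) (ψ : F → Table b a → F),
      (∀ v, φ v ∈ singular b a lam) → (∀ v, IsTheta lam (φ v) (ψ v)) →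
      IsTheta lam (prefactor N w u • diffOp lam w φ u)
        (∑ i : Fin (N + 1), ∑ j : Fin (M + 1), ((B j).eval u * (p i).eval u) •
        (D' i j).mulVec ((weightedDelta (Table b a → F) g ^ (i : ℕ)) ψ u))) : D' = D := by
  classical
  rw [← sub_eq_zero]
  refine coeff_unique hB g p hp hg _ ?_
  filter_upwards [h, h'] with u hu hu' ψ
  -- Surjectivity of `θ` is applied at each point separately, as nothing is required of the
  -- dependence of the functions on `u`.
  choose φ hφ hψ using fun v => hs (ψ v)
  have h1 := (isTheta_iff _ _ _).1 (hu φ ψ hφ hψ)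
  have h2 := (isTheta_iff _ _ _).1 (hu' φ ψ hφ hψ)
  have h3 := toFock_injective (h2.symm.trans h1)
  rw [← sub_eq_zero, ← Finset.sum_sub_distrib] at h3
  refine Eq.trans (Finset.sum_congr rfl fun i _ => ?_) h3
  rw [← Finset.sum_sub_distrib]
  refine Finset.sum_congr rfl fun j _ => ?_
  rw [← smul_sub, ← Matrix.sub_mulVec]
  rfl

end

lemma IsCCoeff.unique {F : Type} [Field F] [CharZero F] {M N : ℕ} {b : Fin M → ℕ} {a : Fin N → ℕ}
    {lam : Fin N → F} {w : Fin M → F}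
    {C₁ C₂ : Fin (M + 1) → Fin (N + 1) → Matrix (Table b a) (Table b a) F}
    (hs : ∀ x : Table b a → F, ∃ v ∈ singular b a lam, IsTheta lam v x)
    (h₁ : IsCCoeff lam w C₁) (h₂ : IsCCoeff lam w C₂) : C₂ = C₁ := by
  have key (D : Fin (M + 1) → Fin (N + 1) → Matrix (Table b a) (Table b a) F)
      (ψ : F → Table b a → F) (u : F) :
      (∑ j : Fin (N + 1), ∑ i : Fin (M + 1), (((X + C (M : F)) ^ (i : ℕ)).eval u *
          ((ascPochhammer F j).comp (X + C (1 - N : F))).eval u) •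
        (D i j).mulVec ((weightedDelta (Table b a → F) (fun _ => 1) ^ (j : ℕ)) ψ u)) =
      ∑ i : Fin (M + 1), ∑ j : Fin (N + 1),
          ((u + M) ^ (i : ℕ) * (ascPochhammer F j).eval (u - N + 1)) •
            (D i j).mulVec ((deltaOp F (Table b a → F) ^ (j : ℕ)) ψ u) := by
    have h1 : u - (N : F) + 1 = u + (1 - N) := by ring
    rw [Finset.sum_comm, weightedDelta_one, h1]
    simp
  have := coeff_unique_of_isTheta (w := w) (isMonicFamily_pow (M : F)) (fun _ => 1)
    (fun j => (ascPochhammer F j).comp (X + C (1 - N : F)))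
    (fun j => ((monic_ascPochhammer F j).comp (Polynomial.monic_X_add_C _)
      (by rw [Polynomial.natDegree_X_add_C]; exact one_ne_zero)).ne_zero) (by simp) hs
    (D := fun j i => C₁ i j) (D' := fun j i => C₂ i j) ?_ ?_
  · funext i j
    exact congrFun (congrFun this j) i
  · filter_upwards [h₁] with u hu φ ψ hφ hψ
    rw [key C₁]
    exact hu φ ψ hφ hψ
  · filter_upwards [h₂] with u hu φ ψ hφ hψ
    rw [key C₂]
    exact hu φ ψ hφ hψ

lemma IsDCoeff.unique {F : Type} [Field F] [CharZero F] {M N : ℕ} {b : Fin M → ℕ} {a : Fin N → ℕ}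
    {lam : Fin N → F} {w : Fin M → F}
    {D₁ D₂ : Fin (N + 1) → Fin (M + 1) → Matrix (Table b a) (Table b a) F}
    (hs : ∀ x : Table b a → F, ∃ v ∈ singular b a lam, IsTheta lam v x)
    (h₁ : IsDCoeff lam w D₁) (h₂ : IsDCoeff lam w D₂) : D₂ = D₁ := by
  have key (D : Fin (N + 1) → Fin (M + 1) → Matrix (Table b a) (Table b a) F)
      (ψ : F → Table b a → F) (u : F) :
      (∑ i : Fin (N + 1), ∑ j : Fin (M + 1), (((descPochhammer F j).comp (X + C (M : F))).eval u *
          (1 : Polynomial F).eval u) •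
        (D i j).mulVec ((weightedDelta (Table b a → F) (fun v : F => v - N + 1) ^ (i : ℕ)) ψ u)) =
      ∑ i : Fin (N + 1), ∑ j : Fin (M + 1), (descPochhammer F j).eval (u + M) •
            (D i j).mulVec
              (((mulOp (fun v : F => algebraMap F (Module.End F (Table b a → F)) (v - N + 1)) *
                deltaOp F (Table b a → F)) ^ (i : ℕ)) ψ u) := by
    simp only [Polynomial.eval_comp, Polynomial.eval_add, Polynomial.eval_X, Polynomial.eval_C,
      Polynomial.eval_one, mul_one]
    rfl
  refine coeff_unique_of_isTheta (w := w) (isMonicFamily_descPochhammer (M : F))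
    (fun v : F => v - N + 1) (fun _ => 1) (by simp) (fun l _ => ?_) hs ?_ ?_
  · have := eventually_eval_ne_zero (Polynomial.X_add_C_ne_zero (l - N + 1 : F))
    filter_upwards [this] with u hu
    rw [Polynomial.eval_add, Polynomial.eval_X, Polynomial.eval_C] at hu
    convert hu using 1
    ring
  · filter_upwards [h₁] with u hu φ ψ hφ hψ
    rw [key D₁]
    exact hu φ ψ hφ hψ
  · filter_upwards [h₂] with u hu φ ψ hφ hψ
    rw [key D₂]
    exact hu φ ψ hφ hψ

lemma Rel.sum {m : ℕ} {ξ : Fin m → ℂ} {e d k : ℕ} {ι : Type} (t : Finset ι)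
    {f : ι → Polynomial (ParamField m)} {c : ι → Polynomial ℂ} (hd : e * d ≤ k)
    (h : ∀ l ∈ t, Rel ξ e d k (f l) (c l)) : Rel ξ e d k (∑ l ∈ t, f l) (∑ l ∈ t, c l) := by
  classical
  induction t using Finset.induction_on with
  | empty => simpa using Rel.zero hd
  | insert l t hl ih =>
    rw [Finset.sum_insert hl, Finset.sum_insert hl]
    exact (h l (Finset.mem_insert_self _ _)).add
      (ih fun l' hl' => h l' (Finset.mem_insert_of_mem hl'))

/-- The leading terms of the coefficients of powers of `d`. -/
def leadOpC {n m : ℕ} (ξ : Fin m → ℂ)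
    (B : List (Fin n) → List (Fin n) → Module.End ℂ (Fock ℂ m n)) (u : ℂ) (r : ℕ) :
    Module.End ℂ (Fock ℂ m n) :=
  betheLead (fun K => coefLeadC ξ B (List.finRange m) u K K) r

/-- Existence and leading terms come from the explicit operators on the Fock space. The bijectivity
of `θ` enters only through uniqueness, where it supplies singular vectors over the field of
parameters. -/
theorem exists_cCoeff {n m : ℕ} (a : Fin n → ℕ) (b : Fin m → ℕ) (μ : Fin n → ℂ) (ξ : Fin m → ℂ)
    (hμ : ThetaBijective b a μ) :
    ∃ B : List (Fin n) → List (Fin n) → Module.End ℂ (Fock ℂ m n),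
      (B [] [] = 1 ∧ (∀ i j, B [i] [j] = minorOp m μ i j) ∧
        ∀ j k, j < k → B [j, k] [j, k] = ((μ j + 1) * μ k) • 1) ∧
    ∃ (C : Fin (m + 1) → Fin (n + 1) → Matrix (Table b a) (Table b a) (ParamField m))
      (c : Fin (m + 1) → Fin (n + 1) → Matrix (Table b a) (Table b a) ℂ),
      IsCCoeff (fun j => algebraMap ℂ (ParamField m) (μ j)) (wParam b) C ∧
      (∀ C', IsCCoeff (fun j => algebraMap ℂ (ParamField m) (μ j)) (wParam b) C' → C' = C) ∧
      (∀ (i : Fin (m + 1)) (j : Fin (n + 1)) x y, IsLeading ξ (m - (i : ℕ)) (C i j x y) (c i j x y)) ∧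
      ∀ (j : Fin (n + 1)) (u : ℂ) x y, ∑ i : Fin (m + 1), c i j x y * u ^ (i : ℕ) =
        opMatrix b a (leadOpC ξ B u (n - j)) x y := by
  obtain ⟨B, hB1, hB2, hB⟩ := exists_base_const m m μ
  refine ⟨B, hB, ?_⟩
  have hlead (r : ℕ) : Lead ξ 1 m m 0 (fun u => bethe (siteOp (ParamField m)) (wParam b)
      (fun I J => bc _ m n (B I J)) r u) (fun u => leadOpC ξ B u r) := by
    refine lead_bethe (by simp) fun K _ => ?_
    have := lead_coefRec_C (ξ := ξ) (w := wParam b) (IsLead.wParam b) (P := fun I J => bc _ m n (B I J))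
      (fun _ _ => rfl) hB1 (List.finRange m) K K
    rw [List.length_finRange, minorWt_self] at this
    exact this
  choose f c hfc hf hc using fun r => (hlead r).exists_matrix rfl b a
  -- Composition with `q` rewrites powers of `u` as powers of `u + m`. Since `u` counts with degree
  -- one, the shift by the constant `m` leaves leading terms unchanged.
  let q : Polynomial (ParamField m) := X - C (m : ParamField m)
  have hrel (r : ℕ) (x y : Table b a) : Rel ξ 1 m m ((f r x y).comp q) (c r x y) := by
    have h := hfc r x y
    rw [Polynomial.comp_eq_sum_left,
      Polynomial.sum_over_range' _ (by simp) (m + 1) (Nat.lt_succ_of_le h.1),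
      Polynomial.as_sum_range_C_mul_X_pow' (c r x y) (Nat.lt_succ_of_le h.2)]
    have hq : Rel ξ 1 1 1 q X := by
      have := (Rel.X (ξ := ξ) (e := 1)).add ((Rel.C (e := 1)
        (IsLead.natCast (ξ := ξ) m).neg).weaken zero_le_one zero_lt_one le_rfl)
      rw [add_zero, map_neg, ← sub_eq_add_neg] at this
      exact this
    have hqp (l : ℕ) : Rel ξ 1 l l (q ^ l) (X ^ l) := by
      induction l with
      | zero => simpa using Rel.C (e := 1) (IsLead.one (ξ := ξ))
      | succ l ih => rw [pow_succ, pow_succ]; exact ih.mul hq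
    refine Rel.sum _ (by simp) fun l hl => ?_
    · have hl' : l ≤ m := Nat.le_of_lt_succ (Finset.mem_range.1 hl)
      have h1 := (Rel.C (e := 1) (h.4 l hl')).mul (hqp l)
      rw [one_mul, zero_add, Nat.sub_add_cancel hl'] at h1
      exact h1.mono_left hl' (by simp)
  have hIs : IsCCoeff (fun j => algebraMap ℂ (ParamField m) (μ j)) (wParam b)
      fun (i : Fin (m + 1)) (j : Fin (n + 1)) => Matrix.of fun x y : Table b a =>
        ((f (n - j) x y).comp q).coeff i := by
    filter_upwards [isTheta_diffOp hB2 f hf] with u hu φ ψ hφ hψ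
    convert hu φ ψ hφ hψ using 1
    rw [Finset.sum_comm]
    refine Finset.sum_congr rfl fun j _ => ?_
    have h1 : (Matrix.of fun l k => (f (n - j) l k).eval u) = ∑ i : Fin (m + 1),
        (u + m) ^ (i : ℕ) • (Matrix.of fun x y : Table b a =>
          ((f (n - j) x y).comp q).coeff (i : ℕ)) := by
      ext x y
      have h2 : (f (n - j) x y).eval u = ((f (n - j) x y).comp q).eval (u + m) := by
        simp [q, Polynomial.eval_comp]
      rw [Matrix.of_apply, h2, Polynomial.eval_eq_sum_range' (Nat.lt_succ_of_le (hrel _ x y).1),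
        Finset.sum_range, Matrix.sum_apply]
      refine Finset.sum_congr rfl fun i _ => ?_
      simp [mul_comm]
    rw [h1, Matrix.sum_mulVec, Finset.smul_sum]
    refine Finset.sum_congr rfl fun i _ => ?_
    rw [Matrix.smul_mulVec, smul_smul, mul_comm]
  refine ⟨_, fun i j => Matrix.of fun x y => (c (n - j) x y).coeff i, hIs, fun C' hC' => ?_,
    fun i j x y => ?_, fun j u x y => ?_⟩
  · exact hIs.unique (exists_singular_bc hμ) hC'
  · have := (hrel (n - j) x y).4 i (by omega)
    rw [one_mul] at this
    exact this.isLeading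
  · rw [hc (n - j) u, Matrix.of_apply,
      Polynomial.eval_eq_sum_range' (Nat.lt_succ_of_le (hrel _ x y).2), Finset.sum_range]
    rfl

/-- The leading terms of the coefficients of powers of `d` when the highest weight is a parameter. -/
def leadOpD {n m : ℕ} (ξ : Fin m → ℂ) (z : Fin n → ℂ) (u : ℂ) (r : ℕ) :
    Module.End ℂ (Fock ℂ n m) :=
  betheLead (fun K => coefLeadD z (fun I J => capLead ξ I J • 1) (List.finRange n) u K K) r

theorem exists_dCoeff {n m : ℕ} (a : Fin n → ℕ) (b : Fin m → ℕ) (z : Fin n → ℂ) (ξ : Fin m → ℂ) :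
    ∃ (D : Fin (m + 1) → Fin (n + 1) → Matrix (Table a b) (Table a b) (ParamField m))
      (d : Fin (m + 1) → Fin (n + 1) → Matrix (Table a b) (Table a b) ℂ),
      IsDCoeff (lamVar m) (fun j => algebraMap ℂ (ParamField m) (z j)) D ∧
      (∀ D', IsDCoeff (lamVar m) (fun j => algebraMap ℂ (ParamField m) (z j)) D' → D' = D) ∧
      (∀ (i : Fin (m + 1)) (j : Fin (n + 1)) x y, IsLeading ξ (m - (i : ℕ)) (D i j x y) (d i j x y)) ∧
      ∀ (i : Fin (m + 1)) (u : ℂ) x y, ∑ j : Fin (n + 1), d i j x y * (descPochhammer ℂ j).eval (u + n) =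
        opMatrix a b (leadOpD ξ z u (m - i)) x y := by
  obtain ⟨P, hP1, hP2⟩ := exists_base_lead n ξ
  have hlead (r : ℕ) : Lead ξ 0 n r 0 (fun u => bethe (siteOp (ParamField m))
      (fun j => algebraMap ℂ (ParamField m) (z j)) P r u) (fun u => leadOpD ξ z u r) := by
    refine lead_bethe (by simp) fun K hK => ?_
    have := lead_coefRec_D (ξ := ξ) (z := z) (fun _ => rfl) hP1 (List.finRange n) K K
    rw [List.length_finRange, minorWt_self, (List.mem_sublistsLen.1 hK).2] at this
    exact this
  choose f c hfc hf hc using fun r => (hlead r).exists_matrix rfl a b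
  -- These numbers express the rising factorial times `d^l` through powers of `(u - m + 1) d`.
  let α (l i : ℕ) : ℂ := (descPochhammer ℂ l).coeff i
  let fD (i : ℕ) (x y : Table a b) : Polynomial (ParamField m) :=
    ∑ l ∈ Finset.range (m + 1), C (algebraMap ℂ _ (α l i)) * f (m - l) x y
  have hα (l i : ℕ) (h : l < i) : α l i = 0 :=
    Polynomial.coeff_eq_zero_of_natDegree_lt (by rwa [descPochhammer_natDegree])
  have hα1 (l : ℕ) : α l l = 1 := by
    have := (monic_descPochhammer ℂ l).coeff_natDegree
    rwa [descPochhammer_natDegree] at this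
  -- The coefficient of the `i`-th power collects `f (m - l)` with `l ≥ i`. These have degree at
  -- most `m - l`, so only `l = i` reaches degree `m - i`.
  have hrel (i : ℕ) (hi : i ≤ m) (x y : Table a b) : Rel ξ 0 n (m - i) (fD i x y) (c (m - i) x y) := by
    have h1 (l : ℕ) (hl : l ∈ Finset.range (m + 1)) : Rel ξ 0 n (m - i)
        (C (algebraMap ℂ _ (α l i)) * f (m - l) x y) (if l = i then c (m - i) x y else 0) := by
      have hl' := Nat.le_of_lt_succ (Finset.mem_range.1 hl)
      rcases lt_trichotomy l i with h | rfl | h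
      · rw [hα l i h, map_zero, map_zero, zero_mul, if_neg h.ne]
        exact Rel.zero (by simp)
      · rw [hα1, map_one, map_one, one_mul, if_pos rfl]
        exact hfc _ x y
      · rw [if_neg h.ne']
        have h2 := (Rel.C (e := 0) (IsLead.const (ξ := ξ) (α l i))).mul (hfc (m - l) x y)
        exact h2.weaken (by simp) (by omega) (by simp)
    have h2 := Rel.sum (Finset.range (m + 1)) (by simp) h1
    simp only [Finset.sum_ite_eq', Finset.mem_range, Nat.lt_succ_iff, hi, if_true] at h2
    exact h2
  -- The change from powers of `u` to falling factorials of `u + n` has complex coefficients, so it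
  -- does not affect degrees in the parameters.
  have hexp (l : ℕ) (hl : l ≤ n) : ∃ s : ℕ → ℂ, (X : Polynomial ℂ) ^ l =
      ∑ j ∈ Finset.range (n + 1), C (s j) * (descPochhammer ℂ j).comp (X + C (n : ℂ)) :=
    (isMonicFamily_descPochhammer (n : ℂ)).exists_expansion n _ (by simpa using hl)
  choose! S hS using hexp
  have hS' (p : Polynomial ℂ) (hp : p.natDegree ≤ n) (u : ℂ) : p.eval u =
      ∑ j : Fin (n + 1), (∑ l ∈ Finset.range (n + 1), p.coeff l * S l j) *
        (descPochhammer ℂ j).eval (u + n) := by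
    rw [Polynomial.eval_eq_sum_range' (Nat.lt_succ_of_le hp)]
    simp only [Finset.sum_mul]
    rw [Finset.sum_comm]
    refine Finset.sum_congr rfl fun l hl => ?_
    have h1 := congrArg (Polynomial.eval u) (hS l (Nat.le_of_lt_succ (Finset.mem_range.1 hl)))
    rw [Polynomial.eval_pow, Polynomial.eval_X, Polynomial.eval_finsetSum, Finset.sum_range] at h1
    rw [h1, Finset.mul_sum]
    refine Finset.sum_congr rfl fun j _ => ?_
    rw [Polynomial.eval_mul, Polynomial.eval_C, Polynomial.eval_comp]
    simp [mul_assoc]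
  have hSF (p : Polynomial (ParamField m)) (hp : p.natDegree ≤ n) (u : ParamField m) : p.eval u =
      ∑ j : Fin (n + 1), (∑ l ∈ Finset.range (n + 1), p.coeff l * algebraMap ℂ _ (S l j)) *
        (descPochhammer (ParamField m) j).eval (u + n) := by
    rw [Polynomial.eval_eq_sum_range' (Nat.lt_succ_of_le hp)]
    simp only [Finset.sum_mul]
    rw [Finset.sum_comm]
    refine Finset.sum_congr rfl fun l hl => ?_
    have h1 := congrArg (fun p => Polynomial.eval u (p.map (algebraMap ℂ (ParamField m))))
      (hS l (Nat.le_of_lt_succ (Finset.mem_range.1 hl)))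
    simp only [Polynomial.map_pow, Polynomial.map_X, Polynomial.eval_pow, Polynomial.eval_X,
      Polynomial.map_sum, Polynomial.map_mul, Polynomial.map_C, Polynomial.map_comp,
      descPochhammer_map, Polynomial.map_add, map_natCast, Polynomial.eval_finsetSum] at h1
    rw [h1, Finset.sum_range, Finset.mul_sum]
    refine Finset.sum_congr rfl fun j _ => ?_
    simp [mul_assoc]
  let D (i : Fin (m + 1)) (j : Fin (n + 1)) : Matrix (Table a b) (Table a b) (ParamField m) :=
    Matrix.of fun x y => ∑ l ∈ Finset.range (n + 1), (fD i x y).coeff l * algebraMap ℂ _ (S l j)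
  have hg : (fun v : ParamField m => v - (m : ParamField m) + 1) =
      fun v : ParamField m => v + (1 - m : ParamField m) := by
    funext v; ring
  have hIs : IsDCoeff (lamVar m) (fun j => algebraMap ℂ (ParamField m) (z j)) D := by
    filter_upwards [isTheta_diffOp hP2 f hf] with u hu φ ψ hφ hψ
    convert hu φ ψ hφ hψ using 1
    have h1 (i : Fin (m + 1)) (y : Table a b → ParamField m) : ∑ j : Fin (n + 1),
        (descPochhammer (ParamField m) j).eval (u + n) • (D i j).mulVec y =
        (Matrix.of fun x y => (fD i x y).eval u).mulVec y := by
      simp only [← Matrix.smul_mulVec, ← Matrix.sum_mulVec]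
      congr 1
      ext x y
      rw [Matrix.of_apply, hSF _ (hrel i (by omega) x y).1, Matrix.sum_apply]
      refine Finset.sum_congr rfl fun j _ => ?_
      simp [D, mul_comm]
    simp only [h1]
    have h2 (i : Fin (m + 1)) : (Matrix.of fun x y => (fD i x y).eval u) =
        ∑ l : Fin (m + 1), algebraMap ℂ (ParamField m) (α l i) •
          (Matrix.of fun x y => (f (m - l) x y).eval u) := by
      ext x y
      rw [Matrix.of_apply, Matrix.sum_apply]
      simp only [fD]
      rw [Polynomial.eval_finsetSum, Finset.sum_range]
      simp
    simp only [h2, Matrix.sum_mulVec]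
    rw [Finset.sum_comm]
    refine Finset.sum_congr rfl fun l _ => ?_
    have h3 := aeval_descPochhammer_weightedDelta (V := Table a b → ParamField m)
      (1 - m : ParamField m) l ψ u
    have h4 : u - (m : ParamField m) + 1 = u + (1 - m) := by ring
    rw [h4, ← Matrix.mulVec_smul, ← h3, Polynomial.aeval_eq_sum_range' (n := m + 1)
      (by rw [descPochhammer_natDegree]; exact l.2), Finset.sum_range, LinearMap.sum_apply,
      Finset.sum_apply, Matrix.mulVec_sum]
    refine Finset.sum_congr rfl fun i _ => ?_
    rw [LinearMap.smul_apply, Pi.smul_apply, Matrix.mulVec_smul, Matrix.smul_mulVec, ← hg]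
    congr 1
    simp only [α]
    rw [← Polynomial.coeff_map, descPochhammer_map]
  refine ⟨D, fun i j => Matrix.of fun x y => ∑ l ∈ Finset.range (n + 1),
    (c (m - i) x y).coeff l * S l j, hIs, fun D' hD' => ?_, fun i j x y => ?_, fun i u x y => ?_⟩
  · exact hIs.unique exists_singular_generic hD'
  · refine IsLead.isLeading ?_
    refine IsLead.sum (s := Finset.range (n + 1)) (c := fun l => (c (m - i) x y).coeff l * S l j) fun l hl => ?_
    have h1 := (hrel i (by omega) x y).4 l (Nat.le_of_lt_succ (Finset.mem_range.1 hl))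
    rw [zero_mul, Nat.sub_zero] at h1
    exact h1.mul (IsLead.const (S l j))
  · rw [hc (m - i) u, Matrix.of_apply, hS' _ (hrel i (by omega) x y).2]
    rfl

end

/-! ### Residues, interpolation sums and matrices of operators -/

section

open Polynomial (C X)

/-! ### Residues -/

/-- The Laurent expansion of a polynomial at a point. -/
def laurentAt (x : ℂ) : Polynomial ℂ →+* LaurentSeries ℂ :=
  (HahnSeries.ofPowerSeries ℤ ℂ).comp
    (Polynomial.coeToPowerSeries.ringHom.comp (Polynomial.compRingHom (X + C x)))

lemma laurentAt_eq (x : ℂ) (p : Polynomial ℂ) : p.eval₂ (HahnSeries.C : ℂ →+* LaurentSeries ℂ)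
    (HahnSeries.C x + HahnSeries.single (1 : ℤ) (1 : ℂ)) = laurentAt x p := by
  refine RingHom.congr_fun (f := Polynomial.eval₂RingHom _ _) (g := laurentAt x) ?_ p
  refine Polynomial.ringHom_ext (fun a => ?_) ?_
  · simp [laurentAt, HahnSeries.ofPowerSeries_C]
  · simp [laurentAt, HahnSeries.ofPowerSeries_C, HahnSeries.ofPowerSeries_X, add_comm]

lemma laurentAt_apply (x : ℂ) (p : Polynomial ℂ) : laurentAt x p =
    HahnSeries.ofPowerSeries ℤ ℂ (Polynomial.taylor x p : Polynomial ℂ) := rfl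

lemma laurentAt_injective (x : ℂ) : Function.Injective (laurentAt x) := fun _ _ h =>
  Polynomial.taylor_injective x
    (Polynomial.coe_injective _ (HahnSeries.ofPowerSeries_injective h))

/-- In the local parameter `t` the function is `t⁻² N / R` with `R` invertible as a power series, so
the residue is the derivative of `N / R` at `x`. -/
lemma residueAt_eq {f : RatFunc ℂ} {N R : Polynomial ℂ} {x : ℂ} (hR : R.eval x ≠ 0)
    (hf : f * algebraMap _ _ ((X - C x) ^ 2 * R) = algebraMap _ _ N) :
    residueAt x f = (N.derivative.eval x * R.eval x - N.eval x * R.derivative.eval x) /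
      R.eval x ^ 2 := by
  have hnd : f.num * ((X - C x) ^ 2 * R) = N * f.denom := by
    have hd : algebraMap (Polynomial ℂ) (RatFunc ℂ) f.denom ≠ 0 :=
      RatFunc.algebraMap_ne_zero f.denom_ne_zero
    refine RatFunc.algebraMap_injective ℂ ?_
    rw [map_mul, map_mul _ N, ← hf]
    nth_rw 2 [← RatFunc.num_div_denom f]
    field_simp
  have hd : laurentAt x f.denom ≠ 0 := fun h =>
    f.denom_ne_zero (laurentAt_injective x (h.trans (map_zero _).symm))
  have h1 := congrArg (laurentAt x) hnd
  have ht : laurentAt x (X - C x) = HahnSeries.single (1 : ℤ) (1 : ℂ) := by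
    simp [laurentAt, HahnSeries.ofPowerSeries_X]
  rw [map_mul, map_mul, map_pow, ht, map_mul] at h1
  set n := (Polynomial.taylor x N : PowerSeries ℂ) with hn
  set r := (Polynomial.taylor x R : PowerSeries ℂ) with hr
  have hr0 : PowerSeries.coeff 0 r = R.eval x := by
    rw [hr, Polynomial.coeff_coe, Polynomial.taylor_coeff_zero]
  have hr1 : PowerSeries.coeff 1 r = R.derivative.eval x := by
    rw [hr, Polynomial.coeff_coe, Polynomial.taylor_coeff_one]
  have hn0 : PowerSeries.coeff 0 n = N.eval x := by
    rw [hn, Polynomial.coeff_coe, Polynomial.taylor_coeff_zero]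
  have hn1 : PowerSeries.coeff 1 n = N.derivative.eval x := by
    rw [hn, Polynomial.coeff_coe, Polynomial.taylor_coeff_one]
  have hrc : PowerSeries.constantCoeff r ≠ 0 := by
    rwa [← PowerSeries.coeff_zero_eq_constantCoeff_apply, hr0]
  have hG : (n * r⁻¹) * r = n := by rw [mul_assoc, PowerSeries.inv_mul_cancel _ hrc, mul_one]
  set G := n * r⁻¹ with hGdef
  have hres : RatFunc.eval (HahnSeries.C : ℂ →+* LaurentSeries ℂ)
      (HahnSeries.C x + HahnSeries.single (1 : ℤ) (1 : ℂ)) f =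
      HahnSeries.single (-2 : ℤ) (1 : ℂ) * HahnSeries.ofPowerSeries ℤ ℂ G := by
    rw [RatFunc.eval, laurentAt_eq, laurentAt_eq, div_eq_iff hd]
    have hrL : laurentAt x R = HahnSeries.ofPowerSeries ℤ ℂ r := laurentAt_apply x R
    have hnL : laurentAt x N = HahnSeries.ofPowerSeries ℤ ℂ G * HahnSeries.ofPowerSeries ℤ ℂ r := by
      rw [← map_mul, hG]
      rfl
    have hrne : HahnSeries.ofPowerSeries ℤ ℂ r ≠ 0 := fun h => by
      have := HahnSeries.ofPowerSeries_injective (h.trans (map_zero _).symm)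
      rw [this] at hrc
      simp at hrc
    have htt : HahnSeries.single (-2 : ℤ) (1 : ℂ) * HahnSeries.single (1 : ℤ) (1 : ℂ) ^ 2 = 1 := by
      rw [sq, HahnSeries.single_mul_single, HahnSeries.single_mul_single]
      norm_num
    rw [hrL, hnL] at h1
    refine mul_right_cancel₀ hrne ?_
    calc laurentAt x f.num * HahnSeries.ofPowerSeries ℤ ℂ r
        = HahnSeries.single (-2 : ℤ) (1 : ℂ) * (laurentAt x f.num *
          (HahnSeries.single (1 : ℤ) (1 : ℂ) ^ 2 * HahnSeries.ofPowerSeries ℤ ℂ r)) := by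
          rw [mul_left_comm (laurentAt x f.num), ← mul_assoc (HahnSeries.single (-2 : ℤ) (1 : ℂ)),
            htt, one_mul]
      _ = _ := by rw [h1]; ring
  clear_value G
  have e0 : PowerSeries.coeff 0 G * R.eval x = N.eval x := by
    rw [← hr0, ← hn0, ← hG]
    simp
  have e1 : PowerSeries.coeff 0 G * R.derivative.eval x + PowerSeries.coeff 1 G * R.eval x =
      N.derivative.eval x := by
    have := PowerSeries.coeff_mul 1 G r
    rw [Finset.Nat.sum_antidiagonal_eq_sum_range_succ_mk] at this
    rw [← hr0, ← hr1, ← hn1, ← hG, this]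
    simp [Finset.sum_range_succ]
  have e2 : residueAt x f = PowerSeries.coeff 1 G := by
    rw [residueAt, hres]
    have := HahnSeries.coeff_single_mul_add (r := (1 : ℂ)) (x := HahnSeries.ofPowerSeries ℤ ℂ G)
      (a := (1 : ℤ)) (b := -2)
    rw [one_mul] at this
    norm_num at this
    rw [this]
    exact HahnSeries.ofPowerSeries_apply_coeff (Γ := ℤ) G 1
  rw [e2, eq_div_iff (pow_ne_zero 2 hR), ← e0, ← e1]
  ring

section

variable {m n : ℕ}

/-- The numerator of `leadSeries`. -/
def leadNum (n : ℕ) {T : Type} (c : Fin (m + 1) → Fin (n + 1) → Matrix T T ℂ) (k : ℕ) (x y : T) :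
    Polynomial ℂ :=
  ∑ i : Fin (m + 1), ∑ j : Fin (n + 1),
    C ((descPochhammer ℂ j).coeff (n - k) * c i j x y) * X ^ (i : ℕ)

lemma leadSeries_apply {T : Type} (ξ : Fin m → ℂ) (c : Fin (m + 1) → Fin (n + 1) → Matrix T T ℂ)
    {k : ℕ} (hk : k ≤ n) (x y : T) : leadSeries n ξ c k x y * algebraMap _ _ (∏ l, (X - C (ξ l))) =
      algebraMap _ _ (leadNum n c k x y) := by
  have h : algebraMap (Polynomial ℂ) (RatFunc ℂ) (∏ l, (X - C (ξ l))) =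
      ∏ l, (RatFunc.X - RatFunc.C (ξ l)) := by simp [map_prod, RatFunc.algebraMap_X, RatFunc.algebraMap_C]
  have h0 : algebraMap (Polynomial ℂ) (RatFunc ℂ) (∏ l, (X - C (ξ l))) ≠ 0 :=
    RatFunc.algebraMap_ne_zero (Finset.prod_ne_zero_iff.2 fun _ _ => Polynomial.X_sub_C_ne_zero _)
  rw [leadSeries, if_pos hk, Matrix.of_apply, ← h, div_mul_cancel₀ _ h0]
  simp [leadNum, map_sum, RatFunc.algebraMap_X, RatFunc.algebraMap_C]

/-- The value of `∏_{l ≠ i} (u - ξ_l)` at `u = ξ_i`. -/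
def simpleDeriv (ξ : Fin m → ℂ) (i : Fin m) : ℂ := ∏ l ∈ Finset.univ.erase i, (ξ i - ξ l)

lemma simpleDeriv_ne_zero {ξ : Fin m → ℂ} (hξ : Function.Injective ξ) (i : Fin m) :
    simpleDeriv ξ i ≠ 0 :=
  Finset.prod_ne_zero_iff.2 fun _ hl => sub_ne_zero.2 fun h => Finset.ne_of_mem_erase hl (hξ h).symm

/-- Half the square of `-(A + ∑ β_s / (u - ξ_s))` has at `ξ_i` a double pole without residue, and
the cross terms give `β_i` times the regular part of the sum. The factor `δ` will be an entry of the
identity matrix, which treats diagonal and off-diagonal entries together. -/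
lemma residueAt_half_sq_sub {ξ : Fin m → ℂ} (hξ : Function.Injective ξ) (A : ℂ) (β : Fin m → ℂ)
    (i : Fin m) {f g : RatFunc ℂ} {p : Polynomial ℂ}
    (hf : f * algebraMap _ _ (∏ l, (X - C (ξ l))) = algebraMap _ _ (-(C A * ∏ l, (X - C (ξ l)) +
      ∑ s, C (β s) * ∏ l ∈ Finset.univ.erase s, (X - C (ξ l)))))
    (hg : g * algebraMap _ _ (∏ l, (X - C (ξ l))) = algebraMap _ _ p) (δ : ℂ) :
    residueAt (ξ i) (RatFunc.C (δ / 2) * f ^ 2 - g) =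
      δ * (β i * (A + ∑ s ∈ Finset.univ.erase i, β s / (ξ i - ξ s))) -
        p.eval (ξ i) / simpleDeriv ξ i := by
  set P := ∏ l, (X - C (ξ l)) with hP
  set Q := ∏ l ∈ Finset.univ.erase i, (X - C (ξ l)) with hQ
  set q := -(C A * P + ∑ s, C (β s) * ∏ l ∈ Finset.univ.erase s, (X - C (ξ l))) with hq
  have hPQ : P = (X - C (ξ i)) * Q := (Finset.mul_prod_erase _ _ (Finset.mem_univ i)).symm
  have hQi : Q.eval (ξ i) = simpleDeriv ξ i := by
    simp [hQ, Polynomial.eval_prod, simpleDeriv]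
  have hQ0 : Q.eval (ξ i) ≠ 0 := hQi ▸ simpleDeriv_ne_zero hξ i
  have hN : (RatFunc.C (δ / 2) * f ^ 2 - g) * algebraMap _ _ ((X - C (ξ i)) ^ 2 * Q ^ 2) =
      algebraMap _ _ (C (δ / 2) * q ^ 2 - p * P) := by
    rw [← mul_pow, ← hPQ, map_sub, map_mul, map_mul, map_pow, map_pow, ← hf, ← hg,
      RatFunc.algebraMap_C]
    ring
  rw [residueAt_eq (by rw [Polynomial.eval_pow]; exact pow_ne_zero 2 hQ0) hN]
  have hfac (s : Fin m) (hs : s ∈ Finset.univ.erase i) :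
      ∏ l ∈ Finset.univ.erase s, (X - C (ξ l)) =
        (X - C (ξ i)) * ∏ l ∈ (Finset.univ.erase i).erase s, (X - C (ξ l)) := by
    rw [Finset.erase_right_comm, Finset.mul_prod_erase (Finset.univ.erase s) fun l => X - C (ξ l)]
    exact Finset.mem_erase.2 ⟨(Finset.ne_of_mem_erase hs).symm, Finset.mem_univ _⟩
  have hq' : q = -(C A * P + C (β i) * Q + (X - C (ξ i)) * ∑ s ∈ Finset.univ.erase i,
      C (β s) * ∏ l ∈ (Finset.univ.erase i).erase s, (X - C (ξ l))) := by
    rw [hq, ← Finset.add_sum_erase _ _ (Finset.mem_univ i), Finset.mul_sum, add_assoc, hQ]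
    congr 3
    refine Finset.sum_congr rfl fun s hs => ?_
    rw [hfac s hs]
    ring
  have hR (s : Fin m) (hs : s ∈ Finset.univ.erase i) :
      (∏ l ∈ (Finset.univ.erase i).erase s, (X - C (ξ l))).eval (ξ i) =
        Q.eval (ξ i) / (ξ i - ξ s) := by
    have h0 : ξ i - ξ s ≠ 0 := sub_ne_zero.2 fun h => Finset.ne_of_mem_erase hs (hξ h).symm
    rw [eq_div_iff h0, hQ, ← Finset.mul_prod_erase _ _ hs]
    simp [mul_comm]
  have hS : (∑ s ∈ Finset.univ.erase i, C (β s) *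
      ∏ l ∈ (Finset.univ.erase i).erase s, (X - C (ξ l))).eval (ξ i) =
      Q.eval (ξ i) * ∑ s ∈ Finset.univ.erase i, β s / (ξ i - ξ s) := by
    rw [Polynomial.eval_finsetSum, Finset.mul_sum]
    refine Finset.sum_congr rfl fun s hs => ?_
    rw [Polynomial.eval_mul, Polynomial.eval_C, hR s hs]
    ring
  have hq0 : q.eval (ξ i) = -(β i * Q.eval (ξ i)) := by
    rw [hq', hPQ]
    simp
  have hq1 : q.derivative.eval (ξ i) = -(A * Q.eval (ξ i) + β i * Q.derivative.eval (ξ i) +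
      Q.eval (ξ i) * ∑ s ∈ Finset.univ.erase i, β s / (ξ i - ξ s)) := by
    rw [hq', hPQ, ← hS]
    simp only [Polynomial.derivative_neg, Polynomial.derivative_add, Polynomial.derivative_mul,
      Polynomial.derivative_C, Polynomial.derivative_sub, Polynomial.derivative_X,
      Polynomial.eval_neg, Polynomial.eval_add, Polynomial.eval_mul, Polynomial.eval_sub,
      Polynomial.eval_X, Polynomial.eval_C, Polynomial.eval_one, Polynomial.eval_zero]
    ring
  have hP0 : P.eval (ξ i) = 0 := by rw [hPQ]; simp
  have hP1 : P.derivative.eval (ξ i) = Q.eval (ξ i) := by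
    rw [hPQ]
    simp
  simp only [Polynomial.derivative_sub, Polynomial.derivative_mul, Polynomial.derivative_C,
    Polynomial.derivative_pow, Polynomial.eval_sub, Polynomial.eval_add, Polynomial.eval_mul,
    Polynomial.eval_pow, Polynomial.eval_C, hq0, hq1, hP0, hP1, ← hQi]
  generalize Q.eval (ξ i) = Q0 at hQ0 ⊢
  generalize (∑ s ∈ Finset.univ.erase i, β s / (ξ i - ξ s)) = S
  simp
  field_simp
  ring

/-- The residues of the leading series in terms of the numerators of its first two coefficients. -/
lemma residueExpr_eq {T : Type} [Fintype T] [DecidableEq T] {ξ : Fin m → ℂ}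
    (hξ0 : ∀ i, ξ i ≠ 0) (hξ : Function.Injective ξ) (hn : 0 < n) (b : Fin m → ℕ) (A : ℂ)
    (c : Fin (m + 1) → Fin (n + 1) → Matrix T T ℂ)
    (h1 : ∀ x y u, (leadNum n c 1 x y).eval u = (1 : Matrix T T ℂ) x y *
      -(A * ∏ l, (u - ξ l) + ∑ s, b s * ξ s * ∏ l ∈ Finset.univ.erase s, (u - ξ l)))
    (i : Fin m) (T₂ : Matrix T T ℂ) (h2 : 2 ≤ n → ∀ x y, (leadNum n c 2 x y).eval (ξ i) =
      ξ i * simpleDeriv ξ i * T₂ x y) (h2' : n = 1 → T₂ = 0) :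
    residueExpr n ξ b c i =
      ((b i : ℂ) * (A + ∑ s ∈ Finset.univ.erase i, b s * (ξ s / (ξ i - ξ s))) - (b i : ℂ) ^ 2 / 2) •
        (1 : Matrix T T ℂ) - T₂ := by
  set P := ∏ l, (X - C (ξ l)) with hP
  have hP0 : algebraMap (Polynomial ℂ) (RatFunc ℂ) P ≠ 0 :=
    RatFunc.algebraMap_ne_zero (Finset.prod_ne_zero_iff.2 fun _ _ => Polynomial.X_sub_C_ne_zero _)
  set q : Polynomial ℂ := -(C A * P +
    ∑ s, C ((b s : ℂ) * ξ s) * ∏ l ∈ Finset.univ.erase s, (X - C (ξ l))) with hq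
  set f : RatFunc ℂ := algebraMap _ _ q / algebraMap _ _ P with hf
  have hfP : f * algebraMap _ _ P = algebraMap _ _ q := div_mul_cancel₀ _ hP0
  have hL1 : leadSeries n ξ c 1 = f • (1 : Matrix T T (RatFunc ℂ)) := by
    ext x y
    refine mul_right_cancel₀ hP0 ?_
    rw [leadSeries_apply ξ c hn, Matrix.smul_apply, smul_eq_mul, mul_right_comm, hfP]
    have : leadNum n c 1 x y = q * C ((1 : Matrix T T ℂ) x y) := by
      refine Polynomial.funext fun u => ?_
      rw [h1, hq]
      simp [Polynomial.eval_finsetSum, Polynomial.eval_prod, hP]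
      ring
    rw [this, map_mul]
    congr 1
    by_cases h : x = y
    · subst h; simp
    · simp [Matrix.one_apply_ne h]
  obtain ⟨p, hp, hpi⟩ : ∃ p : T → T → Polynomial ℂ,
      (∀ x y, leadSeries n ξ c 2 x y * algebraMap _ _ P = algebraMap _ _ (p x y)) ∧
      ∀ x y, (p x y).eval (ξ i) = ξ i * simpleDeriv ξ i * T₂ x y := by
    by_cases hn2 : 2 ≤ n
    · exact ⟨leadNum n c 2, leadSeries_apply ξ c hn2, h2 hn2⟩
    · refine ⟨0, fun x y => ?_, fun x y => ?_⟩
      · simp [leadSeries, hn2]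
      · rw [h2' (by omega)]
        simp
  ext x y
  have hδ : (RatFunc.C (1 / 2 : ℂ) • leadSeries n ξ c 1 ^ 2 - leadSeries n ξ c 2) x y =
      RatFunc.C ((1 : Matrix T T ℂ) x y / 2) * f ^ 2 - leadSeries n ξ c 2 x y := by
    rw [Matrix.sub_apply, hL1, smul_pow, one_pow, smul_smul, Matrix.smul_apply, smul_eq_mul]
    by_cases h : x = y
    · subst h; simp
    · simp [Matrix.one_apply_ne h]
  have hs := simpleDeriv_ne_zero hξ i
  rw [residueExpr, Matrix.sub_apply, Matrix.smul_apply, Matrix.map_apply, hδ,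
    residueAt_half_sq_sub hξ A _ i hfP (hp x y), hpi, Matrix.sub_apply, Matrix.smul_apply,
    Matrix.smul_apply, smul_eq_mul, smul_eq_mul, smul_eq_mul]
  have h3 : (∑ s ∈ Finset.univ.erase i, (b s : ℂ) * ξ s / (ξ i - ξ s)) =
    ∑ s ∈ Finset.univ.erase i, b s * (ξ s / (ξ i - ξ s)) :=
      Finset.sum_congr rfl fun s _ => mul_div_assoc _ _ _
  rw [h3]
  have := hξ0 i
  field_simp
  ring

end

end

section

open Polynomial (C X)

/-! ### Sums over sublists -/

section PairSum

variable {ι A : Type*}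

/-- The sum of `f s t` over the pairs of entries `s`, `t` of a list such that `s` precedes `t`. -/
def pairSum [AddCommMonoid A] (f : ι → ι → A) : List ι → A
  | [] => 0
  | s :: S => (S.map (f s)).sum + pairSum f S

lemma sum_sublistsLen_zero [AddCommMonoid A] (V : List ι → A) (l : List ι) :
    ((List.sublistsLen 0 l).map V).sum = V [] := by simp

lemma sum_sublistsLen_one [AddCommMonoid A] (V : List ι → A) (l : List ι) :
    ((List.sublistsLen 1 l).map V).sum = (l.map fun j => V [j]).sum := by
  induction l with
  | nil => simp
  | cons j l ih =>
    rw [List.sublistsLen_succ_cons, List.map_append, List.sum_append, ih]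
    simp [add_comm]

lemma sum_sublistsLen_two [AddCommMonoid A] (V : List ι → A) (l : List ι) :
    ((List.sublistsLen 2 l).map V).sum = pairSum (fun j k => V [j, k]) l := by
  induction l with
  | nil => simp [pairSum]
  | cons j l ih =>
    rw [List.sublistsLen_succ_cons, List.map_append, List.sum_append, ih, List.map_map,
      sum_sublistsLen_one, pairSum, add_comm]
    rfl

lemma pairSum_eq [AddCommMonoid A] [LinearOrder ι] (f : ι → ι → A) {l : List ι}
    (hl : l.Pairwise (· < ·)) :
    pairSum f l = ∑ j ∈ l.toFinset, ∑ k ∈ l.toFinset.filter (fun k => j < k), f j k := by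
  induction l with
  | nil => simp [pairSum]
  | cons j l ih =>
    rw [List.pairwise_cons] at hl
    have hj : j ∉ l.toFinset := fun h => lt_irrefl _ (hl.1 j (List.mem_toFinset.1 h))
    have hnd : l.Nodup := hl.2.imp ne_of_lt
    rw [pairSum, ih hl.2, List.toFinset_cons, Finset.sum_insert hj, ← List.sum_toFinset _ hnd]
    congr 1
    · rw [Finset.filter_insert, if_neg (lt_irrefl j), Finset.filter_true_of_mem]
      exact fun k hk => hl.1 k (List.mem_toFinset.1 hk)
    · refine Finset.sum_congr rfl fun i hi => ?_
      rw [Finset.filter_insert, if_neg (lt_asymm (hl.1 i (List.mem_toFinset.1 hi)))]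

lemma pairSum_finRange [AddCommMonoid A] {n : ℕ} (f : Fin n → Fin n → A) :
    pairSum f (List.finRange n) =
      ∑ j, ∑ k ∈ Finset.univ.filter (fun k => j < k), f j k := by
  rw [pairSum_eq f (List.pairwise_lt_finRange n), List.toFinset_finRange]

lemma sum_sum_eq_diag_add [AddCommMonoid A] {n : ℕ} (f : Fin n → Fin n → A) :
    ∑ j, ∑ k, f j k = ∑ j, f j j +
      ∑ j, ∑ k ∈ Finset.univ.filter (fun k => j < k), (f j k + f k j) := by
  have h (j : Fin n) : ∑ k, f j k = f j j + ((∑ k ∈ Finset.univ.filter (fun k => j < k), f j k) +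
      ∑ k ∈ Finset.univ.filter (fun k => k < j), f j k) := by
    rw [← Finset.add_sum_erase _ _ (Finset.mem_univ j),
      ← Finset.sum_filter_add_sum_filter_not (Finset.univ.erase j) (fun k => j < k)]
    congr 2 <;> refine Finset.sum_congr ?_ fun _ _ => rfl
    · ext k
      simp only [Finset.mem_filter, Finset.mem_erase, Finset.mem_univ, and_true, true_and]
      exact ⟨fun h => h.2, fun h => ⟨h.ne', h⟩⟩
    · ext k
      simp only [Finset.mem_filter, Finset.mem_erase, Finset.mem_univ, and_true, true_and, not_lt]
      exact ⟨fun h => lt_of_le_of_ne h.2 h.1, fun h => ⟨h.ne, h.le⟩⟩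
  rw [Finset.sum_congr rfl fun j _ => h j, Finset.sum_add_distrib, Finset.sum_add_distrib]
  simp only [Finset.sum_add_distrib]
  congr 2
  simp only [Finset.sum_filter]
  rw [Finset.sum_comm]

end PairSum

/-! ### Matrices of operators -/

section

variable {M N : ℕ} (b : Fin M → ℕ) (a : Fin N → ℕ)

/-- The matrix of an operator, as a linear map. -/
def opMatrixLin : Module.End ℂ (Fock ℂ M N) →ₗ[ℂ] Matrix (Table b a) (Table b a) ℂ where
  toFun := opMatrix b a
  map_add' := opMatrix_add b a
  map_smul' := opMatrix_smul b a

lemma opMatrixLin_apply (A : Module.End ℂ (Fock ℂ M N)) : opMatrixLin b a A = opMatrix b a A := rfl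

/-- The right factor acts first, on the basis of the weight subspace. This is why number and Cartan
operators are moved to the right in the formulas for the Hamiltonians. -/
lemma opMatrixLin_mul_of_eigen {A B : Module.End ℂ (Fock ℂ M N)} {c : ℂ}
    (h : ∀ x : Table b a → ℂ, B (toFock x) = c • toFock x) :
    opMatrixLin b a (A * B) = c • opMatrixLin b a A := by
  classical
  ext x y
  have h1 := h (Pi.single y 1)
  rw [toFock_single] at h1
  simp [opMatrixLin_apply, opMatrix, h1]

lemma opMatrixLin_one [DecidableEq (Table b a)] : opMatrixLin b a 1 = 1 := by
  ext x y
  rw [opMatrixLin_apply, opMatrix, Matrix.of_apply, Module.End.one_apply,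
    MvPolynomial.coeff_monomial, Matrix.one_apply]
  refine if_congr ⟨fun h => ?_, fun h => by rw [h]⟩ rfl rfl
  exact (Subtype.ext (expo_injective h)).symm

lemma opMatrixLin_mul_diagOp (A : Module.End ℂ (Fock ℂ M N)) (i : Fin N) :
    opMatrixLin b a (A * diagOp ℂ i i) = (a i : ℂ) • opMatrixLin b a A :=
  opMatrixLin_mul_of_eigen b a fun x => by simpa using (isTab_toFock x).2 i

lemma opMatrixLin_mul_rowOp (A : Module.End ℂ (Fock ℂ M N)) (s : Fin M) :
    opMatrixLin b a (A * rowOp ℂ N s) = (b s : ℂ) • opMatrixLin b a A :=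
  opMatrixLin_mul_of_eigen b a fun x => (isTab_toFock x).1 s

end

/-! ### The coefficients of the falling factorials -/

lemma coeff_descPochhammer_self (n : ℕ) : (descPochhammer ℂ n).coeff n = 1 := by
  have := (monic_descPochhammer ℂ n).coeff_natDegree
  rwa [descPochhammer_natDegree] at this

lemma coeff_descPochhammer_of_lt {k n : ℕ} (h : k < n) : (descPochhammer ℂ k).coeff n = 0 :=
  Polynomial.coeff_eq_zero_of_natDegree_lt (by rwa [descPochhammer_natDegree])

lemma coeff_descPochhammer_succ (n : ℕ) :
    (descPochhammer ℂ (n + 1)).coeff n = -(n * (n + 1) / 2) := by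
  induction n with
  | zero => simp
  | succ n ih =>
    rw [descPochhammer_succ_right, mul_sub, Polynomial.coeff_sub, Polynomial.coeff_mul_X, ih,
      ← Polynomial.C_eq_natCast, Polynomial.coeff_mul_C, coeff_descPochhammer_self]
    push_cast
    ring

section

variable {m n : ℕ} {ι : Type*}

/-! ### Interpolation sums -/

variable {A : Type*} [AddCommGroup A] [Module ℂ A]

/-- The sum of `∏_{l ≠ s} (u - ξ_l) X_s` over the entries `s` of a list. -/
def lagrangeSum (ξ : ι → ℂ) (u : ℂ) : List ι → (ι → A) → A
  | [], _ => 0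
  | s :: S, Y => (u - ξ s) • lagrangeSum ξ u S Y + (S.map fun l => u - ξ l).prod • Y s

/-- The sum of `∏_{l ≠ s, t} (u - ξ_l) Y_{s t}` over the pairs of entries `s`, `t` of a list. -/
def lagrangePairSum (ξ : ι → ℂ) (u : ℂ) : List ι → (ι → ι → A) → A
  | [], _ => 0
  | s :: S, Y => (u - ξ s) • lagrangePairSum ξ u S Y + lagrangeSum ξ u S (Y s)

lemma lagrangeSum_add (ξ : ι → ℂ) (u : ℂ) (S : List ι) (Y Z : ι → A) :
    lagrangeSum ξ u S (fun s => Y s + Z s) = lagrangeSum ξ u S Y + lagrangeSum ξ u S Z := by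
  induction S with
  | nil => simp [lagrangeSum]
  | cons s S ih => simp only [lagrangeSum, ih]; module

lemma map_lagrangeSum {B : Type*} [AddCommGroup B] [Module ℂ B] (g : A →ₗ[ℂ] B) (ξ : ι → ℂ) (u : ℂ)
    (S : List ι) (Y : ι → A) : g (lagrangeSum ξ u S Y) = lagrangeSum ξ u S fun s => g (Y s) := by
  induction S with
  | nil => simp [lagrangeSum]
  | cons s S ih => simp [lagrangeSum, ih]

variable [DecidableEq ι]

lemma prod_map_eq (ξ : ι → ℂ) (u : ℂ) {S : List ι} (hS : S.Nodup) :
    (S.map fun l => u - ξ l).prod = ∏ l ∈ S.toFinset, (u - ξ l) :=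
  (List.prod_toFinset _ hS).symm

lemma lagrangeSum_eq (ξ : ι → ℂ) (u : ℂ) {S : List ι} (hS : S.Nodup) (Y : ι → A) :
    lagrangeSum ξ u S Y = ∑ s ∈ S.toFinset, (∏ l ∈ S.toFinset.erase s, (u - ξ l)) • Y s := by
  induction S with
  | nil => simp [lagrangeSum]
  | cons s S ih =>
    rw [List.nodup_cons] at hS
    have hs : s ∉ S.toFinset := fun h => hS.1 (List.mem_toFinset.1 h)
    rw [lagrangeSum, ih hS.2, List.toFinset_cons, Finset.sum_insert hs, Finset.erase_insert hs,
      prod_map_eq ξ u hS.2, add_comm, Finset.smul_sum]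
    congr 1
    refine Finset.sum_congr rfl fun t ht => ?_
    have hst : s ≠ t := fun h => hs (h ▸ ht)
    rw [Finset.erase_insert_of_ne hst, Finset.prod_insert (fun h => hs (Finset.mem_of_mem_erase h)),
      smul_smul]

/-- At `u = ξ_i` a pair not containing `i` retains the factor `u - ξ_i` and vanishes. Symmetry of
`Y` makes it irrelevant on which side of the pair `i` stands. -/
lemma lagrangePairSum_eq {ξ : ι → ℂ} (hξ : Function.Injective ξ) {S : List ι} (hS : S.Nodup)
    {Y : ι → ι → A} (hY : ∀ s t, s ≠ t → Y s t = Y t s) {i : ι} (hi : i ∈ S) :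
    lagrangePairSum ξ (ξ i) S Y = (∏ l ∈ S.toFinset.erase i, (ξ i - ξ l)) •
      ∑ t ∈ S.toFinset.erase i, (ξ i - ξ t)⁻¹ • Y i t := by
  induction S with
  | nil => simp at hi
  | cons s S ih =>
    rw [List.nodup_cons] at hS
    have hs : s ∉ S.toFinset := fun h => hS.1 (List.mem_toFinset.1 h)
    have hne {t : ι} (h : i ≠ t) : ξ i - ξ t ≠ 0 := sub_ne_zero.2 fun h' => h (hξ h')
    rw [lagrangePairSum, lagrangeSum_eq ξ _ hS.2, List.toFinset_cons]
    by_cases his : i = s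
    · subst his
      rw [sub_self, zero_smul, zero_add, Finset.erase_insert hs, Finset.smul_sum]
      refine Finset.sum_congr rfl fun t ht => ?_
      rw [smul_smul, ← Finset.mul_prod_erase _ _ ht,
        mul_right_comm, mul_inv_cancel₀ (hne fun h => hs (h ▸ ht)), one_mul]
    · have hi' : i ∈ S := (List.mem_cons.1 hi).resolve_left his
      have hs' : s ∉ S.toFinset.erase i := fun h => hs (Finset.mem_of_mem_erase h)
      rw [ih hS.2 hi', Finset.erase_insert_of_ne (Ne.symm his), Finset.prod_insert hs',
        Finset.sum_insert hs', Finset.sum_eq_single_of_mem i (List.mem_toFinset.2 hi') ?_,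
        hY s i (Ne.symm his), smul_add, smul_smul, smul_smul, mul_right_comm,
        mul_inv_cancel₀ (hne his), one_mul, add_comm]
      intro t _ ht
      rw [Finset.prod_eq_zero (Finset.mem_erase.2 ⟨ht.symm, List.mem_toFinset.2 hi'⟩) (sub_self _),
        zero_smul]

end

end

/-! ### First kind of coefficients and the Gaudin Hamiltonians -/

section

open Polynomial (C X)

/-! ### The leading terms for the first kind of coefficients -/

section

variable {m n : ℕ} {ξ : Fin m → ℂ}
  {B : List (Fin n) → List (Fin n) → Module.End ℂ (Fock ℂ m n)}

lemma leadNum_eval {T : Type} (c : Fin (m + 1) → Fin (n + 1) → Matrix T T ℂ) (k : ℕ) (x y : T)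
    (u : ℂ) : (leadNum n c k x y).eval u = ∑ j : Fin (n + 1), (descPochhammer ℂ j).coeff (n - k) *
      ∑ i : Fin (m + 1), c i j x y * u ^ (i : ℕ) := by
  rw [leadNum, Polynomial.eval_finsetSum, Finset.sum_congr rfl fun i _ =>
    Polynomial.eval_finsetSum _ _ _, Finset.sum_comm]
  refine Finset.sum_congr rfl fun j _ => ?_
  rw [Finset.mul_sum]
  refine Finset.sum_congr rfl fun i _ => ?_
  simp [mul_assoc]

/-- The quadratic term of two sites in a principal minor of order two. -/
def minorPair (j k : Fin n) (s t : Fin m) : Module.End ℂ (Fock ℂ m n) :=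
  siteOp ℂ s j j * siteOp ℂ t k k - siteOp ℂ s j k * siteOp ℂ t k j -
    siteOp ℂ s k j * siteOp ℂ t j k + siteOp ℂ s k k * siteOp ℂ t j j

lemma minorPair_comm (j k : Fin n) {s t : Fin m} (h : s ≠ t) :
    minorPair j k s t = minorPair j k t s := by
  rw [minorPair, minorPair, (siteOp_comm_of_ne h j j k k).eq, (siteOp_comm_of_ne h j k k j).eq,
    (siteOp_comm_of_ne h k j j k).eq, (siteOp_comm_of_ne h k k j j).eq]
  abel

lemma coefLeadC_nil (hB : B [] [] = 1) (S : List (Fin m)) (u : ℂ) :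
    coefLeadC ξ B S u [] [] = (S.map fun l => u - ξ l).prod • 1 := by
  induction S with
  | nil => simp [coefLeadC, hB]
  | cons s S ih => simp [coefLeadC, ih, smul_smul]

lemma coefLeadC_single (hB : B [] [] = 1) (S : List (Fin m)) (u : ℂ) (i j : Fin n) :
    coefLeadC ξ B S u [i] [j] = (S.map fun l => u - ξ l).prod • B [i] [j] +
      u • lagrangeSum ξ u S fun s => siteOp ℂ s i j := by
  induction S with
  | nil => simp [coefLeadC, lagrangeSum]
  | cons s S ih =>
    simp only [coefLeadC, ih, altSum_cons, altSum_nil, sub_zero, lagrangeSum, coefLeadC_nil hB,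
      List.map_cons, List.prod_cons, mul_smul_comm, mul_one]
    module

/-- Every site that acts deletes one row and one column, so at most two sites act. The three terms
correspond to zero, one or two acting sites, and the rest of the minor is left to the Verma part on
the right. -/
lemma coefLeadC_pair (hB : B [] [] = 1) (S : List (Fin m)) (u : ℂ) (j k : Fin n) :
    coefLeadC ξ B S u [j, k] [j, k] = (S.map fun l => u - ξ l).prod • B [j, k] [j, k] +
      u • lagrangeSum ξ u S (fun s => siteOp ℂ s j j * B [k] [k] - siteOp ℂ s j k * B [k] [j] -
        siteOp ℂ s k j * B [j] [k] + siteOp ℂ s k k * B [j] [j]) +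
      u ^ 2 • lagrangePairSum ξ u S (minorPair j k) := by
  induction S with
  | nil => simp [coefLeadC, lagrangeSum, lagrangePairSum]
  | cons s S ih =>
    have h (T T' : Module.End ℂ (Fock ℂ m n)) (Y : Fin m → Module.End ℂ (Fock ℂ m n)) :
        T * lagrangeSum ξ u S Y = lagrangeSum ξ u S fun t => T * Y t :=
      map_lagrangeSum (LinearMap.mulLeft ℂ T) ξ u S Y
    have h1 : lagrangeSum ξ u S (minorPair j k s) =
        siteOp ℂ s j j * lagrangeSum ξ u S (fun t => siteOp ℂ t k k) -
        siteOp ℂ s j k * lagrangeSum ξ u S (fun t => siteOp ℂ t k j) -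
        siteOp ℂ s k j * lagrangeSum ξ u S (fun t => siteOp ℂ t j k) +
        siteOp ℂ s k k * lagrangeSum ξ u S (fun t => siteOp ℂ t j j) := by
      have e : minorPair j k s = fun t => (siteOp ℂ s j j * siteOp ℂ t k k +
          (-1 : ℂ) • (siteOp ℂ s j k * siteOp ℂ t k j)) +
          ((-1 : ℂ) • (siteOp ℂ s k j * siteOp ℂ t j k) + siteOp ℂ s k k * siteOp ℂ t j j) := by
        funext t
        rw [minorPair]
        module
      have hs (Y : Fin m → Module.End ℂ (Fock ℂ m n)) : lagrangeSum ξ u S (fun t => (-1 : ℂ) • Y t) =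
          (-1 : ℂ) • lagrangeSum ξ u S Y :=
        (map_lagrangeSum (LinearMap.lsmul ℂ _ (-1 : ℂ)) ξ u S Y).symm
      rw [e, lagrangeSum_add, lagrangeSum_add, lagrangeSum_add, hs, hs, h _ 0, h _ 0, h _ 0, h _ 0]
      module
    simp only [coefLeadC, ih, altSum_cons, altSum_nil, sub_zero, lagrangeSum, lagrangePairSum,
      coefLeadC_single hB, List.map_cons, List.prod_cons, mul_smul_comm, mul_add, h1]
    module

lemma leadOpC_zero (hB : B [] [] = 1) (u : ℂ) : leadOpC ξ B u 0 = (∏ l, (u - ξ l)) • 1 := by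
  rw [leadOpC, betheLead, sum_sublistsLen_zero, coefLeadC_nil hB,
    prod_map_eq ξ u (List.nodup_finRange m), List.toFinset_finRange, pow_zero, one_smul]

/-- Summed over the diagonal, the generators of a site add up to its number operator. This is what
makes the first coefficient a scalar on the weight subspace. -/
lemma leadOpC_one (hB : B [] [] = 1) {μ : Fin n → ℂ}
    (hB1 : ∀ i j, B [i] [j] = minorOp m μ i j) (u : ℂ) :
    leadOpC ξ B u 1 = (-1 : ℂ) • (((∏ l, (u - ξ l)) * ∑ j, μ j) • 1 +
      u • ∑ s, (∏ l ∈ Finset.univ.erase s, (u - ξ l)) • rowOp ℂ n s) := by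
  rw [leadOpC, betheLead, sum_sublistsLen_one, pow_one, ← List.sum_toFinset _ (List.nodup_finRange n),
    List.toFinset_finRange]
  congr 1
  simp only [coefLeadC_single hB, hB1, prod_map_eq ξ u (List.nodup_finRange m),
    List.toFinset_finRange, lagrangeSum_eq ξ u (List.nodup_finRange m)]
  rw [Finset.sum_add_distrib, ← Finset.smul_sum, ← Finset.smul_sum, Finset.sum_comm]
  simp only [← Finset.smul_sum, rowOp]
  congr 1
  simp only [minorOp, lt_irrefl, if_false, if_true]
  rw [← Finset.sum_smul, smul_smul]

/-- At `u = ξ_i` the term without acting sites vanishes and the others survive only if the site `i`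
acts. For `j < k` the Verma generator `e_{jk}` is represented by minus the total one and `e_{kj}` by
zero, so of the two mixed products only `e_{kj}` at site `i` times the total `e_{jk}` remains. -/
lemma leadOpC_two (hξ : Function.Injective ξ) (hB : B [] [] = 1) {μ : Fin n → ℂ}
    (hB1 : ∀ i j, B [i] [j] = minorOp m μ i j) (i : Fin m) :
    leadOpC ξ B (ξ i) 2 = (ξ i * simpleDeriv ξ i) •
      ((∑ j, ∑ k ∈ Finset.univ.filter (fun k => j < k),
        (μ k • siteOp ℂ i j j + μ j • siteOp ℂ i k k + siteOp ℂ i k j * diagOp ℂ j k)) +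
      ∑ t ∈ Finset.univ.erase i, (ξ i * (ξ i - ξ t)⁻¹) •
        ∑ j, ∑ k ∈ Finset.univ.filter (fun k => j < k), minorPair j k i t) := by
  have hP : ∏ l, (ξ i - ξ l) = 0 := Finset.prod_eq_zero (Finset.mem_univ i) (sub_self _)
  have hL (Y : Fin m → Module.End ℂ (Fock ℂ m n)) :
      ∑ s, (∏ l ∈ Finset.univ.erase s, (ξ i - ξ l)) • Y s = simpleDeriv ξ i • Y i := by
    rw [Finset.sum_eq_single_of_mem i (Finset.mem_univ i), simpleDeriv]
    intro t _ ht
    rw [Finset.prod_eq_zero (Finset.mem_erase.2 ⟨ht.symm, Finset.mem_univ i⟩) (sub_self _), zero_smul]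
  rw [leadOpC, betheLead, sum_sublistsLen_two, pairSum_finRange, neg_one_sq, one_smul]
  have h (j k : Fin n) (hjk : j < k) :
      coefLeadC ξ B (List.finRange m) (ξ i) [j, k] [j, k] = (ξ i * simpleDeriv ξ i) •
      ((μ k • siteOp ℂ i j j + μ j • siteOp ℂ i k k + siteOp ℂ i k j * diagOp ℂ j k) +
        ∑ t ∈ Finset.univ.erase i, (ξ i * (ξ i - ξ t)⁻¹) • minorPair j k i t) := by
    rw [coefLeadC_pair hB, prod_map_eq ξ _ (List.nodup_finRange m),
      lagrangeSum_eq ξ _ (List.nodup_finRange m), lagrangePairSum_eq hξ (List.nodup_finRange m)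
      (fun s t h => minorPair_comm j k h) (List.mem_finRange i), List.toFinset_finRange, hP,
      zero_smul, zero_add, hL, ← simpleDeriv]
    have hneg (T T' : Module.End ℂ (Fock ℂ m n)) : T * -T' = (-1 : ℂ) • (T * T') := by
      rw [← neg_one_smul ℂ T', mul_smul_comm]
    simp only [hB1, minorOp, lt_irrefl, if_false, if_true, hjk, not_lt_of_gt hjk, hjk.ne', mul_zero,
      hneg, mul_smul_comm, mul_one, ← smul_smul, ← Finset.smul_sum]
    module
  rw [Finset.sum_congr rfl fun j _ => Finset.sum_congr rfl fun k hk =>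
    h j k (Finset.mem_filter.1 hk).2]
  simp only [← Finset.smul_sum, Finset.sum_add_distrib]
  congr 2
  simp only [Finset.smul_sum]
  rw [Finset.sum_comm (s := Finset.univ.erase i)]
  exact Finset.sum_congr rfl fun j _ => Finset.sum_comm

end

end

section

open Polynomial (C X)

/-! ### The trigonometric Gaudin Hamiltonians -/

section

variable {m n : ℕ}

lemma sum_filter_lt_right {A : Type*} [AddCommGroup A] [Module ℂ A] (f : Fin n → A) :
    ∑ j : Fin n, ∑ k ∈ Finset.univ.filter (fun k => j < k), f k = ∑ k : Fin n, ((k : ℕ) : ℂ) • f k := by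
  simp only [Finset.sum_filter]
  rw [Finset.sum_comm]
  refine Finset.sum_congr rfl fun k _ => ?_
  rw [← Finset.sum_filter, Finset.sum_const, Nat.cast_smul_eq_nsmul]
  congr 1
  have : (Finset.univ.filter fun j : Fin n => j < k) = Finset.Iio k := by ext; simp
  rw [this, Fin.card_Iio]

lemma sum_diagOp_eq_sum_rowOp : ∑ k, diagOp ℂ (M := m) (N := n) k k = ∑ t, rowOp ℂ n t := by
  simp only [diagOp, rowOp]
  exact Finset.sum_comm

lemma diagOp_eq_add (i : Fin m) (j k : Fin n) : diagOp ℂ j k =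
    siteOp ℂ i j k + ∑ t ∈ Finset.univ.erase i, siteOp ℂ t j k :=
  (Finset.add_sum_erase _ _ (Finset.mem_univ i)).symm

lemma rowOp_mul_rowOp (s t : Fin m) : rowOp ℂ n s * rowOp ℂ n t =
    ∑ j, siteOp ℂ s j j * siteOp ℂ t j j +
      ∑ j, ∑ k ∈ Finset.univ.filter (fun k => j < k),
        (siteOp ℂ s j j * siteOp ℂ t k k + siteOp ℂ s k k * siteOp ℂ t j j) := by
  rw [rowOp, rowOp, Finset.sum_mul_sum, sum_sum_eq_diag_add]

lemma sum_minorPair (s t : Fin m) :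
    ∑ j : Fin n, ∑ k ∈ Finset.univ.filter (fun k => j < k), minorPair j k s t =
      rowOp ℂ n s * rowOp ℂ n t - ∑ j, siteOp ℂ s j j * siteOp ℂ t j j -
      (∑ j, ∑ k ∈ Finset.univ.filter (fun k => j < k), siteOp ℂ s j k * siteOp ℂ t k j) -
      ∑ j, ∑ k ∈ Finset.univ.filter (fun k => j < k), siteOp ℂ s k j * siteOp ℂ t j k := by
  rw [rowOp_mul_rowOp, add_sub_cancel_left, ← Finset.sum_sub_distrib, ← Finset.sum_sub_distrib]
  refine Finset.sum_congr rfl fun j _ => ?_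
  rw [← Finset.sum_sub_distrib, ← Finset.sum_sub_distrib]
  refine Finset.sum_congr rfl fun k _ => ?_
  rw [minorPair]
  abel

/-- A relation special to symmetric powers, where `e_{ij} = x_i ∂_j`: after normal ordering both
products involve the same commuting factors. -/
lemma siteOp_mul_siteOp_swap (s : Fin m) {j k : Fin n} (h : j ≠ k) :
    siteOp ℂ s k j * siteOp ℂ s j k = siteOp ℂ s k k * siteOp ℂ s j j + siteOp ℂ s k k := by
  rw [siteOp_mul_siteOp_same, siteOp_mul_siteOp_same, if_pos rfl, if_neg h.symm, add_zero,
    (dOp_comm s s j k).eq]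

lemma two_smul_sum_siteOp_swap (s : Fin m) : (2 : ℂ) • ∑ j : Fin n,
    ∑ k ∈ Finset.univ.filter (fun k => j < k), siteOp ℂ s k j * siteOp ℂ s j k =
      rowOp ℂ n s * rowOp ℂ n s - ∑ j, siteOp ℂ s j j * siteOp ℂ s j j +
        (2 : ℂ) • ∑ j : Fin n, ((j : ℕ) : ℂ) • siteOp ℂ s j j := by
  rw [rowOp_mul_rowOp, add_sub_cancel_left, ← sum_filter_lt_right fun j => siteOp ℂ s j j,
    Finset.smul_sum, Finset.smul_sum, ← Finset.sum_add_distrib]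
  refine Finset.sum_congr rfl fun j _ => ?_
  rw [Finset.smul_sum, Finset.smul_sum, ← Finset.sum_add_distrib]
  refine Finset.sum_congr rfl fun k hk => ?_
  have hjk := (Finset.mem_filter.1 hk).2.ne
  have h : siteOp ℂ s j j * siteOp ℂ s k k = siteOp ℂ s k k * siteOp ℂ s j j := by
    rw [siteOp_mul_siteOp_same, siteOp_mul_siteOp_same, if_neg hjk, if_neg hjk.symm,
      (dOp_comm s s j k).eq, (xOp_comm s s j k).eq]
  rw [siteOp_mul_siteOp_swap s hjk, h]
  module

/-- The right side consists of number operators, Cartan terms and the operators of `leadOpC_two`.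
The identity `ξ_i / (ξ_i - ξ_t) = 1 + ξ_t / (ξ_i - ξ_t)` turns `Ω⁺` and `Ω⁻` into `minorPair`. The
constant `1` in it completes the products of site `i` with the others to products with total
generators. The products at site `i` added in this completion are reduced by
`two_smul_sum_siteOp_swap`, which accounts for the shift of `z_j` by the index `j`. -/
lemma gaudinH_eq (z : Fin n → ℂ) {ξ : Fin m → ℂ} (hξ : Function.Injective ξ) (i : Fin m) :
    gaudinH z ξ i = ∑ j : Fin n, (z j + n + (j : ℕ)) • siteOp ℂ i j j +
      (∑ j, ∑ k, siteOp ℂ i j j * diagOp ℂ k k - ∑ j, siteOp ℂ i j j * diagOp ℂ j j) +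
      ∑ s ∈ Finset.univ.erase i, (ξ s / (ξ i - ξ s)) • (rowOp ℂ n i * rowOp ℂ n s) -
      (1 / 2 : ℂ) • (rowOp ℂ n i * rowOp ℂ n i) -
      (∑ j : Fin n, ∑ k ∈ Finset.univ.filter (fun k => j < k), siteOp ℂ i k j * diagOp ℂ j k) -
      ∑ t ∈ Finset.univ.erase i, (ξ i * (ξ i - ξ t)⁻¹) •
        ∑ j, ∑ k ∈ Finset.univ.filter (fun k => j < k), minorPair j k i t := by
  have hz : ∑ j : Fin n, ((z j + n) • (1 : Module.End ℂ (Fock ℂ m n)) - (1 / 2 : ℂ) • diagOp ℂ j j) *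
      siteOp ℂ i j j = ∑ j : Fin n, (z j + n) • siteOp ℂ i j j -
        (1 / 2 : ℂ) • ∑ j, siteOp ℂ i j j * diagOp ℂ j j := by
    rw [Finset.smul_sum, ← Finset.sum_sub_distrib]
    refine Finset.sum_congr rfl fun j _ => ?_
    have h1 := diagOp_siteOp_lie (F := ℂ) i j j j j
    rw [sub_self, sub_eq_zero] at h1
    rw [sub_mul, smul_mul_assoc, smul_mul_assoc, one_mul, h1]
  have h1 : ∑ j, ∑ k, siteOp ℂ i j j * diagOp ℂ k k = rowOp ℂ n i * rowOp ℂ n i +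
      ∑ t ∈ Finset.univ.erase i, rowOp ℂ n i * rowOp ℂ n t := by
    rw [← Finset.sum_mul_sum, sum_diagOp_eq_sum_rowOp, ← rowOp, Finset.mul_sum,
      Finset.add_sum_erase _ (fun t => rowOp ℂ n i * rowOp ℂ n t) (Finset.mem_univ i)]
  have h2 : ∑ j : Fin n, siteOp ℂ i j j * diagOp ℂ j j = ∑ j, siteOp ℂ i j j * siteOp ℂ i j j +
      ∑ t ∈ Finset.univ.erase i, ∑ j, siteOp ℂ i j j * siteOp ℂ t j j := by
    rw [Finset.sum_comm, ← Finset.sum_add_distrib]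
    refine Finset.sum_congr rfl fun j _ => ?_
    rw [diagOp_eq_add i, mul_add, Finset.mul_sum]
  have h3 : ∑ j : Fin n, ∑ k ∈ Finset.univ.filter (fun k => j < k), siteOp ℂ i k j * diagOp ℂ j k =
      (∑ j : Fin n, ∑ k ∈ Finset.univ.filter (fun k => j < k), siteOp ℂ i k j * siteOp ℂ i j k) +
      ∑ t ∈ Finset.univ.erase i, ∑ j : Fin n, ∑ k ∈ Finset.univ.filter (fun k => j < k),
        siteOp ℂ i k j * siteOp ℂ t j k := by
    rw [Finset.sum_comm, ← Finset.sum_add_distrib]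
    refine Finset.sum_congr rfl fun j _ => ?_
    rw [Finset.sum_comm, ← Finset.sum_add_distrib]
    refine Finset.sum_congr rfl fun k _ => ?_
    rw [diagOp_eq_add i, mul_add, Finset.mul_sum]
  have h4 := two_smul_sum_siteOp_swap (n := n) i
  have h5 : ∑ j : Fin n, (z j + n + (j : ℕ)) • siteOp ℂ i j j =
      ∑ j : Fin n, (z j + n) • siteOp ℂ i j j + ∑ j : Fin n, ((j : ℕ) : ℂ) • siteOp ℂ i j j := by
    rw [← Finset.sum_add_distrib]
    exact Finset.sum_congr rfl fun j _ => add_smul _ _ _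
  have h6 : ∑ k ∈ Finset.univ.erase i,
      (ξ i - ξ k)⁻¹ • (ξ i • omegaPlus n i k + ξ k • omegaMinus n i k) =
      ∑ t ∈ Finset.univ.erase i, rowOp ℂ n i * rowOp ℂ n t -
      (1 / 2 : ℂ) • ∑ t ∈ Finset.univ.erase i, ∑ j, siteOp ℂ i j j * siteOp ℂ t j j +
      ∑ s ∈ Finset.univ.erase i, (ξ s / (ξ i - ξ s)) • (rowOp ℂ n i * rowOp ℂ n s) -
      (∑ t ∈ Finset.univ.erase i, ∑ j : Fin n, ∑ k ∈ Finset.univ.filter (fun k => j < k),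
        siteOp ℂ i k j * siteOp ℂ t j k) -
      ∑ t ∈ Finset.univ.erase i, (ξ i * (ξ i - ξ t)⁻¹) •
        ∑ j, ∑ k ∈ Finset.univ.filter (fun k => j < k), minorPair j k i t := by
    rw [Finset.smul_sum, ← Finset.sum_sub_distrib, ← Finset.sum_add_distrib,
      ← Finset.sum_sub_distrib, ← Finset.sum_sub_distrib]
    refine Finset.sum_congr rfl fun t ht => ?_
    have h0 : ξ i - ξ t ≠ 0 := sub_ne_zero.2 fun h => Finset.ne_of_mem_erase ht (hξ h).symm
    have hρ : ξ i * (ξ i - ξ t)⁻¹ = 1 + ξ t / (ξ i - ξ t) := by field_simp; ring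
    rw [sum_minorPair, smul_add, smul_smul, smul_smul, mul_comm _ (ξ i), hρ, mul_comm _ (ξ t),
      ← div_eq_mul_inv, omegaPlus, omegaMinus]
    generalize ξ t / (ξ i - ξ t) = κ
    module
  rw [gaudinH, hz, h1, h2, h3, h5, h6]
  have h7 : ∑ j : Fin n, ∑ k ∈ Finset.univ.filter (fun k => j < k), siteOp ℂ i k j * siteOp ℂ i j k =
      (1 / 2 : ℂ) • (rowOp ℂ n i * rowOp ℂ n i - ∑ j, siteOp ℂ i j j * siteOp ℂ i j j) +
        ∑ j : Fin n, ((j : ℕ) : ℂ) • siteOp ℂ i j j := by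
    refine smul_right_injective _ (two_ne_zero (α := ℂ)) ?_
    simp only [h4]
    module
  rw [h7]
  module

lemma sum_fin_cast (n : ℕ) : ∑ j : Fin n, ((j : ℕ) : ℂ) = n * (n - 1) / 2 := by
  induction n with
  | zero => simp
  | succ n ih =>
    rw [Fin.sum_univ_castSucc]
    simp only [Fin.val_castSucc, ih, Fin.val_last]
    push_cast
    ring

/-- The coefficients for the first kind and their leading terms give the Gaudin Hamiltonians. -/
theorem opMatrix_gaudinH (hn : 0 < n) (a : Fin n → ℕ) (b : Fin m → ℕ)
    (hab : ∑ i, a i = ∑ j, b j) (μ : Fin n → ℂ) {ξ : Fin m → ℂ} (hξ0 : ∀ i, ξ i ≠ 0)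
    (hξ : Function.Injective ξ) {B : List (Fin n) → List (Fin n) → Module.End ℂ (Fock ℂ m n)}
    (hB : B [] [] = 1) (hB1 : ∀ i j, B [i] [j] = minorOp m μ i j)
    {c : Fin (m + 1) → Fin (n + 1) → Matrix (Table b a) (Table b a) ℂ}
    (hc : ∀ (j : Fin (n + 1)) (u : ℂ) x y, ∑ i : Fin (m + 1), c i j x y * u ^ (i : ℕ) =
      opMatrix b a (leadOpC ξ B u (n - j)) x y) (i : Fin m) :
    opMatrix b a (gaudinH (zParam μ a) ξ i) = residueExpr n ξ b c i := by
  set Mj : Fin n → Matrix (Table b a) (Table b a) ℂ := fun j =>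
    opMatrixLin b a (siteOp ℂ i j j) with hMj
  have hrow (s : Fin m) : opMatrixLin b a (rowOp ℂ n s) = (b s : ℂ) • 1 := by
    have := opMatrixLin_mul_rowOp b a 1 s
    rwa [one_mul, opMatrixLin_one] at this
  have hM : ∑ j, Mj j = (b i : ℂ) • 1 := by rw [← hrow, rowOp, map_sum]
  set R : Matrix (Table b a) (Table b a) ℂ := opMatrixLin b a
    (∑ j : Fin n, ∑ k ∈ Finset.univ.filter (fun k => j < k), siteOp ℂ i k j * diagOp ℂ j k +
      ∑ t ∈ Finset.univ.erase i, (ξ i * (ξ i - ξ t)⁻¹) •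
        ∑ j, ∑ k ∈ Finset.univ.filter (fun k => j < k), minorPair j k i t) with hR
  have hev (k : ℕ) (x y : Table b a) (u : ℂ) : (leadNum n c k x y).eval u =
      ∑ j ∈ Finset.range (n + 1), (descPochhammer ℂ j).coeff (n - k) *
        opMatrixLin b a (leadOpC ξ B u (n - j)) x y := by
    rw [leadNum_eval, Finset.sum_range]
    exact Finset.sum_congr rfl fun j _ => by rw [hc j]; rfl
  have e1 (u : ℂ) : opMatrixLin b a (leadOpC ξ B u 1) = (-((∏ l, (u - ξ l)) * ∑ j, μ j +
      u * ∑ s, (∏ l ∈ Finset.univ.erase s, (u - ξ l)) * b s)) • 1 := by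
    rw [leadOpC_one hB hB1]
    simp only [map_smul, map_add, map_sum, hrow, opMatrixLin_one, smul_smul, ← Finset.sum_smul]
    module
  have e2 : opMatrixLin b a (leadOpC ξ B (ξ i) 2) = (ξ i * simpleDeriv ξ i) •
      ((∑ j, μ j) • ((b i : ℂ) • 1) - ∑ j, μ j • Mj j + R) := by
    have h1 : ∑ j, ∑ k ∈ Finset.univ.filter (fun k => j < k), (μ k • Mj j + μ j • Mj k) =
        (∑ j, μ j) • ((b i : ℂ) • 1) - ∑ j, μ j • Mj j := by
      have h := sum_sum_eq_diag_add fun j k => μ k • Mj j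
      simp only [← Finset.sum_smul] at h
      rw [← Finset.smul_sum, hM] at h
      rw [h, add_sub_cancel_left]
    rw [leadOpC_two hξ hB hB1, map_smul, ← h1, hR]
    simp only [Finset.sum_add_distrib, map_add, map_sum, map_smul, hMj]
    rw [add_assoc]
  set A : ℂ := ∑ j, (zParam μ a j + n) with hA
  -- The first summand comes from the minors of order one, through the subleading coefficient `-(n -
  -- 1) (n - 2) / 2` of the falling factorial of order `n - 1`. The minors of order zero vanish at
  -- `ξ_i`.
  set T₂ : Matrix (Table b a) (Table b a) ℂ := ((n - 1) * (n - 2) / 2 * b i : ℂ) • 1 +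
    ((∑ j, μ j) • ((b i : ℂ) • 1) - ∑ j, μ j • Mj j) + R with hT₂
  -- In this form the constant is visible in the first coefficient: `n (n - 1) / 2` from the falling
  -- factorial of order `n`, and the sum of the `b_s` from the polynomial part of `u ∏_{l ≠ s} (u -
  -- ξ_l)`.
  have hAval : A = ∑ j, μ j + ∑ s, (b s : ℂ) + n * (n - 1) / 2 := by
    have h : (∑ i, (a i : ℂ)) = ∑ s, (b s : ℂ) := by exact_mod_cast hab
    rw [hA, ← h]
    simp only [zParam, Finset.sum_add_distrib, Finset.sum_sub_distrib, sum_fin_cast]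
    simp
    ring
  rw [residueExpr_eq hξ0 hξ hn b A c (fun x y u => ?_) i T₂ (fun hn2 x y => ?_) (fun hn1 => ?_)]
  · have h1 : ∑ j : Fin n, (zParam μ a j + n + (j : ℕ)) • Mj j =
        ∑ j, μ j • Mj j + ∑ j, (a j : ℂ) • Mj j + (n - 1 : ℂ) • ((b i : ℂ) • 1) := by
      rw [← hM, Finset.smul_sum, ← Finset.sum_add_distrib, ← Finset.sum_add_distrib]
      refine Finset.sum_congr rfl fun j _ => ?_
      rw [zParam]
      module
    have h2 : ∑ j, ∑ k, (a k : ℂ) • Mj j = (∑ s, (b s : ℂ)) • ((b i : ℂ) • 1) := by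
      have h : (∑ i, (a i : ℂ)) = ∑ s, (b s : ℂ) := by exact_mod_cast hab
      simp only [← Finset.sum_smul]
      rw [← Finset.smul_sum, hM, h]
    have h3 : ∑ s ∈ Finset.univ.erase i, (ξ s / (ξ i - ξ s)) •
        ((b s : ℂ) • ((b i : ℂ) • (1 : Matrix (Table b a) (Table b a) ℂ))) =
        (∑ s ∈ Finset.univ.erase i, b s * (ξ s / (ξ i - ξ s))) • ((b i : ℂ) • 1) := by
      rw [Finset.sum_smul]
      refine Finset.sum_congr rfl fun s _ => ?_
      module
    rw [← opMatrixLin_apply, gaudinH_eq _ hξ, sub_sub _ _ (Finset.sum _ _), map_sub, ← hR]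
    simp only [map_sub, map_add, map_sum, map_smul, opMatrixLin_mul_diagOp, opMatrixLin_mul_rowOp,
      hrow]
    rw [h1, h2, h3, hT₂, hAval]
    module
  · obtain ⟨k, rfl⟩ : ∃ k, n = k + 1 := ⟨n - 1, by omega⟩
    rw [hev, Nat.add_sub_cancel, Finset.sum_range_succ, Finset.sum_range_succ,
      Finset.sum_eq_zero (fun j hj => by
        rw [coeff_descPochhammer_of_lt (Finset.mem_range.1 hj), zero_mul]),
      coeff_descPochhammer_self, coeff_descPochhammer_succ, Nat.sub_self, leadOpC_zero hB,
      show k + 1 - k = 1 by omega, e1, map_smul, opMatrixLin_one, hAval]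
    simp only [Matrix.smul_apply, smul_eq_mul]
    -- Writing `u = (u - ξ_s) + ξ_s` separates the constant part from the pole at `ξ_s`.
    have h (s : Fin m) : u * ((∏ l ∈ Finset.univ.erase s, (u - ξ l)) * b s) =
        b s * ∏ l, (u - ξ l) + b s * ξ s * ∏ l ∈ Finset.univ.erase s, (u - ξ l) := by
      rw [← Finset.mul_prod_erase _ _ (Finset.mem_univ s)]
      ring
    have h' : u * ∑ s, (∏ l ∈ Finset.univ.erase s, (u - ξ l)) * (b s : ℂ) =
        (∑ s, (b s : ℂ)) * ∏ l, (u - ξ l) +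
          ∑ s, b s * ξ s * ∏ l ∈ Finset.univ.erase s, (u - ξ l) := by
      rw [Finset.mul_sum, Finset.sum_congr rfl fun s _ => h s, Finset.sum_add_distrib,
        ← Finset.sum_mul]
    rw [h']
    push_cast
    ring
  · obtain ⟨k, rfl⟩ : ∃ k, n = k + 2 := ⟨n - 2, by omega⟩
    have hP : ∏ l, (ξ i - ξ l) = 0 := Finset.prod_eq_zero (Finset.mem_univ i) (sub_self _)
    have hQ : ∑ s, (∏ l ∈ Finset.univ.erase s, (ξ i - ξ l)) * (b s : ℂ) =
        simpleDeriv ξ i * b i := by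
      rw [Finset.sum_eq_single_of_mem i (Finset.mem_univ i), simpleDeriv]
      intro t _ ht
      rw [Finset.prod_eq_zero (Finset.mem_erase.2 ⟨ht.symm, Finset.mem_univ i⟩) (sub_self _),
        zero_mul]
    rw [hev, Nat.add_sub_cancel, Finset.sum_range_succ, Finset.sum_range_succ,
      Finset.sum_range_succ, Finset.sum_eq_zero (fun j hj => by
        rw [coeff_descPochhammer_of_lt (Finset.mem_range.1 hj), zero_mul]),
      coeff_descPochhammer_self, coeff_descPochhammer_succ, Nat.sub_self, leadOpC_zero hB,
      show k + 2 - k = 2 by omega, show k + 2 - (k + 1) = 1 by omega, e1, e2, hP, hQ, hT₂,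
      zero_smul, map_zero]
    simp only [Matrix.smul_apply, Matrix.add_apply, smul_eq_mul, Matrix.zero_apply]
    push_cast
    ring
  -- For `n = 1` the second coefficient is zero by convention. The operator side agrees, since there
  -- are no pairs of indices and the only Cartan generator of site `i` is its number operator.
  · subst hn1
    have h0 : Mj 0 = (b i : ℂ) • 1 := by simpa using hM
    have hf (j : Fin 1) : Finset.univ.filter (fun k => j < k) = ∅ :=
      Finset.filter_false_of_mem fun k _ => by rw [Subsingleton.elim j k]; exact lt_irrefl k
    have hR0 : R = 0 := by
      simp only [hR, hf, Finset.sum_empty, Finset.sum_const_zero, smul_zero, add_zero, map_zero]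
    rw [hT₂, hR0]
    simp [h0]

end

end

/-! ### Second kind of coefficients and the dynamical Hamiltonians -/

section

open Polynomial (C X)

/-! ### Contractions of the alternating symbol -/

section CapLead

variable {N : ℕ} {A : Type*} [AddCommGroup A] (η : Fin N → ℂ)

lemma altSum_eq_zero {ι B : Type*} [AddCommGroup B] (l : List ι) (f : ι → List ι → B)
    (h : ∀ k l', (k :: l').Perm l → f k l' = 0) : altSum l f = 0 := by
  rw [altSum_congr l f (fun _ _ => 0) h, altSum_zero]

lemma altSum_sum {ι κ B : Type*} [AddCommGroup B] (s : Finset κ) (l : List ι)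
    (f : κ → ι → List ι → B) :
    altSum l (fun i I => ∑ c ∈ s, f c i I) = ∑ c ∈ s, altSum l (f c) := by
  classical
  induction s using Finset.induction_on with
  | empty => simp [altSum_zero]
  | insert c s hc ih => simp only [Finset.sum_insert hc, altSum_add, ih]

lemma capLead_cons (I : List (Fin N)) (j : Fin N) (l : List (Fin N)) :
    capLead η I (j :: l) = altSum I fun i I' => if i = j then η i * capLead η I' l else 0 := rfl

lemma altSum_ite_of_notMem {I : List (Fin N)} {j : Fin N} (h : j ∉ I) (f : Fin N → List (Fin N) → A) :
    (altSum I fun i I' => if i = j then f i I' else 0) = 0 :=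
  altSum_eq_zero _ _ fun _ _ hk => if_neg fun e : _ = j => h (hk.subset (e ▸ List.mem_cons_self))

lemma capLead_of_notMem (J : List (Fin N)) : ∀ (I : List (Fin N)) {x : Fin N}, x ∈ I → x ∉ J →
    capLead η I J = 0 := by
  induction J with
  | nil =>
    intro I x hx _
    rw [capLead, if_neg (List.ne_nil_of_mem hx)]
  | cons j l ih =>
    intro I x hx hxJ
    rw [capLead_cons]
    refine altSum_eq_zero _ _ fun i I' hI => ?_
    split_ifs with hij
    · have : x ∈ i :: I' := hI.symm.subset hx
      rcases List.mem_cons.1 this with h | h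
      · exact absurd (h.trans hij ▸ List.mem_cons_self) hxJ
      · rw [ih I' h fun h' => hxJ (List.mem_cons_of_mem _ h'), mul_zero]
    · rfl

/-- On repetition-free lists `capLead` is the sign of the permutation matching rows to columns times
`∏ η`. This rule and the next ones follow the first column `j` through the few places where it can
occur among the rows. -/
lemma capLead_cons_cons {I l : List (Fin N)} {j : Fin N} (hI : j ∉ I) (c : Fin N) :
    capLead η (c :: I) (j :: l) = if c = j then η j * capLead η I l else 0 := by
  rw [capLead_cons, altSum_cons, altSum_ite_of_notMem hI, sub_zero]
  split_ifs with h
  · rw [h]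
  · rfl

lemma capLead_cons_cons_cons {I l : List (Fin N)} {j : Fin N} (hI : j ∉ I) (c d : Fin N) :
    capLead η (d :: c :: I) (j :: l) = (if d = j then η j * capLead η (c :: I) l else 0) -
      if c = j then η j * capLead η (d :: I) l else 0 := by
  rw [capLead_cons, altSum_cons, altSum_cons, altSum_ite_of_notMem hI, sub_zero]
  congr 1 <;> split_ifs with h <;> simp [h]

lemma capLead_cons_head {I l : List (Fin N)} {j : Fin N} (hI : j ∉ I) (hl : j ∉ l) (c : Fin N) :
    capLead η (c :: j :: I) (j :: l) = -(η j * capLead η (c :: I) l) := by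
  rw [capLead_cons_cons_cons η hI, capLead_of_notMem η l (j :: I) List.mem_cons_self hl]
  simp

lemma capLead_cons_cons_head {I l : List (Fin N)} {j : Fin N} (hI : j ∉ I) (hl : j ∉ l)
    (c d : Fin N) : capLead η (d :: c :: j :: I) (j :: l) = η j * capLead η (d :: c :: I) l := by
  rw [capLead_cons, altSum_cons, altSum_cons, altSum_cons, altSum_ite_of_notMem hI,
    capLead_of_notMem η l (c :: j :: I) (List.mem_cons_of_mem _ List.mem_cons_self) hl,
    capLead_of_notMem η l (d :: j :: I) (List.mem_cons_of_mem _ List.mem_cons_self) hl]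
  simp

lemma capLead_self {K : List (Fin N)} (hK : K.Nodup) : capLead η K K = (K.map η).prod := by
  induction K with
  | nil => simp [capLead]
  | cons j l ih =>
    rw [List.nodup_cons] at hK
    rw [capLead_cons_cons η hK.1, if_pos rfl, ih hK.2]
    simp

lemma notMem_of_perm {j i : Fin N} {l I : List (Fin N)} (hj : j ∉ l) (h : (i :: I).Perm l) :
    j ∉ I ∧ j ≠ i :=
  ⟨fun h' => hj (h.subset (List.mem_cons_of_mem _ h')),
    fun h' => hj (h.subset (h' ▸ List.mem_cons_self))⟩

variable [Module ℂ A]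

/-- After deleting the row `i` and inserting `c`, the rows match the columns only if `c = i`, and
the sign of the deletion cancels the sign of the reinsertion at the front. -/
lemma altSum_capLead (c : Fin N) (f : Fin N → A) {K : List (Fin N)} (hK : K.Nodup) :
    (altSum K fun i I => capLead η (c :: I) K • f i) =
      if c ∈ K then (K.map η).prod • f c else 0 := by
  induction K with
  | nil => simp
  | cons j l ih =>
    rw [List.nodup_cons] at hK
    rw [altSum_cons, capLead_cons_cons η hK.1, capLead_self η hK.2,
      altSum_congr l _ (fun k l' => (-η j) • capLead η (c :: l') l • f k) fun k l' hk => by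
        rw [capLead_cons_head η (notMem_of_perm hK.1 hk).1 hK.1, smul_smul, neg_mul],
      ← smul_altSum, ih hK.2, List.map_cons, List.prod_cons]
    by_cases hc : c = j
    · subst hc
      simp [hK.1]
    · by_cases hcl : c ∈ l
      · simp [hc, hcl, smul_smul]
      · simp [hc, hcl]

/-- The two deleted rows must be `c` and `d`, in one of the two orders, and these carry opposite
signs. -/
lemma altSum_altSum_capLead (c d : Fin N) (f : Fin N → Fin N → A) {K : List (Fin N)}
    (hK : K.Nodup) :
    (altSum K fun i I => altSum I fun k I' => capLead η (d :: c :: I') K • f i k) =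
      if c ∈ K ∧ d ∈ K ∧ c ≠ d then (K.map η).prod • (f d c - f c d) else 0 := by
  induction K with
  | nil => simp
  | cons j l ih =>
    rw [List.nodup_cons] at hK
    have h1 : (altSum l fun k I' => capLead η (d :: c :: I') (j :: l) • f j k) =
        (if d = j ∧ c ∈ l then ((j :: l).map η).prod • f j c else 0) -
          if c = j ∧ d ∈ l then ((j :: l).map η).prod • f j d else 0 := by
      rw [altSum_congr l _ (fun k I' => (if d = j then η j else 0) • capLead η (c :: I') l • f j k +
        (-if c = j then η j else 0) • capLead η (d :: I') l • f j k) fun k l' hk => by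
          rw [capLead_cons_cons_cons η (notMem_of_perm hK.1 hk).1]
          split_ifs <;> module, altSum_add, ← smul_altSum, ← smul_altSum,
        altSum_capLead η c (f j) hK.2, altSum_capLead η d (f j) hK.2, List.map_cons, List.prod_cons]
      split_ifs <;> simp_all [smul_smul]
    have h2 : (altSum l fun i I => capLead η (d :: c :: I) (j :: l) • f i j) =
        (if d = j ∧ c ∈ l then ((j :: l).map η).prod • f c j else 0) -
          if c = j ∧ d ∈ l then ((j :: l).map η).prod • f d j else 0 := by
      rw [altSum_congr l _ (fun k I' => (if d = j then η j else 0) • capLead η (c :: I') l • f k j +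
        (-if c = j then η j else 0) • capLead η (d :: I') l • f k j) fun k l' hk => by
          rw [capLead_cons_cons_cons η (notMem_of_perm hK.1 hk).1]
          split_ifs <;> module, altSum_add, ← smul_altSum, ← smul_altSum,
        altSum_capLead η c (fun i => f i j) hK.2, altSum_capLead η d (fun i => f i j) hK.2,
        List.map_cons, List.prod_cons]
      split_ifs <;> simp_all [smul_smul]
    have h3 : (altSum l fun i I => altSum I fun k I' =>
        capLead η (d :: c :: j :: I') (j :: l) • f i k) =
        η j • if c ∈ l ∧ d ∈ l ∧ c ≠ d then (l.map η).prod • (f d c - f c d) else 0 := by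
      rw [← ih hK.2, smul_altSum]
      refine altSum_congr _ _ _ fun i I hi => ?_
      rw [smul_altSum]
      refine altSum_congr _ _ _ fun k I' hk => ?_
      rw [capLead_cons_cons_head η (notMem_of_perm (notMem_of_perm hK.1 hi).1 hk).1 hK.1, mul_smul]
    have h4 : (altSum l fun i I => altSum (j :: I) fun k I' =>
        capLead η (d :: c :: I') (j :: l) • f i k) =
        (altSum l fun i I => capLead η (d :: c :: I) (j :: l) • f i j) -
        altSum l fun i I => altSum I fun k I' => capLead η (d :: c :: j :: I') (j :: l) • f i k := by
      rw [eq_sub_iff_add_eq, ← altSum_add]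
      refine altSum_congr _ _ _ fun i I _ => ?_
      rw [altSum_cons]
      abel
    rw [altSum_cons, h4, h1, h2, h3]
    simp only [List.mem_cons, List.map_cons, List.prod_cons]
    have hj := hK.1
    by_cases hc : c = j
    · subst hc
      by_cases hd : d = c
      · subst hd; simp [hj]
      · by_cases hdl : d ∈ l
        · simp [hj, hd, hdl, Ne.symm hd]; module
        · simp [hj, hd, hdl]
    · by_cases hd : d = j
      · subst hd
        by_cases hcl : c ∈ l
        · simp [hj, hc, hcl]; module
        · simp [hj, hc, hcl]
      · by_cases h : c ∈ l ∧ d ∈ l ∧ c ≠ d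
        · simp [hc, hd, h, smul_smul]
        · simp [hc, hd, h]

end CapLead

/-! ### The leading terms for the second kind of coefficients -/

section

variable {M N : ℕ}

/-- The operation by which a tensor factor enters `coefLeadD`. -/
def siteStep (z : Fin M → ℂ) (s : Fin M)
    (V : List (Fin N) → List (Fin N) → Module.End ℂ (Fock ℂ M N)) (I J : List (Fin N)) :
    Module.End ℂ (Fock ℂ M N) :=
  (-z s) • V I J + altSum I fun i I' => ∑ c, siteOp ℂ s i c * V (c :: I') J

/-- The coefficient of `(u + q) ^ (length - k)` in `coefLeadD (z - q)`. -/
def topCoef (z : Fin M → ℂ) (base : List (Fin N) → List (Fin N) → Module.End ℂ (Fock ℂ M N)) :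
    List (Fin M) → ℕ → List (Fin N) → List (Fin N) → Module.End ℂ (Fock ℂ M N)
  | [], 0 => base
  | [], _ + 1 => fun _ _ => 0
  | _ :: S, 0 => topCoef z base S 0
  | s :: S, k + 1 => fun I J => topCoef z base S (k + 1) I J + siteStep z s (topCoef z base S k) I J

variable {z : Fin M → ℂ} {base : List (Fin N) → List (Fin N) → Module.End ℂ (Fock ℂ M N)}

lemma siteStep_zero (s : Fin M) (I J : List (Fin N)) :
    siteStep z s (fun _ _ => (0 : Module.End ℂ (Fock ℂ M N))) I J = 0 := by
  simp [siteStep, altSum_zero]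

lemma siteStep_add (s : Fin M) (V W : List (Fin N) → List (Fin N) → Module.End ℂ (Fock ℂ M N))
    (I J : List (Fin N)) : siteStep z s (fun I J => V I J + W I J) I J =
      siteStep z s V I J + siteStep z s W I J := by
  simp only [siteStep, mul_add, Finset.sum_add_distrib, altSum_add, smul_add]
  abel

lemma siteStep_smul (s : Fin M) (c : ℂ) (V : List (Fin N) → List (Fin N) → Module.End ℂ (Fock ℂ M N))
    (I J : List (Fin N)) : siteStep z s (fun I J => c • V I J) I J = c • siteStep z s V I J := by
  simp only [siteStep, mul_smul_comm, ← Finset.smul_sum, ← smul_altSum, smul_add]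
  rw [smul_comm]

lemma siteStep_sum {ι : Type*} (t : Finset ι) (s : Fin M)
    (V : ι → List (Fin N) → List (Fin N) → Module.End ℂ (Fock ℂ M N)) (I J : List (Fin N)) :
    siteStep z s (fun I J => ∑ i ∈ t, V i I J) I J = ∑ i ∈ t, siteStep z s (V i) I J := by
  classical
  induction t using Finset.induction_on with
  | empty => simp [siteStep_zero]
  | insert i t hi ih => simp only [Finset.sum_insert hi, siteStep_add, ih]

lemma topCoef_zero (S : List (Fin M)) : topCoef z base S 0 = base := by
  induction S with
  | nil => rfl
  | cons s S ih => exact ih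

lemma topCoef_of_length_lt (S : List (Fin M)) : ∀ k, S.length < k →
    topCoef z base S k = fun _ _ => 0 := by
  induction S with
  | nil =>
    intro k hk
    obtain ⟨l, rfl⟩ := Nat.exists_eq_succ_of_ne_zero hk.ne'
    rfl
  | cons s S ih =>
    intro k hk
    obtain ⟨l, rfl⟩ := Nat.exists_eq_succ_of_ne_zero (Nat.ne_zero_of_lt hk)
    have hl : S.length < l := by simpa using hk
    funext I J
    simp only [topCoef, ih l hl, ih (l + 1) (by omega), siteStep_zero, add_zero]

/-- Writing `u - z_s = (u + q) - (z_s + q)`, each site gives either a power of `u + q` or one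
application of `siteStep`. The index `k` counts the latter. -/
lemma coefLeadD_eq (z : Fin M → ℂ) (q u : ℂ) (S : List (Fin M)) : ∀ I J,
    coefLeadD z base S u I J = ∑ k ∈ Finset.range (S.length + 1),
      (u + q) ^ (S.length - k) • topCoef (fun s => z s + q) base S k I J := by
  induction S with
  | nil => intro I J; simp [coefLeadD, topCoef]
  | cons s S ih =>
    intro I J
    have h1 : coefLeadD z base (s :: S) u I J = (u + q) • coefLeadD z base S u I J +
        siteStep (fun s => z s + q) s (coefLeadD z base S u) I J := by
      rw [coefLeadD, siteStep]
      module
    have h2 : coefLeadD z base S u = fun I J => ∑ k ∈ Finset.range (S.length + 1),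
      (u + q) ^ (S.length - k) • topCoef (fun s => z s + q) base S k I J := by
      funext I J; exact ih I J
    rw [h1, h2, siteStep_sum, List.length_cons, Finset.sum_range_succ' _ (S.length + 1)]
    simp only [siteStep_smul, topCoef, Nat.add_sub_add_right, smul_add, Finset.sum_add_distrib,
      Nat.sub_zero]
    rw [Finset.smul_sum, Finset.sum_range_succ (fun k => (u + q) ^ (S.length - k) •
      topCoef (fun s => z s + q) base S (k + 1) I J), topCoef_of_length_lt S _ (Nat.lt_succ_self _),
      smul_zero, add_zero, Finset.sum_range_succ' _ S.length]
    have h3 : ∀ k ∈ Finset.range S.length, (u + q) • (u + q) ^ (S.length - (k + 1)) •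
        topCoef (fun s => z s + q) base S (k + 1) I J =
        (u + q) ^ (S.length - k) • topCoef (fun s => z s + q) base S (k + 1) I J := fun k hk => by
      rw [smul_smul, ← pow_succ']
      congr 2
      have := Finset.mem_range.1 hk
      omega
    rw [Finset.sum_congr rfl h3, smul_smul, Nat.sub_zero, ← pow_succ']
    abel

lemma topCoef_one (S : List (Fin M)) (I J : List (Fin N)) :
    topCoef z base S 1 I J = (S.map fun t => siteStep z t base I J).sum := by
  induction S with
  | nil => rfl
  | cons s S ih =>
    change topCoef z base S 1 I J + siteStep z s (topCoef z base S 0) I J = _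
    rw [ih, topCoef_zero, List.map_cons, List.sum_cons, add_comm]

lemma siteStep_listSum (S : List (Fin M)) (s : Fin M)
    (V : Fin M → List (Fin N) → List (Fin N) → Module.End ℂ (Fock ℂ M N)) (I J : List (Fin N)) :
    siteStep z s (fun I J => (S.map fun t => V t I J).sum) I J =
      (S.map fun t => siteStep z s (V t) I J).sum := by
  induction S with
  | nil => simp [siteStep_zero]
  | cons t S ih => simp only [List.map_cons, List.sum_cons, siteStep_add, ih]

lemma topCoef_two (S : List (Fin M)) (I J : List (Fin N)) :
    topCoef z base S 2 I J =
      pairSum (fun s t => siteStep z s (siteStep z t base) I J) S := by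
  induction S with
  | nil => rfl
  | cons s S ih =>
    change topCoef z base S 2 I J + siteStep z s (topCoef z base S 1) I J = _
    rw [ih, pairSum, add_comm]
    congr 1
    have : topCoef z base S 1 = fun I J => (S.map fun t => siteStep z t base I J).sum := by
      funext I J; exact topCoef_one S I J
    rw [this, siteStep_listSum]

variable {η : Fin N → ℂ}

lemma siteStep_capLead (s : Fin M) {K : List (Fin N)} (hK : K.Nodup) :
    siteStep z s (fun I J => capLead η I J • (1 : Module.End ℂ (Fock ℂ M N))) K K =
      (K.map η).prod • ((-z s) • 1 + ∑ c, if c ∈ K then siteOp ℂ s c c else 0) := by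
  rw [siteStep, capLead_self η hK, altSum_sum]
  simp only [mul_smul_comm, mul_one]
  rw [Finset.sum_congr rfl fun c _ => altSum_capLead η c (fun i => siteOp ℂ s i c) hK, smul_add,
    Finset.smul_sum, smul_comm]
  simp

/-- The second generator acts either on the row created by the first, which gives the sum of
products `e_{cd} e_{dc}`, or on another row of `K`, which gives an antisymmetrised product over
ordered pairs in `K`. The remaining terms come from the shifts `-z`. -/
lemma siteStep_siteStep_capLead (s t : Fin M) {K : List (Fin N)} (hK : K.Nodup) :
    siteStep z s (siteStep z t
      (fun I J => capLead η I J • (1 : Module.End ℂ (Fock ℂ M N)))) K K =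
      (K.map η).prod • ((z s * z t) • 1 +
        ∑ c, (if c ∈ K then (-z s) • siteOp ℂ t c c + (-z t) • siteOp ℂ s c c +
          ∑ d, siteOp ℂ s c d * siteOp ℂ t d c else 0) +
        ∑ c, ∑ d, if c ∈ K ∧ d ∈ K ∧ c ≠ d then
          siteOp ℂ s c c * siteOp ℂ t d d - siteOp ℂ s d c * siteOp ℂ t c d else 0) := by
  have h1 : (altSum K fun i I => ∑ c, siteOp ℂ s i c * siteStep z t
      (fun I J => capLead η I J • (1 : Module.End ℂ (Fock ℂ M N))) (c :: I) K) =
      (∑ c, altSum K fun i I => capLead η (c :: I) K • ((-z t) • siteOp ℂ s i c)) +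
      ((∑ d, altSum K fun i I => capLead η (d :: I) K •
        ∑ c, siteOp ℂ s i c * siteOp ℂ t c d) +
      ∑ c, ∑ d, altSum K fun i I => altSum I fun k I' => capLead η (d :: c :: I') K •
        ((-1 : ℂ) • (siteOp ℂ s i c * siteOp ℂ t k d))) := by
    simp only [← altSum_sum, ← altSum_add]
    refine altSum_congr _ _ _ fun i I _ => ?_
    have h2 (c : Fin N) : siteOp ℂ s i c * siteStep z t
        (fun I J => capLead η I J • (1 : Module.End ℂ (Fock ℂ M N))) (c :: I) K =
        capLead η (c :: I) K • ((-z t) • siteOp ℂ s i c) +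
        (∑ d, capLead η (d :: I) K • (siteOp ℂ s i c * siteOp ℂ t c d) +
        ∑ d, altSum I fun k I' => capLead η (d :: c :: I') K •
          ((-1 : ℂ) • (siteOp ℂ s i c * siteOp ℂ t k d))) := by
      rw [siteStep, altSum_cons, mul_add, mul_sub, ← altSum_sum, mul_altSum]
      simp only [mul_smul_comm, mul_one, Finset.mul_sum]
      have h3 : (altSum I fun k I' => ∑ d, capLead η (d :: c :: I') K •
          ((-1 : ℂ) • (siteOp ℂ s i c * siteOp ℂ t k d))) = (-1 : ℂ) •
          altSum I fun k I' => ∑ d, capLead η (d :: c :: I') K •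
          (siteOp ℂ s i c * siteOp ℂ t k d) := by
        rw [smul_altSum]
        refine altSum_congr _ _ _ fun k I' _ => ?_
        rw [Finset.smul_sum]
        exact Finset.sum_congr rfl fun d _ => smul_comm _ _ _
      rw [h3]
      module
    rw [Finset.sum_congr rfl fun c _ => h2 c, Finset.sum_add_distrib, Finset.sum_add_distrib]
    congr 2
    · rw [Finset.sum_comm]
      simp only [Finset.smul_sum]
    · simp only [altSum_sum]
  rw [siteStep, siteStep_capLead t hK, h1]
  simp only [altSum_capLead η _ _ hK, altSum_altSum_capLead η _ _ _ hK]
  have e1 (c : Fin N) : (if c ∈ K then (K.map η).prod • (-z t) • siteOp ℂ s c c else 0) =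
      (K.map η).prod • if c ∈ K then (-z t) • siteOp ℂ s c c else 0 := by split_ifs <;> simp
  have e2 (d : Fin N) : (if d ∈ K then (K.map η).prod • ∑ c, siteOp ℂ s d c * siteOp ℂ t c d else 0) =
      (K.map η).prod • if d ∈ K then ∑ c, siteOp ℂ s d c * siteOp ℂ t c d else 0 := by
    split_ifs <;> simp
  have e3 (c d : Fin N) : (if c ∈ K ∧ d ∈ K ∧ c ≠ d then (K.map η).prod •
      ((-1 : ℂ) • (siteOp ℂ s d c * siteOp ℂ t c d) - (-1 : ℂ) • (siteOp ℂ s c c * siteOp ℂ t d d))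
      else 0) = (K.map η).prod • if c ∈ K ∧ d ∈ K ∧ c ≠ d then
          siteOp ℂ s c c * siteOp ℂ t d d - siteOp ℂ s d c * siteOp ℂ t c d else 0 := by
    split_ifs
    · congr 1
      module
    · simp
  have e4 : (∑ c, if c ∈ K then (-z s) • siteOp ℂ t c c + (-z t) • siteOp ℂ s c c +
          ∑ d, siteOp ℂ s c d * siteOp ℂ t d c else 0) =
      (-z s) • (∑ c, if c ∈ K then siteOp ℂ t c c else 0) +
      ((∑ c, if c ∈ K then (-z t) • siteOp ℂ s c c else 0) +
      ∑ c, if c ∈ K then ∑ d, siteOp ℂ s c d * siteOp ℂ t d c else 0) := by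
    rw [Finset.smul_sum, ← Finset.sum_add_distrib, ← Finset.sum_add_distrib]
    refine Finset.sum_congr rfl fun c _ => ?_
    split_ifs
    · module
    · simp
  simp only [e1, e2, e3, ← Finset.smul_sum, e4]
  module

end

end

section

open Polynomial (C X)

/-! ### Weighted sums over subsets -/

section

variable {m : ℕ} (ξ : Fin m → ℂ) (u : ℂ)

/-- The weight of a subset in the expansion of `∏ (u - ξ_l)`. -/
def subsetWeight (K : Finset (Fin m)) : ℂ := (∏ k ∈ K, -ξ k) * ∏ _k ∈ Finset.univ \ K, u

/-- Expand `∏ (-ξ_l + u)` over subsets after replacing `u` by `0` in the factors with `l ∈ s`: the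
choice `-ξ_l` is then forced there, which is the condition `s ⊆ K`. -/
lemma sum_subsetWeight (s : Finset (Fin m)) :
    ∑ K : Finset (Fin m), (if s ⊆ K then subsetWeight ξ u K else 0) =
      (∏ l ∈ s, -ξ l) * ∏ l ∈ Finset.univ \ s, (u - ξ l) := by
  have h := Finset.prod_add (fun l => -ξ l) (fun l => if l ∈ s then 0 else u) Finset.univ
  rw [← Finset.prod_sdiff (Finset.subset_univ s), mul_comm] at h
  rw [Finset.prod_congr rfl (g := fun l => -ξ l) fun l hl => by simp [hl],
    Finset.prod_congr (s₁ := Finset.univ \ s) rfl (g := fun l => u - ξ l) fun l hl => by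
      rw [if_neg (Finset.mem_sdiff.1 hl).2]; ring] at h
  rw [h, Finset.powerset_univ]
  refine Finset.sum_congr rfl fun K _ => ?_
  split_ifs with hs
  · rw [subsetWeight]
    congr 1
    refine Finset.prod_congr rfl fun l hl => ?_
    rw [if_neg fun h => (Finset.mem_sdiff.1 hl).2 (hs h)]
  · obtain ⟨l, hl, hlK⟩ := Finset.not_subset.1 hs
    have h0 : ∏ l ∈ Finset.univ \ K, (if l ∈ s then 0 else u) = 0 :=
      Finset.prod_eq_zero (Finset.mem_sdiff.2 ⟨Finset.mem_univ l, hlK⟩) (if_pos hl)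
    rw [h0, mul_zero]

variable {A : Type*} [AddCommGroup A]

lemma sum_sublistsLen (r : ℕ) {F : List (Fin m) → A} {g : Finset (Fin m) → A}
    (hF : ∀ K : List (Fin m), K.Nodup → F K = g K.toFinset) :
    ((List.sublistsLen r (List.finRange m)).map F).sum =
      ∑ K ∈ Finset.powersetCard r Finset.univ, g K := by
  have h1 : ((List.sublistsLen r (List.finRange m)).map F) =
      (List.sublistsLen r (List.finRange m)).map fun K => g (Multiset.ofList K).toFinset := by
    refine List.map_congr_left fun K hK => ?_
    rw [hF K ((List.nodup_finRange m).sublist (List.mem_sublistsLen.1 hK).1)]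
    rfl
  have h2 : (Finset.univ : Finset (Fin m)).val = (List.finRange m : Multiset (Fin m)) := rfl
  have h3 := Finset.map_val_val_powersetCard (Finset.univ : Finset (Fin m)) r
  rw [h2, Multiset.powersetCard_coe] at h3
  have h4 := congrArg (fun s => (s.map fun K : Multiset (Fin m) => g K.toFinset).sum) h3
  simp only [Multiset.map_map, Function.comp_def, Finset.val_toFinset, Multiset.map_coe,
    List.map_map, Multiset.sum_coe] at h4
  rw [h1]
  exact h4.symm

variable [Module ℂ A]

lemma sum_subsetWeight_smul (s : Finset (Fin m)) (Y : A) :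
    ∑ K : Finset (Fin m), subsetWeight ξ u K • (if s ⊆ K then Y else 0) =
      ((∏ l ∈ s, -ξ l) * ∏ l ∈ Finset.univ \ s, (u - ξ l)) • Y := by
  rw [← sum_subsetWeight, Finset.sum_smul]
  refine Finset.sum_congr rfl fun K _ => ?_
  split_ifs <;> simp

lemma sum_sublistsLen_weighted {F : List (Fin m) → A} {g : Finset (Fin m) → A}
    (hF : ∀ K : List (Fin m), K.Nodup → F K = (K.map ξ).prod • g K.toFinset) :
    ∑ i : Fin (m + 1), (u ^ (i : ℕ) * (-1) ^ (m - i)) •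
        ((List.sublistsLen (m - i) (List.finRange m)).map F).sum =
      ∑ K : Finset (Fin m), subsetWeight ξ u K • g K := by
  rw [← Finset.powerset_univ, Finset.sum_powerset, Finset.card_univ, Fintype.card_fin,
    ← Finset.sum_range_reflect, Finset.sum_range]
  refine Finset.sum_congr rfl fun i _ => ?_
  have hi : m + 1 - 1 - (i : ℕ) = m - i := by omega
  rw [hi, sum_sublistsLen (g := fun K => (∏ k ∈ K, ξ k) • g K) _ fun K hK => by
    rw [hF K hK, List.prod_toFinset _ hK], Finset.smul_sum]
  refine Finset.sum_congr rfl fun K hK => ?_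
  have hc := (Finset.mem_powersetCard.1 hK).2
  rw [smul_smul, subsetWeight, Finset.prod_neg, Finset.prod_const, Finset.card_univ_sdiff,
    Fintype.card_fin, hc, Nat.sub_sub_self (by omega)]
  congr 1
  ring

end

/-! ### The leading terms for the second kind of coefficients -/

section

variable {m n : ℕ} {ξ : Fin m → ℂ} {z : Fin n → ℂ}

/-- The coefficient of `x ^ (n - k)` in the leading terms for the second kind of coefficients,
where `x = u + n`. -/
def topD (ξ : Fin m → ℂ) (z : Fin n → ℂ) (k : ℕ) (u : ℂ) : Module.End ℂ (Fock ℂ n m) :=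
  ∑ i : Fin (m + 1), (u ^ (i : ℕ) * (-1) ^ (m - i)) •
    ((List.sublistsLen (m - i) (List.finRange m)).map fun K =>
      topCoef (fun s => z s + n) (fun I J => capLead ξ I J • 1) (List.finRange n) k K K).sum

/-- The falling factorials in the expansion are taken at `u + n`, so the spectral variable is `x -
n`. Expanding with `q = n` gives powers of `x`, which is the source of the combinations `z_s + n`.
-/
lemma sum_leadOpD (u x : ℂ) : ∑ i : Fin (m + 1), u ^ (i : ℕ) • leadOpD ξ z (x - n) (m - i) =
    ∑ k ∈ Finset.range (n + 1), x ^ (n - k) • topD ξ z k u := by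
  have h (L : List (List (Fin m))) : (L.map fun K => coefLeadD z (fun I J => capLead ξ I J • 1)
      (List.finRange n) (x - n) K K).sum = ∑ k ∈ Finset.range (n + 1), x ^ (n - k) •
      (L.map fun K => topCoef (fun s => z s + n) (fun I J => capLead ξ I J • 1)
        (List.finRange n) k K K).sum := by
    induction L with
    | nil => simp
    | cons K L ih =>
      rw [List.map_cons, List.sum_cons, ih, coefLeadD_eq z n]
      simp only [List.map_cons, List.sum_cons, List.length_finRange, sub_add_cancel, smul_add,
        Finset.sum_add_distrib]
  simp only [leadOpD, betheLead, h, topD, Finset.smul_sum]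
  rw [Finset.sum_comm]
  refine Finset.sum_congr rfl fun k _ => Finset.sum_congr rfl fun i _ => ?_
  simp only [smul_smul]
  congr 1
  ring

/-- For fixed `u` there are two expansions of the same polynomial in `x`, one in falling factorials
and one in powers. The claim compares coefficients of `x^{n-k}`. -/
lemma leadNum_eval_topD {a : Fin n → ℕ} {b : Fin m → ℕ}
    {d : Fin (m + 1) → Fin (n + 1) → Matrix (Table a b) (Table a b) ℂ}
    (hd : ∀ (i : Fin (m + 1)) (u : ℂ) x y,
      ∑ j : Fin (n + 1), d i j x y * (descPochhammer ℂ j).eval (u + n) =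
        opMatrix a b (leadOpD ξ z u (m - i)) x y) {k : ℕ} (hk : k ≤ n) (x y : Table a b) (u : ℂ) :
    (leadNum n d k x y).eval u = opMatrixLin a b (topD ξ z k u) x y := by
  have h : ∑ j : Fin (n + 1), C (∑ i : Fin (m + 1), d i j x y * u ^ (i : ℕ)) *
      descPochhammer ℂ j = ∑ k ∈ Finset.range (n + 1),
        C (opMatrixLin a b (topD ξ z k u) x y) * X ^ (n - k) := by
    refine Polynomial.funext fun t => ?_
    have h1 := congrArg (fun T => opMatrixLin a b T x y) (sum_leadOpD (ξ := ξ) (z := z) u t)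
    simp only [map_sum, map_smul, Matrix.sum_apply, Matrix.smul_apply, smul_eq_mul] at h1
    simp only [Polynomial.eval_finsetSum, Polynomial.eval_mul, Polynomial.eval_C,
      Polynomial.eval_pow, Polynomial.eval_X, Finset.sum_mul]
    rw [Finset.sum_comm]
    refine Eq.trans (Finset.sum_congr rfl fun i _ => ?_) (h1.trans
      (Finset.sum_congr rfl fun k _ => mul_comm _ _))
    have h2 := hd i (t - n) x y
    rw [sub_add_cancel] at h2
    rw [opMatrixLin_apply, ← h2, Finset.mul_sum]
    exact Finset.sum_congr rfl fun j _ => by ring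
  have h3 := congrArg (fun p => Polynomial.coeff p (n - k)) h
  simp only [Polynomial.finsetSum_coeff, Polynomial.coeff_C_mul, Polynomial.coeff_X_pow] at h3
  rw [Finset.sum_eq_single_of_mem (s := Finset.range (n + 1)) k
    (Finset.mem_range.2 (Nat.lt_succ_of_le hk)) fun l hl hlk => by
      have := Finset.mem_range.1 hl
      rw [if_neg (by omega), mul_zero], if_pos rfl, mul_one] at h3
  rw [leadNum_eval, ← h3]
  exact Finset.sum_congr rfl fun j _ => mul_comm _ _

/-- With one acting site the dependence on `K` is only through membership of single indices, so
`sum_subsetWeight` is needed for the empty set and for singletons. -/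
lemma topD_one (u : ℂ) : topD ξ z 1 u = (-1 : ℂ) • ((∏ l, (u - ξ l)) • (∑ s, (z s + n)) • 1 +
    ∑ c, (ξ c * ∏ l ∈ Finset.univ.erase c, (u - ξ l)) • diagOp ℂ c c) := by
  obtain ⟨S, hS⟩ : ∃ S, S = ∑ s, (z s + (n : ℂ)) := ⟨_, rfl⟩
  rw [← hS, topD, sum_sublistsLen_weighted ξ u (g := fun K => (-S) • 1 +
    ∑ c, if {c} ⊆ K then diagOp ℂ c c else 0) fun K hK => ?_]
  · have h0 := sum_subsetWeight_smul ξ u ∅ ((-S) • (1 : Module.End ℂ (Fock ℂ n m)))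
    simp only [Finset.empty_subset, if_true, Finset.prod_empty, one_mul, Finset.sdiff_empty] at h0
    simp only [smul_add, Finset.sum_add_distrib, h0, Finset.smul_sum]
    rw [Finset.sum_comm]
    simp only [sum_subsetWeight_smul, Finset.prod_singleton, Finset.sdiff_singleton_eq_erase]
    rw [smul_smul, smul_smul, smul_smul]
    congr 1
    · congr 1
      ring
    · refine Finset.sum_congr rfl fun c _ => ?_
      rw [smul_smul]
      congr 1
      ring
  · rw [topCoef_one, ← List.sum_toFinset _ (List.nodup_finRange n), List.toFinset_finRange]
    simp only [siteStep_capLead _ hK, ← Finset.smul_sum, Finset.sum_add_distrib, ← Finset.sum_smul]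
    rw [Finset.sum_comm]
    congr 2
    · rw [hS, Finset.sum_neg_distrib]
    · refine Finset.sum_congr rfl fun c _ => ?_
      simp only [Finset.singleton_subset_iff, List.mem_toFinset]
      split_ifs
      · rfl
      · simp

end

end

section

open Polynomial (C X)

/-! ### The dynamical Hamiltonians -/

section

variable {m n : ℕ} {ξ : Fin m → ℂ} {z : Fin n → ℂ}

/-- At `u = ξ_i` a condition `s ⊆ K` contributes only if `i ∈ s`, since otherwise the factor `u -
ξ_i` is left. The set `{i}` gives the weight `-ξ_i` and `{i, k}` gives `ξ_i ξ_k / (ξ_i - ξ_k)`, both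
times `simpleDeriv`. -/
lemma sum_subsetWeight_pairs {A : Type*} [AddCommGroup A] [Module ℂ A]
    (hξ : Function.Injective ξ) (i : Fin m) (Y₀ : A) (Y₁ : Fin m → A) (Y₂ : Fin m → Fin m → A) :
    ∑ K : Finset (Fin m), subsetWeight ξ (ξ i) K • (Y₀ + (∑ c, if {c} ⊆ K then Y₁ c else 0) +
      ∑ c, ∑ d, if c ≠ d then (if {c, d} ⊆ K then Y₂ c d else 0) else 0) =
    (ξ i * simpleDeriv ξ i) • (-Y₁ i +
      ∑ k ∈ Finset.univ.erase i, (ξ k / (ξ i - ξ k)) • (Y₂ i k + Y₂ k i)) := by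
  have hzero (s : Finset (Fin m)) (hs : i ∉ s) : ∏ l ∈ Finset.univ \ s, (ξ i - ξ l) = 0 :=
    Finset.prod_eq_zero (Finset.mem_sdiff.2 ⟨Finset.mem_univ i, hs⟩) (sub_self _)
  have h0 : ∑ K : Finset (Fin m), subsetWeight ξ (ξ i) K • Y₀ = 0 := by
    have := sum_subsetWeight_smul ξ (ξ i) ∅ Y₀
    have h : ∏ l, (ξ i - ξ l) = 0 := Finset.prod_eq_zero (Finset.mem_univ i) (sub_self _)
    simpa [h] using this
  have h1 : ∑ K : Finset (Fin m), subsetWeight ξ (ξ i) K • (∑ c, if {c} ⊆ K then Y₁ c else 0) =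
      -((ξ i * simpleDeriv ξ i) • Y₁ i) := by
    simp only [Finset.smul_sum]
    rw [Finset.sum_comm]
    simp only [sum_subsetWeight_smul]
    rw [Finset.sum_eq_single_of_mem i (Finset.mem_univ i), Finset.prod_singleton,
      Finset.sdiff_singleton_eq_erase, ← simpleDeriv, neg_mul, neg_smul]
    intro c _ hc
    rw [hzero {c} (by simpa using hc.symm), mul_zero, zero_smul]
  have hW (k : Fin m) (hk : k ∈ Finset.univ.erase i) (s : Finset (Fin m)) (hs : s = {i, k}) :
      (∏ l ∈ s, -ξ l) * ∏ l ∈ Finset.univ \ s, (ξ i - ξ l) =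
      ξ i * simpleDeriv ξ i * (ξ k / (ξ i - ξ k)) := by
    have hki := (Finset.ne_of_mem_erase hk).symm
    have hne : ξ i - ξ k ≠ 0 := sub_ne_zero.2 fun h => hki (hξ h)
    have hs' : Finset.univ \ {i, k} = (Finset.univ.erase i).erase k := by
      ext l; simp [and_comm]
    rw [hs, hs', Finset.prod_pair hki, simpleDeriv, ← Finset.mul_prod_erase _ _ hk]
    field_simp
  have h2 : ∑ K : Finset (Fin m), subsetWeight ξ (ξ i) K •
      (∑ c, ∑ d, if c ≠ d then (if {c, d} ⊆ K then Y₂ c d else 0) else 0) =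
      (ξ i * simpleDeriv ξ i) •
        ∑ k ∈ Finset.univ.erase i, (ξ k / (ξ i - ξ k)) • (Y₂ i k + Y₂ k i) := by
    have e (c d : Fin m) : ∑ K : Finset (Fin m), subsetWeight ξ (ξ i) K •
        (if c ≠ d then (if {c, d} ⊆ K then Y₂ c d else 0) else 0) =
        if c ≠ d then ((∏ l ∈ {c, d}, -ξ l) *
          ∏ l ∈ Finset.univ \ {c, d}, (ξ i - ξ l)) • Y₂ c d else 0 := by
      by_cases h : c = d
      · simp [h]
      · simp only [ne_eq, h, not_false_eq_true, if_true, sum_subsetWeight_smul]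
    simp only [Finset.smul_sum]
    rw [Finset.sum_comm, Finset.sum_congr rfl fun c _ => Finset.sum_comm,
      Finset.sum_congr rfl fun c _ => Finset.sum_congr rfl fun d _ => e c d,
      ← Finset.add_sum_erase _ _ (Finset.mem_univ i), ← Finset.add_sum_erase _ _ (Finset.mem_univ i),
      if_neg (by simp), zero_add, ← Finset.sum_add_distrib]
    refine Finset.sum_congr rfl fun k hk => ?_
    have hki := Finset.ne_of_mem_erase hk
    rw [if_pos hki.symm, hW k hk _ rfl, Finset.sum_eq_single_of_mem i (Finset.mem_univ i),
      if_pos hki, hW k hk _ (Finset.pair_comm _ _), smul_smul, smul_add]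
    intro d _ hd
    rw [hzero {k, d} (by simp [hki.symm, hd.symm]), mul_zero, zero_smul, ite_self]
  simp only [smul_add, Finset.sum_add_distrib] at h0 h1 h2 ⊢
  rw [h0, h1, h2, zero_add, smul_neg]

/-- The quadratic term of two tensor factors in the leading terms of the second kind. -/
def quadPair (ξ : Fin m → ℂ) (z : Fin n → ℂ) (i : Fin m) (s t : Fin n) :
    Module.End ℂ (Fock ℂ n m) :=
  (z s + n) • siteOp ℂ t i i + (z t + n) • siteOp ℂ s i i -
    ∑ d, siteOp ℂ s i d * siteOp ℂ t d i +
    ∑ k ∈ Finset.univ.erase i, (ξ k / (ξ i - ξ k)) • minorPair i k s t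

/-- The two orders of the pair `{i, k}` in the antisymmetrised products add up to `minorPair`. -/
lemma topD_two (hξ : Function.Injective ξ) (i : Fin m) : topD ξ z 2 (ξ i) =
    (ξ i * simpleDeriv ξ i) •
      ∑ s, ∑ t ∈ Finset.univ.filter (fun t => s < t), quadPair ξ z i s t := by
  rw [topD, sum_sublistsLen_weighted ξ (ξ i) (g := fun K => ∑ s, ∑ t ∈ Finset.univ.filter
    (fun t => s < t), (((z s + n) * (z t + n)) • (1 : Module.End ℂ (Fock ℂ n m)) +
      (∑ c, if {c} ⊆ K then (-(z s + n)) • siteOp ℂ t c c + (-(z t + n)) • siteOp ℂ s c c +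
        ∑ d, siteOp ℂ s c d * siteOp ℂ t d c else 0) +
      ∑ c, ∑ d, if c ≠ d then (if {c, d} ⊆ K then
        siteOp ℂ s c c * siteOp ℂ t d d - siteOp ℂ s d c * siteOp ℂ t c d else 0) else 0))
      fun K hK => ?_]
  · simp only [Finset.smul_sum]
    rw [Finset.sum_comm]
    refine Finset.sum_congr rfl fun s _ => ?_
    rw [Finset.sum_comm]
    refine Finset.sum_congr rfl fun t _ => ?_
    rw [sum_subsetWeight_pairs hξ, quadPair]
    congr 1
    have h (k : Fin m) : siteOp ℂ s i i * siteOp ℂ t k k - siteOp ℂ s k i * siteOp ℂ t i k +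
        (siteOp ℂ s k k * siteOp ℂ t i i - siteOp ℂ s i k * siteOp ℂ t k i) =
        minorPair i k s t := by
      rw [minorPair]
      abel
    simp only [h]
    module
  · rw [topCoef_two, pairSum_finRange]
    rw [Finset.smul_sum]
    refine Finset.sum_congr rfl fun s _ => ?_
    rw [Finset.smul_sum]
    refine Finset.sum_congr rfl fun t _ => ?_
    rw [siteStep_siteStep_capLead _ _ hK]
    refine congrArg (fun T => (K.map ξ).prod • T) (congrArg₂ (· + ·) (congrArg₂ (· + ·) rfl ?_) ?_)
    · simp only [Finset.singleton_subset_iff, List.mem_toFinset]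
    · refine Finset.sum_congr rfl fun c _ => Finset.sum_congr rfl fun d _ => ?_
      simp only [Finset.insert_subset_iff, Finset.singleton_subset_iff, List.mem_toFinset]
      by_cases hc : c ∈ K <;> by_cases hd : d ∈ K <;> by_cases hcd : c = d <;> simp [hc, hd, hcd]

/-- Split the total generators into sites. At equal sites the relation of symmetric powers gives
`e_{ii} e_{jj} + e_{ii}`, and the extra terms sum to the subtracted `e_{ii}`. At distinct sites the
difference from the product of Cartan generators is a sum of minors. -/
lemma diagOp_mul_diagOp_swap_sub {i j : Fin m} (h : j ≠ i) :
    diagOp ℂ i j * diagOp ℂ j i - diagOp ℂ i i = diagOp ℂ (M := n) i i * diagOp ℂ j j -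
      ∑ s, ∑ t ∈ Finset.univ.filter (fun t => s < t), minorPair i j s t := by
  have e (i j : Fin m) : diagOp ℂ i j = ∑ s : Fin n, siteOp ℂ s i j := rfl
  have h1 : diagOp ℂ i j * diagOp ℂ j i = ∑ s : Fin n, siteOp ℂ s i i * siteOp ℂ s j j +
      diagOp ℂ i i + ∑ s, ∑ t ∈ Finset.univ.filter (fun t => s < t),
      (siteOp ℂ s i j * siteOp ℂ t j i + siteOp ℂ s j i * siteOp ℂ t i j) := by
    rw [e i j, e j i, e i i, Finset.sum_mul_sum, sum_sum_eq_diag_add]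
    refine congrArg₂ (· + ·) ?_ ?_
    · rw [← Finset.sum_add_distrib]
      exact Finset.sum_congr rfl fun s _ => siteOp_mul_siteOp_swap s h
    · refine Finset.sum_congr rfl fun s _ => Finset.sum_congr rfl fun t ht => ?_
      rw [(siteOp_comm_of_ne (Finset.mem_filter.1 ht).2.ne' i j j i).eq]
  have h2 : diagOp ℂ i i * diagOp ℂ j j = ∑ s : Fin n, siteOp ℂ s i i * siteOp ℂ s j j +
      ∑ s, ∑ t ∈ Finset.univ.filter (fun t => s < t),
      (siteOp ℂ s i i * siteOp ℂ t j j + siteOp ℂ s j j * siteOp ℂ t i i) := by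
    rw [e i i, e j j, Finset.sum_mul_sum, sum_sum_eq_diag_add]
    refine congrArg₂ (· + ·) rfl ?_
    refine Finset.sum_congr rfl fun s _ => Finset.sum_congr rfl fun t ht => ?_
    rw [(siteOp_comm_of_ne (Finset.mem_filter.1 ht).2.ne' i i j j).eq]
  have h3 : (∑ s, ∑ t ∈ Finset.univ.filter (fun t => s < t), minorPair i j s t) =
      (∑ s : Fin n, ∑ t ∈ Finset.univ.filter (fun t => s < t),
        (siteOp ℂ s i i * siteOp ℂ t j j + siteOp ℂ s j j * siteOp ℂ t i i)) -
      ∑ s, ∑ t ∈ Finset.univ.filter (fun t => s < t),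
        (siteOp ℂ s i j * siteOp ℂ t j i + siteOp ℂ s j i * siteOp ℂ t i j) := by
    rw [← Finset.sum_sub_distrib]
    refine Finset.sum_congr rfl fun s _ => ?_
    rw [← Finset.sum_sub_distrib]
    refine Finset.sum_congr rfl fun t _ => ?_
    rw [minorPair]
    abel
  rw [h1, h2, h3]
  abel

/-- Everything except the sum of `quadPair` is a polynomial in total Cartan generators, hence a
scalar on the weight subspace. The sum of `quadPair` is the operator found in `topD_two`. -/
lemma dynamicalG_eq (i : Fin m) : dynamicalG z ξ i =
    (∑ s, (z s + n)) • diagOp ℂ i i +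
      ∑ k ∈ Finset.univ.erase i, (ξ k / (ξ i - ξ k)) • (diagOp ℂ i i * diagOp ℂ k k) -
      (1 / 2 : ℂ) • (diagOp ℂ i i * diagOp ℂ i i) -
      ∑ s, ∑ t ∈ Finset.univ.filter (fun t => s < t), quadPair ξ z i s t := by
  have h1 : (∑ s, (z s + n)) • diagOp ℂ i i = ∑ s : Fin n, (z s + n) • siteOp ℂ s i i +
      ∑ s, ∑ t ∈ Finset.univ.filter (fun t => s < t),
        ((z s + n) • siteOp ℂ t i i + (z t + n) • siteOp ℂ s i i) := by
    rw [diagOp, Finset.sum_smul, Finset.sum_congr rfl fun s _ => Finset.smul_sum,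
      sum_sum_eq_diag_add]
  have h2 : ∑ j : Fin m, ∑ k : Fin n, ∑ l ∈ Finset.univ.filter (fun l => k < l),
      siteOp ℂ k i j * siteOp ℂ l j i = ∑ k : Fin n, ∑ l ∈ Finset.univ.filter (fun l => k < l),
      ∑ j, siteOp ℂ k i j * siteOp ℂ l j i := by
    rw [Finset.sum_comm]
    exact Finset.sum_congr rfl fun k _ => Finset.sum_comm
  have h3 : ∑ j ∈ Finset.univ.erase i,
      (ξ j / (ξ i - ξ j)) • (diagOp ℂ i j * diagOp ℂ j i - diagOp ℂ (M := n) i i) =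
      ∑ k ∈ Finset.univ.erase i, (ξ k / (ξ i - ξ k)) • (diagOp ℂ i i * diagOp ℂ k k) -
      ∑ s, ∑ t ∈ Finset.univ.filter (fun t => s < t),
        ∑ k ∈ Finset.univ.erase i, (ξ k / (ξ i - ξ k)) • minorPair i k s t := by
    rw [Finset.sum_congr rfl fun j hj => by
      rw [diagOp_mul_diagOp_swap_sub (Finset.ne_of_mem_erase hj), smul_sub],
      Finset.sum_sub_distrib]
    simp only [Finset.smul_sum]
    rw [Finset.sum_comm (s := Finset.univ.erase i)]
    congr 1
    exact Finset.sum_congr rfl fun s _ => Finset.sum_comm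
  have h4 : ∑ s, ∑ t ∈ Finset.univ.filter (fun t => s < t), quadPair ξ z i s t =
      (∑ s, ∑ t ∈ Finset.univ.filter (fun t => s < t),
        ((z s + n) • siteOp ℂ t i i + (z t + n) • siteOp ℂ s i i)) -
      (∑ k : Fin n, ∑ l ∈ Finset.univ.filter (fun l => k < l),
        ∑ j, siteOp ℂ k i j * siteOp ℂ l j i) +
      ∑ s, ∑ t ∈ Finset.univ.filter (fun t => s < t),
        ∑ k ∈ Finset.univ.erase i, (ξ k / (ξ i - ξ k)) • minorPair i k s t := by
    simp only [quadPair, Finset.sum_add_distrib, Finset.sum_sub_distrib]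
  rw [dynamicalG, h1, h2, h3, h4, sq]
  module

/-- The coefficients for the second kind and their leading terms give the dynamical
Hamiltonians. -/
theorem opMatrix_dynamicalG (hn : 0 < n) (a : Fin n → ℕ) (b : Fin m → ℕ)
    (hξ0 : ∀ i, ξ i ≠ 0) (hξ : Function.Injective ξ)
    {d : Fin (m + 1) → Fin (n + 1) → Matrix (Table a b) (Table a b) ℂ}
    (hd : ∀ (i : Fin (m + 1)) (u : ℂ) x y,
      ∑ j : Fin (n + 1), d i j x y * (descPochhammer ℂ j).eval (u + n) =
        opMatrix a b (leadOpD ξ z u (m - i)) x y) (i : Fin m) :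
    opMatrix a b (dynamicalG z ξ i) = residueExpr n ξ b d i := by
  have hdiag (c : Fin m) : opMatrixLin a b (diagOp ℂ c c) = (b c : ℂ) • 1 := by
    have := opMatrixLin_mul_diagOp a b 1 c
    rwa [one_mul, opMatrixLin_one] at this
  rw [residueExpr_eq hξ0 hξ hn b (∑ s, (z s + n)) d (fun x y u => ?_) i
    (opMatrixLin a b (∑ s, ∑ t ∈ Finset.univ.filter (fun t => s < t), quadPair ξ z i s t))
    (fun hn2 x y => ?_) (fun hn1 => ?_)]
  · rw [← opMatrixLin_apply, dynamicalG_eq, map_sub]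
    congr 1
    have h (k : Fin m) : (ξ k / (ξ i - ξ k)) • (b k : ℂ) • (b i : ℂ) •
        (1 : Matrix (Table a b) (Table a b) ℂ) =
        ((b i : ℂ) * (b k * (ξ k / (ξ i - ξ k)))) • 1 := by module
    simp only [map_sub, map_add, map_sum, map_smul, opMatrixLin_mul_diagOp, hdiag, h,
      ← Finset.sum_smul, ← Finset.mul_sum]
    module
  · rw [leadNum_eval_topD hd hn, topD_one]
    simp only [map_add, map_sum, map_smul, hdiag, opMatrixLin_one, Matrix.smul_apply,
      Matrix.add_apply, Matrix.sum_apply, smul_eq_mul]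
    have h : ∑ c, ξ c * (∏ l ∈ Finset.univ.erase c, (u - ξ l)) *
        (b c * (1 : Matrix (Table a b) (Table a b) ℂ) x y) =
        (∑ s, b s * ξ s * ∏ l ∈ Finset.univ.erase s, (u - ξ l)) *
          (1 : Matrix (Table a b) (Table a b) ℂ) x y := by
      rw [Finset.sum_mul]
      exact Finset.sum_congr rfl fun c _ => by ring
    rw [h]
    ring
  · rw [leadNum_eval_topD hd hn2, topD_two hξ, map_smul, Matrix.smul_apply, smul_eq_mul]
  · subst hn1
    have hf (j : Fin 1) : Finset.univ.filter (fun k => j < k) = ∅ :=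
      Finset.filter_false_of_mem fun k _ => by rw [Subsingleton.elim j k]; exact lt_irrefl k
    simp only [hf, Finset.sum_empty, Finset.sum_const_zero, map_zero]

end

end

end GaudinXXX

end

theorem theorem5p9 (n m : ℕ) (hn : 0 < n) (hm : 0 < m) (a : Fin n → ℕ) (b : Fin m → ℕ)
    (hab : ∑ i, a i = ∑ j, b j) (μ : Fin n → ℂ) (ξ : Fin m → ℂ) (hξ0 : ∀ i, ξ i ≠ 0)
    (hξ : Function.Injective ξ) :
    (GaudinXXX.ThetaBijective b a μ →
      ∃ (C : Fin (m + 1) → Fin (n + 1) →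
          Matrix (GaudinXXX.Table b a) (GaudinXXX.Table b a) (GaudinXXX.ParamField m))
        (c : Fin (m + 1) → Fin (n + 1) →
          Matrix (GaudinXXX.Table b a) (GaudinXXX.Table b a) ℂ),
        GaudinXXX.IsCCoeff (fun j => algebraMap ℂ (GaudinXXX.ParamField m) (μ j))
          (GaudinXXX.wParam b) C ∧
        (∀ C', GaudinXXX.IsCCoeff (fun j => algebraMap ℂ (GaudinXXX.ParamField m) (μ j))
          (GaudinXXX.wParam b) C' → C' = C) ∧
        (∀ (i : Fin (m + 1)) (j : Fin (n + 1)) x y,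
          GaudinXXX.IsLeading ξ (m - (i : ℕ)) (C i j x y) (c i j x y)) ∧
        ∀ i : Fin m, GaudinXXX.opMatrix b a (GaudinXXX.gaudinH (GaudinXXX.zParam μ a) ξ i) =
          GaudinXXX.residueExpr n ξ b c i) ∧
    ∃ (D : Fin (m + 1) → Fin (n + 1) →
        Matrix (GaudinXXX.Table a b) (GaudinXXX.Table a b) (GaudinXXX.ParamField m))
      (d : Fin (m + 1) → Fin (n + 1) →
        Matrix (GaudinXXX.Table a b) (GaudinXXX.Table a b) ℂ),
      GaudinXXX.IsDCoeff (GaudinXXX.lamVar m)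
        (fun j => algebraMap ℂ (GaudinXXX.ParamField m) (GaudinXXX.zParam μ a j)) D ∧
      (∀ D', GaudinXXX.IsDCoeff (GaudinXXX.lamVar m)
        (fun j => algebraMap ℂ (GaudinXXX.ParamField m) (GaudinXXX.zParam μ a j)) D' → D' = D) ∧
      (∀ (i : Fin (m + 1)) (j : Fin (n + 1)) x y,
          GaudinXXX.IsLeading ξ (m - (i : ℕ)) (D i j x y) (d i j x y)) ∧
      ∀ i : Fin m, GaudinXXX.opMatrix a b (GaudinXXX.dynamicalG (GaudinXXX.zParam μ a) ξ i) =
        GaudinXXX.residueExpr n ξ b d i := by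
  refine ⟨fun hμ => ?_, ?_⟩
  · obtain ⟨B, ⟨hB, hB1, -⟩, C, c, hC, hu, hl, hc⟩ := GaudinXXX.exists_cCoeff a b μ ξ hμ
    exact ⟨C, c, hC, hu, hl, GaudinXXX.opMatrix_gaudinH hn a b hab μ hξ0 hξ hB hB1 hc⟩
  -- The evaluation points are mere complex constants in this half, so the result for arbitrary `z`
  -- is specialised.
  · obtain ⟨D, d, hD, hu, hl, hd⟩ := GaudinXXX.exists_dCoeff a b (GaudinXXX.zParam μ a) ξ
    exact ⟨D, d, hD, hu, hl, GaudinXXX.opMatrix_dynamicalG hn a b hξ0 hξ hd⟩
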